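/- **Conventions.** Let $P$ be a compact smooth manifold of even dimension $2n\ge 2$ with boundary, let $\beta$ be a smooth $1$-form on $P$ such that $d\beta$ is symplectic and $(P,d\beta)$ has convex boundary (the Liouville vector field $X$, $\iota_X d\beta=\beta$, is transverse to $\partial P$ and points outwards), and let $\Psi:P\to P$ be a diffeomorphism with $\Psi^*d\beta=d\beta$ that is the identity near $\partial P$. Let $M=(P\times[0,1])/\!\sim$ be the closed $(2n+1)$-manifold obtained from $(p,t)\sim(p,s)$ for $p\in B:=\partial P$ and $(\Psi(q),0)\sim(q,1)$. Its smooth structure is that of the mapping torus of $\Psi$ off $B$, and near $B$ it is that of $B\times\{z\in\mathbb{C}:|z|<\delta\}$, glued in by $(b,r,t)\mapsto(b,re^{2\pi i t})$ for a collar $B\times[0,\delta)$ of $\partial P$. The open book $(B,\pi)$ of $M$ is given by $\pi:M\setminus B\to S^1=\mathbb{R}/\mathbb{Z}$, $\pi(p,t)=t$; its open pages are the fibres of $\pi$. A contact form on $M$ is a smooth $1$-form $\alpha$ such that $\alpha\wedge(d\alpha)^n$ is a volume form; it defines the cooriented contact structure $\ker\alpha$. A contact form $\alpha$ *supports* $(B,\pi)$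 if $B$ is a contact submanifold on which $\alpha|_B$ is positive for the orientation of $B$ as the boundary of the pages oriented by $(d\alpha)^n$, the Reeb vector field $R$ of $\alpha$ satisfies $d\pi(R)>0$ on $M\setminus B$, and $R$ is tangent to $B$. **Proposition.** 1. There is a contact form $\alpha$ on $M$ (hence a contact structure $\ker\alpha$) that supports $(B,\pi)$ and satisfies $\alpha\wedge(d\alpha)^n>0$ for the orientation $dt\wedge(d\beta)^n$ of $M$. 2. Let $\alpha_0,\alpha_1$ be contact forms on $M$ that support $(B,\pi)$ and induce symplectomorphic pages relative to the boundary in the following sense: there is a diffeomorphism $F$ of $M$, isotopic to the identity, that fixes $B$ pointwise, maps every open page to itself, and satisfies $F^*d\alpha_1=d\alpha_0$ on every open page. (For example, $F=\mathrm{id}$: $\alpha_0$ and $\alpha_1$ induce the same symplectic structure on every open page.) Then $\ker\alpha_0$ and $\ker\alpha_1$ are isotopic through contact structures: there are a smooth path $(\alpha_s)_{s\in[0,1]}$ of contact forms on $M$ from $\alpha_0$ to $\alpha_1$ and a smooth isotopy $(\Phi_s)$ of $M$ with $\Phi_0=\mathrm{id}$ such that $\Phi_s$ carries the cooriented contact structure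 $\ker\alpha_0$ onto $\ker\alpha_s$ for every $s\in[0,1]$. -/

import Mathlib

open scoped Manifold ContDiff Topology

noncomputable section

namespace SymplecticOpenBook

/-! ### Differential forms -/

section Forms

variable {E : Type*} [NormedAddCommGroup E] [NormedSpace ℝ E]
  {H : Type*} [TopologicalSpace H] (I : ModelWithCorners ℝ E H)
  {M : Type*} [TopologicalSpace M] [ChartedSpace H M]
  {E' : Type*} [NormedAddCommGroup E'] [NormedSpace ℝ E']
  {H' : Type*} [TopologicalSpace H'] (I' : ModelWithCorners ℝ E' H')
  {M' : Type*} [TopologicalSpace M'] [ChartedSpace H' M']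

/-- A (not necessarily smooth) differential `1`-form on `M`. -/
abbrev OneForm (M : Type*) [TopologicalSpace M] [ChartedSpace H M] : Type _ :=
  ∀ x : M, TangentSpace I x →L[ℝ] ℝ

variable {I I'}

/-- The expression of a `1`-form in the preferred chart at `x₀`, i.e. its pull-back under the
inverse of that chart. -/
def OneForm.inChart (α : OneForm I M) (x₀ : M) (y : E) : E →L[ℝ] ℝ :=
  (α ((extChartAt I x₀).symm y)).comp
    (mfderivWithin 𝓘(ℝ, E) I (extChartAt I x₀).symm (Set.range I) y)

/-- A `1`-form is smooth if its expression in every chart is smooth. -/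
def OneForm.IsSmooth (α : OneForm I M) : Prop :=
  ∀ x₀ : M, ContDiffOn ℝ ∞ (α.inChart x₀) (extChartAt I x₀).target

/-- A one-parameter family of `1`-forms is smooth if its expression in every chart is smooth,
jointly in the parameter and in the point. -/
def IsSmoothFamily (A : ℝ → OneForm I M) : Prop :=
  ∀ x₀ : M, ContDiffOn ℝ ∞ (fun p : ℝ × E => (A p.1).inChart x₀ p.2)
    (Set.univ ×ˢ (extChartAt I x₀).target)

/-- The exterior derivative `dα`, evaluated on two tangent vectors at `x`; it is computed in the
chart at `x` as `dω (u, v) = (D_u ω) v - (D_v ω) u`. -/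
def OneForm.d (α : OneForm I M) (x : M) (u v : TangentSpace I x) : ℝ :=
  let φ := mfderiv I 𝓘(ℝ, E) (extChartAt I x) x
  let D := fderivWithin ℝ (α.inChart x) (Set.range I) (extChartAt I x x)
  D (φ u) (φ v) - D (φ v) (φ u)

/-- The pull-back `f^* α`. -/
def OneForm.pullback (f : M' → M) (α : OneForm I M) : OneForm I' M' :=
  fun x => (α (f x)).comp (mfderiv I' I f x)

end Forms

section Algebra

variable {V : Type*}

/-- The value `w^k (v_0, …, v_{2k-1})` of the `k`-th exterior power of a two-form `w`. -/
def wedgePow (k : ℕ) (w : V → V → ℝ) (v : Fin (2 * k) → V) : ℝ :=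
  (1 / 2 ^ k : ℝ) * ∑ σ : Equiv.Perm (Fin (2 * k)), ((Equiv.Perm.sign σ : ℤ) : ℝ) *
    ∏ i : Fin k, w (v (σ ⟨2 * i, by omega⟩)) (v (σ ⟨2 * i + 1, by omega⟩))

/-- The value `(a ∧ w^k) (v_0, …, v_{2k})` for a one-form `a` and a two-form `w`. -/
def wedgeWedgePow (k : ℕ) (a : V → ℝ) (w : V → V → ℝ) (v : Fin (2 * k + 1) → V) : ℝ :=
  (1 / 2 ^ k : ℝ) * ∑ σ : Equiv.Perm (Fin (2 * k + 1)), ((Equiv.Perm.sign σ : ℤ) : ℝ) *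
    (a (v (σ 0)) *
      ∏ i : Fin k, w (v (σ ⟨2 * i + 1, by omega⟩)) (v (σ ⟨2 * i + 2, by omega⟩)))

end Algebra

/-! ### Contact forms -/

section Contact

variable {E : Type*} [NormedAddCommGroup E] [NormedSpace ℝ E]
  {H : Type*} [TopologicalSpace H] {I : ModelWithCorners ℝ E H}
  {M : Type*} [TopologicalSpace M] [ChartedSpace H M]

/-- The value of the top-degree form `α ∧ (dα)^k` on `2k + 1` vectors at `x`. -/
def contactVolume (k : ℕ) (α : OneForm I M) (x : M)
    (v : Fin (2 * k + 1) → TangentSpace I x) : ℝ :=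
  wedgeWedgePow k (α x) (α.d x) v

/-- `α` is a contact form on a manifold `M` of dimension `2k + 1`: it is smooth and
`α ∧ (dα)^k` is nowhere zero, i.e. a volume form. The contact structure that `α` defines is the
hyperplane field `ker α`, cooriented by `α`. -/
structure IsContactForm (k : ℕ) (α : OneForm I M) : Prop where
  smooth : α.IsSmooth
  volume_ne_zero : ∀ (x : M) (v : Fin (2 * k + 1) → TangentSpace I x),
    LinearIndependent ℝ v → contactVolume k α x v ≠ 0

/-- `R` is the value at `x` of the Reeb vector field of `α`. -/
def IsReebVector (α : OneForm I M) (x : M) (R : TangentSpace I x) : Prop :=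
  (∀ v, α.d x R v = 0) ∧ α x R = 1

/-- A smooth isotopy of `M`, starting at the identity. -/
def IsIsotopy (Φ : ℝ → (M ≃ₘ⟮I, I⟯ M)) : Prop :=
  ContMDiff (𝓘(ℝ, ℝ).prod I) I ∞ (fun p : ℝ × M => Φ p.1 p.2) ∧ ∀ x, Φ 0 x = x

/-- The contact structures `ker α₀` and `ker α₁` on a manifold of dimension `2k + 1` are isotopic
through contact structures: there are a smooth path of contact forms `A s`, `s ∈ [0, 1]`, from `α₀`
to `α₁`, and an isotopy `Φ s` of `M` which for every `s ∈ [0, 1]` carries the cooriented contact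
structure `ker α₀` onto `ker (A s)`. -/
def IsotopicThroughContact (k : ℕ) (α₀ α₁ : OneForm I M) : Prop :=
  ∃ (A : ℝ → OneForm I M) (Φ : ℝ → (M ≃ₘ⟮I, I⟯ M)),
    IsSmoothFamily A ∧ A 0 = α₀ ∧ A 1 = α₁ ∧ IsIsotopy Φ ∧
    ∀ s ∈ Set.Icc (0 : ℝ) 1, IsContactForm k (A s) ∧
      ∃ f : M → ℝ, (∀ x, 0 < f x) ∧
        ∀ x, (A s).pullback (I' := I) (Φ s) x = f x • α₀ x

end Contact

/-! ### Open book decompositions -/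

section OpenBook

/-- For `π : M → S¹ ⊆ ℂ`, the one-form `dθ ∘ dπ`: the rate of change of the angle of `π`. -/
def dAngle {E : Type*} [NormedAddCommGroup E] [NormedSpace ℝ E]
    {H : Type*} [TopologicalSpace H] (I : ModelWithCorners ℝ E H)
    {M : Type*} [TopologicalSpace M] [ChartedSpace H M] (π : M → Circle) (x : M)
    (v : TangentSpace I x) : ℝ :=
  let w : ℂ := mfderiv I 𝓘(ℝ, ℂ) (fun y => (π y : ℂ)) x v
  (starRingEnd ℂ (π x : ℂ) * w).im

variable (n : ℕ)
  (B : Type*) [TopologicalSpace B] [ChartedSpace (EuclideanSpace ℝ (Fin (2 * n + 1))) B]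
  (M : Type*) [TopologicalSpace M] [ChartedSpace (EuclideanSpace ℝ (Fin (2 * n + 3))) M]

/-- An open book decomposition of a manifold `M` of dimension `2n + 3`, with binding `B`. The
binding is embedded in `M` as the core `B × {0}` of a tubular neighbourhood, trivialised by a
diffeomorphism `tube` from `B × {|z| < δ}` onto an open subset of `M`. The fibration `proj` is
relevant only off the binding, and equals the polar angle in the tubular neighbourhood. -/
structure OpenBook where
  proj : M → Circle
  δ : ℝ
  δ_pos : 0 < δ
  tube : PartialDiffeomorph ((𝓡 (2 * n + 1)).prod 𝓘(ℝ, ℂ)) (𝓡 (2 * n + 3)) (B × ℂ) M ∞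
  tube_source : tube.source = Set.univ ×ˢ Metric.ball 0 δ
  proj_tube : ∀ (b : B) (z : ℂ), z ≠ 0 → ‖z‖ < δ → (proj (tube (b, z)) : ℂ) = z / ‖z‖
  proj_smooth : ContMDiffOn (𝓡 (2 * n + 3)) 𝓘(ℝ, ℂ) ∞ (fun x => (proj x : ℂ))
    (Set.range fun b => tube (b, 0))ᶜ
  proj_submersion : ∀ x ∉ Set.range (fun b => tube (b, 0)), ∃ v : TangentSpace (𝓡 (2 * n + 3)) x,
    dAngle (𝓡 (2 * n + 3)) proj x v ≠ 0

namespace OpenBook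

variable {n B M} (ob : OpenBook n B M)

/-- The embedding of the binding. -/
def incl (b : B) : M := ob.tube (b, 0)

/-- The differential of the trivialisation of the tubular neighbourhood at a point of the core. -/
def dTube (b : B) : (TangentSpace (𝓡 (2 * n + 1)) b × ℂ) →L[ℝ]
    TangentSpace (𝓡 (2 * n + 3)) (ob.incl b) :=
  mfderiv ((𝓡 (2 * n + 1)).prod 𝓘(ℝ, ℂ)) (𝓡 (2 * n + 3)) ob.tube (b, (0 : ℂ))

/-- A contact form `α` on `M` supports the open book: the binding `B` is a contact submanifold,
positively oriented by `α` (the orientations of `B` and `M` given by `α` correspond to each other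
under `TM|_B = TB ⊕ ℂ`; equivalently, `α|_B` is positive for the orientation of `B` as the boundary
of the pages, oriented by `dα`), and the Reeb vector field is positively transverse to the pages and
tangent to the binding. -/
structure Supports (α : OneForm (𝓡 (2 * n + 3)) M) : Prop where
  contact_binding : IsContactForm n (OneForm.pullback (I' := 𝓡 (2 * n + 1)) ob.incl α)
  positive_binding : ∀ (b : B) (v : Fin (2 * n + 1) → TangentSpace (𝓡 (2 * n + 1)) b),
    LinearIndependent ℝ v →
    0 < contactVolume n (OneForm.pullback (I' := 𝓡 (2 * n + 1)) ob.incl α) b v *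
      contactVolume (n + 1) α (ob.incl b)
        (Fin.append (m := 2 * n + 1) (n := 2) (fun i => ob.dTube b (v i, 0))
          ![ob.dTube b (0, 1), ob.dTube b (0, Complex.I)])
  reeb_transverse : ∀ x ∉ Set.range ob.incl, ∀ R, IsReebVector α x R →
    0 < dAngle (𝓡 (2 * n + 3)) ob.proj x R
  reeb_tangent : ∀ (b : B) (R), IsReebVector α (ob.incl b) R →
    ∃ w : TangentSpace (𝓡 (2 * n + 1)) b,
      mfderiv (𝓡 (2 * n + 1)) (𝓡 (2 * n + 3)) ob.incl b w = R

/-- The contact forms `α₀` and `α₁` induce symplectomorphic pages, relative to the boundary: some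
diffeomorphism of `M` that is isotopic to the identity fixes the binding pointwise, maps every page
to itself, and on every open page pulls `dα₁` back to `dα₀`. -/
def SymplectomorphicPages (α₀ α₁ : OneForm (𝓡 (2 * n + 3)) M) : Prop :=
  ∃ F : ℝ → (M ≃ₘ⟮𝓡 (2 * n + 3), 𝓡 (2 * n + 3)⟯ M), IsIsotopy F ∧
    (∀ b, F 1 (ob.incl b) = ob.incl b) ∧
    ∀ x ∉ Set.range ob.incl, ob.proj (F 1 x) = ob.proj x ∧
      ∀ u v : TangentSpace (𝓡 (2 * n + 3)) x,
        dAngle (𝓡 (2 * n + 3)) ob.proj x u = 0 → dAngle (𝓡 (2 * n + 3)) ob.proj x v = 0 →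
        α₁.d (F 1 x) (mfderiv (𝓡 (2 * n + 3)) (𝓡 (2 * n + 3)) (F 1) x u)
          (mfderiv (𝓡 (2 * n + 3)) (𝓡 (2 * n + 3)) (F 1) x v) = α₀.d x u v

end OpenBook

end OpenBook

/-! ### The closed manifold of a page and a monodromy -/

section Abstract

variable {n : ℕ} {P : Type*} [TopologicalSpace P]
  [ChartedSpace (EuclideanHalfSpace (2 * n + 2)) P]

/-- A tangent vector at a boundary point `x` of `P` is transverse to the boundary and points outwards.
In the charts, `P` is the half-space where the coordinate `0` is nonnegative. -/
def PointsOutward (x : P) (X : TangentSpace (𝓡∂ (2 * n + 2)) x) : Prop :=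
  let Y : EuclideanSpace ℝ (Fin (2 * n + 2)) :=
    mfderiv (𝓡∂ (2 * n + 2)) (𝓡 (2 * n + 2)) (extChartAt (𝓡∂ (2 * n + 2)) x) x X
  Y 0 < 0

/-- `(P, dβ)` is an exact symplectic manifold with convex boundary, i.e. the Liouville field `X`,
`ι_X dβ = β`, points outwards along the boundary, and `Ψ` is a symplectomorphism of `(P, dβ)` that
is the identity near the boundary. -/
structure IsSymplecticOpenBook (β : OneForm (𝓡∂ (2 * n + 2)) P)
    (Ψ : P ≃ₘ⟮𝓡∂ (2 * n + 2), 𝓡∂ (2 * n + 2)⟯ P) : Prop where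
  smooth : β.IsSmooth
  nondegenerate : ∀ (x : P) (u : TangentSpace (𝓡∂ (2 * n + 2)) x), (∀ v, β.d x u v = 0) → u = 0
  convex_boundary : ∀ x ∈ (𝓡∂ (2 * n + 2)).boundary P, ∀ X : TangentSpace (𝓡∂ (2 * n + 2)) x,
    (∀ v, β.d x X v = β x v) →
    PointsOutward x X
  symplecto : ∀ (x : P) (u v : TangentSpace (𝓡∂ (2 * n + 2)) x),
    β.d (Ψ x) (mfderiv (𝓡∂ (2 * n + 2)) (𝓡∂ (2 * n + 2)) Ψ x u)
      (mfderiv (𝓡∂ (2 * n + 2)) (𝓡∂ (2 * n + 2)) Ψ x v) = β.d x u v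
  id_near_boundary : ∀ᶠ x in 𝓝ˢ ((𝓡∂ (2 * n + 2)).boundary P), Ψ x = x

/-- The relation on `P × [0, 1]` generating the gluing: `(p, t) ∼ (p, s)` for `p ∈ ∂P`, and
`(Ψ q, 0) ∼ (q, 1)`. -/
inductive Glue (Ψ : P ≃ₘ⟮𝓡∂ (2 * n + 2), 𝓡∂ (2 * n + 2)⟯ P) : P × unitInterval → P × unitInterval → Prop
  | boundary (p : P) (hp : p ∈ (𝓡∂ (2 * n + 2)).boundary P) (t s : unitInterval) : Glue Ψ (p, t) (p, s)
  | monodromy (q : P) : Glue Ψ (Ψ q, 0) (q, 1)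

/-- The quotient space `(P × [0, 1]) / ∼`. -/
abbrev Total (Ψ : P ≃ₘ⟮𝓡∂ (2 * n + 2), 𝓡∂ (2 * n + 2)⟯ P) : Type _ := Quot (Glue Ψ)

variable (Ψ : P ≃ₘ⟮𝓡∂ (2 * n + 2), 𝓡∂ (2 * n + 2)⟯ P)

/-- The projection of `P × [0, 1]` onto the quotient, continued to `P × ℝ` by the rule
`(x, t + 1) ↦ (Ψ x, t)`. -/
def susp (p : P × ℝ) : Total Ψ :=
  Quot.mk _ (((Ψ.toEquiv : Equiv.Perm P) ^ ⌊p.2⌋) p.1,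
    ⟨Int.fract p.2, Int.fract_nonneg _, (Int.fract_lt_one _).le⟩)

/-- The map `(p, t) ↦ exp (2πit)` to the circle; it is meaningful off the image of `∂P`. -/
def angle (y : Total Ψ) : Circle := Circle.exp (2 * Real.pi * ((Quot.out y).2 : ℝ))

section Angle

variable {Ψ}

theorem interior_iff (x : P) :
    Ψ x ∈ (𝓡∂ (2 * n + 2)).interior P ↔ x ∈ (𝓡∂ (2 * n + 2)).interior P :=
  ((Ψ.toPartialDiffeomorph.isLocalDiffeomorphAt _ _ _ (x := x) (Set.mem_univ x)).isInteriorPoint_iff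
    (by simp)).symm

theorem zpow_interior_iff (k : ℤ) (x : P) :
    ((Ψ.toEquiv : Equiv.Perm P) ^ k) x ∈ (𝓡∂ (2 * n + 2)).interior P ↔
      x ∈ (𝓡∂ (2 * n + 2)).interior P := by
  induction k generalizing x with
  | zero => simp
  | succ k ih =>
    rw [zpow_add_one, Equiv.Perm.mul_apply, ih]
    exact interior_iff x
  | pred k ih =>
    rw [zpow_sub_one, Equiv.Perm.mul_apply, ih, ← interior_iff (Ψ := Ψ)]
    rw [show Ψ ((Ψ.toEquiv : Equiv.Perm P)⁻¹ x) = x from Ψ.toEquiv.apply_symm_apply x]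

open Classical in
/-- The angle off the image of `∂P`, and `none` on it. -/
def angleOpt : Total Ψ → Option Circle :=
  Quot.lift (fun p => if p.1 ∈ (𝓡∂ (2 * n + 2)).interior P then
    some (Circle.exp (2 * Real.pi * (p.2 : ℝ))) else none) (by
    rintro _ _ (⟨p, hp, t, s⟩ | ⟨q⟩)
    · rw [← (𝓡∂ (2 * n + 2)).compl_interior] at hp
      simp only [if_neg hp]
    · simp [interior_iff])

theorem angleOpt_susp {x : P}
    (hx : x ∈ (𝓡∂ (2 * n + 2)).interior P) (t : ℝ) :
    angleOpt (susp Ψ (x, t)) = some (Circle.exp (2 * Real.pi * t)) := by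
  have h : Circle.exp (2 * Real.pi * Int.fract t) = Circle.exp (2 * Real.pi * t) := by
    rw [Int.fract, mul_sub, Circle.exp_sub, Circle.exp_two_pi_mul_int, div_one]
  simp only [angleOpt, susp]
  rw [if_pos ((zpow_interior_iff _ _).2 hx), h]

theorem angle_susp {x : P}
    (hx : x ∈ (𝓡∂ (2 * n + 2)).interior P) (t : ℝ) :
    angle Ψ (susp Ψ (x, t)) = Circle.exp (2 * Real.pi * t) := by
  have h := angleOpt_susp (Ψ := Ψ) hx t
  rw [← Quot.out_eq (susp Ψ (x, t))] at h
  simp only [angleOpt] at h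
  split_ifs at h
  exact Option.some.inj h

end Angle

variable (B : Type*) [TopologicalSpace B] [ChartedSpace (EuclideanSpace ℝ (Fin (2 * n + 1))) B]
  [ChartedSpace (EuclideanSpace ℝ (Fin (2 * n + 3))) (Total Ψ)]

/-- The smooth structure of the closed manifold `(P × [0, 1]) / ∼`. On the interior of the mapping
torus it is the one of `P × ℝ`. A collar `B × [0, δ)` of the boundary identifies `B` with `∂P`; a
neighbourhood of the image of `∂P` in the quotient is identified with `B × {|z| < δ}`, such that the
point `(b, r)` of the collar at time `t` becomes `(b, r exp (2πit))`. -/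
structure SmoothGluing where
  δ : ℝ
  δ_pos : 0 < δ
  collar : PartialDiffeomorph ((𝓡 (2 * n + 1)).prod (𝓡∂ 1)) (𝓡∂ (2 * n + 2))
    (B × EuclideanHalfSpace 1) P ∞
  collar_source : collar.source = {p | p.2.val 0 < δ}
  collar_target : (𝓡∂ (2 * n + 2)).boundary P ⊆ collar.target
  tube : PartialDiffeomorph ((𝓡 (2 * n + 1)).prod 𝓘(ℝ, ℂ)) (𝓡 (2 * n + 3)) (B × ℂ) (Total Ψ) ∞
  tube_source : tube.source = Set.univ ×ˢ Metric.ball 0 δ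
  tube_eq : ∀ (b : B) (r : EuclideanHalfSpace 1) (t : ℝ), r.val 0 < δ →
    tube (b, (r.val 0 : ℂ) * Complex.exp (2 * Real.pi * t * Complex.I)) = susp Ψ (collar (b, r), t)
  susp_localDiffeo : IsLocalDiffeomorphOn ((𝓡∂ (2 * n + 2)).prod 𝓘(ℝ, ℝ)) (𝓡 (2 * n + 3)) ∞
    (susp Ψ) ((𝓡∂ (2 * n + 2)).interior P ×ˢ Set.univ)

section Facts

variable {Ψ B}

theorem SmoothGluing.tube_zero (S : SmoothGluing Ψ B) (b : B) (t : ℝ) : S.tube (b, 0) = susp Ψ (S.collar (b, 0), t) := by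
  have := S.tube_eq b 0 t S.δ_pos
  rw [← this]
  congr 2
  show (0 : ℂ) = ((0 : ℝ) : ℂ) * _
  simp

variable (S : SmoothGluing Ψ B)

theorem SmoothGluing.collar_interior_iff (b : B) (r : EuclideanHalfSpace 1) (hr : r.val 0 < S.δ) :
    S.collar (b, r) ∈ (𝓡∂ (2 * n + 2)).interior P ↔ 0 < r.val 0 := by
  have h1 := (S.collar.isLocalDiffeomorphAt _ _ _ (x := (b, r))
    (by rw [S.collar_source]; exact hr)).isInteriorPoint_iff (by simp)
  have h2 : ((b, r) : B × EuclideanHalfSpace 1) ∈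
      ((𝓡 (2 * n + 1)).prod (𝓡∂ 1)).interior (B × EuclideanHalfSpace 1) ↔ 0 < r.val 0 := by
    rw [ModelWithCorners.interior_prod]
    simp [ModelWithCorners.interior_eq_univ]
    show extChartAt (𝓡∂ 1) r r ∈ interior (Set.range (𝓡∂ 1)) ↔ _
    rw [interior_range_modelWithCornersEuclideanHalfSpace]
    rfl
  exact h1.symm.trans h2

theorem SmoothGluing.exists_susp {y : Total Ψ} (hy : y ∉ Set.range fun b => S.tube (b, 0)) :
    ∃ x ∈ (𝓡∂ (2 * n + 2)).interior P, ∃ t, y = susp Ψ (x, t) := by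
  obtain ⟨⟨p, t⟩, rfl⟩ := Quot.exists_rep y
  by_cases hp : p ∈ (𝓡∂ (2 * n + 2)).interior P
  · by_cases ht : (t : ℝ) < 1
    · refine ⟨p, hp, t, ?_⟩
      have h1 : ⌊(t : ℝ)⌋ = 0 := Int.floor_eq_zero_iff.2 ⟨t.2.1, ht⟩
      have h2 : Int.fract (t : ℝ) = t := Int.fract_eq_self.2 ⟨t.2.1, ht⟩
      simp [susp, h1, h2]
    · have h1 : t = 1 := le_antisymm t.2.2 (not_lt.1 ht)
      refine ⟨Ψ p, (interior_iff p).2 hp, 0, ?_⟩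
      rw [h1, ← Quot.sound (Glue.monodromy p)]
      simp [susp]
  · exfalso
    have hb : p ∈ (𝓡∂ (2 * n + 2)).boundary P := by
      rw [← ModelWithCorners.compl_interior]; exact hp
    apply hy
    have hpt := S.collar_target hb
    have hs := S.collar.map_target' hpt
    have hr := S.collar.right_inv' hpt
    set c := S.collar.invFun p with hc
    obtain ⟨b, r⟩ := c
    rw [S.collar_source] at hs
    have hr' : S.collar (b, r) = p := hr
    have h0 : ¬ 0 < r.val 0 := fun h => hp (hr' ▸ (S.collar_interior_iff b r hs).2 h)
    have hr0 : r = 0 := by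
      apply Subtype.ext
      ext i
      fin_cases i
      exact le_antisymm (not_lt.1 h0) r.2
    refine ⟨b, ?_⟩
    show S.tube (b, 0) = _
    rw [S.tube_zero b 0, ← hr0, hr']
    have : susp Ψ (p, 0) = Quot.mk _ (p, 0) := by simp [susp]
    rw [this]
    exact Quot.sound (Glue.boundary p hb 0 t)

theorem SmoothGluing.proj_tube (b : B) (z : ℂ) (hz : z ≠ 0) (h : ‖z‖ < S.δ) :
    (angle Ψ (S.tube (b, z)) : ℂ) = z / ‖z‖ := by
  let r : EuclideanHalfSpace 1 := ⟨!₂[‖z‖], by simp⟩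
  have hr : r.val 0 = ‖z‖ := by simp [r]
  have he : Complex.exp (2 * Real.pi * ((Complex.arg z / (2 * Real.pi) : ℝ) : ℂ) * Complex.I) =
      z / ‖z‖ := by
    have := Complex.norm_mul_exp_arg_mul_I z
    rw [eq_div_iff (by simpa using hz), mul_comm]
    conv_rhs => rw [← this]
    congr 3
    push_cast
    field_simp
  have h1 := S.tube_eq b r (Complex.arg z / (2 * Real.pi)) (hr ▸ h)
  rw [he, hr, mul_div_cancel₀ _ (by simpa using hz)] at h1
  rw [h1, angle_susp ((S.collar_interior_iff b r (hr ▸ h)).2 (by rw [hr]; simpa using hz)),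
    Circle.coe_exp, ← he]
  push_cast
  rfl

variable [IsManifold (𝓡∂ (2 * n + 2)) ∞ P]

theorem SmoothGluing.angle_contMDiffAt (S : SmoothGluing Ψ B) {x : P} (hx : x ∈ (𝓡∂ (2 * n + 2)).interior P) (t : ℝ) :
    ContMDiffAt (𝓡 (2 * n + 3)) 𝓘(ℝ, ℂ) ∞ (fun y => (angle Ψ y : ℂ)) (susp Ψ (x, t)) := by
  have hl := S.susp_localDiffeo ⟨(x, t), hx, Set.mem_univ _⟩
  have hc := hl.localInverse_contMDiffAt
  have h1 : ContMDiffAt (𝓡 (2 * n + 3)) 𝓘(ℝ, ℂ) ∞ (fun y => Complex.exp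
      (2 * Real.pi * ((hl.localInverse y).2 : ℂ) * Complex.I)) (susp Ψ (x, t)) := by
    have h2 : ContMDiffAt (𝓡 (2 * n + 3)) 𝓘(ℝ, ℝ) ∞ (fun y => (hl.localInverse y).2)
      (susp Ψ (x, t)) := contMDiffAt_snd.comp _ hc
    have h3 : ContDiff ℝ ∞ (fun s : ℝ => Complex.exp (2 * Real.pi * (s : ℂ) * Complex.I)) :=
      ((contDiff_const.mul Complex.ofRealCLM.contDiff).mul contDiff_const).cexp
    exact h3.contMDiff.contMDiffAt.comp _ h2
  refine h1.congr_of_eventuallyEq ?_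
  have hval : hl.localInverse (susp Ψ (x, t)) = (x, t) :=
    hl.localInverse_left_inv hl.localInverse_mem_target
  have hopen : ∀ᶠ y in 𝓝 (susp Ψ (x, t)),
      (hl.localInverse y).1 ∈ (𝓡∂ (2 * n + 2)).interior P := by
    have := (continuous_fst.continuousAt.comp hc.continuousAt).preimage_mem_nhds
      (t := (𝓡∂ (2 * n + 2)).interior P)
      (((𝓡∂ (2 * n + 2)).isOpen_interior (n := ∞) (by simp)).mem_nhds (by
        simp only [Function.comp]; rw [hval]; exact hx))
    exact this
  filter_upwards [hopen, hl.localInverse_eventuallyEq_right] with y hy1 hy2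
  have hy3 : susp Ψ (hl.localInverse y) = y := hy2
  conv_lhs => rw [← hy3]
  rw [show hl.localInverse y = ((hl.localInverse y).1, (hl.localInverse y).2) from rfl,
    angle_susp hy1, Circle.coe_exp]
  push_cast
  rfl

theorem SmoothGluing.angle_submersion (S : SmoothGluing Ψ B) {x : P} (hx : x ∈ (𝓡∂ (2 * n + 2)).interior P) (t : ℝ) :
    ∃ v : TangentSpace (𝓡 (2 * n + 3)) (susp Ψ (x, t)),
      dAngle (𝓡 (2 * n + 3)) (angle Ψ) (susp Ψ (x, t)) v ≠ 0 := by
  have hl := S.susp_localDiffeo ⟨(x, t), hx, Set.mem_univ _⟩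
  have hA := (S.angle_contMDiffAt hx t).mdifferentiableAt (by simp)
  have hs := hl.mdifferentiableAt (by simp)
  have hj : MDifferentiableAt 𝓘(ℝ, ℝ) ((𝓡∂ (2 * n + 2)).prod 𝓘(ℝ, ℝ)) (fun s : ℝ => (x, s)) t :=
    (mdifferentiableAt_const.prodMk mdifferentiableAt_id)
  have hcomp : HasMFDerivAt 𝓘(ℝ, ℝ) 𝓘(ℝ, ℂ)
      ((fun y => (angle Ψ y : ℂ)) ∘ (susp Ψ) ∘ fun s : ℝ => (x, s)) t _ :=
    HasMFDerivAt.comp t hA.hasMFDerivAt (HasMFDerivAt.comp t hs.hasMFDerivAt hj.hasMFDerivAt)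
  have heq : ((fun y => (angle Ψ y : ℂ)) ∘ (susp Ψ) ∘ fun s : ℝ => (x, s)) =
      fun s : ℝ => Complex.exp (2 * Real.pi * (s : ℂ) * Complex.I) := by
    funext s
    simp only [Function.comp]
    rw [angle_susp hx, Circle.coe_exp]
    push_cast
    rfl
  rw [heq] at hcomp
  let L : ℝ →L[ℝ] ℂ :=
    (mfderiv (𝓡 (2 * n + 3)) 𝓘(ℝ, ℂ) (fun y => (angle Ψ y : ℂ)) (susp Ψ (x, t))).comp
      ((mfderiv ((𝓡∂ (2 * n + 2)).prod 𝓘(ℝ, ℝ)) (𝓡 (2 * n + 3)) (susp Ψ) (x, t)).comp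
        (mfderiv 𝓘(ℝ, ℝ) ((𝓡∂ (2 * n + 2)).prod 𝓘(ℝ, ℝ)) (fun s : ℝ => (x, s)) t))
  have hf : HasFDerivAt (fun s : ℝ => Complex.exp (2 * Real.pi * (s : ℂ) * Complex.I)) L t :=
    hcomp.hasFDerivAt
  have hd := hf.hasDerivAt
  have hd' : HasDerivAt (fun s : ℝ => Complex.exp (2 * Real.pi * (s : ℂ) * Complex.I))
      (Complex.exp (2 * Real.pi * (t : ℂ) * Complex.I) * (2 * Real.pi * Complex.I)) t := by
    have : HasDerivAt (fun s : ℝ => (2 * Real.pi * (s : ℂ) * Complex.I))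
        (2 * Real.pi * Complex.I) t := by
      have := ((Complex.ofRealCLM.hasDerivAt (x := t)).const_mul (2 * Real.pi : ℂ)).mul_const
        Complex.I
      simpa using this
    exact this.cexp
  have hu := hd.unique hd'
  refine ⟨(mfderiv ((𝓡∂ (2 * n + 2)).prod 𝓘(ℝ, ℝ)) (𝓡 (2 * n + 3)) (susp Ψ) (x, t)).comp
    (mfderiv 𝓘(ℝ, ℝ) ((𝓡∂ (2 * n + 2)).prod 𝓘(ℝ, ℝ)) (fun s : ℝ => (x, s)) t) (1 : ℝ), ?_⟩
  have key : dAngle (𝓡 (2 * n + 3)) (angle Ψ) (susp Ψ (x, t))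
      ((mfderiv ((𝓡∂ (2 * n + 2)).prod 𝓘(ℝ, ℝ)) (𝓡 (2 * n + 3)) (susp Ψ) (x, t)).comp
    (mfderiv 𝓘(ℝ, ℝ) ((𝓡∂ (2 * n + 2)).prod 𝓘(ℝ, ℝ)) (fun s : ℝ => (x, s)) t) (1 : ℝ)) =
      (starRingEnd ℂ (angle Ψ (susp Ψ (x, t)) : ℂ) *
        (Complex.exp (2 * Real.pi * (t : ℂ) * Complex.I) * (2 * Real.pi * Complex.I))).im := by
    rw [← hu]
    rfl
  rw [key, angle_susp hx, Circle.coe_exp]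
  have : ((2 * Real.pi * t : ℝ) : ℂ) = 2 * Real.pi * (t : ℂ) := by push_cast; rfl
  rw [this, ← mul_assoc, ← this, ← Circle.coe_exp, ← Circle.coe_inv_eq_conj, ← Circle.coe_mul,
    inv_mul_cancel]
  simp [Real.pi_ne_zero]

/-- The open book decomposition of the closed manifold `(P × [0, 1]) / ∼`. -/
def SmoothGluing.openBook : OpenBook n B (Total Ψ) where
  proj := angle Ψ
  δ := S.δ
  δ_pos := S.δ_pos
  tube := S.tube
  tube_source := S.tube_source
  proj_tube := S.proj_tube
  proj_smooth := by
    intro y hy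
    obtain ⟨x, hx, t, rfl⟩ := S.exists_susp hy
    exact (S.angle_contMDiffAt hx t).contMDiffWithinAt
  proj_submersion := by
    intro y hy
    obtain ⟨x, hx, t, rfl⟩ := S.exists_susp hy
    exact S.angle_submersion hx t

/-- `α ∧ (dα)^(n+1)` is positive for the orientation `dt ∧ (dβ)^(n+1)` of the total space: on the
interior of every page `P × {t}`, it is positive on `∂_t` followed by the vectors of a basis of `TP`
that is positively oriented by `(dβ)^(n+1)`. -/
def IsPositive (β : OneForm (𝓡∂ (2 * n + 2)) P) (α : OneForm (𝓡 (2 * n + 3)) (Total Ψ)) : Prop :=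
  ∀ x ∈ (𝓡∂ (2 * n + 2)).interior P, ∀ t : ℝ,
    let D : TangentSpace (𝓡∂ (2 * n + 2)) x × ℝ →L[ℝ]
        TangentSpace (𝓡 (2 * n + 3)) (susp Ψ (x, t)) :=
      mfderiv ((𝓡∂ (2 * n + 2)).prod 𝓘(ℝ, ℝ)) (𝓡 (2 * n + 3)) (susp Ψ) (x, t)
    ∀ w : Fin (2 * (n + 1)) → TangentSpace (𝓡∂ (2 * n + 2)) x, 0 < wedgePow (n + 1) (β.d x) w →
      0 < contactVolume (n + 1) α (susp Ψ (x, t)) (Fin.cons (D (0, 1)) fun i => D (w i, 0))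

end Facts

end Abstract

end SymplecticOpenBook

end

set_option linter.unusedSectionVars false

open scoped Manifold ContDiff Topology
open LinearMap (BilinForm)

noncomputable section

namespace SymplecticOpenBook

open OneForm (pullback)

/-! ### Exterior algebra -/

section ExteriorAlgebra

variable {V : Type*} [AddCommGroup V] [Module ℝ V]

open ExteriorAlgebra

/-- Contraction of an exterior form with a vector. -/
def contract (u : V) : ExteriorAlgebra ℝ (Module.Dual ℝ V) →ₗ[ℝ]
    ExteriorAlgebra ℝ (Module.Dual ℝ V) :=
  CliffordAlgebra.contractLeft (Q := (0 : QuadraticForm ℝ (Module.Dual ℝ V)))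
    (Module.Dual.eval ℝ V u)

theorem contract_ι_mul (u : V) (a : Module.Dual ℝ V)
    (x : ExteriorAlgebra ℝ (Module.Dual ℝ V)) :
    contract u (ι ℝ a * x) = a u • x - ι ℝ a * contract u x :=
  CliffordAlgebra.contractLeft_ι_mul _ _ _

theorem contract_ι (u : V) (a : Module.Dual ℝ V) :
    contract u (ι ℝ a) = algebraMap ℝ _ (a u) :=
  CliffordAlgebra.contractLeft_ι (Q := (0 : QuadraticForm ℝ (Module.Dual ℝ V))) _ _

theorem contract_one (u : V) : contract u (1 : ExteriorAlgebra ℝ (Module.Dual ℝ V)) = 0 :=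
  CliffordAlgebra.contractLeft_one (Q := (0 : QuadraticForm ℝ (Module.Dual ℝ V))) _

/-- Evaluation of an exterior form on a family of vectors. -/
def evalForm : ∀ {N : ℕ}, (Fin N → V) → ExteriorAlgebra ℝ (Module.Dual ℝ V) →ₗ[ℝ] ℝ
  | 0, _ => (algebraMapInv (R := ℝ) (M := Module.Dual ℝ V)).toLinearMap
  | _ + 1, v => (evalForm (Fin.tail v)).comp (contract (v 0))

theorem evalForm_zero (v : Fin 0 → V) (x : ExteriorAlgebra ℝ (Module.Dual ℝ V)) :
    evalForm v x = algebraMapInv x := rfl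

theorem evalForm_succ {N : ℕ} (v : Fin (N + 1) → V)
    (x : ExteriorAlgebra ℝ (Module.Dual ℝ V)) :
    evalForm v x = evalForm (Fin.tail v) (contract (v 0) x) := rfl

theorem evalForm_cons {N : ℕ} (u : V) (v : Fin N → V)
    (x : ExteriorAlgebra ℝ (Module.Dual ℝ V)) :
    evalForm (Fin.cons u v) x = evalForm v (contract u x) := by
  simp [evalForm_succ]

theorem contract_ιMulti (u : V) {N : ℕ} (f : Fin (N + 1) → Module.Dual ℝ V) :
    contract u (ιMulti ℝ (N + 1) f) =
      ∑ i : Fin (N + 1), ((-1) ^ (i : ℕ) * f i u) • ιMulti ℝ N (f ∘ i.succAbove) := by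
  induction N with
  | zero =>
    rw [ιMulti_succ_apply, contract_ι_mul]
    simp [contract_one]
  | succ N ih =>
    rw [ιMulti_succ_apply, contract_ι_mul, ih, Fin.sum_univ_succ (n := N + 1), Finset.mul_sum,
      sub_eq_add_neg,
      ← Finset.sum_neg_distrib]
    congr 1
    · simp [Matrix.vecTail, Function.comp_def]
    · refine Finset.sum_congr rfl fun i _ => ?_
      rw [ιMulti_succ_apply (f ∘ i.succ.succAbove)]
      simp only [Function.comp_apply, Fin.succ_succAbove_zero, Fin.val_succ, Matrix.vecTail]
      rw [mul_smul_comm, ← neg_smul, pow_succ]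
      congr 1
      · ring
      · congr 2
        funext j
        simp [Fin.succ_succAbove_succ]

theorem evalForm_ιMulti {N : ℕ} (v : Fin N → V) (f : Fin N → Module.Dual ℝ V) :
    evalForm v (ιMulti ℝ N f) = (Matrix.of fun i j => f i (v j)).det := by
  induction N with
  | zero => simp [evalForm_zero]
  | succ N ih =>
    rw [evalForm_succ, contract_ιMulti, map_sum, Matrix.det_succ_column_zero]
    refine Finset.sum_congr rfl fun i _ => ?_
    rw [map_smul, ih, smul_eq_mul]
    rfl

/-- The two-form `p ∧ q`. -/
def wedgeTwo (p q : Module.Dual ℝ V) : BilinForm ℝ V :=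
  LinearMap.mk₂ ℝ (fun u v => p u * q v - q u * p v)
    (fun _ _ _ => by simp; ring) (fun _ _ _ => by simp; ring)
    (fun _ _ _ => by simp; ring) (fun _ _ _ => by simp; ring)

@[simp] theorem wedgeTwo_apply (p q : Module.Dual ℝ V) (u v : V) :
    wedgeTwo p q u v = p u * q v - q u * p v := rfl

variable [FiniteDimensional ℝ V]

/-- The element of the exterior algebra that represents a two-form. -/
def twoForm : (BilinForm ℝ V) →ₗ[ℝ] ExteriorAlgebra ℝ (Module.Dual ℝ V) where
  toFun w := ∑ i, ι ℝ ((Module.finBasis ℝ V).coord i) * ι ℝ ((1 / 2 : ℝ) • w (Module.finBasis ℝ V i))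
  map_add' w w' := by simp [← Finset.sum_add_distrib, mul_add]
  map_smul' c w := by
    simp only [Finset.smul_sum, LinearMap.smul_apply, RingHom.id_apply]
    refine Finset.sum_congr rfl fun i _ => ?_
    rw [smul_comm, map_smul, mul_smul_comm]

theorem twoForm_apply (w : BilinForm ℝ V) : twoForm w =
    ∑ i, ι ℝ ((Module.finBasis ℝ V).coord i) * ι ℝ ((1 / 2 : ℝ) • w (Module.finBasis ℝ V i)) := rfl

theorem sum_coord_smul (p : Module.Dual ℝ V) :
    ∑ i, p (Module.finBasis ℝ V i) • (Module.finBasis ℝ V).coord i = p :=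
  (Module.finBasis ℝ V).sum_dual_apply_smul_coord p

theorem ι_mul_ι_swap (p q : Module.Dual ℝ V) : ι ℝ p * ι ℝ q = -(ι ℝ q * ι ℝ p) :=
  eq_neg_of_add_eq_zero_left (ι_add_mul_swap p q)

theorem twoForm_wedgeTwo (p q : Module.Dual ℝ V) : twoForm (wedgeTwo p q) = ι ℝ p * ι ℝ q := by
  have h : ∀ i, (wedgeTwo p q) (Module.finBasis ℝ V i) =
      p (Module.finBasis ℝ V i) • q - q (Module.finBasis ℝ V i) • p := fun i => by
    ext v; simp
  have e : ∀ p q : Module.Dual ℝ V, ∑ i, ι ℝ ((Module.finBasis ℝ V).coord i) *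
      (p (Module.finBasis ℝ V i) • ι ℝ q) = ι ℝ p * ι ℝ q := fun p q => by
    conv_rhs => rw [← sum_coord_smul p]
    rw [map_sum, Finset.sum_mul]
    refine Finset.sum_congr rfl fun i _ => ?_
    rw [map_smul, mul_smul_comm, smul_mul_assoc]
  rw [twoForm_apply]
  simp only [h, map_smul, map_sub, mul_smul_comm, mul_sub, ← Finset.smul_sum,
    Finset.sum_sub_distrib]
  simp only [← mul_smul_comm, e]
  rw [ι_mul_ι_swap q p, sub_neg_eq_add, ← two_smul ℝ, smul_smul]
  norm_num

theorem commute_ι_mul_ι (a p q : Module.Dual ℝ V) : Commute (ι ℝ a) (ι ℝ p * ι ℝ q) := by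
  show ι ℝ a * (ι ℝ p * ι ℝ q) = ι ℝ p * ι ℝ q * ι ℝ a
  rw [← mul_assoc, ι_mul_ι_swap a p, neg_mul, mul_assoc, ι_mul_ι_swap a q, mul_neg, neg_neg,
    mul_assoc]

theorem commute_ι_twoForm (a : Module.Dual ℝ V) (w : BilinForm ℝ V) :
    Commute (ι ℝ a) (twoForm w) := by
  rw [twoForm_apply]
  exact Finset.sum_induction _ (Commute (ι ℝ a)) (fun _ _ => Commute.add_right) (Commute.zero_right _)
    fun _ _ => commute_ι_mul_ι _ _ _

theorem contract_twoForm (u : V) {w : BilinForm ℝ V} (hw : ∀ u v, w u v = -w v u) :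
    contract u (twoForm w) = ι ℝ (w u) := by
  rw [twoForm_apply, map_sum]
  simp only [contract_ι_mul, contract_ι, LinearMap.smul_apply, smul_eq_mul]
  rw [Finset.sum_sub_distrib]
  simp only [map_smul (ι ℝ)]
  have h1 : ∑ i, (Module.finBasis ℝ V).coord i u • (1 / 2 : ℝ) • ι ℝ (w (Module.finBasis ℝ V i)) =
      (1 / 2 : ℝ) • ι ℝ (w u) := by
    conv_rhs => rw [← (Module.finBasis ℝ V).sum_repr u]
    simp only [map_sum, map_smul, Finset.smul_sum]
    refine Finset.sum_congr rfl fun i _ => ?_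
    rw [smul_comm]; rfl
  have h2 : ∑ i, ι ℝ ((Module.finBasis ℝ V).coord i) *
      algebraMap ℝ (ExteriorAlgebra ℝ (Module.Dual ℝ V)) (1 / 2 * w (Module.finBasis ℝ V i) u) =
      -((1 / 2 : ℝ) • ι ℝ (w u)) := by
    conv_rhs => rw [← sum_coord_smul (w u)]
    simp only [map_sum, map_smul, Finset.smul_sum, ← Finset.sum_neg_distrib]
    refine Finset.sum_congr rfl fun i _ => ?_
    rw [← Algebra.commutes, ← Algebra.smul_def, hw _ u, smul_smul, ← neg_smul]
    ring_nf
  rw [h1, h2, sub_neg_eq_add, ← add_smul]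
  norm_num

theorem contract_twoForm_mul (u : V) {w : BilinForm ℝ V} (hw : ∀ u v, w u v = -w v u)
    (x : ExteriorAlgebra ℝ (Module.Dual ℝ V)) :
    contract u (twoForm w * x) = ι ℝ (w u) * x + twoForm w * contract u x := by
  have h : ∀ p q : Module.Dual ℝ V, contract u (ι ℝ p * ι ℝ q * x) =
      contract u (ι ℝ p * ι ℝ q) * x + ι ℝ p * ι ℝ q * contract u x := fun p q => by
    rw [mul_assoc, contract_ι_mul, contract_ι_mul, contract_ι_mul, contract_ι, mul_sub, sub_mul,
      smul_mul_assoc, mul_smul_comm, ← mul_assoc, ← Algebra.commutes, ← Algebra.smul_def,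
      smul_mul_assoc]
    abel
  rw [← contract_twoForm u hw, twoForm_apply, Finset.sum_mul, map_sum, map_sum, Finset.sum_mul,
    Finset.sum_mul, ← Finset.sum_add_distrib]
  exact Finset.sum_congr rfl fun i _ => h _ _

theorem contract_twoForm_pow (u : V) {w : BilinForm ℝ V} (hw : ∀ u v, w u v = -w v u)
    (k : ℕ) : contract u (twoForm w ^ (k + 1)) =
      (k + 1 : ℝ) • (ι ℝ (w u) * twoForm w ^ k) := by
  induction k with
  | zero => simp [contract_twoForm u hw]
  | succ k ih =>
    rw [pow_succ', contract_twoForm_mul u hw, ih, mul_smul_comm, ← mul_assoc,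
      ← (commute_ι_twoForm _ _).eq, mul_assoc, ← pow_succ']
    nth_rw 1 [← one_smul ℝ (ι ℝ (w u) * twoForm w ^ (k + 1))]
    rw [← add_smul]
    push_cast
    ring_nf

theorem contract_twoForm_pow_of_eq_zero {u : V} {w : BilinForm ℝ V}
    (hw : ∀ u v, w u v = -w v u) (hu : w u = 0) (k : ℕ) : contract u (twoForm w ^ k) = 0 := by
  cases k with
  | zero => rw [pow_zero, contract_one]
  | succ k => rw [contract_twoForm_pow u hw, hu, map_zero, zero_mul, smul_zero]

theorem twoForm_add_pow (w : BilinForm ℝ V) (p q : Module.Dual ℝ V) (c : ℝ) (k : ℕ) :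
    twoForm (w + c • wedgeTwo p q) ^ k =
      twoForm w ^ k + (c * k) • (ι ℝ p * ι ℝ q * twoForm w ^ (k - 1)) := by
  have h0 : ι ℝ p * ι ℝ q * (ι ℝ p * ι ℝ q) = 0 := by
    rw [← mul_assoc, mul_assoc (ι ℝ p), ι_mul_ι_swap q p, mul_neg, ← mul_assoc, ι_sq_zero]
    simp
  rw [map_add, map_smul, twoForm_wedgeTwo]
  induction k with
  | zero => simp
  | succ k ih =>
    rw [pow_succ, ih]
    have hc : Commute (ι ℝ p * ι ℝ q) (twoForm w) :=
      (commute_ι_twoForm _ _).mul_left (commute_ι_twoForm _ _)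
    have hc' : Commute (ι ℝ p * ι ℝ q) (twoForm w ^ k) := hc.pow_right k
    rw [mul_add, add_mul, add_mul, ← pow_succ, smul_mul_smul_comm, mul_assoc (ι ℝ p * ι ℝ q),
      ← (hc.pow_right (k - 1)).eq, ← mul_assoc (ι ℝ p * ι ℝ q), h0, zero_mul, smul_zero, add_zero,
      mul_smul_comm, ← hc'.eq, smul_mul_assoc, mul_assoc (ι ℝ p * ι ℝ q), add_assoc]
    congr 1
    rcases k with _ | k
    · simp
    · rw [Nat.add_sub_cancel, ← pow_succ, Nat.add_sub_cancel, ← add_smul]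
      push_cast
      ring_nf

/-- The family `p₀, q₀, p₁, q₁, …` of covectors. -/
def interleave {W : Type*} {k : ℕ} (p q : Fin k → W) (i : Fin (2 * k)) : W :=
  if (i : ℕ) % 2 = 0 then p ⟨i / 2, by omega⟩ else q ⟨i / 2, by omega⟩

theorem interleave_even {W : Type*} {k : ℕ} (p q : Fin k → W) (i : Fin k)
    (h : 2 * (i : ℕ) < 2 * k) : interleave p q ⟨2 * i, h⟩ = p i := by
  simp [interleave]

theorem interleave_odd {W : Type*} {k : ℕ} (p q : Fin k → W) (i : Fin k)
    (h : 2 * (i : ℕ) + 1 < 2 * k) : interleave p q ⟨2 * i + 1, h⟩ = q i := by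
  have : (2 * (i : ℕ) + 1) / 2 = i := by omega
  simp [interleave, Nat.add_mod, this]

theorem prod_pairs {A : Type*} [CommMonoid A] {k : ℕ} (f : Fin (2 * k) → A) :
    ∏ i, f i = ∏ i : Fin k, f ⟨2 * i, by omega⟩ * f ⟨2 * i + 1, by omega⟩ := by
  rw [← List.prod_ofFn, ← List.prod_ofFn, List.ofFn_mul', List.prod_flatten, List.map_ofFn]
  congr 2
  funext i
  simp [List.ofFn_succ]

theorem ιMulti_interleave {k : ℕ} (p q : Fin k → Module.Dual ℝ V) :
    ιMulti ℝ (2 * k) (interleave p q) = (List.ofFn fun i => ι ℝ (p i) * ι ℝ (q i)).prod := by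
  rw [ιMulti_apply, List.ofFn_mul', List.prod_flatten, List.map_ofFn]
  congr 2
  funext i
  simp only [Function.comp_apply, List.ofFn_succ, List.ofFn_zero, List.prod_cons, List.prod_nil,
    mul_one, Fin.val_zero, add_zero, Fin.val_succ, zero_add]
  rw [interleave_even, interleave_odd]

theorem sum_pow_eq {A J : Type*} [Semiring A] [Fintype J] (x : J → A) (k : ℕ) :
    (∑ j, x j) ^ k = ∑ c : Fin k → J, (List.ofFn fun i => x (c i)).prod := by
  induction k with
  | zero => simp
  | succ k ih =>
    rw [pow_succ', ih, Finset.sum_mul_sum, ← Fintype.sum_prod_type',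
      ← Fintype.sum_equiv (Fin.consEquiv fun _ => J) _ _ fun _ => rfl]
    refine Finset.sum_congr rfl fun c _ => ?_
    simp [List.ofFn_succ]

theorem bilin_eq_sum_coord (w : BilinForm ℝ V) (x y : V) :
    w x y = ∑ i, (Module.finBasis ℝ V).coord i x * w (Module.finBasis ℝ V i) y := by
  conv_lhs => rw [← (Module.finBasis ℝ V).sum_repr x]
  simp only [map_sum, map_smul, LinearMap.sum_apply, LinearMap.smul_apply, smul_eq_mul,
    Module.Basis.coord_apply]

theorem wedgePow_eq_sum_det (k : ℕ) (w : BilinForm ℝ V) (v : Fin (2 * k) → V) :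
    wedgePow k (fun x y => w x y) v = ∑ c : Fin k → Fin (Module.finrank ℝ V),
      (Matrix.of fun i j => interleave (fun i => (Module.finBasis ℝ V).coord (c i))
        (fun i => (1 / 2 : ℝ) • w (Module.finBasis ℝ V (c i))) i (v j)).det := by
  simp only [← Matrix.det_transpose (Matrix.of _), Matrix.det_apply']
  rw [Finset.sum_comm, wedgePow, Finset.mul_sum]
  refine Finset.sum_congr rfl fun σ _ => ?_
  rw [← Finset.mul_sum, mul_left_comm]
  congr 1
  simp only [prod_pairs, Matrix.transpose_apply, Matrix.of_apply, interleave_even, interleave_odd]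
  have e := Finset.prod_univ_sum (fun _ : Fin k => (Finset.univ : Finset (Fin (Module.finrank ℝ V))))
    (fun i j => (Module.finBasis ℝ V).coord j (v (σ ⟨2 * i, by omega⟩)) *
      ((1 / 2 : ℝ) • w (Module.finBasis ℝ V j)) (v (σ ⟨2 * i + 1, by omega⟩)))
  rw [Fintype.piFinset_univ] at e
  rw [← e]
  have e2 : ∀ x y, ∑ j, (Module.finBasis ℝ V).coord j x *
      ((1 / 2 : ℝ) • w (Module.finBasis ℝ V j)) y = 1 / 2 * w x y := fun x y => by
    rw [bilin_eq_sum_coord w x y, Finset.mul_sum]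
    refine Finset.sum_congr rfl fun i _ => ?_
    simp only [LinearMap.smul_apply, smul_eq_mul]
    ring
  simp only [e2, Finset.prod_mul_distrib]
  simp

theorem wedgeWedgePow_eq_sum_det (k : ℕ) (a : Module.Dual ℝ V) (w : BilinForm ℝ V)
    (v : Fin (2 * k + 1) → V) :
    wedgeWedgePow k a (fun x y => w x y) v = ∑ c : Fin k → Fin (Module.finrank ℝ V),
      (Matrix.of fun i j => (Fin.cons a (interleave (fun i => (Module.finBasis ℝ V).coord (c i))
        (fun i => (1 / 2 : ℝ) • w (Module.finBasis ℝ V (c i)))) :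
          Fin (2 * k + 1) → Module.Dual ℝ V) i (v j)).det := by
  simp only [← Matrix.det_transpose (Matrix.of _), Matrix.det_apply']
  rw [Finset.sum_comm, wedgeWedgePow, Finset.mul_sum]
  refine Finset.sum_congr rfl fun σ _ => ?_
  rw [← Finset.mul_sum, mul_left_comm]
  congr 1
  simp only [Fin.prod_univ_succ, prod_pairs, Matrix.transpose_apply, Matrix.of_apply, Fin.cons_zero,
    Fin.cons_succ, interleave_even, interleave_odd, ← Finset.mul_sum]
  rw [mul_left_comm]
  congr 1
  have e := Finset.prod_univ_sum (fun _ : Fin k => (Finset.univ : Finset (Fin (Module.finrank ℝ V))))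
    (fun i j => (Module.finBasis ℝ V).coord j (v (σ ⟨2 * i + 1, by omega⟩)) *
      ((1 / 2 : ℝ) • w (Module.finBasis ℝ V j)) (v (σ ⟨2 * i + 2, by omega⟩)))
  rw [Fintype.piFinset_univ] at e
  refine Eq.trans ?_ e
  have e2 : ∀ x y, ∑ j, (Module.finBasis ℝ V).coord j x *
      ((1 / 2 : ℝ) • w (Module.finBasis ℝ V j)) y = 1 / 2 * w x y := fun x y => by
    rw [bilin_eq_sum_coord w x y, Finset.mul_sum]
    refine Finset.sum_congr rfl fun i _ => ?_
    simp only [LinearMap.smul_apply, smul_eq_mul]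
    ring
  simp only [e2, Finset.prod_mul_distrib]
  simp

theorem wedgePow_eq (k : ℕ) (w : BilinForm ℝ V) (v : Fin (2 * k) → V) :
    wedgePow k (fun x y => w x y) v = evalForm v (twoForm w ^ k) := by
  rw [wedgePow_eq_sum_det, twoForm_apply, sum_pow_eq, map_sum]
  refine Finset.sum_congr rfl fun c _ => ?_
  rw [← evalForm_ιMulti, ιMulti_interleave]

theorem wedgeWedgePow_eq (k : ℕ) (a : Module.Dual ℝ V) (w : BilinForm ℝ V)
    (v : Fin (2 * k + 1) → V) :
    wedgeWedgePow k a (fun x y => w x y) v = evalForm v (ι ℝ a * twoForm w ^ k) := by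
  rw [wedgeWedgePow_eq_sum_det, twoForm_apply, sum_pow_eq, Finset.mul_sum, map_sum]
  refine Finset.sum_congr rfl fun c _ => ?_
  rw [← evalForm_ιMulti, ιMulti_succ_apply, Fin.cons_zero]
  congr 2
  rw [← ιMulti_interleave]
  congr 1

theorem alternatingMap_sum_apply {J : Type*} {N : ℕ} (s : Finset J) (A : J → V [⋀^Fin N]→ₗ[ℝ] ℝ)
    (v : Fin N → V) : (∑ j ∈ s, A j) v = ∑ j ∈ s, A j v := by
  classical
  induction s using Finset.induction_on with
  | empty => simp
  | insert j s hj ih => rw [Finset.sum_insert hj, Finset.sum_insert hj, AlternatingMap.add_apply, ih]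

/-- The top-degree form `a ∧ w ^ k`. -/
def oddForm (k : ℕ) (a : Module.Dual ℝ V) (w : BilinForm ℝ V) : V [⋀^Fin (2 * k + 1)]→ₗ[ℝ] ℝ :=
  ∑ c : Fin k → Fin (Module.finrank ℝ V), Matrix.detRowAlternating.compLinearMap
    (LinearMap.pi (Fin.cons a (interleave (fun i => (Module.finBasis ℝ V).coord (c i))
        (fun i => (1 / 2 : ℝ) • w (Module.finBasis ℝ V (c i)))) :
          Fin (2 * k + 1) → Module.Dual ℝ V))

/-- The top-degree form `w ^ k`. -/
def evenForm (k : ℕ) (w : BilinForm ℝ V) : V [⋀^Fin (2 * k)]→ₗ[ℝ] ℝ :=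
  ∑ c : Fin k → Fin (Module.finrank ℝ V), Matrix.detRowAlternating.compLinearMap
    (LinearMap.pi (interleave (fun i => (Module.finBasis ℝ V).coord (c i))
        (fun i => (1 / 2 : ℝ) • w (Module.finBasis ℝ V (c i))) : Fin (2 * k) → Module.Dual ℝ V))

theorem oddForm_eq_wedgeWedgePow (k : ℕ) (a : Module.Dual ℝ V) (w : BilinForm ℝ V)
    (v : Fin (2 * k + 1) → V) : oddForm k a w v = wedgeWedgePow k a (fun x y => w x y) v := by
  rw [wedgeWedgePow_eq_sum_det, oddForm, alternatingMap_sum_apply]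
  exact Finset.sum_congr rfl fun c _ => Matrix.det_transpose _

theorem evenForm_eq_wedgePow (k : ℕ) (w : BilinForm ℝ V)
    (v : Fin (2 * k) → V) : evenForm k w v = wedgePow k (fun x y => w x y) v := by
  rw [wedgePow_eq_sum_det, evenForm, alternatingMap_sum_apply]
  exact Finset.sum_congr rfl fun c _ => Matrix.det_transpose _

theorem oddForm_apply (k : ℕ) (a : Module.Dual ℝ V) (w : BilinForm ℝ V)
    (v : Fin (2 * k + 1) → V) : oddForm k a w v = evalForm v (ι ℝ a * twoForm w ^ k) := by
  rw [oddForm_eq_wedgeWedgePow, wedgeWedgePow_eq]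

theorem evenForm_apply (k : ℕ) (w : BilinForm ℝ V) (v : Fin (2 * k) → V) :
    evenForm k w v = evalForm v (twoForm w ^ k) := by
  rw [evenForm_eq_wedgePow, wedgePow_eq]

end ExteriorAlgebra

section TopForms

variable {V : Type*} [AddCommGroup V] [Module ℝ V] [FiniteDimensional ℝ V]

open ExteriorAlgebra

theorem exists_det_smul {N : ℕ} (hV : Module.finrank ℝ V = N) {v v' : Fin N → V}
    (hv : LinearIndependent ℝ v) (hv' : LinearIndependent ℝ v') :
    ∃ c : ℝ, c ≠ 0 ∧ ∀ A : V [⋀^Fin N]→ₗ[ℝ] ℝ, A v' = c * A v := by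
  have hc : Fintype.card (Fin N) = Module.finrank ℝ V := by simp [hV]
  let e := basisOfLinearIndependentOfCardEqFinrank' v hv hc
  let e' := basisOfLinearIndependentOfCardEqFinrank' v' hv' hc
  have he : ⇑e = v := coe_basisOfLinearIndependentOfCardEqFinrank' ..
  have he' : ⇑e' = v' := coe_basisOfLinearIndependentOfCardEqFinrank' ..
  refine ⟨e.det v', ?_, fun A => ?_⟩
  · rw [← he']
    exact (e.isUnit_det e').ne_zero
  · conv_lhs => rw [A.eq_smul_basis_det e]
    simp [he, mul_comm]

theorem topForm_mul_pos {N : ℕ} (hV : Module.finrank ℝ V = N) {v v' : Fin N → V}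
    (hv : LinearIndependent ℝ v) (hv' : LinearIndependent ℝ v') {A B : V [⋀^Fin N]→ₗ[ℝ] ℝ}
    (h : 0 < A v * B v) : 0 < A v' * B v' := by
  obtain ⟨c, hc, hA⟩ := exists_det_smul hV hv hv'
  rw [hA, hA, show c * A v * (c * B v) = c ^ 2 * (A v * B v) by ring]
  positivity

theorem topForm_ne_zero {N : ℕ} (hV : Module.finrank ℝ V = N) {v v' : Fin N → V}
    (hv : LinearIndependent ℝ v) (hv' : LinearIndependent ℝ v') {A : V [⋀^Fin N]→ₗ[ℝ] ℝ}
    (h : A v ≠ 0) : A v' ≠ 0 := by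
  obtain ⟨c, hc, hA⟩ := exists_det_smul hV hv hv'
  rw [hA]
  exact mul_ne_zero hc h

theorem exists_linearIndependent {N : ℕ} (hV : Module.finrank ℝ V = N) :
    ∃ v : Fin N → V, LinearIndependent ℝ v :=
  ⟨_, (Module.finBasisOfFinrankEq ℝ V hV).linearIndependent⟩

theorem linearIndependent_of_topForm {N : ℕ} {A : V [⋀^Fin N]→ₗ[ℝ] ℝ} {v : Fin N → V}
    (h : A v ≠ 0) : LinearIndependent ℝ v := by
  by_contra hv
  exact h (A.map_linearDependent v hv)

theorem exists_linearIndependent_cons {N : ℕ} (hV : Module.finrank ℝ V = N + 1) {R : V}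
    (hR : R ≠ 0) : ∃ v : Fin N → V, LinearIndependent ℝ (Fin.cons R v : Fin (N + 1) → V) := by
  obtain ⟨W, hW⟩ := Submodule.exists_isCompl (Submodule.span ℝ {R})
  have hd : Module.finrank ℝ W = N := by
    have := Submodule.finrank_add_eq_of_isCompl hW
    rw [finrank_span_singleton hR, hV] at this
    omega
  obtain ⟨v, hv⟩ := exists_linearIndependent hd
  refine ⟨fun i => v i, ?_⟩
  rw [linearIndependent_finCons]
  refine ⟨hv.map' W.subtype W.ker_subtype, fun h => hR ?_⟩
  have hle : Submodule.span ℝ (Set.range fun i => (v i : V)) ≤ W :=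
    Submodule.span_le.2 (by rintro _ ⟨i, rfl⟩; exact (v i).2)
  exact (Submodule.mem_bot ℝ).1 (hW.disjoint.le_bot ⟨Submodule.mem_span_singleton_self R, hle h⟩)

theorem topForm_eq_zero {N : ℕ} (hV : Module.finrank ℝ V = N + 1) {R : V} (hR : R ≠ 0)
    {A : V [⋀^Fin (N + 1)]→ₗ[ℝ] ℝ} (h : ∀ v, A (Fin.cons R v) = 0) (v : Fin (N + 1) → V) :
    A v = 0 := by
  by_contra hv
  obtain ⟨u, hu⟩ := exists_linearIndependent_cons hV hR
  exact topForm_ne_zero hV (linearIndependent_of_topForm hv) hu hv (h u)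

theorem oddForm_cons_eq_zero {k : ℕ} {a : Module.Dual ℝ V} {w : BilinForm ℝ V}
    (hw : ∀ u v, w u v = -w v u) {R : V} (ha : a R = 0) (hR : w R = 0) (v : Fin (2 * k) → V) :
    oddForm k a w (Fin.cons R v) = 0 := by
  rw [oddForm_apply, evalForm_cons, contract_ι_mul, ha,
    contract_twoForm_pow_of_eq_zero hw hR]
  simp

theorem eq_zero_of_oddForm_ne_zero {k : ℕ} (hV : Module.finrank ℝ V = 2 * k + 1)
    {a : Module.Dual ℝ V} {w : BilinForm ℝ V} (hw : ∀ u v, w u v = -w v u)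
    {v : Fin (2 * k + 1) → V} (h : oddForm k a w v ≠ 0) {R : V} (ha : a R = 0) (hR : w R = 0) :
    R = 0 := by
  by_contra h0
  exact h (topForm_eq_zero hV h0 (oddForm_cons_eq_zero hw ha hR) v)

theorem oddForm_add_left (k : ℕ) (a b : Module.Dual ℝ V) (w : BilinForm ℝ V)
    (v : Fin (2 * k + 1) → V) :
    oddForm k (a + b) w v = oddForm k a w v + oddForm k b w v := by
  simp only [oddForm_apply, map_add, add_mul]

theorem oddForm_smul_left (k : ℕ) (c : ℝ) (a : Module.Dual ℝ V) (w : BilinForm ℝ V)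
    (v : Fin (2 * k + 1) → V) : oddForm k (c • a) w v = c * oddForm k a w v := by
  simp only [oddForm_apply, map_smul, smul_mul_assoc, smul_eq_mul]

theorem oddForm_eq_mul {k : ℕ} (hV : Module.finrank ℝ V = 2 * k + 1)
    {a : Module.Dual ℝ V} (b : Module.Dual ℝ V) {w : BilinForm ℝ V}
    (hw : ∀ u v, w u v = -w v u) {R : V} (ha : a R = 1) (hR : w R = 0)
    (v : Fin (2 * k + 1) → V) : oddForm k b w v = b R * oddForm k a w v := by
  have h0 : R ≠ 0 := by rintro rfl; simp at ha
  have h1 : b = (b + (-(b R)) • a) + b R • a := by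
    module
  conv_lhs => rw [h1]
  rw [oddForm_add_left, oddForm_smul_left, topForm_eq_zero hV h0
    (oddForm_cons_eq_zero hw (by simp [ha]) hR), zero_add]

/-- The form `k a ∧ p ∧ q ∧ w ^ (k - 1)`. -/
def mixedForm (k : ℕ) (a p q : Module.Dual ℝ V) (w : BilinForm ℝ V) (v : Fin (2 * k + 1) → V) :
    ℝ := oddForm k a (w + wedgeTwo p q) v - oddForm k a w v

theorem mixedForm_eq (k : ℕ) (a p q : Module.Dual ℝ V) (w : BilinForm ℝ V)
    (v : Fin (2 * k + 1) → V) :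
    mixedForm k a p q w v = k * evalForm v (ι ℝ a * (ι ℝ p * ι ℝ q * twoForm w ^ (k - 1))) := by
  rw [mixedForm, oddForm_apply, oddForm_apply, ← one_smul ℝ (wedgeTwo p q), twoForm_add_pow, mul_add,
    map_add, add_sub_cancel_left, mul_smul_comm, map_smul, one_mul, smul_eq_mul]

theorem oddForm_add_smul (k : ℕ) (a p q : Module.Dual ℝ V) (w : BilinForm ℝ V) (c e : ℝ)
    (v : Fin (2 * k + 1) → V) :
    oddForm k (a + c • e • q) (w + c • wedgeTwo p q) v =
      oddForm k a w v + c * (e * oddForm k q w v + mixedForm k a p q w v) := by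
  have h0 : ι ℝ q * (ι ℝ p * ι ℝ q * twoForm w ^ (k - 1)) = 0 := by
    rw [← mul_assoc, ← mul_assoc, ι_mul_ι_swap q p, neg_mul, mul_assoc (ι ℝ p), ι_sq_zero]
    simp
  rw [mixedForm_eq, oddForm_apply, oddForm_apply, oddForm_apply, twoForm_add_pow, map_add, map_smul,
    map_smul, add_mul, mul_add, mul_add, mul_smul_comm, smul_mul_assoc, smul_mul_assoc,
    smul_mul_assoc, smul_mul_assoc, mul_smul_comm, h0]
  simp only [smul_zero, add_zero, map_add, map_smul, smul_eq_mul]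
  ring

theorem evalForm_append {p q : Module.Dual ℝ V} {N : ℕ} (v : Fin N → V)
    (hp : ∀ i, p (v i) = 0) (hq : ∀ i, q (v i) = 0) (X Y : V)
    (x : ExteriorAlgebra ℝ (Module.Dual ℝ V)) :
    evalForm (Fin.append (m := N) (n := 2) v ![X, Y]) (ι ℝ p * ι ℝ q * x) = wedgeTwo p q X Y * evalForm v x := by
  induction N generalizing x with
  | zero =>
    have : Fin.append (m := 0) (n := 2) v ![X, Y] = (![X, Y] ∘ Fin.cast (zero_add 2) : Fin (0 + 2) → V) := by
      rw [Subsingleton.elim v Fin.elim0, Fin.elim0_append]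
    rw [this]
    change evalForm ![X, Y] _ = _
    have hι : ∀ a : Module.Dual ℝ V, algebraMapInv (R := ℝ) (ι ℝ a) = 0 := fun a => by
      simp [algebraMapInv]
    simp only [evalForm_succ, evalForm_zero, Matrix.cons_val_zero, Fin.tail, Fin.succ_zero_eq_one,
      Matrix.cons_val_one, mul_assoc, contract_ι_mul, map_sub, map_smul, map_mul, hι, zero_mul,
      sub_zero, smul_eq_mul, wedgeTwo_apply, mul_sub, mul_smul_comm]
    ring
  | succ N ih =>
    have h1 : contract (v 0) (ι ℝ p * ι ℝ q * x) = ι ℝ p * ι ℝ q * contract (v 0) x := by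
      rw [mul_assoc, contract_ι_mul, contract_ι_mul, hp, hq]
      simp [mul_assoc]
    have h2 : Fin.tail (n := N + 2) (α := fun _ => V) (Fin.append (m := N + 1) (n := 2) v ![X, Y]) =
        Fin.append (m := N) (n := 2) (Fin.tail v) ![X, Y] := by
      funext i
      refine Fin.addCases (fun j => ?_) (fun j => ?_) i
      · rw [Fin.append_left]
        exact Fin.append_left (m := N + 1) (n := 2) v ![X, Y] j.succ
      · rw [Fin.append_right, Fin.tail]
        have : (Fin.natAdd N j).succ = Fin.natAdd (N + 1) j := by
          ext; simp; omega
        exact (congrArg _ this).trans (Fin.append_right (m := N + 1) (n := 2) v ![X, Y] j)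
    have h3 : Fin.append (m := N + 1) (n := 2) v ![X, Y] (0 : Fin (N + 1 + 2)) = v 0 := Fin.append_left (m := N + 1) (n := 2) v ![X, Y] 0
    refine (evalForm_succ (N := N + 2) (Fin.append (m := N + 1) (n := 2) v ![X, Y]) _).trans ?_
    rw [h2, h3, h1, ih (Fin.tail v) (fun i => hp _) (fun i => hq _), evalForm_succ]

theorem mixedForm_append {p q : Module.Dual ℝ V} {k : ℕ} (a : Module.Dual ℝ V)
    (w : BilinForm ℝ V) (v : Fin (2 * k + 1) → V)
    (hp : ∀ i, p (v i) = 0) (hq : ∀ i, q (v i) = 0) (X Y : V) :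
    mixedForm (k + 1) a p q w (Fin.append (m := 2 * k + 1) (n := 2) v ![X, Y]) =
      (k + 1) * (wedgeTwo p q X Y * wedgeWedgePow k a (fun x y => w x y) v) := by
  rw [mixedForm_eq, ← mul_assoc, (commute_ι_mul_ι a p q).eq, mul_assoc, Nat.add_sub_cancel,
    wedgeWedgePow_eq]
  push_cast
  congr 1
  exact evalForm_append v hp hq X Y _

theorem evalForm_ι_mul_eq_zero {q : Module.Dual ℝ V} {N : ℕ} (v : Fin N → V)
    (hq : ∀ i, q (v i) = 0) (x : ExteriorAlgebra ℝ (Module.Dual ℝ V)) :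
    evalForm v (ι ℝ q * x) = 0 := by
  induction N generalizing x with
  | zero => simp [evalForm_zero, algebraMapInv]
  | succ N ih =>
    rw [evalForm_succ, contract_ι_mul, hq, zero_smul, zero_sub, map_neg,
      ih (Fin.tail v) fun i => hq _, neg_zero]

theorem evalForm_cons_ι_mul {q : Module.Dual ℝ V} {N : ℕ} (v : Fin N → V)
    (hq : ∀ i, q (v i) = 0) (Z : V) (x : ExteriorAlgebra ℝ (Module.Dual ℝ V)) :
    evalForm (Fin.cons Z v) (ι ℝ q * x) = q Z * evalForm v x := by
  rw [evalForm_cons, contract_ι_mul, map_sub, evalForm_ι_mul_eq_zero v hq, sub_zero, map_smul,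
    smul_eq_mul]

theorem oddForm_cons {q : Module.Dual ℝ V} {k : ℕ} (w : BilinForm ℝ V) (v : Fin (2 * k) → V)
    (hq : ∀ i, q (v i) = 0) (Z : V) :
    oddForm k q w (Fin.cons Z v) = q Z * wedgePow k (fun x y => w x y) v := by
  rw [oddForm_apply, evalForm_cons_ι_mul v hq, wedgePow_eq]

theorem evenForm_cons {k : ℕ} {w : BilinForm ℝ V} (hw : ∀ u v, w u v = -w v u)
    (Z : V) (v : Fin (2 * k + 1) → V) : evenForm (k + 1) w (Fin.cons Z v) =
      (k + 1) * wedgeWedgePow k (w Z) (fun x y => w x y) v := by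
  rw [evenForm_apply, wedgeWedgePow_eq]
  refine (evalForm_cons Z v _).trans ?_
  rw [contract_twoForm_pow Z hw, map_smul, smul_eq_mul]

theorem evenForm_add_smul (k : ℕ) (p q : Module.Dual ℝ V) (w : BilinForm ℝ V) (c : ℝ)
    (v : Fin (2 * k) → V) : evenForm k (w + c • wedgeTwo p q) v =
      evenForm k w v + c * (k * evalForm v (ι ℝ p * ι ℝ q * twoForm w ^ (k - 1))) := by
  rw [evenForm_apply, evenForm_apply, twoForm_add_pow, map_add, map_smul, smul_eq_mul, mul_assoc]

theorem evalForm_cons_mixed {p q : Module.Dual ℝ V} {k : ℕ} (w : BilinForm ℝ V)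
    (Z : V) (v : Fin (2 * k + 1) → V) (hp : ∀ i, p (v i) = 0) :
    evalForm (Fin.cons Z v : Fin (2 * k + 1 + 1) → V) (ι ℝ p * ι ℝ q * twoForm w ^ k) =
      p Z * wedgeWedgePow k q (fun x y => w x y) v := by
  rw [mul_assoc, evalForm_cons_ι_mul v hp, wedgeWedgePow_eq]

theorem eq_add_wedgeTwo {q : Module.Dual ℝ V} {Z : V} (hZ : q Z = 1) {w w' : BilinForm ℝ V}
    (hw : ∀ u v, w u v = -w v u) (hw' : ∀ u v, w' u v = -w' v u)
    (h : ∀ u v, q u = 0 → q v = 0 → w u v = w' u v) :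
    w = w' + wedgeTwo q (w Z - w' Z) := by
  ext u v
  have h1 := h (u - q u • Z) (v - q v • Z) (by simp [hZ]) (by simp [hZ])
  have e1 := hw u Z
  have e2 := hw' u Z
  have e3 := hw Z Z
  have e4 := hw' Z Z
  simp only [map_sub, map_smul, LinearMap.sub_apply, LinearMap.smul_apply, smul_eq_mul] at h1
  simp only [LinearMap.add_apply, wedgeTwo_apply, LinearMap.sub_apply]
  have e3' : w Z Z = 0 := by linarith
  have e4' : w' Z Z = 0 := by linarith
  rw [e1, e2, e3', e4'] at h1
  linear_combination h1

theorem oddForm_congr_ker {k : ℕ} {q : Module.Dual ℝ V} {w w' : BilinForm ℝ V}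
    (hw : ∀ u v, w u v = -w v u) (hw' : ∀ u v, w' u v = -w' v u)
    (h : ∀ u v, q u = 0 → q v = 0 → w u v = w' u v) (v : Fin (2 * k + 1) → V) :
    oddForm k q w v = oddForm k q w' v := by
  by_cases hq : q = 0
  · simp [oddForm_apply, hq]
  obtain ⟨Z, hZ⟩ := LinearMap.surjective hq 1
  rw [eq_add_wedgeTwo hZ hw hw' h, oddForm_apply, oddForm_apply]
  conv_lhs => rw [← one_smul ℝ (wedgeTwo q _), twoForm_add_pow]
  rw [mul_add, mul_smul_comm, mul_assoc (ι ℝ q) (ι ℝ _), ← mul_assoc (ι ℝ q) (ι ℝ q), ι_sq_zero,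
    zero_mul, smul_zero, add_zero]

end TopForms

theorem exists_wedgePow_ne_zero (m : ℕ) {V : Type*} [AddCommGroup V] [Module ℝ V]
    [FiniteDimensional ℝ V] (hV : Module.finrank ℝ V = 2 * m) {w : BilinForm ℝ V}
    (hw : ∀ u v, w u v = -w v u) (hn : ∀ u, w u = 0 → u = 0) :
    ∃ v : Fin (2 * m) → V, wedgePow m (fun x y => w x y) v ≠ 0 := by
  induction m generalizing V with
  | zero => exact ⟨0, by simp [wedgePow]⟩
  | succ m ih =>
    have : Nontrivial V := Module.nontrivial_of_finrank_pos (R := ℝ) (by omega)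
    obtain ⟨e, he⟩ := exists_ne (0 : V)
    have hwe : w e ≠ 0 := fun h => he (hn e h)
    obtain ⟨f, hf⟩ := LinearMap.surjective hwe 1
    have hself : ∀ u, w u u = 0 := fun u => by have := hw u u; linarith
    have hfe : w f e = -1 := by rw [hw, hf]
    let L : V →ₗ[ℝ] ℝ × ℝ := (w e).prod (w f)
    have hL : Function.Surjective L := fun ⟨x, y⟩ => ⟨x • f - y • e, by
      ext <;> simp [L, hf, hfe, hself]⟩
    have hrank := LinearMap.finrank_range_add_finrank_ker L
    rw [LinearMap.range_eq_top.2 hL, finrank_top, Module.finrank_prod, Module.finrank_self, hV] at hrank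
    let U := LinearMap.ker L
    have hdim : Module.finrank ℝ U = 2 * m := by
      simp only [U]
      omega
    have hU : ∀ x : U, w e x = 0 ∧ w f x = 0 := fun x => by
      have := LinearMap.mem_ker.1 x.2
      exact ⟨congrArg Prod.fst this, congrArg Prod.snd this⟩
    let w' : U →ₗ[ℝ] U →ₗ[ℝ] ℝ := w.compl₁₂ U.subtype U.subtype
    obtain ⟨u, hu⟩ := ih (V := U) hdim (w := w') (fun u v => hw u v) (by
      intro x hx
      apply Subtype.ext
      apply hn
      ext y
      have hy : y - (-(w f y)) • e - w e y • f ∈ U := by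
        rw [LinearMap.mem_ker]
        ext <;> simp [L, hf, hfe, hself]
      have h1 : w x (y - (-(w f y)) • e - w e y • f) = 0 := LinearMap.congr_fun hx ⟨_, hy⟩
      rw [map_sub, map_sub, map_smul, map_smul, hw x e, hw x f, (hU x).1, (hU x).2] at h1
      simpa using h1)
    refine ⟨Fin.cons (α := fun _ => V) e (Fin.cons (α := fun _ => V) f fun i => (u i : V)), ?_⟩
    rw [← evenForm_eq_wedgePow]
    refine ne_of_eq_of_ne (evenForm_cons (k := m) hw e
      (Fin.cons (α := fun _ => V) f fun i => (u i : V))) ?_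
    rw [← oddForm_eq_wedgeWedgePow, oddForm_cons _ _ fun i => (hU _).1]
    refine mul_ne_zero (by positivity) (mul_ne_zero (by rw [hf]; exact one_ne_zero) hu)

theorem evenForm_ne_zero {m : ℕ} {V : Type*} [AddCommGroup V] [Module ℝ V]
    [FiniteDimensional ℝ V] (hV : Module.finrank ℝ V = 2 * m) {w : BilinForm ℝ V}
    (hw : ∀ u v, w u v = -w v u) (hn : ∀ u, w u = 0 → u = 0) {v : Fin (2 * m) → V}
    (hv : LinearIndependent ℝ v) : evenForm m w v ≠ 0 := by
  obtain ⟨u, hu⟩ := exists_wedgePow_ne_zero m hV hw hn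
  rw [← evenForm_eq_wedgePow] at hu
  exact topForm_ne_zero hV (linearIndependent_of_topForm hu) hv hu

/-! ### Exterior derivative and pull-back -/

section Flat

variable {E : Type*} [NormedAddCommGroup E] [NormedSpace ℝ E]
  {E' : Type*} [NormedAddCommGroup E'] [NormedSpace ℝ E']

/-- The exterior derivative of a `1`-form on a subset of a vector space. -/
def flatD (θ : E → E →L[ℝ] ℝ) (s : Set E) (y : E) (u v : E) : ℝ :=
  fderivWithin ℝ θ s y u v - fderivWithin ℝ θ s y v u

/-- The antisymmetrisation of a bilinear map. -/
def antisymm (D : E →L[ℝ] E →L[ℝ] ℝ) : E →ₗ[ℝ] E →ₗ[ℝ] ℝ :=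
  LinearMap.mk₂ ℝ (fun u v => D u v - D v u)
    (fun _ _ _ => by simp only [map_add, add_apply]; ring)
    (fun _ _ _ => by simp only [map_smul, smul_apply, smul_eq_mul]; ring)
    (fun _ _ _ => by simp only [map_add, add_apply]; ring)
    (fun _ _ _ => by simp only [map_smul, smul_apply, smul_eq_mul]; ring)

theorem flatD_pullback {θ : E → E →L[ℝ] ℝ} {F : E' → E} {s : Set E'} {t : Set E} {y : E'}
    (hθ : DifferentiableWithinAt ℝ θ t (F y)) (hF : ContDiffWithinAt ℝ ∞ F s y)
    (hs : UniqueDiffOn ℝ s) (hyc : y ∈ closure (interior s)) (hy : y ∈ s) (hst : Set.MapsTo F s t)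
    (u v : E') :
    flatD (fun y => (θ (F y)).comp (fderivWithin ℝ F s y)) s y u v =
      flatD θ t (F y) (fderivWithin ℝ F s y u) (fderivWithin ℝ F s y v) := by
  have hdF : DifferentiableWithinAt ℝ F s y := hF.differentiableWithinAt (by simp)
  have hd2F : DifferentiableWithinAt ℝ (fderivWithin ℝ F s) s y :=
    (hF.fderivWithin_right (m := 1) hs (by norm_cast) hy).differentiableWithinAt one_ne_zero
  have hcomp : HasFDerivWithinAt (fun y => θ (F y))
      ((fderivWithin ℝ θ t (F y)).comp (fderivWithin ℝ F s y)) s y :=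
    hθ.hasFDerivWithinAt.comp y hdF.hasFDerivWithinAt hst
  have h := (hcomp.clm_comp hd2F.hasFDerivWithinAt).fderivWithin (hs y hy)
  have hsymm : IsSymmSndFDerivWithinAt ℝ F s y :=
    hF.isSymmSndFDerivWithinAt (by simp; norm_cast) hs hyc hy
  unfold flatD
  rw [h]
  simp only [add_apply, ContinuousLinearMap.comp_apply,
    ContinuousLinearMap.compL_apply, ContinuousLinearMap.flip_apply]
  rw [hsymm.eq u v]
  ring

end Flat

variable {E : Type*} [NormedAddCommGroup E] [NormedSpace ℝ E]
  {H : Type*} [TopologicalSpace H] {I : ModelWithCorners ℝ E H}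
  {M : Type*} [TopologicalSpace M] [ChartedSpace H M]
  {E' : Type*} [NormedAddCommGroup E'] [NormedSpace ℝ E']
  {H' : Type*} [TopologicalSpace H'] {I' : ModelWithCorners ℝ E' H'}
  {M' : Type*} [TopologicalSpace M'] [ChartedSpace H' M']

local notation "IR" => ModelWithCorners.prod 𝓘(ℝ, ℝ) I

section Manifold

open Set

/-- The exterior derivative as a bilinear map. -/
def OneForm.dB (α : OneForm I M) (x : M) :
    TangentSpace I x →ₗ[ℝ] TangentSpace I x →ₗ[ℝ] ℝ :=
  (antisymm (fderivWithin ℝ (α.inChart x) (range I) (extChartAt I x x))).compl₁₂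
    (mfderiv I 𝓘(ℝ, E) (extChartAt I x) x).toLinearMap
    (mfderiv I 𝓘(ℝ, E) (extChartAt I x) x).toLinearMap

@[simp] theorem OneForm.dB_apply (α : OneForm I M) (x : M) (u v : TangentSpace I x) :
    α.dB x u v = α.d x u v := rfl

theorem OneForm.dB_neg (α : OneForm I M) (x : M) (u v : TangentSpace I x) :
    α.dB x u v = -α.dB x v u := by
  exact (neg_sub _ _).symm

/-- A `1`-form is smooth at a point. -/
def OneForm.SmoothAt (α : OneForm I M) (x : M) : Prop :=
  ContDiffWithinAt ℝ ∞ (α.inChart x) (range I) (extChartAt I x x)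

variable [IsManifold I ∞ M] [IsManifold I' ∞ M']

theorem OneForm.inChart_pullback {f : M' → M} (α : OneForm I M) {x₀' : M'} {x₀ : M} {y : E'}
    (hy : y ∈ (extChartAt I' x₀').target)
    (hf : MDifferentiableAt I' I f ((extChartAt I' x₀').symm y))
    (hfy : f ((extChartAt I' x₀').symm y) ∈ (chartAt H x₀).source) :
    (pullback (I' := I') f α).inChart x₀' y =
      (α.inChart x₀ ((extChartAt I x₀ ∘ f ∘ (extChartAt I' x₀').symm) y)).comp
        (fderivWithin ℝ (extChartAt I x₀ ∘ f ∘ (extChartAt I' x₀').symm) (range I') y) := by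
  have hyr := extChartAt_target_subset_range x₀' hy
  have hsy : f ((extChartAt I' x₀').symm y) ∈ (extChartAt I x₀).source := by
    rwa [extChartAt_source]
  have e1 := mfderiv_comp_mfderivWithin (I := 𝓘(ℝ, E')) (I' := I') (I'' := I) y hf
    (mdifferentiableWithinAt_extChartAt_symm hy) (I'.uniqueMDiffOn y hyr)
  have h2 : MDifferentiableWithinAt 𝓘(ℝ, E') I (f ∘ (extChartAt I' x₀').symm) (range I') y :=
    hf.comp_mdifferentiableWithinAt y (mdifferentiableWithinAt_extChartAt_symm hy)
  have e2 := mfderiv_comp_mfderivWithin (I := 𝓘(ℝ, E')) (I' := I) (I'' := 𝓘(ℝ, E)) y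
    (mdifferentiableAt_extChartAt (I := I) hfy) h2 (I'.uniqueMDiffOn y hyr)
  have hp : (extChartAt I x₀).symm (extChartAt I x₀ (f ((extChartAt I' x₀').symm y))) =
    f ((extChartAt I' x₀').symm y) := (extChartAt I x₀).left_inv hsy
  have e3 := mfderivWithin_extChartAt_symm_comp_mfderiv_extChartAt' (I := I) hsy
  ext v
  show α (f ((extChartAt I' x₀').symm y)) (mfderiv I' I f ((extChartAt I' x₀').symm y)
    (mfderivWithin 𝓘(ℝ, E') I' (extChartAt I' x₀').symm (range I') y v)) = _
  rw [← mfderivWithin_eq_fderivWithin, e2, e1]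
  have e3' := fun w => DFunLike.congr_fun e3 w
  have key : ∀ (p : M) (hp : p = f ((extChartAt I' x₀').symm y)) (w : E)
    (w' : E), w = w' → α p w = α (f ((extChartAt I' x₀').symm y)) w' := by
    rintro p rfl w w' rfl; rfl
  refine (key _ hp _ _ ?_).symm
  exact e3' _

theorem mapsTo_extChartAt_comp (f : M' → M) (x₀' : M') (x₀ : M) :
    MapsTo (extChartAt I x₀ ∘ f ∘ (extChartAt I' x₀').symm) (range I') (range I) :=
  fun _ _ => mem_range_self _

/-- The coordinate expression of a pull-back near a point. -/
theorem OneForm.inChart_pullback_eventually {f : M' → M} (α : OneForm I M) {x₀' x' : M'} {x₀ : M}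
    (hx' : x' ∈ (chartAt H' x₀').source) (hfx : f x' ∈ (chartAt H x₀).source)
    (hf : ContMDiffAt I' I ∞ f x') :
    (pullback (I' := I') f α).inChart x₀' =ᶠ[𝓝[range I'] (extChartAt I' x₀' x')]
      fun y => (α.inChart x₀ ((extChartAt I x₀ ∘ f ∘ (extChartAt I' x₀').symm) y)).comp
        (fderivWithin ℝ (extChartAt I x₀ ∘ f ∘ (extChartAt I' x₀').symm) (range I') y) := by
  have hxs : x' ∈ (extChartAt I' x₀').source := by rwa [extChartAt_source]
  have h1 : ∀ᶠ z in 𝓝 x', MDifferentiableAt I' I f z ∧ f z ∈ (chartAt H x₀).source := by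
    have ha : ∀ᶠ z in 𝓝 x', ContMDiffAt I' I 1 f z :=
      contMDiffAt_iff_contMDiffAt_nhds (by simp) |>.1 (hf.of_le (by simp))
    filter_upwards [ha, hf.continuousAt.preimage_mem_nhds ((chartAt H x₀).open_source.mem_nhds hfx)]
      with z hz hz'
    exact ⟨hz.mdifferentiableAt one_ne_zero, hz'⟩
  have h2 : ∀ᶠ y in 𝓝[range I'] (extChartAt I' x₀' x'), y ∈ (extChartAt I' x₀').target :=
    extChartAt_target_mem_nhdsWithin' hxs
  have h3 : Filter.Tendsto (extChartAt I' x₀').symm (𝓝[range I'] (extChartAt I' x₀' x')) (𝓝 x') := by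
    have := continuousAt_extChartAt_symm' (I := I') hxs
    have h := this.tendsto
    rw [(extChartAt I' x₀').left_inv hxs] at h
    exact h.mono_left nhdsWithin_le_nhds
  filter_upwards [h2, h3.eventually h1] with y hy hy'
  exact OneForm.inChart_pullback α hy hy'.1 hy'.2

theorem extChartAt_mem_closure_interior (x₀ x : M) :
    extChartAt I x₀ x ∈ closure (interior (range I)) :=
  I.range_subset_closure_interior (mem_range_self _)

theorem OneForm.contDiffWithinAt_pullback {f : M' → M} {α : OneForm I M} {x₀' x' : M'} {x₀ : M}
    (hx' : x' ∈ (chartAt H' x₀').source) (hfx : f x' ∈ (chartAt H x₀).source)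
    (hf : ContMDiffAt I' I ∞ f x')
    (hα : ContDiffWithinAt ℝ ∞ (α.inChart x₀) (range I) (extChartAt I x₀ (f x'))) :
    ContDiffWithinAt ℝ ∞ ((pullback (I' := I') f α).inChart x₀') (range I')
      (extChartAt I' x₀' x') := by
  have hxs : x' ∈ (extChartAt I' x₀').source := by rwa [extChartAt_source]
  have hF := ((contMDiffAt_iff_of_mem_source hx' hfx).1 hf).2
  have hy : extChartAt I' x₀' x' ∈ range I' := mem_range_self _
  refine ContDiffWithinAt.congr_of_eventuallyEq ?_
    (OneForm.inChart_pullback_eventually α hx' hfx hf)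
    ((OneForm.inChart_pullback_eventually α hx' hfx hf).self_of_nhdsWithin hy)
  have h1 := hF.fderivWithin_right (m := ∞) I'.uniqueDiffOn (by simp) hy
  have h2 : ContDiffWithinAt ℝ ∞ (α.inChart x₀) (range I)
      ((extChartAt I x₀ ∘ f ∘ (extChartAt I' x₀').symm) (extChartAt I' x₀' x')) := by
    rwa [Function.comp_apply, Function.comp_apply, (extChartAt I' x₀').left_inv hxs]
  exact (h2.comp _ hF (mapsTo_extChartAt_comp f x₀' x₀)).clm_comp h1

theorem OneForm.pullback_id (α : OneForm I M) : pullback (I' := I) id α = α := by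
  funext x
  ext v
  simp [OneForm.pullback]

theorem OneForm.pullback_comp {E'' : Type*} [NormedAddCommGroup E''] [NormedSpace ℝ E'']
    {H'' : Type*} [TopologicalSpace H''] {I'' : ModelWithCorners ℝ E'' H''}
    {M'' : Type*} [TopologicalSpace M''] [ChartedSpace H'' M''] {f : M' → M} {g : M'' → M'}
    (α : OneForm I M) {x : M''} (hf : MDifferentiableAt I' I f (g x))
    (hg : MDifferentiableAt I'' I' g x) :
    pullback (I' := I'') (f ∘ g) α x =
      pullback (I' := I'') g (pullback (I' := I') f α) x := by
  simp only [OneForm.pullback]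
  rw [mfderiv_comp x hf hg]
  rfl

theorem OneForm.pullback_congr {f g : M' → M} (α : OneForm I M) {x : M'}
    (h : f =ᶠ[𝓝 x] g) : pullback (I' := I') f α x = pullback (I' := I') g α x := by
  simp only [OneForm.pullback]
  rw [h.mfderiv_eq]
  have key : ∀ (p q : M) (hp : p = q) (w : E), α p w = α q w := by rintro p q rfl w; rfl
  ext v
  exact key _ _ h.eq_of_nhds _

theorem OneForm.smoothAt_iff_of_mem_source {α : OneForm I M} {x x₀ : M}
    (hx : x ∈ (chartAt H x₀).source) : α.SmoothAt x ↔
      ContDiffWithinAt ℝ ∞ (α.inChart x₀) (range I) (extChartAt I x₀ x) := by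
  constructor
  · intro h
    have := OneForm.contDiffWithinAt_pullback (α := α) (f := id) hx (mem_chart_source H x)
      contMDiffAt_id h
    rwa [OneForm.pullback_id] at this
  · intro h
    have := OneForm.contDiffWithinAt_pullback (α := α) (f := id) (mem_chart_source H x) hx
      contMDiffAt_id h
    rwa [OneForm.pullback_id] at this

theorem isSmooth_iff {α : OneForm I M} : α.IsSmooth ↔ ∀ x, α.SmoothAt x := by
  constructor
  · intro h x
    exact (h x _ (mem_extChartAt_target x)).mono_of_mem_nhdsWithin
      (extChartAt_target_mem_nhdsWithin x)
  · intro h x₀ y hy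
    have hs := (extChartAt I x₀).map_target hy
    rw [extChartAt_source] at hs
    have := (OneForm.smoothAt_iff_of_mem_source hs).1 (h ((extChartAt I x₀).symm y))
    rw [(extChartAt I x₀).right_inv hy] at this
    exact this.mono (extChartAt_target_subset_range x₀)

theorem OneForm.SmoothAt.pullback {f : M' → M} {α : OneForm I M} {x : M'}
    (hα : α.SmoothAt (f x)) (hf : ContMDiffAt I' I ∞ f x) :
    (OneForm.pullback (I' := I') f α).SmoothAt x :=
  OneForm.contDiffWithinAt_pullback (mem_chart_source _ _) (mem_chart_source _ _) hf hα

theorem OneForm.IsSmooth.pullback {f : M' → M} {α : OneForm I M}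
    (hα : α.IsSmooth) (hf : ContMDiff I' I ∞ f) :
    (OneForm.pullback (I' := I') f α).IsSmooth :=
  isSmooth_iff.2 fun x => (isSmooth_iff.1 hα (f x)).pullback (hf x)

theorem OneForm.flatD_inChart_pullback {f : M' → M} {α : OneForm I M} {x₀' x' : M'} {x₀ : M}
    (hx' : x' ∈ (chartAt H' x₀').source) (hfx : f x' ∈ (chartAt H x₀).source)
    (hf : ContMDiffAt I' I ∞ f x') (hα : α.SmoothAt (f x')) (u v : E') :
    flatD ((pullback (I' := I') f α).inChart x₀') (range I') (extChartAt I' x₀' x') u v =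
    flatD (α.inChart x₀) (range I) (extChartAt I x₀ (f x'))
      (fderivWithin ℝ (extChartAt I x₀ ∘ f ∘ (extChartAt I' x₀').symm) (range I')
        (extChartAt I' x₀' x') u)
      (fderivWithin ℝ (extChartAt I x₀ ∘ f ∘ (extChartAt I' x₀').symm) (range I')
        (extChartAt I' x₀' x') v) := by
  have hxs : x' ∈ (extChartAt I' x₀').source := by rwa [extChartAt_source]
  have hF := ((contMDiffAt_iff_of_mem_source hx' hfx).1 hf).2
  have hy : extChartAt I' x₀' x' ∈ range I' := mem_range_self _
  have hα' := (OneForm.smoothAt_iff_of_mem_source hfx).1 hα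
  have e : (extChartAt I x₀ ∘ f ∘ (extChartAt I' x₀').symm) (extChartAt I' x₀' x') =
      extChartAt I x₀ (f x') := by
    rw [Function.comp_apply, Function.comp_apply, (extChartAt I' x₀').left_inv hxs]
  have hev := OneForm.inChart_pullback_eventually α hx' hfx hf
  have h := flatD_pullback (θ := α.inChart x₀) (t := range I) (by
    rw [e]; exact hα'.differentiableWithinAt (by simp)) hF I'.uniqueDiffOn
    (extChartAt_mem_closure_interior x₀' x') hy (mapsTo_extChartAt_comp f x₀' x₀) u v
  rw [e] at h
  rw [← h]
  unfold flatD
  rw [hev.fderivWithin_eq (hev.self_of_nhdsWithin hy)]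

theorem OneForm.d_eq_flatD (α : OneForm I M) (x : M) (u v : TangentSpace I x) :
    α.d x u v = flatD (α.inChart x) (range I) (extChartAt I x x) u v := by
  simp only [OneForm.d, mfderiv_extChartAt_self]
  rfl

theorem fderivWithin_eq_mfderiv {f : M' → M} {x₀' x' : M'} {x₀ : M}
    (hx' : x' ∈ (chartAt H' x₀').source) (hfx : f x' ∈ (chartAt H x₀).source)
    (hf : MDifferentiableAt I' I f x') (u : TangentSpace I' x') :
    fderivWithin ℝ (extChartAt I x₀ ∘ f ∘ (extChartAt I' x₀').symm) (range I')
        (extChartAt I' x₀' x') (mfderiv I' 𝓘(ℝ, E') (extChartAt I' x₀') x' u) =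
      mfderiv I 𝓘(ℝ, E) (extChartAt I x₀) (f x') (mfderiv I' I f x' u) := by
  have hxs : x' ∈ (extChartAt I' x₀').source := by rwa [extChartAt_source]
  have hy := (extChartAt I' x₀').map_source hxs
  have hyr : extChartAt I' x₀' x' ∈ range I' := mem_range_self _
  have hp := (extChartAt I' x₀').left_inv hxs
  have e1 := mfderiv_comp_mfderivWithin_of_eq (I := 𝓘(ℝ, E')) (I' := I') (I'' := I)
    (y := x') (x := extChartAt I' x₀' x') hf
    (mdifferentiableWithinAt_extChartAt_symm hy) (I'.uniqueMDiffOn _ hyr) hp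
  have h2 : MDifferentiableWithinAt 𝓘(ℝ, E') I (f ∘ (extChartAt I' x₀').symm) (range I')
      (extChartAt I' x₀' x') :=
    (MDifferentiableAt.comp_mdifferentiableWithinAt_of_eq (y := x') _ hf
      (mdifferentiableWithinAt_extChartAt_symm hy) hp)
  have e2 := mfderiv_comp_mfderivWithin_of_eq (I := 𝓘(ℝ, E')) (I' := I) (I'' := 𝓘(ℝ, E))
    (y := f x') (x := extChartAt I' x₀' x')
    (mdifferentiableAt_extChartAt (I := I) hfx) h2 (I'.uniqueMDiffOn _ hyr) (by
      rw [Function.comp_apply, hp])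
  have e3 := DFunLike.congr_fun
    (mfderivWithin_extChartAt_symm_comp_mfderiv_extChartAt' (I := I') hxs) u
  rw [← mfderivWithin_eq_fderivWithin, e2, e1]
  exact congrArg (fun w => mfderiv I 𝓘(ℝ, E) (extChartAt I x₀) (f x') (mfderiv I' I f x' w)) e3

/-- The exterior derivative in another chart. -/
theorem OneForm.d_eq_flatD_of_mem_source {α : OneForm I M} {x x₀ : M}
    (hx : x ∈ (chartAt H x₀).source) (hα : α.SmoothAt x) (u v : TangentSpace I x) :
    α.d x u v = flatD (α.inChart x₀) (range I) (extChartAt I x₀ x)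
      (mfderiv I 𝓘(ℝ, E) (extChartAt I x₀) x u) (mfderiv I 𝓘(ℝ, E) (extChartAt I x₀) x v) := by
  have h := OneForm.flatD_inChart_pullback (α := α) (f := id) (mem_chart_source H x) hx
    contMDiffAt_id hα u v
  have e := fun u => fderivWithin_eq_mfderiv (I := I) (I' := I) (f := id) (mem_chart_source H x) hx
    mdifferentiableAt_id u
  rw [OneForm.pullback_id] at h
  rw [OneForm.d_eq_flatD]
  refine h.trans ?_
  simp only [mfderiv_extChartAt_self, mfderiv_id] at e
  have e' : ∀ w : E, fderivWithin ℝ (extChartAt I x₀ ∘ id ∘ (extChartAt I x).symm) (range I)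
        (extChartAt I x x) w = mfderiv I 𝓘(ℝ, E) (extChartAt I x₀) x w := e
  exact congrArg₂ (flatD (α.inChart x₀) (range I) (extChartAt I x₀ x)) (e' u) (e' v)

/-- The exterior derivative commutes with pull-back. -/
theorem OneForm.d_pullback {f : M' → M} {α : OneForm I M} {x : M'}
    (hα : α.SmoothAt (f x)) (hf : ContMDiffAt I' I ∞ f x) (u v : TangentSpace I' x) :
    (pullback (I' := I') f α).d x u v = α.d (f x) (mfderiv I' I f x u)
      (mfderiv I' I f x v) := by
  have e := fun u => fderivWithin_eq_mfderiv (I := I) (I' := I') (f := f) (mem_chart_source H' x)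
    (mem_chart_source H (f x)) (hf.mdifferentiableAt (by simp)) u
  simp only [mfderiv_extChartAt_self] at e
  have e' : ∀ w : E', fderivWithin ℝ (extChartAt I (f x) ∘ f ∘ (extChartAt I' x).symm) (range I')
        (extChartAt I' x x) w = mfderiv I' I f x w := e
  rw [OneForm.d_eq_flatD, OneForm.d_eq_flatD]
  exact (OneForm.flatD_inChart_pullback (mem_chart_source H' x) (mem_chart_source H (f x)) hf hα u
    v).trans (congrArg₂ (flatD (α.inChart (f x)) (range I) (extChartAt I (f x) (f x))) (e' u) (e' v))

end Manifold

/-! ### Operations on `1`-forms -/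

section Operations

open Set

/-- The product of a function and a `1`-form. -/
def OneForm.fsmul (g : M → ℝ) (α : OneForm I M) : OneForm I M := fun x => g x • α x

theorem OneForm.inChart_add (α β : OneForm I M) (x₀ : M) :
    (α + β).inChart x₀ = α.inChart x₀ + β.inChart x₀ := by
  funext y; ext v; rfl

theorem OneForm.inChart_fsmul (g : M → ℝ) (α : OneForm I M) (x₀ : M) :
    (OneForm.fsmul g α).inChart x₀ = fun y => g ((extChartAt I x₀).symm y) • α.inChart x₀ y := by
  funext y; ext v; rfl

/-- The differential of a function. -/
def differential (g : M → ℝ) : OneForm I M := fun x => mfderiv I 𝓘(ℝ, ℝ) g x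

theorem OneForm.fsmul_const (c : ℝ) (α : OneForm I M) : OneForm.fsmul (fun _ => c) α = c • α := rfl

theorem OneForm.SmoothAt.add {α β : OneForm I M} {x : M} (hα : α.SmoothAt x) (hβ : β.SmoothAt x) :
    (α + β).SmoothAt x := by
  rw [OneForm.SmoothAt, OneForm.inChart_add]
  exact ContDiffWithinAt.add hα hβ

theorem contDiffWithinAt_comp_extChartAt_symm [IsManifold I ∞ M] {g : M → ℝ} {x : M}
    (hg : ContMDiffAt I 𝓘(ℝ, ℝ) ∞ g x) :
    ContDiffWithinAt ℝ ∞ (g ∘ (extChartAt I x).symm) (range I) (extChartAt I x x) :=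
  ((contMDiffAt_iff_of_mem_source (mem_chart_source H x) (mem_chart_source ℝ (g x))).1 hg).2

theorem OneForm.SmoothAt.fsmul [IsManifold I ∞ M] {g : M → ℝ} {α : OneForm I M} {x : M}
    (hg : ContMDiffAt I 𝓘(ℝ, ℝ) ∞ g x) (hα : α.SmoothAt x) : (OneForm.fsmul g α).SmoothAt x := by
  rw [OneForm.SmoothAt, OneForm.inChart_fsmul]
  exact ContDiffWithinAt.smul (contDiffWithinAt_comp_extChartAt_symm hg) hα

theorem OneForm.SmoothAt.smul [IsManifold I ∞ M] {α : OneForm I M} {x : M} (hα : α.SmoothAt x)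
    (c : ℝ) : (c • α).SmoothAt x :=
  OneForm.SmoothAt.fsmul (g := fun _ => c) contMDiffAt_const hα

theorem OneForm.d_add [IsManifold I ∞ M] {α β : OneForm I M} {x : M} (hα : α.SmoothAt x)
    (hβ : β.SmoothAt x) (u v : TangentSpace I x) : (α + β).d x u v = α.d x u v + β.d x u v := by
  have h : fderivWithin ℝ (α.inChart x + β.inChart x) (range I) (extChartAt I x x) = _ :=
    fderivWithin_add (I.uniqueDiffOn _ (mem_range_self _))
    (ContDiffWithinAt.differentiableWithinAt hα (by simp))
    (ContDiffWithinAt.differentiableWithinAt hβ (by simp))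
  rw [OneForm.d_eq_flatD, OneForm.d_eq_flatD, OneForm.d_eq_flatD, OneForm.inChart_add]
  unfold flatD
  rw [h]
  exact add_sub_add_comm _ _ _ _

theorem OneForm.d_fsmul [IsManifold I ∞ M] {g : M → ℝ} {α : OneForm I M} {x : M}
    (hg : ContMDiffAt I 𝓘(ℝ, ℝ) ∞ g x) (hα : α.SmoothAt x) (u v : TangentSpace I x) :
    (OneForm.fsmul g α).d x u v = g x * α.d x u v +
      (differential g x u * α x v - differential g x v * α x u) := by
  have hg' := (contDiffWithinAt_comp_extChartAt_symm hg).differentiableWithinAt (by simp)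
  have h := (hg'.hasFDerivWithinAt.smul
    (ContDiffWithinAt.differentiableWithinAt hα (by simp)).hasFDerivWithinAt).fderivWithin
    (I.uniqueDiffOn _ (mem_range_self _))
  have e : fderivWithin ℝ (g ∘ (extChartAt I x).symm) (range I) (extChartAt I x x) =
      differential (I := I) g x := by
    exact ((hg.mdifferentiableAt (by simp)).mfderiv).symm
  have h' : fderivWithin ℝ ((OneForm.fsmul g α).inChart x) (range I) (extChartAt I x x) = _ := h
  rw [OneForm.d_eq_flatD, OneForm.d_eq_flatD]
  unfold flatD
  rw [h']
  revert u v
  change ∀ u v : E, _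
  intro u v
  have e0 : g ((extChartAt I x).symm (extChartAt I x x)) = g x := by
    rw [extChartAt_to_inv]
  have e1 : ∀ w : E, α.inChart x (extChartAt I x x) w = α x w := by
    intro w
    have key : ∀ p : M, p = x → (α p) w = α x w := by rintro p rfl; rfl
    rw [OneForm.inChart, mfderivWithin_range_extChartAt_symm]
    exact key _ (extChartAt_to_inv x)
  have e2 : ∀ u v : E, ((fderivWithin ℝ (g ∘ (extChartAt I x).symm) (range I)
      (extChartAt I x x)).smulRight (α.inChart x (extChartAt I x x)) u) v =
      differential g x u * α x v := fun u v =>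
    congrArg₂ (fun a b : ℝ => a * b) (DFunLike.congr_fun e u) (e1 v)
  simp only [add_apply, smul_apply, Function.comp_apply, smul_eq_mul, e0, e2]
  ring

theorem OneForm.d_smul [IsManifold I ∞ M] {α : OneForm I M} {x : M} (hα : α.SmoothAt x) (c : ℝ)
    (u v : TangentSpace I x) : (c • α).d x u v = c * α.d x u v := by
  have h := OneForm.d_fsmul (g := fun _ => c) contMDiffAt_const hα u v
  rw [OneForm.fsmul_const] at h
  rw [h]
  have h0 : differential (I := I) (fun _ : M => c) x = 0 := mfderiv_const
  simp [h0]

theorem OneForm.inChart_eventuallyEq {α β : OneForm I M} {x : M} (h : ∀ᶠ y in 𝓝 x, α y = β y) :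
    α.inChart x =ᶠ[𝓝[range I] (extChartAt I x x)] β.inChart x := by
  have h3 : Filter.Tendsto (extChartAt I x).symm (𝓝[range I] (extChartAt I x x)) (𝓝 x) := by
    have h := (continuousAt_extChartAt_symm (I := I) x).tendsto
    rw [extChartAt_to_inv] at h
    exact h.mono_left nhdsWithin_le_nhds
  filter_upwards [h3.eventually h] with y hy
  simp only [OneForm.inChart, hy]

theorem OneForm.SmoothAt.congr {α β : OneForm I M} {x : M} (hα : α.SmoothAt x) (h : ∀ᶠ y in 𝓝 x, β y = α y) :
    β.SmoothAt x :=
  ContDiffWithinAt.congr_of_eventuallyEq hα (OneForm.inChart_eventuallyEq h)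
    ((OneForm.inChart_eventuallyEq h).self_of_nhdsWithin (mem_range_self _))

theorem OneForm.d_congr {α β : OneForm I M} {x : M} (h : ∀ᶠ y in 𝓝 x, α y = β y) : α.d x = β.d x := by
  have := OneForm.inChart_eventuallyEq h
  funext u v
  simp only [OneForm.d, this.fderivWithin_eq (this.self_of_nhdsWithin (mem_range_self _))]

theorem OneForm.pullback_add (f : M' → M) (α β : OneForm I M) :
    pullback (I' := I') f (α + β) =
      pullback (I' := I') f α + pullback (I' := I') f β := rfl

theorem OneForm.pullback_smul (f : M' → M) (c : ℝ) (α : OneForm I M) :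
    pullback (I' := I') f (c • α) = c • pullback (I' := I') f α := rfl

/-! ### Volumes -/

instance [FiniteDimensional ℝ E] (x : M) : FiniteDimensional ℝ (TangentSpace I x) :=
  inferInstanceAs (FiniteDimensional ℝ E)

theorem contactVolume_eq_oddForm [FiniteDimensional ℝ E] (k : ℕ) (α : OneForm I M) (x : M)
    (v : Fin (2 * k + 1) → TangentSpace I x) :
    contactVolume k α x v = oddForm k (α x).toLinearMap (α.dB x) v := by
  rw [oddForm_eq_wedgeWedgePow]
  rfl

theorem contactVolume_pullback [IsManifold I ∞ M] [IsManifold I' ∞ M'] (k : ℕ) {f : M' → M}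
    {α : OneForm I M} {x : M'} (hα : α.SmoothAt (f x)) (hf : ContMDiffAt I' I ∞ f x)
    (v : Fin (2 * k + 1) → TangentSpace I' x) :
    contactVolume k (pullback (I' := I') f α) x v =
      contactVolume k α (f x) fun i => mfderiv I' I f x (v i) := by
  have h : (pullback (I' := I') f α).d x = fun u v => α.d (f x) (mfderiv I' I f x u)
      (mfderiv I' I f x v) := by
    funext u v
    exact OneForm.d_pullback hα hf u v
  simp only [contactVolume, h]
  rfl

/-- Smooth local frames, and the continuity of the components of smooth forms in them. -/
theorem exists_frame [IsManifold I ∞ M] (x₀ : M) {N : ℕ} {e : Fin N → E}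
    (he : LinearIndependent ℝ e) :
    ∃ v : ∀ x : M, Fin N → TangentSpace I x, (∀ᶠ x in 𝓝 x₀, LinearIndependent ℝ (v x)) ∧
      ∀ γ : OneForm I M, (∀ᶠ x in 𝓝 x₀, γ.SmoothAt x) →
        (∀ i, ContinuousAt (fun x => γ x (v x i)) x₀) ∧
        ∀ i j, ContinuousAt (fun x => γ.d x (v x i) (v x j)) x₀ := by
  let v : ∀ x : M, Fin N → TangentSpace I x := fun x i =>
    mfderivWithin 𝓘(ℝ, E) I (extChartAt I x₀).symm (range I) (extChartAt I x₀ x) (e i)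
  have hsrc : ∀ᶠ x in 𝓝 x₀, x ∈ (extChartAt I x₀).source := extChartAt_source_mem_nhds x₀
  have hv : ∀ x ∈ (extChartAt I x₀).source, ∀ i,
      mfderiv I 𝓘(ℝ, E) (extChartAt I x₀) x (v x i) = e i := fun x hx i =>
    DFunLike.congr_fun (mfderiv_extChartAt_comp_mfderivWithin_extChartAt_symm' (I := I) hx) (e i)
  refine ⟨v, ?_, fun γ hγ => ?_⟩
  · filter_upwards [hsrc] with x hx
    refine LinearIndependent.of_comp (mfderiv I 𝓘(ℝ, E) (extChartAt I x₀) x).toLinearMap ?_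
    convert! he using 1
    funext i
    exact hv x hx i
  have hsm := (OneForm.smoothAt_iff_of_mem_source (mem_chart_source H x₀)).1 hγ.self_of_nhds
  have ht : Filter.Tendsto (extChartAt I x₀) (𝓝 x₀) (𝓝[range I] (extChartAt I x₀ x₀)) :=
    tendsto_nhdsWithin_of_tendsto_nhds_of_eventually_within _ (continuousAt_extChartAt x₀)
      (Filter.Eventually.of_forall fun _ => mem_range_self _)
  constructor
  · intro i
    have h1 : ContinuousAt (fun x => γ.inChart x₀ (extChartAt I x₀ x) (e i)) x₀ :=
      ContinuousAt.clm_apply (hsm.continuousWithinAt.tendsto.comp ht) continuousAt_const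
    refine h1.congr ?_
    filter_upwards [hsrc] with x hx
    have key : ∀ p : M, p = x → ∀ w : E, (γ p) w = γ x w := by rintro p rfl w; rfl
    exact key _ ((extChartAt I x₀).left_inv hx) _
  · intro i j
    have hd : ContinuousWithinAt (fderivWithin ℝ (γ.inChart x₀) (range I)) (range I)
        (extChartAt I x₀ x₀) :=
      (hsm.fderivWithin_right (m := 0) I.uniqueDiffOn (by simp) (mem_range_self _)).continuousWithinAt
    have h1 : ∀ i j, ContinuousAt (fun x => fderivWithin ℝ (γ.inChart x₀) (range I)
        (extChartAt I x₀ x) (e i) (e j)) x₀ := fun i j =>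
      ContinuousAt.clm_apply (ContinuousAt.clm_apply (hd.tendsto.comp ht) continuousAt_const)
        continuousAt_const
    refine ((h1 i j).sub (h1 j i)).congr ?_
    filter_upwards [hsrc, hγ] with x hx hx'
    rw [extChartAt_source] at hx
    rw [OneForm.d_eq_flatD_of_mem_source hx hx', hv, hv]
    · rfl
    all_goals rwa [extChartAt_source]

end Operations

section Families

variable [IsManifold I ∞ M]

open Set

theorem contMDiff_mk_left (s : ℝ) :
    ContMDiff I IR ∞ (fun x : M => ((s, x) : ℝ × M)) :=
  contMDiff_const.prodMk contMDiff_id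

theorem mfderiv_mk_left (s : ℝ) (x : M) (v : TangentSpace I x) :
    (mfderiv I IR (fun x : M => ((s, x) : ℝ × M)) x v : ℝ × E) = (0, v) := by
  have h : HasMFDerivAt I IR (fun x : M => ((s, x) : ℝ × M)) x
      (ContinuousLinearMap.prod (0 : E →L[ℝ] ℝ) (ContinuousLinearMap.id ℝ E)) :=
    HasMFDerivAt.prodMk (hasMFDerivAt_const s x) (hasMFDerivAt_id x)
  rw [h.mfderiv]
  rfl

theorem isSmoothFamily_slice {θ : OneForm IR (ℝ × M)} (hθ : θ.IsSmooth) :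
    IsSmoothFamily fun s => pullback (I' := I) (fun x : M => ((s, x) : ℝ × M)) θ := by
  intro x₀
  have h := hθ (0, x₀)
  rw [extChartAt_prod] at h
  have h' : ContDiffOn ℝ ∞ (fun p : ℝ × E => (θ.inChart (0, x₀) p).comp
      (ContinuousLinearMap.inr ℝ ℝ E)) (univ ×ˢ (extChartAt I x₀).target) := by
    refine ContDiffOn.clm_comp ?_ contDiffOn_const
    simpa using! h
  refine h'.congr fun p hp => ?_
  have hy : p.2 ∈ (extChartAt I x₀).target := hp.2
  rw [OneForm.inChart_pullback (I := 𝓘(ℝ, ℝ).prod I) (I' := I) (f := fun x : M => ((p.1, x) : ℝ × M))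
    θ (x₀ := (0, x₀)) hy ((contMDiff_mk_left _).mdifferentiableAt (by simp)) (by
      have := (extChartAt I x₀).map_target hy
      rw [extChartAt_source] at this
      exact ⟨mem_univ _, this⟩)]
  have he : (extChartAt IR ((0, x₀) : ℝ × M) ∘ (fun x : M => ((p.1, x) : ℝ × M)) ∘
      (extChartAt I x₀).symm) =ᶠ[𝓝[range I] p.2] fun y => (p.1, y) := by
    filter_upwards [extChartAt_target_mem_nhdsWithin_of_mem hy] with y hy
    simp only [Function.comp_apply, extChartAt_prod, PartialEquiv.prod_coe]
    rw [(extChartAt I x₀).right_inv hy]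
    rfl
  have hr := extChartAt_target_subset_range x₀ hy
  rw [he.self_of_nhdsWithin hr, he.fderivWithin_eq (he.self_of_nhdsWithin hr)]
  congr 1
  have : HasFDerivWithinAt (fun y : E => ((p.1, y) : ℝ × E)) (ContinuousLinearMap.inr ℝ ℝ E)
      (range I) p.2 := (hasFDerivWithinAt_const _ _ _).prodMk (hasFDerivWithinAt_id _ _)
  exact this.fderivWithin (I.uniqueDiffOn _ hr)

/-- A family of `1`-forms on `M`, as a `1`-form on `ℝ × M`. -/
def totalForm (A : ℝ → OneForm I M) : OneForm IR (ℝ × M) := fun p =>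
  (A p.1 p.2).comp (ContinuousLinearMap.snd ℝ ℝ E)

theorem pullback_totalForm (A : ℝ → OneForm I M) (s : ℝ) :
    pullback (I' := I) (fun x : M => ((s, x) : ℝ × M)) (totalForm A) = A s := by
  funext x
  ext v
  show (A s x) (mfderiv I IR (fun x : M => ((s, x) : ℝ × M)) x v).2 = _
  rw [mfderiv_mk_left]

theorem isSmooth_totalForm {A : ℝ → OneForm I M} (hA : IsSmoothFamily A) :
    (totalForm A).IsSmooth := by
  rintro ⟨s₀, x₀⟩
  have h : ContDiffOn ℝ ∞ (fun p : ℝ × E => ((A p.1).inChart x₀ p.2).comp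
      (ContinuousLinearMap.snd ℝ ℝ E)) (univ ×ˢ (extChartAt I x₀).target) :=
    (hA x₀).clm_comp contDiffOn_const
  have ht : (extChartAt IR ((s₀, x₀) : ℝ × M)).target =
      univ ×ˢ (extChartAt I x₀).target := by
    rw [extChartAt_prod, PartialEquiv.prod_target]
    congr 1
    exact inter_univ univ
  rw [ht]
  refine h.congr fun p hp => ?_
  have hr := extChartAt_target_subset_range x₀ hp.2
  have hs : (extChartAt IR ((s₀, x₀) : ℝ × M)).symm =
      fun q : ℝ × E => (q.1, (extChartAt I x₀).symm q.2) := by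
    rw [extChartAt_prod]; rfl
  refine ContinuousLinearMap.ext fun v => ?_
  have h1 : HasMFDerivWithinAt 𝓘(ℝ, ℝ × E) IR
      (fun q : ℝ × E => (q.1, (extChartAt I x₀).symm q.2)) (range IR) p
      ((ContinuousLinearMap.fst ℝ ℝ E).prod ((mfderivWithin 𝓘(ℝ, E) I (extChartAt I x₀).symm
        (range I) p.2).comp (ContinuousLinearMap.snd ℝ ℝ E))) := by
    refine HasMFDerivWithinAt.prodMk ?_ ?_
    · exact (hasFDerivWithinAt_fst).hasMFDerivWithinAt
    · refine HasMFDerivWithinAt.comp p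
        (mdifferentiableWithinAt_extChartAt_symm hp.2).hasMFDerivWithinAt
        (hasFDerivWithinAt_snd).hasMFDerivWithinAt ?_
      rintro q ⟨⟨a, b⟩, rfl⟩
      exact mem_range_self b
  have hu : UniqueMDiffWithinAt 𝓘(ℝ, ℝ × E) (range IR) p := by
    refine (IR).uniqueMDiffOn p ?_
    rw [modelWithCorners_prod_coe, range_prodMap]
    exact ⟨by simp, hr⟩
  rw [OneForm.inChart, hs, h1.mfderivWithin hu]
  rfl

end Families

/-! ### Smooth dependence of solutions of differential equations on the initial values -/

section Superposition

universe u

variable {K : Type} [TopologicalSpace K] [CompactSpace K]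
  {E F : Type u} [NormedAddCommGroup E] [NormedSpace ℝ E] [NormedAddCommGroup F] [NormedSpace ℝ F]

variable (K E F) in
/-- The pointwise application of a continuous family of linear maps. -/
def pointwiseApply : C(K, E →L[ℝ] F) →L[ℝ] C(K, E) →L[ℝ] C(K, F) :=
  LinearMap.mkContinuous₂ (LinearMap.mk₂ ℝ
    (fun (L : C(K, E →L[ℝ] F)) (γ : C(K, E)) => (⟨fun t => L t (γ t), L.continuous.clm_apply γ.continuous⟩ : C(K, F)))
    (fun _ _ _ => by ext; rfl) (fun _ _ _ => by ext; rfl)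
    (fun _ _ _ => by ext; simp) (fun _ _ _ => by ext; simp)) 1 (by
      intro L γ
      rw [one_mul]
      refine (ContinuousMap.norm_le _ (by positivity)).2 fun t => ?_
      exact ((L t).le_opNorm _).trans (mul_le_mul (L.norm_coe_le_norm t) (γ.norm_coe_le_norm t)
        (norm_nonneg _) (norm_nonneg L)))

theorem hasFDerivAt_superposition {f : C(E, F)} {f' : C(E, E →L[ℝ] F)}
    (hf : ∀ x, HasFDerivAt f (f' x) x) (γ : C(K, E)) :
    HasFDerivAt (fun γ : C(K, E) => f.comp γ) (pointwiseApply K E F (f'.comp γ)) γ := by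
  rw [hasFDerivAt_iff_isLittleO_nhds_zero, Asymptotics.isLittleO_iff]
  intro c hc
  have hcont : Continuous fun h : C(K, E) => f'.comp (γ + h) :=
    (ContinuousMap.continuous_postcomp f').comp (continuous_const.add continuous_id)
  have h0 : ∃ δ > 0, ∀ ⦃h : C(K, E)⦄, dist h 0 < δ → dist (f'.comp (γ + h)) (f'.comp (γ + 0)) < c :=
    (@Metric.tendsto_nhds_nhds C(K, E) C(K, E →L[ℝ] F) _ _ _ _ _).1 (hcont.tendsto 0) c hc
  obtain ⟨δ, hδ, h1⟩ := h0
  filter_upwards [Metric.ball_mem_nhds (0 : C(K, E)) hδ] with h hh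
  refine (ContinuousMap.norm_le _ (by positivity)).2 fun t => ?_
  have key : ∀ y ∈ segment ℝ (γ t) (γ t + h t), ‖f' y - f' (γ t)‖ ≤ c := by
    rintro y hy
    rw [segment_eq_image'] at hy
    obtain ⟨θ, hθ, rfl⟩ := hy
    have h2 := @h1 (θ • h) (by
      rw [dist_zero_right, norm_smul, Real.norm_of_nonneg hθ.1]
      rw [mem_ball_zero_iff] at hh
      exact lt_of_le_of_lt (mul_le_of_le_one_left (norm_nonneg _) hθ.2) hh)
    have h3 := (ContinuousMap.dist_apply_le_dist t).trans h2.le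
    rw [dist_eq_norm] at h3
    simpa using h3
  have h4 := (convex_segment (γ t) (γ t + h t)).norm_image_sub_le_of_norm_hasFDerivWithin_le'
    (fun y _ => (hf y).hasFDerivWithinAt) key (left_mem_segment ℝ _ _) (right_mem_segment ℝ _ _)
  simp only [add_sub_cancel_left] at h4
  exact h4.trans (mul_le_mul_of_nonneg_left (h.norm_coe_le_norm t) hc.le)

theorem contDiff_superposition (n : ℕ) : ∀ {F : Type u} [NormedAddCommGroup F] [NormedSpace ℝ F]
    {f : C(E, F)}, ContDiff ℝ n f → ContDiff ℝ n (fun γ : C(K, E) => f.comp γ) := by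
  induction n with
  | zero =>
    intro F _ _ f _
    exact contDiff_zero.2 (ContinuousMap.continuous_postcomp f)
  | succ n ih =>
    intro F _ _ f hf
    have hf' := contDiff_succ_iff_hasFDerivAt.1 (by exact_mod_cast hf)
    obtain ⟨f', h1, h2⟩ := hf'
    let g : C(E, E →L[ℝ] F) := ⟨f', h1.continuous⟩
    have := contDiff_succ_iff_hasFDerivAt (𝕜 := ℝ) (n := n) (f := fun γ : C(K, E) => f.comp γ)
    push_cast
    refine this.2 ⟨fun γ => pointwiseApply K E F (g.comp γ), ?_,
      hasFDerivAt_superposition (f' := g) h2⟩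
    exact (pointwiseApply K E F).contDiff.comp (ih (f := g) h1)

end Superposition

section LocalFlow

open Set

variable {E : Type*} [NormedAddCommGroup E] [NormedSpace ℝ E] [CompleteSpace E]

/-- The extension of a function on `[-1, 1]` by constants. -/
abbrev extendIcc (γ : C(Icc (-1 : ℝ) 1, E)) : ℝ → E := IccExtend (by norm_num : (-1 : ℝ) ≤ 1) γ

theorem continuous_extendIcc (γ : C(Icc (-1 : ℝ) 1, E)) : Continuous (extendIcc γ) :=
  γ.continuous.Icc_extend'

theorem norm_extendIcc_le (γ : C(Icc (-1 : ℝ) 1, E)) (t : ℝ) : ‖extendIcc γ t‖ ≤ ‖γ‖ :=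
  γ.norm_coe_le_norm _

variable (E) in
/-- Integration from `0` as an operator on continuous functions on `[-1, 1]`. -/
def primitive : C(Icc (-1 : ℝ) 1, E) →L[ℝ] C(Icc (-1 : ℝ) 1, E) :=
  LinearMap.mkContinuous
    { toFun := fun γ => ⟨fun t => ∫ s in (0 : ℝ)..t, extendIcc γ s,
        (intervalIntegral.continuous_primitive
          (fun _ _ => (continuous_extendIcc γ).intervalIntegrable _ _) 0).comp
            continuous_subtype_val⟩
      map_add' := fun γ γ' => by
        ext t
        exact intervalIntegral.integral_add ((continuous_extendIcc γ).intervalIntegrable _ _)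
          ((continuous_extendIcc γ').intervalIntegrable _ _)
      map_smul' := fun c γ => by
        ext t
        exact intervalIntegral.integral_smul c _ } 1 (by
    intro γ
    rw [one_mul]
    refine (ContinuousMap.norm_le _ (norm_nonneg _)).2 fun t => ?_
    have h := intervalIntegral.norm_integral_le_of_norm_le_const (a := 0) (b := (t : ℝ))
      (f := extendIcc γ) fun s _ => norm_extendIcc_le γ s
    refine h.trans (mul_le_of_le_one_right (norm_nonneg _) ?_)
    rw [sub_zero, abs_le]
    exact t.2)

theorem primitive_apply (γ : C(Icc (-1 : ℝ) 1, E)) (t : Icc (-1 : ℝ) 1) :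
    primitive E γ t = ∫ s in (0 : ℝ)..t, extendIcc γ s := rfl

/-- The solutions of `γ' = τ V(γ)`, `γ(0) = x` on `[-1, 1]`, as a differentiable function of
`(τ, x)`. -/
theorem exists_solution (n : ℕ) (hn : n ≠ 0) (V : C(E, E)) (hV : ContDiff ℝ n V) (x₀ : E) :
    ∃ Γ : ℝ × E → C(Icc (-1 : ℝ) 1, E), ContDiffAt ℝ n Γ (0, x₀) ∧
      Γ (0, x₀) = ContinuousMap.const _ x₀ ∧
      (∀ᶠ p in 𝓝 ((0, x₀) : ℝ × E),
        Γ p = ContinuousMap.const _ p.2 + p.1 • primitive E (V.comp (Γ p))) ∧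
      ∀ᶠ q in 𝓝 (((0, x₀), ContinuousMap.const _ x₀) : (ℝ × E) × C(Icc (-1 : ℝ) 1, E)),
        q.2 = ContinuousMap.const _ q.1.2 + q.1.1 • primitive E (V.comp q.2) → Γ q.1 = q.2 := by
  let G : (ℝ × E) × C(Icc (-1 : ℝ) 1, E) → C(Icc (-1 : ℝ) 1, E) := fun q =>
    q.2 - (ContinuousMap.const _ q.1.2 + q.1.1 • primitive E (V.comp q.2))
  have hconst : ContDiff ℝ n fun x : E => (ContinuousMap.const (Icc (-1 : ℝ) 1) x) :=
    ((LinearMap.mkContinuous (σ := RingHom.id ℝ)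
      { toFun := fun x : E => (ContinuousMap.const (Icc (-1 : ℝ) 1) x)
        map_add' := fun _ _ => rfl
        map_smul' := fun _ _ => rfl } 1 (fun x => by
      rw [one_mul]
      exact (ContinuousMap.norm_le _ (norm_nonneg _)).2 fun t => le_rfl)).contDiff)
  have hG : ContDiff ℝ n G :=
    contDiff_snd.sub ((hconst.comp (contDiff_snd.comp contDiff_fst)).add
      ((contDiff_fst.comp contDiff_fst).smul ((primitive E).contDiff.comp
        ((contDiff_superposition n hV).comp contDiff_snd))))
  set u : (ℝ × E) × C(Icc (-1 : ℝ) 1, E) := ((0, x₀), ContinuousMap.const _ x₀) with hu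
  have hGu : G u = 0 := by simp [G, hu]
  have hn' : (n : ℕ∞ω) ≠ 0 := by exact_mod_cast hn
  have hinv : fderiv ℝ G u ∘L .inr ℝ (ℝ × E) C(Icc (-1 : ℝ) 1, E) = ContinuousLinearMap.id ℝ _ := by
    have h1 : HasFDerivAt G (fderiv ℝ G u) u := (hG.differentiable hn' u).hasFDerivAt
    have h2 : HasFDerivAt (fun γ : C(Icc (-1 : ℝ) 1, E) => (((0, x₀), γ) : (ℝ × E) × _))
        (.inr ℝ (ℝ × E) C(Icc (-1 : ℝ) 1, E)) (ContinuousMap.const _ x₀) :=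
      hasFDerivAt_prodMk_right (0, x₀) _
    have h3 := h1.comp (ContinuousMap.const _ x₀) h2
    have h4 : HasFDerivAt (G ∘ fun γ : C(Icc (-1 : ℝ) 1, E) => (((0, x₀), γ) : (ℝ × E) × _))
        (ContinuousLinearMap.id ℝ _) (ContinuousMap.const _ x₀) := by
      have : (G ∘ fun γ : C(Icc (-1 : ℝ) 1, E) => (((0, x₀), γ) : (ℝ × E) × _)) =
          fun γ => γ - ContinuousMap.const _ x₀ := by
        funext γ; simp [G]
      rw [this]
      exact (hasFDerivAt_id _).sub_const _
    exact h3.unique h4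
  have hI : (fderiv ℝ G u ∘L .inr ℝ (ℝ × E) C(Icc (-1 : ℝ) 1, E)).IsInvertible := by
    rw [hinv]; exact ⟨ContinuousLinearEquiv.refl ℝ _, rfl⟩
  have hGa : ContDiffAt ℝ n G u := hG.contDiffAt
  refine ⟨hGa.implicitFunction hn' hI, hGa.contDiffAt_implicitFunction hn' hI,
    hGa.implicitFunction_apply_self hn' hI, ?_, ?_⟩
  · filter_upwards [hGa.eventually_apply_implicitFunction hn' hI] with p hp
    rw [hGu] at hp
    exact sub_eq_zero.1 hp
  · filter_upwards [hGa.eventually_apply_eq_iff_implicitFunction hn' hI] with q hq h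
    exact hq.1 (by rw [hGu]; exact sub_eq_zero.2 h)

/-- Local flows of vector fields on vector spaces. -/
theorem exists_localFlow (n : ℕ) (hn : n ≠ 0) (V : E → E) (hV : ContDiff ℝ n V) {x₀ : E} {W : Set E}
    (hW : W ∈ 𝓝 x₀) :
    ∃ Fl : ℝ × E → E, ContDiffAt ℝ n Fl (0, x₀) ∧ ∃ ε > 0, ∀ᶠ x in 𝓝 x₀, Fl (0, x) = x ∧
      ∀ s ∈ Ioo (-ε) ε, HasDerivAt (fun s => Fl (s, x)) (V (Fl (s, x))) s ∧ Fl (s, x) ∈ W := by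
  obtain ⟨Γ, h1, h2, h3, h4⟩ := exists_solution n hn ⟨V, hV.continuous⟩ hV x₀
  let one : Icc (-1 : ℝ) 1 := ⟨1, by norm_num⟩
  obtain ⟨ρ₁, hρ₁, hW⟩ := Metric.mem_nhds_iff.1 hW
  obtain ⟨ρ₂, hρ₂, h4⟩ := Metric.eventually_nhds_iff_ball.1 h4
  set ρ := min ρ₁ ρ₂ with hρ
  have hρ0 : 0 < ρ := lt_min hρ₁ hρ₂
  have h5 : ∀ᶠ p in 𝓝 ((0, x₀) : ℝ × E), Γ p ∈ Metric.ball (ContinuousMap.const _ x₀) ρ := by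
    have := h1.continuousAt.preimage_mem_nhds (t := Metric.ball (ContinuousMap.const _ x₀) ρ)
      (by rw [h2]; exact Metric.ball_mem_nhds _ hρ0)
    exact this
  obtain ⟨r, hr, h6⟩ := Metric.eventually_nhds_iff_ball.1 (h3.and h5)
  set τ := min (r / 2) (ρ / 2) with hτ
  have hτ0 : 0 < τ := lt_min (by positivity) (by positivity)
  have hτr : τ < r := (min_le_left _ _).trans_lt (by linarith)
  have hτρ : τ < ρ := (min_le_right _ _).trans_lt (by linarith)
  refine ⟨fun p => Γ p one, ?_, τ, hτ0, ?_⟩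
  · exact (ContinuousMap.evalCLM ℝ one : C(Icc (-1 : ℝ) 1, E) →L[ℝ] E).contDiff.contDiffAt.comp _ h1
  filter_upwards [Metric.ball_mem_nhds x₀ (lt_min hr hρ0)] with x hx
  have hxr : dist x x₀ < r := lt_of_lt_of_le hx (min_le_left _ _)
  have hxρ : dist x x₀ < ρ := lt_of_lt_of_le hx (min_le_right _ _)
  obtain ⟨e1, e2⟩ := h6 (τ, x) (by
    rw [Metric.mem_ball, Prod.dist_eq]
    simp only [Real.dist_0_eq_abs]
    exact max_lt (by rwa [abs_of_pos hτ0]) hxr)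
  set γ := Γ (τ, x) with hγ
  set g := extendIcc γ with hg
  have hgc : Continuous g := continuous_extendIcc γ
  have hVg : Continuous fun s => V (g s) := hV.continuous.comp hgc
  have eq : ∀ u ∈ Icc (-1 : ℝ) 1, g u = x + τ • ∫ s in (0 : ℝ)..u, V (g s) := by
    intro u hu
    have := DFunLike.congr_fun e1 ⟨u, hu⟩
    rw [hg, extendIcc, IccExtend_of_mem _ _ hu, this]
    rfl
  have hgball : ∀ u, g u ∈ Metric.ball x₀ ρ := by
    intro u
    exact lt_of_le_of_lt (ContinuousMap.dist_apply_le_dist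
      (f := γ) (g := ContinuousMap.const _ x₀) (projIcc (-1 : ℝ) 1 (by norm_num) u)) e2
  have main : ∀ s ∈ Icc (-τ) τ, Γ (s, x) one = g (s / τ) := by
    intro s hs
    have hdiv : |s / τ| ≤ 1 := by
      rw [abs_div, abs_of_pos hτ0, div_le_one hτ0, abs_le]; exact hs
    let γs : C(Icc (-1 : ℝ) 1, E) := ⟨fun t => g (s / τ * t), by fun_prop⟩
    have hγs : ∀ t ∈ Icc (-1 : ℝ) 1, extendIcc γs t = g (s / τ * t) := by
      intro t ht
      rw [extendIcc, IccExtend_of_mem _ _ ht]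
      rfl
    have hs' : Γ (s, x) = γs := by
      refine h4 ((s, x), γs) ?_ ?_
      · rw [Metric.mem_ball, Prod.dist_eq, Prod.dist_eq]
        simp only [Real.dist_0_eq_abs]
        refine max_lt (max_lt ?_ (hxρ.trans_le (min_le_right _ _))) ?_
        · exact lt_of_le_of_lt (abs_le.2 hs) (hτρ.trans_le (min_le_right _ _))
        · refine lt_of_lt_of_le ?_ (min_le_right ρ₁ ρ₂)
          rw [ContinuousMap.dist_lt_iff hρ0]
          exact fun t => hgball _
      · ext t
        have ht : s / τ * t ∈ Icc (-1 : ℝ) 1 := by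
          rw [mem_Icc, ← abs_le, abs_mul]
          exact mul_le_one₀ hdiv (abs_nonneg _) (abs_le.2 t.2)
        show g (s / τ * t) = x + s • primitive E _ t
        rw [eq _ ht, primitive_apply]
        congr 1
        have e3 : ∫ s' in (0 : ℝ)..t, extendIcc ((⟨V, hV.continuous⟩ : C(E, E)).comp γs) s' =
            ∫ s' in (0 : ℝ)..t, V (g (s / τ * s')) := by
          refine intervalIntegral.integral_congr fun t' ht' => ?_
          have : t' ∈ Icc (-1 : ℝ) 1 := by
            have h0 : uIcc (0 : ℝ) t ⊆ Icc (-1) 1 :=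
              uIcc_subset_Icc (by norm_num) t.2
            exact h0 ht'
          show V (extendIcc γs t') = _
          rw [hγs _ this]
        rw [e3]
        have e4 := intervalIntegral.smul_integral_comp_mul_left (fun s => V (g s)) (s / τ)
          (a := 0) (b := (t : ℝ))
        rw [mul_zero] at e4
        rw [← e4, smul_smul, mul_div_cancel₀ _ hτ0.ne']
    rw [hs']
    show g (s / τ * 1) = _
    rw [mul_one]
  refine ⟨?_, fun s hs => ?_⟩
  · show Γ (0, x) one = x
    rw [main 0 ⟨by linarith, hτ0.le⟩, zero_div, eq 0 (by norm_num)]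
    simp
  have hs1 : |s / τ| < 1 := by
    rw [abs_div, abs_of_pos hτ0, div_lt_one hτ0, abs_lt]; exact hs
  constructor
  · have hev : (fun s => Γ (s, x) one) =ᶠ[𝓝 s] fun s => x + τ • ∫ s in (0 : ℝ)..(s / τ), V (g s) := by
      filter_upwards [isOpen_Ioo.mem_nhds hs] with s' hs'
      rw [main s' (Ioo_subset_Icc_self hs'), eq]
      rw [mem_Icc, ← abs_le, abs_div, abs_of_pos hτ0, div_le_one hτ0, abs_le]
      exact Ioo_subset_Icc_self hs'
    refine HasDerivAt.congr_of_eventuallyEq ?_ hev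
    have hd : HasDerivAt (fun u => ∫ s in (0 : ℝ)..u, V (g s)) (V (g (s / τ))) (s / τ) :=
      intervalIntegral.integral_hasDerivAt_right (hVg.intervalIntegrable _ _)
        (hVg.stronglyMeasurableAtFilter _ _) hVg.continuousAt
    have hd2 := (HasDerivAt.scomp s hd ((hasDerivAt_id s).div_const τ)).const_smul τ
    have hd3 := hd2.const_add x
    rw [smul_smul, mul_one_div_cancel hτ0.ne', one_smul] at hd3
    rw [main s (Ioo_subset_Icc_self hs)]
    exact hd3
  · show Γ (s, x) one ∈ W
    rw [main s (Ioo_subset_Icc_self hs)]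
    exact hW (Metric.ball_subset_ball (min_le_left _ _) (hgball _))

end LocalFlow

/-! ### Flows of vector fields on manifolds -/

section ManifoldFlow

open Set

variable [FiniteDimensional ℝ E]
  {N : Type*} [TopologicalSpace N] [ChartedSpace H N] [IsManifold I ∞ N] [BoundarylessManifold I N]

theorem exists_contDiff_eventuallyEq {F : Type*} [NormedAddCommGroup F] [NormedSpace ℝ F] {n : ℕ}
    {f : E → F} {x₀ : E} (hf : ContDiffAt ℝ n f x₀) :
    ∃ g : E → F, ContDiff ℝ n g ∧ g =ᶠ[𝓝 x₀] f := by
  obtain ⟨u, hu, hfu⟩ := hf.contDiffOn le_rfl (by simp)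
  obtain ⟨r, hr, hru⟩ := Metric.mem_nhds_iff.1 hu
  let χ : ContDiffBump x₀ := ⟨r / 4, r / 2, by positivity, by linarith⟩
  refine ⟨fun x => χ x • f x, contDiff_iff_contDiffAt.2 fun x => ?_, ?_⟩
  · by_cases hx : dist x x₀ < r
    · have hxu : u ∈ 𝓝 x := Filter.mem_of_superset (Metric.isOpen_ball.mem_nhds hx) hru
      exact χ.contDiffAt.smul ((hfu.contDiffAt hxu).of_le (by simp))
    · have h0 : (fun x => χ x • f x) =ᶠ[𝓝 x] fun _ => 0 := by
        have h1 : ∀ᶠ y in 𝓝 x, r / 2 < dist y x₀ :=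
          (continuous_id.dist continuous_const).continuousAt.eventually_const_lt
            (by simp only [id]; linarith)
        filter_upwards [h1] with y hy
        rw [χ.zero_of_le_dist hy.le, zero_smul]
      exact contDiffAt_const.congr_of_eventuallyEq h0
  · filter_upwards [χ.eventuallyEq_one] with x hx
    rw [hx]
    exact one_smul _ _

theorem exists_localFlow_manifold {V : ∀ x : N, TangentSpace I x}
    (hV : ContMDiff I I.tangent ∞ fun x => (⟨x, V x⟩ : TangentBundle I N)) (n : ℕ) (hn : n ≠ 0)
    (p₀ : N) : ∃ Fl : ℝ × N → N, ContMDiffAt IR I n Fl (0, p₀) ∧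
      ∃ ε > 0, ∀ᶠ p in 𝓝 p₀, Fl (0, p) = p ∧
        IsMIntegralCurveOn (fun s => Fl (s, p)) V (Ioo (-ε) ε) := by
  have : CompleteSpace E := FiniteDimensional.complete ℝ E
  set x₀ := extChartAt I p₀ p₀ with hx₀
  have hint : interior (extChartAt I p₀).target ∈ 𝓝 x₀ :=
    isOpen_interior.mem_nhds ((I.isInteriorPoint_iff).1 BoundarylessManifold.isInteriorPoint)
  have hv := ((contMDiffAt_iff.1 ((hV p₀).of_le (m := n) (by exact_mod_cast le_top))).2.contDiffAt
    (range_mem_nhds_isInteriorPoint BoundarylessManifold.isInteriorPoint)).snd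
  obtain ⟨Vh, hVh, hVe⟩ := exists_contDiff_eventuallyEq hv
  obtain ⟨Fl, hFl, ε, hε, hflow⟩ := exists_localFlow n hn Vh hVh
    (W := {y | Vh y = _} ∩ interior (extChartAt I p₀).target) (x₀ := x₀)
    (Filter.inter_mem hVe hint)
  refine ⟨fun q => (extChartAt I p₀).symm (Fl (q.1, extChartAt I p₀ q.2)), ?_, ε, hε, ?_⟩
  · have h1 : ContMDiffAt IR 𝓘(ℝ, ℝ × E) n
        (fun q : ℝ × N => (q.1, extChartAt I p₀ q.2)) (0, p₀) := by
      have : ContMDiffAt IR 𝓘(ℝ, E) n (fun q : ℝ × N => extChartAt I p₀ q.2)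
          ((0, p₀) : ℝ × N) :=
        ContMDiffAt.comp (g := extChartAt I p₀) (I' := I) ((0, p₀) : ℝ × N) contMDiffAt_extChartAt
          contMDiffAt_snd
      have h0 : ContMDiffAt IR 𝓘(ℝ, ℝ) n (fun q : ℝ × N => q.1) ((0, p₀) : ℝ × N) :=
        contMDiffAt_fst
      exact h0.prodMk_space this
    have h2 : ContMDiffAt IR 𝓘(ℝ, E) n
        (fun q : ℝ × N => Fl (q.1, extChartAt I p₀ q.2)) (0, p₀) :=
      ContMDiffAt.comp (g := Fl) (0, p₀) hFl.contMDiffAt h1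
    have hfix : Fl (0, x₀) = x₀ := hflow.self_of_nhds.1
    have h3 : ContMDiffAt 𝓘(ℝ, E) I n (extChartAt I p₀).symm (Fl (0, extChartAt I p₀ p₀)) := by
      rw [← hx₀, hfix]
      exact (contMDiffOn_extChartAt_symm p₀).contMDiffAt
        (Filter.mem_of_superset hint interior_subset)
    exact ContMDiffAt.comp ((0, p₀) : ℝ × N) (g := (extChartAt I p₀).symm) h3 h2
  have hsrc := extChartAt_source_mem_nhds (I := I) p₀
  filter_upwards [hsrc, (continuousAt_extChartAt (I := I) p₀).eventually hflow] with p hp hf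
  refine ⟨?_, fun t ht => ?_⟩
  · show (extChartAt I p₀).symm (Fl (0, extChartAt I p₀ p)) = p
    rw [hf.1, (extChartAt I p₀).left_inv hp]
  set f : ℝ → E := fun s => Fl (s, extChartAt I p₀ p) with hfdef
  obtain ⟨hd, hW1, hf3⟩ := hf.2 t ht
  let xₜ : N := (extChartAt I p₀).symm (f t)
  have h : HasDerivAt f (tangentCoordChange I xₜ p₀ xₜ (V xₜ)) t := by
    have hW1' : Vh (Fl (t, extChartAt I p₀ p)) = _ := hW1
    rw [hW1'] at hd
    exact hd
  have hf3' := interior_subset hf3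
  have hft1 : xₜ ∈ (extChartAt I p₀).source := (extChartAt I p₀).map_target hf3'
  have hft2 := mem_extChartAt_source (I := I) xₜ
  apply HasMFDerivAt.hasMFDerivWithinAt
  change HasMFDerivAt 𝓘(ℝ, ℝ) I ((extChartAt I p₀).symm ∘ f) t
    ((1 : ℝ →L[ℝ] ℝ).smulRight <| V xₜ)
  refine ⟨ContinuousAt.comp (f := f) (continuousAt_extChartAt_symm'' hf3') h.continuousAt, ?_⟩
  have hlin : ((1 : ℝ →L[ℝ] ℝ).smulRight (V xₜ) : ℝ →L[ℝ] E) =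
      ContinuousLinearMap.toSpanSingleton ℝ (V xₜ : E) :=
    ContinuousLinearMap.ext fun _ => rfl
  have hVx : ∀ w : E, tangentCoordChange I p₀ xₜ xₜ (tangentCoordChange I xₜ p₀ xₜ w) = w := fun w =>
    (tangentCoordChange_comp ⟨⟨hft2, hft1⟩, hft2⟩).trans (tangentCoordChange_self hft2)
  have hchange : HasFDerivAt (extChartAt I xₜ ∘ (extChartAt I p₀).symm)
      (tangentCoordChange I p₀ xₜ xₜ) (f t) := by
    have h0 := hasFDerivWithinAt_tangentCoordChange (I := I) (x := p₀) (y := xₜ) (z := xₜ)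
      ⟨hft1, hft2⟩
    rw [(extChartAt I p₀).right_inv hf3'] at h0
    exact h0.hasFDerivAt <| mem_nhds_iff.mpr ⟨interior (extChartAt I p₀).target,
      subset_trans interior_subset (extChartAt_target_subset_range ..), isOpen_interior, hf3⟩
  have hder : HasFDerivAt ((extChartAt I xₜ ∘ (extChartAt I p₀).symm) ∘ f)
      ((1 : ℝ →L[ℝ] ℝ).smulRight (V xₜ) : ℝ →L[ℝ] E) t :=
    (congrArg (fun L => HasFDerivAt ((extChartAt I xₜ ∘ (extChartAt I p₀).symm) ∘ f) L t)
      (hlin.trans (congrArg (ContinuousLinearMap.toSpanSingleton ℝ) (hVx (V xₜ)).symm))).mpr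
        (hchange.comp_hasDerivAt t h).hasFDerivAt
  have hd' := hder.hasFDerivWithinAt (s := range 𝓘(ℝ, ℝ))
  exact hd'

variable [T2Space N]

/-- A vector field whose integral curves exist for a uniform time has a global smooth flow. -/
theorem exists_flow {V : ∀ x : N, TangentSpace I x}
    (hV : ContMDiff I I.tangent ∞ fun x => (⟨x, V x⟩ : TangentBundle I N)) {ε : ℝ} (hε : 0 < ε)
    (h : ∀ p : N, ∃ γ : ℝ → N, γ 0 = p ∧ IsMIntegralCurveOn γ V (Ioo (-ε) ε)) :
    ∃ Φ : ℝ × N → N, ContMDiff IR I ∞ Φ ∧ (∀ p, Φ (0, p) = p) ∧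
      (∀ p, IsMIntegralCurve (fun t => Φ (t, p)) V) ∧
      ∀ s t p, Φ (s + t, p) = Φ (s, Φ (t, p)) := by
  have : CompleteSpace E := FiniteDimensional.complete ℝ E
  have hV1 : ContMDiff I I.tangent 1 fun x => (⟨x, V x⟩ : TangentBundle I N) :=
    hV.of_le (by exact_mod_cast le_top)
  choose γ hγ0 hγ using exists_isMIntegralCurve_of_isMIntegralCurveOn hV1 hε h
  let Φ : ℝ × N → N := fun q => γ q.2 q.1
  have hgroup : ∀ s t p, Φ (s + t, p) = Φ (s, Φ (t, p)) := by
    intro s t p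
    have h1 : IsMIntegralCurve (γ p ∘ (· + t)) V := (hγ p).comp_add t
    have := isMIntegralCurve_Ioo_eq_of_contMDiff_boundaryless (t₀ := 0) hV1 h1 (hγ (γ p t))
      (by simp [hγ0])
    exact congrFun this s
  refine ⟨Φ, ?_, hγ0, hγ, hgroup⟩
  rw [contMDiff_infty]
  intro m
  suffices hsuff : ∀ n : ℕ, n ≠ 0 → ContMDiff IR I n Φ from
    (hsuff (m + 1) (by simp)).of_le (by exact_mod_cast Nat.le_succ m)
  intro n hn
  -- smoothness near time zero
  have hzero : ∀ p₀, ∀ᶠ q in 𝓝 ((0, p₀) : ℝ × N), ContMDiffAt IR I n Φ q := by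
    intro p₀
    obtain ⟨Fl, hFl, δ, hδ, hflow⟩ := exists_localFlow_manifold hV n hn p₀
    have heq : ∀ᶠ q in 𝓝 ((0, p₀) : ℝ × N), Φ q = Fl q := by
      rw [nhds_prod_eq]
      have hIoo : ∀ᶠ s in 𝓝 (0 : ℝ), s ∈ Ioo (-δ) δ :=
        isOpen_Ioo.mem_nhds ⟨neg_lt_zero.2 hδ, hδ⟩
      filter_upwards [hIoo.prod_inl (𝓝 p₀), hflow.prod_inr (𝓝 (0 : ℝ))] with q hq1 hq2
      exact isMIntegralCurveOn_Ioo_eqOn_of_contMDiff_boundaryless (t₀ := 0)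
        ⟨neg_lt_zero.2 hδ, hδ⟩ hV1 ((hγ q.2).isMIntegralCurveOn _) hq2.2
        ((hγ0 q.2).trans hq2.1.symm) hq1
    exact contMDiffAt_iff_contMDiffAt_nhds (by simp) |>.1 (hFl.congr_of_eventuallyEq heq)
  rintro ⟨t₁, p₀⟩
  have hcont : Continuous (γ p₀) := (hγ p₀).continuous
  let T : Set ℝ := {t | ContMDiffAt IR I n Φ (t, p₀)}
  have hlocal : ∀ t₀ : ℝ, ∀ᶠ t in 𝓝 t₀, ∀ᶠ t' in 𝓝 t₀, t ∈ T → t' ∈ T := by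
    intro t₀
    have h1 : Filter.Tendsto (fun q : ℝ × ℝ => ((q.2 - q.1, γ p₀ q.1) : ℝ × N)) (𝓝 (t₀, t₀))
        (𝓝 (0, γ p₀ t₀)) := by
      have : ContinuousAt (fun q : ℝ × ℝ => ((q.2 - q.1, γ p₀ q.1) : ℝ × N)) (t₀, t₀) := by
        fun_prop
      simpa [ContinuousAt] using this
    have h2 := h1.eventually (hzero (γ p₀ t₀))
    rw [nhds_prod_eq] at h2
    filter_upwards [h2.curry] with t ht
    filter_upwards [ht] with t' ht' htT
    have htT' : ContMDiffAt IR I n Φ (t, p₀) := htT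
    have h3 : ContMDiffAt IR I n (fun q : ℝ × N => Φ (t, q.2)) (t', p₀) := by
      have : ContMDiffAt IR IR n (fun q : ℝ × N => (t, q.2)) (t', p₀) :=
        contMDiffAt_const.prodMk contMDiffAt_snd
      exact ContMDiffAt.comp (g := Φ) (t', p₀) htT' this
    have h4 : ContMDiffAt IR 𝓘(ℝ, ℝ) n (fun q : ℝ × N => q.1 - t) (t', p₀) := by
      have : ContDiff ℝ n fun s : ℝ => s - t := contDiff_id.sub contDiff_const
      exact ContMDiffAt.comp (g := fun s : ℝ => s - t) (t', p₀) this.contMDiff.contMDiffAt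
        contMDiffAt_fst
    have h5 : ContMDiffAt IR I n (fun q : ℝ × N => Φ (q.1 - t, Φ (t, q.2))) (t', p₀) :=
      ContMDiffAt.comp (g := Φ) (t', p₀) ht' (h4.prodMk h3)
    refine h5.congr_of_eventuallyEq (Filter.Eventually.of_forall fun q => ?_)
    show Φ (q.1, q.2) = _
    show _ = Φ (q.1 - t, Φ (t, q.2))
    rw [← hgroup, sub_add_cancel]
  have hT0 : (0 : ℝ) ∈ T := (hzero p₀).self_of_nhds
  have hopen : IsOpen T := isOpen_iff_mem_nhds.2 fun t ht => by
    filter_upwards [(hlocal t).self_of_nhds] with t' ht' using ht' ht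
  have hclosed : IsClosed T := by
    rw [← isOpen_compl_iff, isOpen_iff_mem_nhds]
    intro t ht
    filter_upwards [hlocal t] with t' ht' ht'T
    exact ht (ht'.self_of_nhds ht'T)
  have := IsClopen.eq_univ ⟨hclosed, hopen⟩ ⟨0, hT0⟩
  exact (this ▸ mem_univ t₁ : t₁ ∈ T)

end ManifoldFlow

/-! ### Vector fields defined by linear equations -/

section ReebOperator

variable {E : Type*} [NormedAddCommGroup E] [NormedSpace ℝ E] [FiniteDimensional ℝ E]

/-- The antisymmetrisation of a continuous bilinear map. -/
def antisymmL (D : E →L[ℝ] E →L[ℝ] ℝ) : E →L[ℝ] E →L[ℝ] ℝ := D - D.flip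

variable (E) in
/-- The linear system `D(V, ·) - D(·, V) - m a - n σ = 0`, `a(V) = 0`, `σ(V) = 1` for
`(V, m, n)`. -/
def reebOp (p : (E →L[ℝ] E →L[ℝ] ℝ) × (E →L[ℝ] ℝ) × (E →L[ℝ] ℝ)) :
    (E × ℝ × ℝ) →L[ℝ] ((E →L[ℝ] ℝ) × ℝ × ℝ) :=
  LinearMap.toContinuousLinearMap
    { toFun := fun q => (antisymmL p.1 q.1 - q.2.1 • p.2.1 - q.2.2 • p.2.2, p.2.1 q.1, p.2.2 q.1)
      map_add' := fun q r => by
        simp only [Prod.fst_add, Prod.snd_add, map_add, add_smul, Prod.mk_add_mk, Prod.mk.injEq,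
          and_true]
        abel
      map_smul' := fun c q => by
        simp only [Prod.smul_fst, Prod.smul_snd, map_smul, smul_eq_mul, mul_smul, Prod.smul_mk,
          smul_sub, RingHom.id_apply] }

theorem contDiffWithinAt_clm_apply {X F : Type*} [NormedAddCommGroup X] [NormedSpace ℝ X]
    [NormedAddCommGroup F] [NormedSpace ℝ F] {f : X → E →L[ℝ] F} {s : Set X} {x : X} :
    ContDiffWithinAt ℝ ∞ f s x ↔ ∀ y, ContDiffWithinAt ℝ ∞ (fun z => f z y) s x := by
  refine ⟨fun h y => h.clm_apply contDiffWithinAt_const, fun h => ?_⟩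
  let d := Module.finrank ℝ E
  have hd : d = Module.finrank ℝ (Fin d → ℝ) := (Module.finrank_fin_fun ℝ).symm
  let e₁ := ContinuousLinearEquiv.ofFinrankEq hd
  let e₂ := (e₁.arrowCongr (1 : F ≃L[ℝ] F)).trans (ContinuousLinearEquiv.piRing (Fin d))
  rw [← Function.id_comp f, ← e₂.symm_comp_self]
  exact e₂.symm.contDiff.comp_contDiffWithinAt (contDiffWithinAt_pi.2 fun i => h _)

theorem contDiffAt_reebOp {X : Type*} [NormedAddCommGroup X] [NormedSpace ℝ X] {s : Set X} {x : X}
    {D : X → E →L[ℝ] E →L[ℝ] ℝ} {a σ : X → E →L[ℝ] ℝ} (hD : ContDiffWithinAt ℝ ∞ D s x)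
    (ha : ContDiffWithinAt ℝ ∞ a s x) (hσ : ContDiffWithinAt ℝ ∞ σ s x) :
    ContDiffWithinAt ℝ ∞ (fun y => reebOp E (D y, a y, σ y)) s x := by
  have h : ∀ q : E × ℝ × ℝ, ContDiffWithinAt ℝ ∞ (fun y => reebOp E (D y, a y, σ y) q) s x := by
    rintro ⟨V, m, n⟩
    have h0 : ContDiffWithinAt ℝ ∞ (fun y => antisymmL (D y) V) s x := by
      rw [contDiffWithinAt_clm_apply]
      intro u
      exact ((hD.clm_apply contDiffWithinAt_const).clm_apply contDiffWithinAt_const).sub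
        ((hD.clm_apply contDiffWithinAt_const).clm_apply contDiffWithinAt_const)
    have h3 := ((h0.sub (ha.const_smul m)).sub (hσ.const_smul n)).prodMk ((ha.clm_apply (contDiffWithinAt_const (c := V))).prodMk
        (hσ.clm_apply (contDiffWithinAt_const (c := V))))
    exact h3
  rw [contDiffWithinAt_clm_apply]
  exact h

theorem reebOp_eq_iff (D : E →L[ℝ] E →L[ℝ] ℝ) (a σ : E →L[ℝ] ℝ) (V : E) (m n s t : ℝ) :
    reebOp E (D, a, σ) (V, m, n) = (0, s, t) ↔
      (∀ y, antisymmL D V y = m * a y + n * σ y) ∧ a V = s ∧ σ V = t := by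
  have h : reebOp E (D, a, σ) (V, m, n) = (antisymmL D V - m • a - n • σ, a V, σ V) := rfl
  rw [h, Prod.mk.injEq, Prod.mk.injEq]
  refine and_congr_left fun _ => ⟨fun h y => ?_, fun h => ContinuousLinearMap.ext fun y => ?_⟩
  · have h4 : antisymmL D V y - m * a y - n * σ y = 0 := DFunLike.congr_fun h y
    linarith
  · show antisymmL D V y - m * a y - n * σ y = 0
    rw [h]; ring

theorem reebOp_exists_equiv {D : E →L[ℝ] E →L[ℝ] ℝ} {a σ : E →L[ℝ] ℝ}
    (h : ∀ (u : E) (m n : ℝ), (∀ v, antisymmL D u v = m * a v + n * σ v) → a u = 0 → σ u = 0 →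
      u = 0 ∧ m = 0 ∧ n = 0) :
    ∃ e : (E × ℝ × ℝ) ≃L[ℝ] ((E →L[ℝ] ℝ) × ℝ × ℝ), (e : _ →L[ℝ] _) = reebOp E (D, a, σ) := by
  have hinj : Function.Injective (reebOp E (D, a, σ)).toLinearMap := by
    rw [injective_iff_map_eq_zero]
    rintro ⟨u, m, n⟩ h0
    obtain ⟨h1, h2, h3⟩ := (reebOp_eq_iff D a σ u m n 0 0).1 h0
    obtain ⟨rfl, rfl, rfl⟩ := h u m n h1 h2 h3
    rfl
  have hdim : Module.finrank ℝ (E × ℝ × ℝ) = Module.finrank ℝ ((E →L[ℝ] ℝ) × ℝ × ℝ) := by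
    have h1 : Module.finrank ℝ (E →L[ℝ] ℝ) = Module.finrank ℝ E := by
      rw [← (LinearMap.toContinuousLinearMap (𝕜 := ℝ) (E := E) (F' := ℝ)).finrank_eq]
      exact Subspace.dual_finrank_eq
    exact Module.finrank_prod.trans ((congrArg (· + Module.finrank ℝ (ℝ × ℝ)) h1.symm).trans
      (Module.finrank_prod (R := ℝ) (M := E →L[ℝ] ℝ) (M' := ℝ × ℝ)).symm)
  refine ⟨(LinearMap.linearEquivOfInjective _ hinj hdim).toContinuousLinearEquiv, ?_⟩
  ext x <;> rfl

end ReebOperator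

section Sections

open Set

variable {N : Type*} [TopologicalSpace N] [ChartedSpace H N] [IsManifold I ∞ N]

theorem OneForm.inChart_mfderiv (θ : OneForm I N) {x₀ q : N} (hq : q ∈ (extChartAt I x₀).source)
    (u : TangentSpace I q) :
    θ.inChart x₀ (extChartAt I x₀ q) (mfderiv I 𝓘(ℝ, E) (extChartAt I x₀) q u) = θ q u := by
  have e := DFunLike.congr_fun
    (mfderivWithin_extChartAt_symm_comp_mfderiv_extChartAt' (I := I) hq) u
  have key : ∀ (p : N), p = q → ∀ w : E, θ p w = θ q w := by rintro p rfl w; rfl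
  refine (key _ ((extChartAt I x₀).left_inv hq) _).trans ?_
  exact congrArg (θ q) e

theorem contMDiffAt_comp_extChartAt {F : Type*} [NormedAddCommGroup F] [NormedSpace ℝ F] {x₀ : N}
    {f : E → F} (hf : ContDiffWithinAt ℝ ∞ f (range I) (extChartAt I x₀ x₀)) :
    ContMDiffAt I 𝓘(ℝ, F) ∞ (fun x => f (extChartAt I x₀ x)) x₀ :=
  ContMDiffWithinAt.comp (t := range I) (g := f) x₀ hf.contMDiffWithinAt
    (contMDiffAt_extChartAt (I := I)).contMDiffWithinAt (fun _ _ => mem_range_self _)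

theorem contMDiffAt_section_iff {V : ∀ x : N, TangentSpace I x} {x₀ : N} :
    ContMDiffAt I I.tangent ∞ (fun x => (⟨x, V x⟩ : TangentBundle I N)) x₀ ↔
      ContMDiffAt I 𝓘(ℝ, E) ∞ (fun x => (mfderiv I 𝓘(ℝ, E) (extChartAt I x₀) x (V x) : E)) x₀ := by
  have h := Bundle.contMDiffAt_section (IB := I) (F := E) (n := ∞) (s := V) x₀
  refine h.trans (Filter.EventuallyEq.contMDiffAt_iff ?_)
  filter_upwards [(chartAt H x₀).open_source.mem_nhds (mem_chart_source H x₀)] with x hx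
  rw [← TangentBundle.continuousLinearMapAt_trivializationAt (𝕜 := ℝ) hx]
  exact (Bundle.Trivialization.continuousLinearMapAt_apply_of_mem (R := ℝ)
    (e := trivializationAt E (TangentSpace I) x₀) hx (V x)).symm

variable [FiniteDimensional ℝ E]

theorem contMDiff_of_equations {θ σ : OneForm I N} (hθ : θ.IsSmooth) (hσ : σ.IsSmooth)
    (huniq : ∀ (p : N) (u : TangentSpace I p) (m n : ℝ),
      (∀ w, θ.d p u w = m * θ p w + n * σ p w) → θ p u = 0 → σ p u = 0 → u = 0 ∧ m = 0 ∧ n = 0) :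
    ∃ (V : ∀ p : N, TangentSpace I p) (μ ν : N → ℝ),
      ContMDiff I I.tangent ∞ (fun x => (⟨x, V x⟩ : TangentBundle I N)) ∧
      ContMDiff I 𝓘(ℝ, ℝ) ∞ μ ∧ (∀ p w, θ.d p (V p) w = μ p * θ p w + ν p * σ p w) ∧
      (∀ p, θ p (V p) = 0) ∧ ∀ p, σ p (V p) = 1 := by
  have hθ' := isSmooth_iff.1 hθ
  have hσ' := isSmooth_iff.1 hσ
  let L : N → N → (E × ℝ × ℝ) →L[ℝ] ((E →L[ℝ] ℝ) × ℝ × ℝ) := fun p q => reebOp E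
    (fderivWithin ℝ (θ.inChart p) (range I) (extChartAt I p q),
      θ.inChart p (extChartAt I p q), σ.inChart p (extChartAt I p q))
  have hd : ∀ (p q : N), q ∈ (extChartAt I p).source → ∀ u w : TangentSpace I q,
      antisymmL (fderivWithin ℝ (θ.inChart p) (range I) (extChartAt I p q))
        (mfderiv I 𝓘(ℝ, E) (extChartAt I p) q u) (mfderiv I 𝓘(ℝ, E) (extChartAt I p) q w) =
        θ.d q u w := by
    intro p q hq u w
    rw [extChartAt_source] at hq
    exact (OneForm.d_eq_flatD_of_mem_source hq (hθ' q) u w).symm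
  have hsurj : ∀ (p q : N), q ∈ (extChartAt I p).source → ∀ y : E, ∃ u : TangentSpace I q,
      mfderiv I 𝓘(ℝ, E) (extChartAt I p) q u = y := fun p q hq y =>
    ⟨mfderivWithin 𝓘(ℝ, E) I (extChartAt I p).symm (range I) (extChartAt I p q) y,
      DFunLike.congr_fun (mfderiv_extChartAt_comp_mfderivWithin_extChartAt_symm' (I := I) hq) y⟩
  have hequiv : ∀ (p q : N), q ∈ (extChartAt I p).source →
      ∃ e : (E × ℝ × ℝ) ≃L[ℝ] ((E →L[ℝ] ℝ) × ℝ × ℝ), (e : _ →L[ℝ] _) = L p q := by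
    intro p q hq
    refine reebOp_exists_equiv fun u m n h1 h2 h3 => ?_
    obtain ⟨u, rfl⟩ := hsurj p q hq u
    have := huniq q u m n (fun w => by
      have := h1 (mfderiv I 𝓘(ℝ, E) (extChartAt I p) q w)
      rwa [hd p q hq, OneForm.inChart_mfderiv θ hq, OneForm.inChart_mfderiv σ hq] at this)
      (by rwa [OneForm.inChart_mfderiv θ hq] at h2) (by rwa [OneForm.inChart_mfderiv σ hq] at h3)
    exact ⟨by rw [this.1]; exact map_zero _, this.2⟩
  have hex : ∀ p : N, ∃ (V : TangentSpace I p) (m n : ℝ),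
      (∀ w, θ.d p V w = m * θ p w + n * σ p w) ∧ θ p V = 0 ∧ σ p V = 1 := by
    intro p
    have hp := mem_extChartAt_source (I := I) p
    obtain ⟨e, he⟩ := hequiv p p hp
    obtain ⟨⟨y, m, n⟩, hy⟩ := e.surjective (0, 0, 1)
    obtain ⟨u, rfl⟩ := hsurj p p hp y
    have hy' : L p p (mfderiv I 𝓘(ℝ, E) (extChartAt I p) p u, m, n) = (0, 0, 1) := by
      rw [← he]; exact hy
    obtain ⟨h1, h2, h3⟩ := (reebOp_eq_iff _ _ _ _ _ _ _ _).1 hy'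
    refine ⟨u, m, n, fun w => ?_, (OneForm.inChart_mfderiv θ hp u).symm.trans h2,
      (OneForm.inChart_mfderiv σ hp u).symm.trans h3⟩
    exact (hd p p hp u w).symm.trans ((h1 _).trans (congrArg₂ (fun a b : ℝ => m * a + n * b)
      (OneForm.inChart_mfderiv θ hp w) (OneForm.inChart_mfderiv σ hp w)))
  choose V μ ν h1 h2 h3 using hex
  have hLsmooth : ∀ p : N, ContMDiffAt I 𝓘(ℝ, (E × ℝ × ℝ) →L[ℝ] ((E →L[ℝ] ℝ) × ℝ × ℝ)) ∞ (L p) p := by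
    intro p
    have hf : ContDiffWithinAt ℝ ∞ (fun y => reebOp E
        (fderivWithin ℝ (θ.inChart p) (range I) y, θ.inChart p y, σ.inChart p y))
        (range I) (extChartAt I p p) := by
      have h1 : ContDiffWithinAt ℝ ∞ (fderivWithin ℝ (θ.inChart p) (range I)) (range I)
          (extChartAt I p p) :=
        ContDiffWithinAt.fderivWithin_right (hθ' p) I.uniqueDiffOn (by simp) (mem_range_self _)
      exact contDiffAt_reebOp h1 (hθ' p) (hσ' p)
    exact contMDiffAt_comp_extChartAt hf
  have hsol : ∀ p : N, ContMDiffAt I 𝓘(ℝ, E × ℝ × ℝ) ∞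
      (fun q => ((mfderiv I 𝓘(ℝ, E) (extChartAt I p) q (V q) : E), μ q, ν q)) p := by
    intro p
    have hp := mem_extChartAt_source (I := I) p
    obtain ⟨e, he⟩ := hequiv p p hp
    have h4 : ContMDiffAt I 𝓘(ℝ, ((E →L[ℝ] ℝ) × ℝ × ℝ) →L[ℝ] (E × ℝ × ℝ)) ∞
        (fun q => (L p q).inverse) p := by
      have : ContDiffAt ℝ ∞ ContinuousLinearMap.inverse (L p p) := by
        have : CompleteSpace (E × ℝ × ℝ) := FiniteDimensional.complete ℝ _
        rw [← he]; exact contDiffAt_map_inverse e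
      exact ContMDiffAt.comp (g := ContinuousLinearMap.inverse) p this.contMDiffAt (hLsmooth p)
    have h5 : ContMDiffAt I 𝓘(ℝ, E × ℝ × ℝ) ∞ (fun q => (L p q).inverse (0, 0, 1)) p :=
      h4.clm_apply contMDiffAt_const
    refine h5.congr_of_eventuallyEq ?_
    filter_upwards [extChartAt_source_mem_nhds (I := I) p] with q hq
    obtain ⟨e, he⟩ := hequiv p q hq
    rw [← he, ContinuousLinearMap.inverse_equiv]
    refine e.injective ((?_ : _ = ((0, 0, 1) : (E →L[ℝ] ℝ) × ℝ × ℝ)).trans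
      (e.apply_symm_apply _).symm)
    have he' : ∀ z, e z = L p q z := fun z => DFunLike.congr_fun he z
    rw [he']
    refine (reebOp_eq_iff _ _ _ _ _ _ _ _).2 ⟨fun y => ?_,
      (OneForm.inChart_mfderiv θ hq _).trans (h2 q), (OneForm.inChart_mfderiv σ hq _).trans (h3 q)⟩
    obtain ⟨w, rfl⟩ := hsurj p q hq y
    exact (hd p q hq _ w).trans ((h1 q w).trans (congrArg₂ (fun a b : ℝ => μ q * a + ν q * b)
      (OneForm.inChart_mfderiv θ hq w).symm (OneForm.inChart_mfderiv σ hq w).symm))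
  refine ⟨V, μ, ν, fun p => contMDiffAt_section_iff.2 ?_, fun p => ?_, h1, h2, h3⟩
  · exact ContMDiffAt.comp (g := Prod.fst) p contDiff_fst.contMDiff.contMDiffAt (hsol p)
  · exact ContMDiffAt.comp (g := fun z : E × ℝ × ℝ => z.2.1) p
      (contDiff_fst.comp contDiff_snd).contMDiff.contMDiffAt (hsol p)

end Sections

/-! ### Gray stability -/

section VectorForms

variable {F : Type*} [NormedAddCommGroup F] [NormedSpace ℝ F]

theorem inChart_vecForm (f : F → F →L[ℝ] ℝ) (x₀ y : F) :
    OneForm.inChart (I := 𝓘(ℝ, F)) (M := F) f x₀ y = f y := by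
  have h : mfderivWithin 𝓘(ℝ, F) 𝓘(ℝ, F) (extChartAt 𝓘(ℝ, F) x₀).symm (Set.range 𝓘(ℝ, F)) y =
      ContinuousLinearMap.id ℝ F := by
    rw [show ((extChartAt 𝓘(ℝ, F) x₀).symm : F → F) = id from rfl]
    exact mfderivWithin_id (by
      rw [show Set.range 𝓘(ℝ, F) = Set.univ from Set.range_id]; exact uniqueMDiffWithinAt_univ _)
  refine ContinuousLinearMap.ext fun v => ?_
  exact congrArg (f y) (DFunLike.congr_fun h v)

theorem isSmooth_vecForm {f : F → F →L[ℝ] ℝ} (hf : ContDiff ℝ ∞ f) :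
    OneForm.IsSmooth (I := 𝓘(ℝ, F)) (M := F) f := by
  intro x₀
  rw [show OneForm.inChart (I := 𝓘(ℝ, F)) (M := F) f x₀ = f from funext (inChart_vecForm f x₀)]
  exact hf.contDiffOn

theorem d_vecForm (f : F → F →L[ℝ] ℝ) (x u v : F) :
    OneForm.d (I := 𝓘(ℝ, F)) (M := F) f x u v = fderiv ℝ f x u v - fderiv ℝ f x v u := by
  have h := OneForm.d_eq_flatD (I := 𝓘(ℝ, F)) (M := F) f x u v
  rw [show OneForm.inChart (I := 𝓘(ℝ, F)) (M := F) f x = f from funext (inChart_vecForm f x),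
    show Set.range 𝓘(ℝ, F) = Set.univ from Set.range_id] at h
  unfold flatD at h
  rw [fderivWithin_univ] at h
  exact h

end VectorForms

section Algebra

variable {V : Type*} [AddCommGroup V] [Module ℝ V] [FiniteDimensional ℝ V]

theorem eq_zero_of_oddForm_ne_zero_of_eq_smul {k : ℕ} (hV : Module.finrank ℝ V = 2 * k + 1)
    {a : Module.Dual ℝ V} {w : BilinForm ℝ V} (hw : ∀ u v, w u v = -w v u)
    {v : Fin (2 * k + 1) → V} (h : oddForm k a w v ≠ 0) {R : V} {μ : ℝ} (ha : a R = 0)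
    (hR : ∀ y, w R y = μ * a y) : R = 0 := by
  by_contra hR0
  obtain ⟨q, hq⟩ : ∃ q : Module.Dual ℝ V, q R = μ := by
    obtain ⟨f, hf⟩ : ∃ f : Module.Dual ℝ V, f R ≠ 0 := by
      by_contra! h
      exact hR0 ((Module.forall_dual_apply_eq_zero_iff ℝ R).1 h)
    exact ⟨(μ / f R) • f, by simp [div_mul_cancel₀ _ hf]⟩
  have hanti : ∀ u v, (w - wedgeTwo q a) u v = -(w - wedgeTwo q a) v u := by
    intro u v
    simp only [LinearMap.sub_apply, wedgeTwo_apply, hw u v]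
    ring
  have h2 : oddForm k a (w - wedgeTwo q a) v ≠ 0 := by
    rwa [oddForm_congr_ker (w' := w) hanti hw]
    intro x y hx hy
    simp only [LinearMap.sub_apply, wedgeTwo_apply, hx, hy]
    ring
  refine hR0 (eq_zero_of_oddForm_ne_zero hV hanti h2 ha (LinearMap.ext fun y => ?_))
  simp only [LinearMap.sub_apply, wedgeTwo_apply, hR, hq, ha, LinearMap.zero_apply]
  ring

end Algebra

section Gray

open Set

variable [IsManifold I ∞ M]

theorem extChartAt_prod_symm_coe (s₀ : ℝ) (x₀ : M) :
    (extChartAt IR ((s₀, x₀) : ℝ × M)).symm =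
      fun q : ℝ × E => (q.1, (extChartAt I x₀).symm q.2) := by
  rw [extChartAt_prod]; rfl

theorem mfderivWithin_extChartAt_prod_symm (s₀ : ℝ) (x₀ : M) {p : ℝ × E}
    (hp : p.2 ∈ (extChartAt I x₀).target) (v : ℝ × E) :
    (mfderivWithin 𝓘(ℝ, ℝ × E) IR
      (extChartAt IR ((s₀, x₀) : ℝ × M)).symm (range IR) p v : ℝ × E) =
      (v.1, mfderivWithin 𝓘(ℝ, E) I (extChartAt I x₀).symm (range I) p.2 v.2) := by
  have hr := extChartAt_target_subset_range x₀ hp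
  have h1 : HasMFDerivWithinAt 𝓘(ℝ, ℝ × E) IR
      (fun q : ℝ × E => (q.1, (extChartAt I x₀).symm q.2)) (range IR) p
      ((ContinuousLinearMap.fst ℝ ℝ E).prod ((mfderivWithin 𝓘(ℝ, E) I (extChartAt I x₀).symm
        (range I) p.2).comp (ContinuousLinearMap.snd ℝ ℝ E))) := by
    refine HasMFDerivWithinAt.prodMk ?_ ?_
    · exact (hasFDerivWithinAt_fst).hasMFDerivWithinAt
    · refine HasMFDerivWithinAt.comp p
        (mdifferentiableWithinAt_extChartAt_symm hp).hasMFDerivWithinAt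
        (hasFDerivWithinAt_snd).hasMFDerivWithinAt ?_
      rintro q ⟨⟨a, b⟩, rfl⟩
      exact mem_range_self b
  have hu : UniqueMDiffWithinAt 𝓘(ℝ, ℝ × E) (range IR) p := by
    refine (IR).uniqueMDiffOn p ?_
    rw [modelWithCorners_prod_coe, range_prodMap]
    exact ⟨by simp, hr⟩
  rw [extChartAt_prod_symm_coe, h1.mfderivWithin hu]
  rfl

theorem OneForm.hasDerivAt_slice {τ : OneForm IR (ℝ × M)} (hτ : τ.IsSmooth)
    (hv : ∀ p, τ p ((1, 0) : ℝ × E) = 0) (s : ℝ) (x : M) (c : E) :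
    HasDerivAt (fun t => τ (t, x) ((0, c) : ℝ × E))
      (τ.d (s, x) ((1, 0) : ℝ × E) ((0, c) : ℝ × E)) s := by
  set z : ℝ × E := extChartAt IR (s, x) (s, x) with hz
  have hz' : z = (s, extChartAt I x x) := by rw [hz, extChartAt_prod]; rfl
  have hsm : ContDiffWithinAt ℝ ∞ (τ.inChart (s, x)) (range IR) z := isSmooth_iff.1 hτ (s, x)
  have hd := (hsm.differentiableWithinAt (by simp)).hasFDerivWithinAt
  have htgt : ∀ p : ℝ × E, p.2 ∈ (extChartAt I x).target → ∀ v : ℝ × E,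
      τ.inChart (s, x) p v = τ (p.1, (extChartAt I x).symm p.2)
        ((v.1, mfderivWithin 𝓘(ℝ, E) I (extChartAt I x).symm (range I) p.2 v.2) : ℝ × E) := by
    intro p hp v
    have key : ∀ (q q' : ℝ × M), q = q' → ∀ w w' : ℝ × E, w = w' → τ q w = τ q' w' := by
      rintro q _ rfl w _ rfl; rfl
    exact key _ _ (congrFun (extChartAt_prod_symm_coe s x) p) _ _
      (mfderivWithin_extChartAt_prod_symm s x hp v)
  have hxt := mem_extChartAt_target (I := I) x
  have hrange : range IR = univ ×ˢ range I := by
    rw [modelWithCorners_prod_coe, range_prodMap]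
    congr 1
    exact range_id
  -- the component along the first factor vanishes
  have hzero : ∀ w : ℝ × E, fderivWithin ℝ (τ.inChart (s, x)) (range IR) z w ((1, 0) : ℝ × E) = 0 := by
    intro w
    have h1 : HasFDerivWithinAt (fun p => τ.inChart (s, x) p ((1, 0) : ℝ × E))
        (((fderivWithin ℝ (τ.inChart (s, x)) (range IR) z).flip ((1, 0) : ℝ × E))) (range IR) z := by
      have := hd.clm_apply (hasFDerivWithinAt_const ((1, 0) : ℝ × E) z (range IR))
      refine this.congr_fderiv ?_
      ext <;> simp
    have h2 : (fun p => τ.inChart (s, x) p ((1, 0) : ℝ × E)) =ᶠ[𝓝[range IR] z] fun _ => 0 := by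
      have h3 : ∀ᶠ p in 𝓝[range IR] z, p.2 ∈ (extChartAt I x).target := by
        rw [hz', hrange, nhdsWithin_prod_eq]
        exact Filter.Eventually.prod_inr (show ∀ᶠ y in 𝓝[range I] (extChartAt I x x),
          y ∈ (extChartAt I x).target from extChartAt_target_mem_nhdsWithin x) _
      filter_upwards [h3] with p hp
      rw [htgt p hp]
      have : (mfderivWithin 𝓘(ℝ, E) I (extChartAt I x).symm (range I) p.2 (0 : E) : E) = 0 :=
        map_zero _
      refine (congrArg (fun w : E => τ (p.1, (extChartAt I x).symm p.2) ((1, w) : ℝ × E)) this).trans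
        (hv _)
    have hzr : z ∈ range IR := mem_range_self _
    have h4 := (h1.congr_of_eventuallyEq h2.symm (h2.self_of_nhdsWithin hzr).symm).fderivWithin
      ((IR).uniqueDiffOn z hzr)
    rw [fderivWithin_const_apply] at h4
    exact (DFunLike.congr_fun h4 w).symm
  have hcurve : HasDerivAt (fun t : ℝ => ((t, extChartAt I x x) : ℝ × E)) ((1, 0) : ℝ × E) s :=
    (hasDerivAt_id s).prodMk (hasDerivAt_const s _)
  have h5 : HasDerivAt (fun t : ℝ => τ.inChart (s, x) (t, extChartAt I x x))
      (fderivWithin ℝ (τ.inChart (s, x)) (range IR) z ((1, 0) : ℝ × E)) s := by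
    rw [hz'] at hd ⊢
    have := HasFDerivWithinAt.comp_hasDerivWithinAt (t := range IR) (s := univ) s hd
      hcurve.hasDerivWithinAt (fun t _ => by rw [hrange]; exact ⟨mem_univ _, mem_range_self _⟩)
    exact hasDerivWithinAt_univ.1 this
  have h6 := h5.clm_apply (hasDerivAt_const s ((0, c) : ℝ × E))
  have h7 : τ.d (s, x) ((1, 0) : ℝ × E) ((0, c) : ℝ × E) =
      fderivWithin ℝ (τ.inChart (s, x)) (range IR) z ((1, 0) : ℝ × E) ((0, c) : ℝ × E) := by
    refine (OneForm.d_eq_flatD τ (s, x) _ _).trans ?_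
    exact (congrArg (fun r => _ - r) (hzero _)).trans (sub_zero _)
  have h8 : (fun t : ℝ => τ.inChart (s, x) (t, extChartAt I x x) ((0, c) : ℝ × E)) =
      fun t => τ (t, x) ((0, c) : ℝ × E) := by
    funext t
    rw [htgt _ hxt]
    have key : ∀ (q q' : M), q = q' → ∀ w w' : ℝ × E, w = w' → τ (t, q) w = τ (t, q') w' := by
      rintro q _ rfl w _ rfl; rfl
    refine key _ _ (extChartAt_to_inv x) _ _ (Prod.ext rfl ?_)
    exact DFunLike.congr_fun (mfderivWithin_range_extChartAt_symm (I := I) (x := x)) c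
  rw [h8, map_zero, add_zero, ← h7] at h6
  exact h6

variable (I M) in
/-- The form `ds` on `ℝ × M`. -/
def timeForm : OneForm IR (ℝ × M) := fun _ => ContinuousLinearMap.fst ℝ ℝ E

theorem timeForm_eq : timeForm I M = pullback (I := 𝓘(ℝ, ℝ)) (I' := 𝓘(ℝ, ℝ).prod I)
    (Prod.fst : ℝ × M → ℝ) (fun _ => ContinuousLinearMap.id ℝ ℝ) := by
  funext p
  refine ContinuousLinearMap.ext fun v => ?_
  have h : mfderiv IR 𝓘(ℝ, ℝ) (Prod.fst : ℝ × M → ℝ) p = _ := mfderiv_fst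
  exact (DFunLike.congr_fun h v).symm

theorem isSmooth_timeForm : (timeForm I M).IsSmooth := by
  rw [timeForm_eq]
  exact OneForm.IsSmooth.pullback (isSmooth_vecForm contDiff_const) contMDiff_fst

theorem IsSmoothFamily.isSmooth {A : ℝ → OneForm I M} (hA : IsSmoothFamily A) (s : ℝ) :
    (A s).IsSmooth := by
  rw [← pullback_totalForm A s]
  exact (isSmooth_totalForm hA).pullback (contMDiff_mk_left s)

theorem d_totalForm {A : ℝ → OneForm I M} (hA : IsSmoothFamily A) (s : ℝ) (x : M) (v w : E) :
    (totalForm A).d (s, x) ((0, v) : ℝ × E) ((0, w) : ℝ × E) = (A s).d x v w := by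
  have h := OneForm.d_pullback (I' := I) (f := fun x : M => ((s, x) : ℝ × M)) (x := x)
    (isSmooth_iff.1 (isSmooth_totalForm hA) (s, x)) (contMDiff_mk_left s x) v w
  rw [pullback_totalForm] at h
  rw [h]
  exact congrArg₂ ((totalForm A).d (s, x)) (mfderiv_mk_left s x v).symm (mfderiv_mk_left s x w).symm

end Gray

section GrayTheorem

open Set

variable [FiniteDimensional ℝ E] [IsManifold I ∞ M]

theorem finrank_tangentSpace (x : M) :
    Module.finrank ℝ (TangentSpace I x) = Module.finrank ℝ E := rfl

theorem OneForm.d_zero_left (α : OneForm I M) (x : M) (v : TangentSpace I x) : α.d x 0 v = 0 :=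
  congrArg (fun L : TangentSpace I x →ₗ[ℝ] ℝ => L v) (map_zero (α.dB x))

theorem OneForm.d_sub_left (α : OneForm I M) (x : M) (u u' v : TangentSpace I x) :
    α.d x (u - u') v = α.d x u v - α.d x u' v :=
  congrArg (fun L : TangentSpace I x →ₗ[ℝ] ℝ => L v) (map_sub (α.dB x) u u')

theorem exists_oddForm_ne_zero {k : ℕ} (hdim : Module.finrank ℝ E = 2 * k + 1) {α : OneForm I M}
    (hα : IsContactForm k α) (x : M) :
    ∃ v, oddForm k (α x).toLinearMap (α.dB x) v ≠ 0 := by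
  obtain ⟨v, hv⟩ := exists_linearIndependent (V := TangentSpace I x)
    ((finrank_tangentSpace x).trans hdim)
  refine ⟨v, ?_⟩
  rw [← contactVolume_eq_oddForm]
  exact hα.volume_ne_zero x v hv

theorem IsContactForm.eq_zero {k : ℕ} (hdim : Module.finrank ℝ E = 2 * k + 1) {α : OneForm I M}
    (hα : IsContactForm k α) {x : M} {u : TangentSpace I x} {m : ℝ} (h0 : α x u = 0)
    (h : ∀ y, α.d x u y = m * α x y) : u = 0 := by
  obtain ⟨v, hv⟩ := exists_oddForm_ne_zero hdim hα x
  exact eq_zero_of_oddForm_ne_zero_of_eq_smul ((finrank_tangentSpace x).trans hdim) (α.dB_neg x) hv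
    h0 h

theorem IsContactForm.exists_ne_zero {k : ℕ} (hdim : Module.finrank ℝ E = 2 * k + 1)
    {α : OneForm I M} (hα : IsContactForm k α) (x : M) : ∃ y, α x y ≠ 0 := by
  obtain ⟨v, hv⟩ := exists_oddForm_ne_zero hdim hα x
  by_contra! h
  refine hv ?_
  have h6 : (α x).toLinearMap = (0 : ℝ) • (α x).toLinearMap := by
    rw [zero_smul]
    exact LinearMap.ext h
  rw [h6, oddForm_smul_left, zero_mul]

theorem eq_zero_of_totalForm {k : ℕ} (hdim : Module.finrank ℝ E = 2 * k + 1)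
    {A : ℝ → OneForm I M} (hA : IsSmoothFamily A) (hc : ∀ s, IsContactForm k (A s))
    (p : ℝ × M) (u : ℝ × E) (m n : ℝ)
    (h : ∀ w : ℝ × E, (totalForm A).d p u w = m * totalForm A p w + n * timeForm I M p w)
    (h1 : totalForm A p u = 0) (h2 : timeForm I M p u = 0) : u = 0 ∧ m = 0 ∧ n = 0 := by
  obtain ⟨s, x⟩ := p
  obtain ⟨u1, u2⟩ := u
  have hu1 : u1 = 0 := h2
  subst hu1
  have hu : u2 = 0 := by
    refine (hc s).eq_zero (x := x) (m := m) hdim h1 fun y => ?_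
    have h3 := h ((0, y) : ℝ × E)
    have h4 : n * timeForm I M (s, x) ((0, y) : ℝ × E) = 0 := mul_zero n
    rw [h4, add_zero] at h3
    exact (d_totalForm hA s x u2 y).symm.trans h3
  subst hu
  have hz : ∀ w : ℝ × E, (totalForm A).d (s, x) ((0, 0) : ℝ × E) w = 0 := fun w =>
    (totalForm A).d_zero_left (s, x) w
  have hn : n = 0 := by
    have h3 := h ((1, 0) : ℝ × E)
    rw [hz] at h3
    have h4 : totalForm A (s, x) ((1, 0) : ℝ × E) = 0 := map_zero (A s x)
    have h5 : timeForm I M (s, x) ((1, 0) : ℝ × E) = 1 := rfl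
    rw [h4, h5] at h3
    linarith
  refine ⟨rfl, ?_, hn⟩
  obtain ⟨y, hy⟩ := (hc s).exists_ne_zero hdim x
  have h3 := h ((0, y) : ℝ × E)
  rw [hz, hn, zero_mul, add_zero] at h3
  exact (mul_eq_zero.1 h3.symm).resolve_right hy

theorem mfderiv_snd_apply (p : ℝ × M) (v : ℝ × E) :
    (mfderiv IR I (Prod.snd : ℝ × M → M) p v : E) = v.2 := by
  have h : mfderiv IR I (Prod.snd : ℝ × M → M) p = _ := mfderiv_snd
  exact DFunLike.congr_fun h v

/-- Where a family of forms is constant in time, so is its total form. -/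
theorem d_totalForm_of_eventually_const {A : ℝ → OneForm I M} (hA : IsSmoothFamily A) {s s₀ : ℝ}
    (hs : ∀ᶠ t in 𝓝 s, A t = A s₀) (x : M) (w : ℝ × E) :
    (totalForm A).d (s, x) ((1, 0) : ℝ × E) w = 0 := by
  have h1 : ∀ᶠ q in 𝓝 ((s, x) : ℝ × M), totalForm A q =
      pullback (I' := 𝓘(ℝ, ℝ).prod I) (Prod.snd : ℝ × M → M) (A s₀) q := by
    rw [nhds_prod_eq]
    filter_upwards [hs.prod_inl (𝓝 x)] with q hq
    refine ContinuousLinearMap.ext fun v => ?_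
    have h2 : totalForm A q v = A s₀ q.2 v.2 := congrFun hq q.2 ▸ rfl
    exact h2.trans (congrArg (A s₀ q.2) (mfderiv_snd_apply q v).symm)
  rw [OneForm.d_congr h1]
  have h3 := OneForm.d_pullback (f := (Prod.snd : ℝ × M → M)) (x := (s, x))
    (isSmooth_iff.1 (hA.isSmooth s₀) x) (I' := 𝓘(ℝ, ℝ).prod I) contMDiff_snd.contMDiffAt
      ((1, 0) : ℝ × E) w
  refine h3.trans ?_
  have h2 := mfderiv_snd_apply (I := I) (s, x) ((1, 0) : ℝ × E)
  exact (congrArg (fun e : TangentSpace I x => (A s₀).d x e _) h2).trans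
    ((A s₀).d_zero_left x _)

variable [BoundarylessManifold I M] [T2Space M] [CompactSpace M]

/-- Integral curves exist for a uniform time, for vector fields on `ℝ × M` that are equal to `∂_s`
outside of a compact set. -/
theorem exists_uniform_time {V : ∀ p : ℝ × M, TangentSpace IR p}
    (hV : ContMDiff IR (IR).tangent ∞
      fun x => (⟨x, V x⟩ : TangentBundle IR (ℝ × M)))
    (hout : ∀ (s : ℝ) (x : M), s ∉ Icc (0 : ℝ) 1 → V (s, x) = ((1, 0) : ℝ × E)) :
    ∃ ε > 0, ∀ p : ℝ × M, ∃ γ : ℝ → ℝ × M, γ 0 = p ∧ IsMIntegralCurveOn γ V (Ioo (-ε) ε) := by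
  have hK : IsCompact (Icc (-1 : ℝ) 2 ×ˢ (univ : Set M)) := isCompact_Icc.prod isCompact_univ
  obtain ⟨ε, hε, h⟩ : ∃ ε > 0, ∀ p ∈ Icc (-1 : ℝ) 2 ×ˢ (univ : Set M), ∃ γ : ℝ → ℝ × M, γ 0 = p ∧
      IsMIntegralCurveOn γ V (Ioo (-ε) ε) := by
    refine hK.induction_on (p := fun S => ∃ ε > 0, ∀ p ∈ S, ∃ γ : ℝ → ℝ × M, γ 0 = p ∧
      IsMIntegralCurveOn γ V (Ioo (-ε) ε)) ⟨1, one_pos, by simp⟩ ?_ ?_ ?_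
    · rintro S T hST ⟨ε, hε, h⟩
      exact ⟨ε, hε, fun p hp => h p (hST hp)⟩
    · rintro S T ⟨ε, hε, h⟩ ⟨ε', hε', h'⟩
      refine ⟨min ε ε', lt_min hε hε', ?_⟩
      rintro p (hp | hp)
      · obtain ⟨γ, h0, h1⟩ := h p hp
        exact ⟨γ, h0, h1.mono (Ioo_subset_Ioo (neg_le_neg (min_le_left _ _)) (min_le_left _ _))⟩
      · obtain ⟨γ, h0, h1⟩ := h' p hp
        exact ⟨γ, h0, h1.mono (Ioo_subset_Ioo (neg_le_neg (min_le_right _ _)) (min_le_right _ _))⟩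
    · intro p _
      obtain ⟨Fl, -, ε, hε, hev⟩ := exists_localFlow_manifold hV 1 one_ne_zero p
      exact ⟨_, mem_nhdsWithin_of_mem_nhds hev, ε, hε, fun q hq => ⟨_, hq.1, hq.2⟩⟩
  refine ⟨min ε 1, lt_min hε one_pos, fun p => ?_⟩
  by_cases hp : p.1 ∈ Icc (-1 : ℝ) 2
  · obtain ⟨γ, h0, h1⟩ := h p ⟨hp, mem_univ _⟩
    exact ⟨γ, h0, h1.mono (Ioo_subset_Ioo (neg_le_neg (min_le_left _ _)) (min_le_left _ _))⟩
  · refine ⟨fun t => (p.1 + t, p.2), by simp, fun t ht => ?_⟩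
    have ht1 : -1 < t ∧ t < 1 :=
      ⟨lt_of_le_of_lt (neg_le_neg (min_le_right _ _)) ht.1, lt_of_lt_of_le ht.2 (min_le_right _ _)⟩
    have hnot : p.1 + t ∉ Icc (0 : ℝ) 1 := fun h => hp ⟨by linarith [h.1], by linarith [h.2]⟩
    have hd : HasMFDerivAt 𝓘(ℝ, ℝ) IR (fun t : ℝ => (p.1 + t, p.2)) t
        (ContinuousLinearMap.prod (ContinuousLinearMap.id ℝ ℝ) (0 : ℝ →L[ℝ] E)) := by
      refine HasMFDerivAt.prodMk ?_ (hasMFDerivAt_const p.2 t)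
      exact ((hasFDerivAt_id t).const_add p.1).hasMFDerivAt
    refine (hd.congr_mfderiv ?_).hasMFDerivWithinAt
    refine ContinuousLinearMap.ext fun r => ?_
    have h9 : ∀ (r : ℝ) (y : ℝ × E), y = (1, 0) → ((r, 0) : ℝ × E) = r • y := by
      rintro r _ rfl; simp
    exact h9 r _ (hout _ _ hnot)

theorem exists_gray_flow {k : ℕ} (hdim : Module.finrank ℝ E = 2 * k + 1) {A : ℝ → OneForm I M}
    (hA : IsSmoothFamily A) (hc : ∀ s, IsContactForm k (A s)) (h0 : ∀ s ≤ 0, A s = A 0)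
    (h1 : ∀ s, 1 ≤ s → A s = A 1) :
    ∃ (V : ∀ p : ℝ × M, TangentSpace IR p) (μ ν : ℝ × M → ℝ)
      (Fl : ℝ × (ℝ × M) → ℝ × M), Continuous μ ∧
      (∀ p w, (totalForm A).d p (V p) w = μ p * totalForm A p w + ν p * timeForm I M p w) ∧
      (∀ p, totalForm A p (V p) = 0) ∧
      ContMDiff (𝓘(ℝ, ℝ).prod IR) IR ∞ Fl ∧
      (∀ p, Fl (0, p) = p) ∧ (∀ p, IsMIntegralCurve (fun t => Fl (t, p)) V) ∧
      (∀ s t p, Fl (s + t, p) = Fl (s, Fl (t, p))) ∧ ∀ t p, (Fl (t, p)).1 = p.1 + t := by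
  have huniq : ∀ (p : ℝ × M) (u : TangentSpace IR p) (m n : ℝ),
      (∀ w, (totalForm A).d p u w = m * totalForm A p w + n * timeForm I M p w) →
      totalForm A p u = 0 → timeForm I M p u = 0 → u = 0 ∧ m = 0 ∧ n = 0 :=
    fun p u m n => eq_zero_of_totalForm hdim hA hc p u m n
  obtain ⟨V, μ, ν, hV, hμ, e1, e2, e3⟩ := contMDiff_of_equations (isSmooth_totalForm hA)
    isSmooth_timeForm huniq
  have hout : ∀ (s : ℝ) (x : M), s ∉ Icc (0 : ℝ) 1 → V (s, x) = ((1, 0) : ℝ × E) := by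
    intro s x hs
    have hev : ∃ s₀, ∀ᶠ t in 𝓝 s, A t = A s₀ := by
      by_cases h : s < 0
      · exact ⟨0, by filter_upwards [gt_mem_nhds h] with t ht using h0 t ht.le⟩
      · have h' : 1 < s := by
          by_contra h''
          exact hs ⟨not_lt.1 h, not_lt.1 h''⟩
        exact ⟨1, by filter_upwards [lt_mem_nhds h'] with t ht using h1 t ht.le⟩
    obtain ⟨s₀, hev⟩ := hev
    have hd := d_totalForm_of_eventually_const hA hev x
    let e : TangentSpace IR ((s, x) : ℝ × M) := ((1, 0) : ℝ × E)
    have hd' : ∀ w, (totalForm A).d (s, x) e w = 0 := hd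
    have h4 : totalForm A (s, x) e = 0 := map_zero (A s x)
    have h5 : timeForm I M (s, x) e = 1 := rfl
    have h2 := huniq (s, x) (V (s, x) - e) (μ (s, x)) (ν (s, x))
      (fun w => by rw [OneForm.d_sub_left, hd', sub_zero, e1])
      (by rw [map_sub, e2, h4, sub_zero]) (by rw [map_sub, e3, h5, sub_self])
    exact sub_eq_zero.1 h2.1
  obtain ⟨ε, hε, hex⟩ := exists_uniform_time hV hout
  obtain ⟨Fl, f1, f2, f3, f4⟩ := exists_flow hV hε hex
  refine ⟨V, μ, ν, Fl, hμ.continuous, e1, e2, f1, f2, f3, f4, fun t p => ?_⟩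
  have hder : ∀ t, HasDerivAt (fun t => (Fl (t, p)).1 - t) 0 t := by
    intro t
    have h2 := HasMFDerivAt.comp t (hasMFDerivAt_fst (I := 𝓘(ℝ, ℝ)) (I' := I) (Fl (t, p))) (f3 p t)
    have h3 : HasFDerivAt (fun t => (Fl (t, p)).1) (ContinuousLinearMap.toSpanSingleton ℝ (1 : ℝ)) t := by
      refine (h2.congr_mfderiv ?_).hasFDerivAt
      refine ContinuousLinearMap.ext fun r => ?_
      have h5 : ∀ (r : ℝ) (y : ℝ × E), y.1 = 1 → (r • y).1 = r * 1 := by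
        intro r y hy; rw [Prod.smul_fst, hy, smul_eq_mul]
      exact h5 r _ (e3 (Fl (t, p)))
    have h6 := h3.hasDerivAt.sub (hasDerivAt_id t)
    have h7 : HasDerivAt (fun t => (Fl (t, p)).1 - t) (ContinuousLinearMap.toSpanSingleton ℝ (1 : ℝ) 1 - 1) t := h6
    exact h7.congr_deriv (by simp)
  have hconst := is_const_of_deriv_eq_zero (fun t => (hder t).differentiableAt)
    (fun t => (hder t).deriv) t 0
  simp only [f2, sub_zero] at hconst
  linarith

/-- A solution of `b' = m b` is `b 0` times the exponential of the integral of `m`. -/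
theorem eq_exp_mul_of_hasDerivAt {b m : ℝ → ℝ} (hm : Continuous m)
    (hb : ∀ s, HasDerivAt b (m s * b s) s) (s : ℝ) :
    b s = Real.exp (∫ t in (0 : ℝ)..s, m t) * b 0 := by
  have hi : ∀ s, HasDerivAt (fun s => ∫ t in (0 : ℝ)..s, m t) (m s) s := fun s =>
    intervalIntegral.integral_hasDerivAt_right (hm.intervalIntegrable _ _)
      hm.aestronglyMeasurable.stronglyMeasurableAtFilter hm.continuousAt
  have hd : ∀ s, HasDerivAt (fun s => Real.exp (-∫ t in (0 : ℝ)..s, m t) * b s) 0 s := fun s => by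
    have := ((hi s).neg.exp).mul (hb s)
    refine this.congr_deriv ?_
    simp only [Pi.neg_apply]
    ring
  have hconst := is_const_of_deriv_eq_zero (fun t => (hd t).differentiableAt)
    (fun t => (hd t).deriv) s 0
  simp only [intervalIntegral.integral_same, neg_zero, Real.exp_zero, one_mul] at hconst
  rw [← hconst, ← mul_assoc, ← Real.exp_add, add_neg_cancel, Real.exp_zero, one_mul]

theorem mfderiv_of_isMIntegralCurve {V : ∀ p : ℝ × M, TangentSpace IR p}
    {G : ℝ × M → ℝ × M} (hG : ContMDiff IR IR ∞ G) (s : ℝ) (x : M)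
    (hV : IsMIntegralCurve (fun t => G (t, x)) V) :
    (mfderiv IR IR G (s, x) ((1, 0) : ℝ × E) : ℝ × E) =
      V (G (s, x)) := by
  have h1 : HasMFDerivAt 𝓘(ℝ, ℝ) IR (fun t : ℝ => (t, x)) s
      (ContinuousLinearMap.prod (ContinuousLinearMap.id ℝ ℝ) (0 : ℝ →L[ℝ] E)) :=
    HasMFDerivAt.prodMk (hasMFDerivAt_id s) (hasMFDerivAt_const x s)
  have h2 := HasMFDerivAt.comp s (hG.mdifferentiableAt (x := (s, x)) (by simp)).hasMFDerivAt h1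
  have h3 := hasMFDerivAt_unique h2 (hV s)
  have h4 := DFunLike.congr_fun h3 (1 : ℝ)
  have h5 : ∀ y : ℝ × E, (1 : ℝ) • y = y := one_smul ℝ
  exact h4.trans (h5 _)

theorem mfderiv_fst_of_fst_eq {G : ℝ × M → ℝ × M}
    (hG : ContMDiff IR IR ∞ G) (h : ∀ p, (G p).1 = p.1) (p : ℝ × M)
    (w : ℝ × E) :
    (mfderiv IR IR G p w : ℝ × E).1 = w.1 := by
  have h2 := HasMFDerivAt.comp p (hasMFDerivAt_fst (I := 𝓘(ℝ, ℝ)) (I' := I) (G p))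
    (hG.mdifferentiableAt (x := p) (by simp)).hasMFDerivAt
  have h3 : (Prod.fst ∘ G : ℝ × M → ℝ) = Prod.fst := funext h
  rw [h3] at h2
  exact DFunLike.congr_fun (hasMFDerivAt_unique h2 (hasMFDerivAt_fst p)) w

/-- **Gray's theorem**: a path of contact forms on a closed manifold is induced by an isotopy. -/
theorem gray {k : ℕ} (hdim : Module.finrank ℝ E = 2 * k + 1) {A : ℝ → OneForm I M}
    (hA : IsSmoothFamily A) (hc : ∀ s, IsContactForm k (A s)) (h0 : ∀ s ≤ 0, A s = A 0)
    (h1 : ∀ s, 1 ≤ s → A s = A 1) :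
    ∃ Φ : ℝ → (M ≃ₘ⟮I, I⟯ M), IsIsotopy Φ ∧ ∀ s, ∃ f : M → ℝ, (∀ x, 0 < f x) ∧
      ∀ x, (A s).pullback (I' := I) (Φ s) x = f x • A 0 x := by
  obtain ⟨V, μ, ν, Fl, hμ, e1, e2, f1, f2, f3, f4, f5⟩ := exists_gray_flow hdim hA hc h0 h1
  let G : ℝ × M → ℝ × M := fun p => Fl (p.1, (0, p.2))
  have hG : ContMDiff IR IR ∞ G :=
    f1.comp (contMDiff_fst.prodMk (contMDiff_const.prodMk contMDiff_snd))
  have hG1 : ∀ p, (G p).1 = p.1 := fun p => (f5 _ _).trans (zero_add _)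
  have hG0 : ∀ x, G (0, x) = (0, x) := fun x => f2 _
  have hinv : ContMDiff IR I ∞ (fun p : ℝ × M => (Fl (-p.1, (p.1, p.2))).2) := by
    refine contMDiff_snd.comp (f1.comp (ContMDiff.prodMk ?_ contMDiff_id))
    exact (contDiff_neg (𝕜 := ℝ) (F := ℝ)).contMDiff.comp contMDiff_fst
  have hl : ∀ s x, Fl (-s, (s, (Fl (s, (0, x))).2)) = (0, x) := fun s x => by
    have : (s, (Fl (s, (0, x))).2) = Fl (s, (0, x)) := Prod.ext (hG1 (s, x)).symm rfl
    rw [this, ← f4, neg_add_cancel, f2]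
  have hr : ∀ s x, Fl (s, (0, (Fl (-s, (s, x))).2)) = (s, x) := fun s x => by
    have : (0, (Fl (-s, (s, x))).2) = Fl (-s, (s, x)) :=
      Prod.ext ((f5 (-s) (s, x)).trans (add_neg_cancel s)).symm rfl
    rw [this, ← f4, add_neg_cancel, f2]
  let Φ : ℝ → (M ≃ₘ⟮I, I⟯ M) := fun s =>
    { toFun := fun x => (G (s, x)).2
      invFun := fun x => (Fl (-s, (s, x))).2
      left_inv := fun x => congrArg Prod.snd (hl s x)
      right_inv := fun x => congrArg Prod.snd (hr s x)
      contMDiff_toFun := contMDiff_snd.comp (hG.comp (contMDiff_mk_left s))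
      contMDiff_invFun := hinv.comp (contMDiff_mk_left s) }
  refine ⟨Φ, ⟨contMDiff_snd.comp hG, fun x => congrArg Prod.snd (hG0 x)⟩, fun s => ?_⟩
  let τ : OneForm IR (ℝ × M) :=
    pullback (I' := 𝓘(ℝ, ℝ).prod I) G (totalForm A)
  have hτ : τ.IsSmooth := (isSmooth_totalForm hA).pullback hG
  have hd1 : ∀ (s : ℝ) (x : M), (mfderiv IR IR G (s, x)
      ((1, 0) : ℝ × E) : ℝ × E) = V (G (s, x)) := fun s x =>
    mfderiv_of_isMIntegralCurve hG s x (f3 (0, x))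
  have hv : ∀ p, τ p ((1, 0) : ℝ × E) = 0 := fun p =>
    (congrArg (totalForm A (G p)) (hd1 p.1 p.2)).trans (e2 (G p))
  have hτd : ∀ (s : ℝ) (x : M) (c : E), τ.d (s, x) ((1, 0) : ℝ × E) ((0, c) : ℝ × E) =
      μ (G (s, x)) * τ (s, x) ((0, c) : ℝ × E) := by
    intro s x c
    have h2 := OneForm.d_pullback (f := G) (x := (s, x)) (I' := 𝓘(ℝ, ℝ).prod I)
      (isSmooth_iff.1 (isSmooth_totalForm hA) (G (s, x))) (hG (s, x))
      ((1, 0) : ℝ × E) ((0, c) : ℝ × E)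
    refine h2.trans ?_
    refine (congrArg (fun e => (totalForm A).d (G (s, x)) e _) (hd1 s x)).trans ?_
    rw [e1]
    have h3 : timeForm I M (G (s, x)) (mfderiv IR IR G (s, x)
      ((0, c) : ℝ × E)) = 0 := mfderiv_fst_of_fst_eq hG hG1 (s, x) (0, c)
    rw [h3, mul_zero, add_zero]
    rfl
  have hpull : ∀ (s : ℝ) (x : M) (c : E), τ (s, x) ((0, c) : ℝ × E) =
      pullback (I' := I) (Φ s) (A s) x c := by
    intro s x c
    have hcomp : G ∘ (fun x : M => ((s, x) : ℝ × M)) = (fun x : M => ((s, x) : ℝ × M)) ∘ Φ s :=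
      funext fun x => Prod.ext (hG1 (s, x)) rfl
    have h2 := OneForm.pullback_comp (I'' := I) (totalForm A) (f := G)
      (g := fun x : M => ((s, x) : ℝ × M)) (x := x) (hG.mdifferentiableAt (by simp))
      ((contMDiff_mk_left s).mdifferentiableAt (by simp))
    have h3 := OneForm.pullback_comp (I'' := I) (totalForm A) (f := fun x : M => ((s, x) : ℝ × M))
      (g := Φ s) (x := x) ((contMDiff_mk_left s).mdifferentiableAt (by simp))
      ((Φ s).contMDiff.mdifferentiableAt (by simp))
    rw [← hcomp, pullback_totalForm, h2] at h3
    refine Eq.trans ?_ (DFunLike.congr_fun h3 c)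
    exact congrArg (τ (s, x)) (mfderiv_mk_left s x c).symm
  refine ⟨fun x => Real.exp (∫ t in (0 : ℝ)..s, μ (G (t, x))), fun x => Real.exp_pos _,
    fun x => ContinuousLinearMap.ext fun c => ?_⟩
  have hm : Continuous fun t => μ (G (t, x)) :=
    hμ.comp (hG.continuous.comp (continuous_id.prodMk continuous_const))
  have h5 := eq_exp_mul_of_hasDerivAt hm (b := fun t => τ (t, x) ((0, c) : ℝ × E))
    (fun s => (OneForm.hasDerivAt_slice hτ hv s x c).congr_deriv (hτd s x c)) s
  refine (hpull s x c).symm.trans (h5.trans ?_)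
  have hid : (Φ 0 : M → M) = id := funext fun x => congrArg Prod.snd (hG0 x)
  have h7 : pullback (I' := I) (Φ 0) (A 0) = A 0 := by rw [hid, OneForm.pullback_id]
  have h6 : τ (0, x) ((0, c) : ℝ × E) = A 0 x c :=
    (hpull 0 x c).trans (DFunLike.congr_fun (congrFun h7 x) c)
  exact congrArg _ h6

end GrayTheorem

/-! ### Large perturbations of families of forms -/

section Perturbation

open Set

theorem continuousAt_wedgeWedgePow {X : Type*} [TopologicalSpace X] {p₀ : X} (k : ℕ)
    {V : X → Type*} {a : ∀ p, V p → ℝ} {w : ∀ p, V p → V p → ℝ}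
    {v : ∀ p, Fin (2 * k + 1) → V p} (ha : ∀ i, ContinuousAt (fun p => a p (v p i)) p₀)
    (hw : ∀ i j, ContinuousAt (fun p => w p (v p i) (v p j)) p₀) :
    ContinuousAt (fun p => wedgeWedgePow k (a p) (w p) (v p)) p₀ := by
  unfold wedgeWedgePow
  refine continuousAt_const.mul (tendsto_finsetSum _ fun σ _ => continuousAt_const.mul
    ((ha _).mul ?_))
  exact tendsto_finsetProd _ fun i _ => hw _ _

/-- The segment from `γ₀` to `γ₁`. -/
def segmentForm (γ₀ γ₁ : OneForm I M) (s : ℝ) : OneForm I M := (1 - s) • γ₀ + s • γ₁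

/-- The difference of the volumes of `γ + η` and `γ`. -/
def volumeChange (k : ℕ) (γ η : OneForm I M) (x : M) (v : Fin (2 * k + 1) → TangentSpace I x) : ℝ :=
  contactVolume k (γ + η) x v - contactVolume k γ x v

variable [IsManifold I ∞ M]

theorem OneForm.SmoothAt.segmentForm {γ₀ γ₁ : OneForm I M} {x : M} (h₀ : γ₀.SmoothAt x)
    (h₁ : γ₁.SmoothAt x) (s : ℝ) : (segmentForm γ₀ γ₁ s).SmoothAt x :=
  (h₀.smul _).add (h₁.smul _)

theorem OneForm.d_segmentForm {γ₀ γ₁ : OneForm I M} {x : M} (h₀ : γ₀.SmoothAt x)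
    (h₁ : γ₁.SmoothAt x) (s : ℝ) (u v : TangentSpace I x) :
    (segmentForm γ₀ γ₁ s).d x u v = (1 - s) * γ₀.d x u v + s * γ₁.d x u v := by
  rw [SymplecticOpenBook.segmentForm, OneForm.d_add (h₀.smul _) (h₁.smul _), OneForm.d_smul h₀,
    OneForm.d_smul h₁]

variable [FiniteDimensional ℝ E]

theorem OneForm.dB_add {α β : OneForm I M} {x : M} (hα : α.SmoothAt x) (hβ : β.SmoothAt x) :
    (α + β).dB x = α.dB x + β.dB x :=
  LinearMap.ext fun u => LinearMap.ext fun v => OneForm.d_add hα hβ u v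

theorem OneForm.dB_smul {α : OneForm I M} {x : M} (hα : α.SmoothAt x) (c : ℝ) :
    (c • α).dB x = c • α.dB x :=
  LinearMap.ext fun u => LinearMap.ext fun v => OneForm.d_smul hα c u v

theorem contactVolume_add_smul (k : ℕ) {γ η : OneForm I M} {x : M} (hγ : γ.SmoothAt x)
    (hη : η.SmoothAt x) {p q : Module.Dual ℝ (TangentSpace I x)} {e : ℝ}
    (he : (η x).toLinearMap = e • q) (hd : η.dB x = wedgeTwo p q) (c : ℝ)
    (v : Fin (2 * k + 1) → TangentSpace I x) :
    contactVolume k (γ + c • η) x v = contactVolume k γ x v +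
      c * (e * oddForm k q (γ.dB x) v + mixedForm k (γ x).toLinearMap p q (γ.dB x) v) := by
  rw [contactVolume_eq_oddForm, contactVolume_eq_oddForm, ← oddForm_add_smul,
    OneForm.dB_add hγ (hη.smul c), OneForm.dB_smul hη, hd, ← he]
  rfl

theorem volumeChange_eq (k : ℕ) {γ η : OneForm I M} {x : M} (hγ : γ.SmoothAt x)
    (hη : η.SmoothAt x) {p q : Module.Dual ℝ (TangentSpace I x)} {e : ℝ}
    (he : (η x).toLinearMap = e • q) (hd : η.dB x = wedgeTwo p q)
    (v : Fin (2 * k + 1) → TangentSpace I x) :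
    volumeChange k γ η x v =
      e * oddForm k q (γ.dB x) v + mixedForm k (γ x).toLinearMap p q (γ.dB x) v := by
  have h := contactVolume_add_smul k hγ hη he hd 1 v
  rw [one_smul, one_mul] at h
  rw [volumeChange, h, add_sub_cancel_left]

/-- Near every point there is a frame on which the volumes of the segment between two forms vary
continuously. -/
theorem continuousAt_contactVolume (k : ℕ) {v : ∀ x : M, Fin (2 * k + 1) → TangentSpace I x}
    {x₀ : M} (hv : ∀ γ : OneForm I M, (∀ᶠ x in 𝓝 x₀, γ.SmoothAt x) →
        (∀ i, ContinuousAt (fun x => γ x (v x i)) x₀) ∧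
        ∀ i j, ContinuousAt (fun x => γ.d x (v x i) (v x j)) x₀)
    {γ₀ γ₁ : OneForm I M} (h₀ : ∀ᶠ x in 𝓝 x₀, γ₀.SmoothAt x) (h₁ : ∀ᶠ x in 𝓝 x₀, γ₁.SmoothAt x)
    (s₀ : ℝ) :
    ContinuousAt (fun q : ℝ × M => contactVolume k (segmentForm γ₀ γ₁ q.1) q.2 (v q.2))
      (s₀, x₀) := by
  have hs : ContinuousAt (fun q : ℝ × M => q.1) (s₀, x₀) := continuousAt_fst
  refine continuousAt_wedgeWedgePow k (fun i => ?_) fun i j => ?_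
  · have e0 := ((hv γ₀ h₀).1 i).comp (f := Prod.snd) (x := ((s₀, x₀) : ℝ × M)) continuousAt_snd
    have e1 := ((hv γ₁ h₁).1 i).comp (f := Prod.snd) (x := ((s₀, x₀) : ℝ × M)) continuousAt_snd
    exact ((continuousAt_const.sub hs).mul e0).add (hs.mul e1)
  · have e0 := ((hv γ₀ h₀).2 i j).comp (f := Prod.snd) (x := ((s₀, x₀) : ℝ × M)) continuousAt_snd
    have e1 := ((hv γ₁ h₁).2 i j).comp (f := Prod.snd) (x := ((s₀, x₀) : ℝ × M)) continuousAt_snd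
    refine (((continuousAt_const (y := (1 : ℝ))).sub hs).mul e0 |>.add (hs.mul e1)).congr ?_
    have h := (h₀.and h₁).prod_inr (𝓝 s₀)
    rw [← nhds_prod_eq] at h
    filter_upwards [h] with q hq
    exact (OneForm.d_segmentForm hq.1 hq.2 q.1 _ _).symm

theorem segmentForm_add (γ₀ γ₁ η : OneForm I M) (s : ℝ) :
    segmentForm γ₀ γ₁ s + η = segmentForm (γ₀ + η) (γ₁ + η) s := by
  simp only [segmentForm]
  module

theorem mul_pos_of_large {a b κ : ℝ} (hb : b ≠ 0) (h : |a| < κ * |b|) : 0 < (a + κ * b) * b := by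
  have h1 : -(|a| * |b|) ≤ a * b := by rw [← abs_mul]; exact neg_abs_le _
  have h2 : b * b = |b| * |b| := (abs_mul_abs_self b).symm
  have h3 : 0 < |b| := abs_pos.2 hb
  have h4 : 0 < (κ * |b| - |a|) * |b| := mul_pos (sub_pos.2 h) h3
  rw [show (a + κ * b) * b = a * b + κ * (b * b) by ring, h2]
  linarith

/-- If `η ∧ dη = 0 = dη ∧ dη` and adding `η` changes the volume of `γ_s` at every point, then
`γ_s + κ η` is a contact form for all large `κ`. -/
theorem exists_forall_contactVolume_pos [CompactSpace M] {k : ℕ}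
    (hdim : Module.finrank ℝ E = 2 * k + 1) {γ₀ γ₁ η : OneForm I M} (h₀ : γ₀.IsSmooth)
    (h₁ : γ₁.IsSmooth) (hη : η.IsSmooth)
    (hdec : ∀ x, ∃ (p q : Module.Dual ℝ (TangentSpace I x)) (e : ℝ),
      (η x).toLinearMap = e • q ∧ η.dB x = wedgeTwo p q)
    (hne : ∀ s ∈ Icc (0 : ℝ) 1, ∀ x v, LinearIndependent ℝ v →
      volumeChange k (segmentForm γ₀ γ₁ s) η x v ≠ 0) :
    ∃ K : ℝ, 0 ≤ K ∧ ∀ κ ≥ K, ∀ s ∈ Icc (0 : ℝ) 1, ∀ x v, LinearIndependent ℝ v →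
      0 < contactVolume k (segmentForm γ₀ γ₁ s + κ • η) x v *
        volumeChange k (segmentForm γ₀ γ₁ s) η x v := by
  have hsm : ∀ {γ : OneForm I M}, γ.IsSmooth → ∀ x, γ.SmoothAt x := fun h => isSmooth_iff.1 h
  have haff : ∀ κ s x v, contactVolume k (segmentForm γ₀ γ₁ s + κ • η) x v =
      contactVolume k (segmentForm γ₀ γ₁ s) x v +
        κ * volumeChange k (segmentForm γ₀ γ₁ s) η x v := by
    intro κ s x v
    obtain ⟨p, q, e, he, hd⟩ := hdec x
    have h := (hsm h₀ x).segmentForm (hsm h₁ x) s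
    rw [contactVolume_add_smul k h (hsm hη x) he hd, volumeChange_eq k h (hsm hη x) he hd]
  have hK : IsCompact (Icc (0 : ℝ) 1 ×ˢ (univ : Set M)) := isCompact_Icc.prod isCompact_univ
  suffices h : ∃ K : ℝ, 0 ≤ K ∧ ∀ κ ≥ K, ∀ q ∈ Icc (0 : ℝ) 1 ×ˢ (univ : Set M), ∀ v,
      LinearIndependent ℝ v → 0 < contactVolume k (segmentForm γ₀ γ₁ q.1 + κ • η) q.2 v *
        volumeChange k (segmentForm γ₀ γ₁ q.1) η q.2 v by
    obtain ⟨K, hK0, h⟩ := h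
    exact ⟨K, hK0, fun κ hκ s hs x v hv => h κ hκ (s, x) ⟨hs, mem_univ _⟩ v hv⟩
  refine hK.induction_on (p := fun S => ∃ K : ℝ, 0 ≤ K ∧ ∀ κ ≥ K, ∀ q ∈ S, ∀ v,
      LinearIndependent ℝ v → 0 < contactVolume k (segmentForm γ₀ γ₁ q.1 + κ • η) q.2 v *
        volumeChange k (segmentForm γ₀ γ₁ q.1) η q.2 v) ⟨0, le_rfl, by simp⟩ ?_ ?_ ?_
  · rintro S T hST ⟨K, hK0, h⟩
    exact ⟨K, hK0, fun κ hκ q hq => h κ hκ q (hST hq)⟩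
  · rintro S T ⟨K, hK0, h⟩ ⟨K', hK0', h'⟩
    refine ⟨max K K', le_max_of_le_left hK0, ?_⟩
    rintro κ hκ q (hq | hq)
    · exact h κ (le_trans (le_max_left _ _) hκ) q hq
    · exact h' κ (le_trans (le_max_right _ _) hκ) q hq
  rintro ⟨s₀, x₀⟩ ⟨hs₀, -⟩
  obtain ⟨e, he⟩ := exists_linearIndependent hdim
  obtain ⟨v, hv, hcont⟩ := exists_frame (I := I) x₀ he
  have ev : ∀ {γ : OneForm I M}, γ.IsSmooth → ∀ᶠ x in 𝓝 x₀, γ.SmoothAt x := fun h =>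
    Filter.Eventually.of_forall (hsm h)
  have ev' : ∀ {γ : OneForm I M}, γ.IsSmooth → ∀ᶠ x in 𝓝 x₀, (γ + η).SmoothAt x := fun h =>
    Filter.Eventually.of_forall fun x => (hsm h x).add (hsm hη x)
  have hca := continuousAt_contactVolume k hcont (ev h₀) (ev h₁) s₀
  have hcb : ContinuousAt (fun q : ℝ × M => volumeChange k (segmentForm γ₀ γ₁ q.1) η q.2 (v q.2))
      (s₀, x₀) := by
    have := (continuousAt_contactVolume k hcont (ev' h₀) (ev' h₁) s₀).sub hca
    refine this.congr (Filter.Eventually.of_forall fun q => ?_)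
    simp only [volumeChange, segmentForm_add, Pi.sub_apply]
  have hb0 := hne s₀ hs₀ x₀ (v x₀) hv.self_of_nhds
  set a : ℝ × M → ℝ := fun q => contactVolume k (segmentForm γ₀ γ₁ q.1) q.2 (v q.2) with ha
  set b : ℝ × M → ℝ := fun q => volumeChange k (segmentForm γ₀ γ₁ q.1) η q.2 (v q.2) with hb
  have hb0' : 0 < |b (s₀, x₀)| := abs_pos.2 hb0
  have h1 : ∀ᶠ q in 𝓝 (s₀, x₀), |b (s₀, x₀)| / 2 < |b q| :=
    hcb.abs.eventually (lt_mem_nhds (half_lt_self hb0'))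
  have h2 : ∀ᶠ q in 𝓝 (s₀, x₀), |a q| < |a (s₀, x₀)| + 1 :=
    hca.abs.eventually (gt_mem_nhds (lt_add_one _))
  have h3 : ∀ᶠ q in 𝓝 (s₀, x₀), LinearIndependent ℝ (v q.2) := by
    rw [nhds_prod_eq]; exact hv.prod_inr _
  refine ⟨_, mem_nhdsWithin_of_mem_nhds (h1.and (h2.and h3)),
    (|a (s₀, x₀)| + 1) / (|b (s₀, x₀)| / 2), by positivity, ?_⟩
  rintro κ hκ q ⟨q1, q2, q3⟩ v' hv'
  have hbq : b q ≠ 0 := abs_pos.1 (lt_trans (by positivity) q1)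
  have hpos : 0 < (a q + κ * b q) * b q := by
    refine mul_pos_of_large hbq (lt_of_lt_of_le q2 ?_)
    rw [ge_iff_le, div_le_iff₀ (by positivity)] at hκ
    have : 0 ≤ κ := by
      by_contra hneg
      nlinarith [abs_nonneg (a (s₀, x₀))]
    nlinarith
  have hA : ∀ u, contactVolume k (segmentForm γ₀ γ₁ q.1 + κ • η) q.2 u = oddForm k
      ((segmentForm γ₀ γ₁ q.1 + κ • η) q.2).toLinearMap
      ((segmentForm γ₀ γ₁ q.1 + κ • η).dB q.2) u := fun u => contactVolume_eq_oddForm _ _ _ _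
  have hB : ∀ u, volumeChange k (segmentForm γ₀ γ₁ q.1) η q.2 u = (oddForm k
      ((segmentForm γ₀ γ₁ q.1 + η) q.2).toLinearMap ((segmentForm γ₀ γ₁ q.1 + η).dB q.2) -
      oddForm k ((segmentForm γ₀ γ₁ q.1) q.2).toLinearMap ((segmentForm γ₀ γ₁ q.1).dB q.2)) u := by
    intro u
    rw [volumeChange, contactVolume_eq_oddForm, contactVolume_eq_oddForm]
    rfl
  have hpos' := hpos
  rw [ha, hb] at hpos'
  simp only [← haff] at hpos'
  rw [hA, hB] at hpos' ⊢
  exact topForm_mul_pos ((finrank_tangentSpace q.2).trans hdim) q3 hv' hpos'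

end Perturbation

/-! ### Forms and local diffeomorphisms -/

section LocalDiffeo

variable [IsManifold I ∞ M] [IsManifold I' ∞ M']

theorem IsLocalDiffeomorphAt.mdifferentiableAt' {f : M' → M} {x : M'}
    (hf : IsLocalDiffeomorphAt I' I ∞ f x) : MDifferentiableAt I' I f x :=
  hf.mdifferentiableAt (by simp)

theorem IsLocalDiffeomorphAt.eventually {f : M' → M} {x : M'}
    (hf : IsLocalDiffeomorphAt I' I ∞ f x) : ∀ᶠ y in 𝓝 x, IsLocalDiffeomorphAt I' I ∞ f y := by
  obtain ⟨Φ, hx, h⟩ := hf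
  filter_upwards [Φ.open_source.mem_nhds hx] with y hy using ⟨Φ, hy, h⟩

/-- Near `f x`, a form is the pull-back of its pull-back under a local inverse of `f`. -/
theorem OneForm.eventually_eq_pullback_localInverse {f : M' → M} {x : M'}
    (hf : IsLocalDiffeomorphAt I' I ∞ f x) (α : OneForm I M) :
    ∀ᶠ y in 𝓝 (f x), α y = pullback (I' := I) hf.localInverse
      (pullback (I' := I') f α) y := by
  have hg := hf.localInverse_contMDiffAt
  have hval : hf.localInverse (f x) = x := hf.localInverse_left_inv hf.localInverse_mem_target
  have h1 : ∀ᶠ y in 𝓝 (f x), IsLocalDiffeomorphAt I' I ∞ f (hf.localInverse y) := by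
    have := IsLocalDiffeomorphAt.eventually hf
    rw [← hval] at this
    exact hg.continuousAt.eventually this
  have h2 : ∀ᶠ y in 𝓝 (f x), MDifferentiableAt I I' hf.localInverse y := by
    filter_upwards [hf.localInverse_open_source.mem_nhds hf.localInverse_mem_source] with y hy
    exact (hf.contmdiffOn_localInverse.contMDiffAt
      (hf.localInverse_open_source.mem_nhds hy)).mdifferentiableAt (by simp)
  have h3 := hf.localInverse_eventuallyEq_right
  filter_upwards [h1, h2, h3.eventuallyEq_nhds] with y h1 h2 h3
  have h4 := OneForm.pullback_congr (I' := I) α h3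
  rw [OneForm.pullback_id] at h4
  rw [← h4]
  exact OneForm.pullback_comp α (IsLocalDiffeomorphAt.mdifferentiableAt' h1) h2

theorem OneForm.SmoothAt.of_pullback {f : M' → M} {x : M'}
    (hf : IsLocalDiffeomorphAt I' I ∞ f x) {α : OneForm I M}
    (h : (OneForm.pullback (I' := I') f α).SmoothAt x) : α.SmoothAt (f x) := by
  have hval : hf.localInverse (f x) = x := hf.localInverse_left_inv hf.localInverse_mem_target
  refine OneForm.SmoothAt.congr ?_ (OneForm.eventually_eq_pullback_localInverse hf α)
  refine OneForm.SmoothAt.pullback ?_ hf.localInverse_contMDiffAt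
  rwa [hval]

theorem linearIndependent_mfderiv {f : M' → M} {x : M'} (hf : IsLocalDiffeomorphAt I' I ∞ f x)
    {ι : Type*} {v : ι → TangentSpace I' x} (hv : LinearIndependent ℝ v) :
    LinearIndependent ℝ fun i => mfderiv I' I f x (v i) := by
  have h := hf.mfderivToContinuousLinearEquiv_coe (by simp)
  have h2 := hv.map' (hf.mfderivToContinuousLinearEquiv (by simp)).toLinearEquiv.toLinearMap
    (LinearMap.ker_eq_bot.2 (hf.mfderivToContinuousLinearEquiv (by simp)).injective)
  have h3 : ∀ w, mfderiv I' I f x w = hf.mfderivToContinuousLinearEquiv (by simp) w := fun w =>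
    (DFunLike.congr_fun h w).symm
  simp only [h3]
  exact h2

theorem exists_mfderiv_eq {f : M' → M} {x : M'} (hf : IsLocalDiffeomorphAt I' I ∞ f x)
    (w : TangentSpace I (f x)) : ∃ u, mfderiv I' I f x u = w := by
  have h := hf.mfderivToContinuousLinearEquiv_coe (by simp)
  refine ⟨(hf.mfderivToContinuousLinearEquiv (by simp)).symm w, ?_⟩
  exact (DFunLike.congr_fun h _).symm.trans
    ((hf.mfderivToContinuousLinearEquiv (by simp)).apply_symm_apply w)

end LocalDiffeo

/-! ### The angular form -/

section Angular

/-- The form `x dy - y dx` on `ℂ`. -/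
def rot (z : ℂ) : ℂ →L[ℝ] ℝ :=
  Complex.imCLM.comp (ContinuousLinearMap.mul ℝ ℂ (starRingEnd ℂ z))

theorem rot_apply (z w : ℂ) : rot z w = z.re * w.im - z.im * w.re := by
  simp [rot, sub_eq_add_neg]

theorem rot_eq_clm : rot = (((ContinuousLinearMap.compL ℝ ℂ ℂ ℝ Complex.imCLM).comp
    (ContinuousLinearMap.mul ℝ ℂ)).comp (Complex.conjCLE : ℂ →L[ℝ] ℂ) : ℂ → ℂ →L[ℝ] ℝ) := rfl

theorem contDiff_rot : ContDiff ℝ ∞ rot := by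
  rw [rot_eq_clm]
  exact ContinuousLinearMap.contDiff _

/-- The form `x dy - y dx` on `ℂ`. -/
def planeForm : OneForm 𝓘(ℝ, ℂ) ℂ := fun z => rot z

theorem isSmooth_planeForm : planeForm.IsSmooth := isSmooth_vecForm contDiff_rot

theorem d_planeForm (z u v : ℂ) : planeForm.d z u v = 2 * (u.re * v.im - u.im * v.re) := by
  have h : fderiv ℝ rot z = (((ContinuousLinearMap.compL ℝ ℂ ℂ ℝ Complex.imCLM).comp
    (ContinuousLinearMap.mul ℝ ℂ)).comp (Complex.conjCLE : ℂ →L[ℝ] ℂ)) := by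
    rw [rot_eq_clm]
    exact ContinuousLinearMap.fderiv _
  have h1 : ∀ u v : ℂ, fderiv ℝ rot z u v = rot u v := fun u v => by rw [h]; rfl
  have h2 := d_vecForm rot z u v
  rw [h1, h1, rot_apply, rot_apply] at h2
  refine h2.trans ?_
  ring

theorem rot_normalize {z : ℂ} (hz : z ≠ 0) (w : ℂ) :
    rot (‖z‖⁻¹ • z) (fderiv ℝ (fun z : ℂ => ‖z‖⁻¹ • z) z w) = (‖z‖ ^ 2)⁻¹ * rot z w := by
  have h1 : DifferentiableAt ℝ (fun z : ℂ => ‖z‖⁻¹) z :=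
    ((contDiffAt_norm ℝ hz (n := 1)).differentiableAt (by simp)).inv (norm_ne_zero_iff.2 hz)
  have h2 : fderiv ℝ (fun z : ℂ => ‖z‖⁻¹ • z) z w =
      ‖z‖⁻¹ • w + (fderiv ℝ (fun z : ℂ => ‖z‖⁻¹) z w) • z := by
    have := h1.hasFDerivAt.smul (hasFDerivAt_id z)
    exact DFunLike.congr_fun this.fderiv w
  rw [h2, map_add]
  simp only [rot_apply, Complex.smul_re, Complex.smul_im, smul_eq_mul]
  field_simp
  ring

end Angular

section RadialProfile

open Set

/-- A smooth concave function that is the identity near `0` and constant from `a` on. -/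
def profile (a u : ℝ) : ℝ := ∫ t in (0 : ℝ)..u, (1 - Real.smoothTransition (2 * t / a - 1))

theorem continuous_profile_integrand (a : ℝ) :
    Continuous fun t : ℝ => 1 - Real.smoothTransition (2 * t / a - 1) :=
  continuous_const.sub (Real.smoothTransition.continuous.comp (by fun_prop))

theorem hasDerivAt_profile (a u : ℝ) :
    HasDerivAt (profile a) (1 - Real.smoothTransition (2 * u / a - 1)) u :=
  intervalIntegral.integral_hasDerivAt_right
    ((continuous_profile_integrand a).intervalIntegrable _ _)
    (continuous_profile_integrand a).aestronglyMeasurable.stronglyMeasurableAtFilter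
    (continuous_profile_integrand a).continuousAt

theorem contDiff_profile (a : ℝ) : ContDiff ℝ ∞ (profile a) := by
  rw [contDiff_infty_iff_deriv]
  refine ⟨fun u => (hasDerivAt_profile a u).differentiableAt, ?_⟩
  rw [funext fun u => (hasDerivAt_profile a u).deriv]
  refine contDiff_const.sub (Real.smoothTransition.contDiff.comp ?_)
  fun_prop

theorem deriv_profile_nonneg (a u : ℝ) : 0 ≤ deriv (profile a) u := by
  rw [(hasDerivAt_profile a u).deriv]
  exact sub_nonneg.2 (Real.smoothTransition.le_one _)

theorem deriv_profile_of_le {a u : ℝ} (ha : 0 < a) (h : a ≤ u) : deriv (profile a) u = 0 := by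
  rw [(hasDerivAt_profile a u).deriv, Real.smoothTransition.one_of_one_le, sub_self]
  rw [le_sub_iff_add_le, le_div_iff₀ ha]
  linarith

theorem profile_of_le {a u : ℝ} (ha : 0 < a) (hu : u ≤ a / 2) : profile a u = u := by
  rw [profile, intervalIntegral.integral_congr (g := fun _ => (1 : ℝ))]
  · simp
  · intro t ht
    have ht' : t ≤ a / 2 := by
      rcases le_total 0 u with h | h
      · rw [uIcc_of_le h] at ht; exact ht.2.trans hu
      · rw [uIcc_of_ge h] at ht; linarith [ht.2]
    simp only
    rw [Real.smoothTransition.zero_of_nonpos, sub_zero]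
    rw [sub_nonpos, div_le_one ha]
    linarith

theorem profile_of_ge {a u u' : ℝ} (ha : 0 < a) (hu : a ≤ u) (hu' : a ≤ u') :
    profile a u = profile a u' := by
  have h := intervalIntegral.integral_add_adjacent_intervals
    ((continuous_profile_integrand a).intervalIntegrable (μ := MeasureTheory.volume) 0 u)
    ((continuous_profile_integrand a).intervalIntegrable u u')
  have h0 : ∫ t in u..u', (1 - Real.smoothTransition (2 * t / a - 1)) = 0 := by
    rw [intervalIntegral.integral_congr (g := fun _ => (0 : ℝ))]
    · simp
    · intro t ht
      have ht' : a ≤ t := le_trans (le_min hu hu') ht.1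
      simp only
      rw [Real.smoothTransition.one_of_one_le, sub_self]
      rw [le_sub_iff_add_le, le_div_iff₀ ha]
      linarith
  rw [h0, add_zero] at h
  exact h

theorem profile_sub_nonneg {a u : ℝ} (ha : 0 < a) (hu : 0 ≤ u) :
    0 ≤ profile a u - u * deriv (profile a) u := by
  rw [(hasDerivAt_profile a u).deriv]
  have h : u * (1 - Real.smoothTransition (2 * u / a - 1)) =
      ∫ _ in (0 : ℝ)..u, (1 - Real.smoothTransition (2 * u / a - 1)) := by simp; ring
  rw [h, profile, sub_nonneg]
  refine intervalIntegral.integral_mono_on hu (by simp)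
    ((continuous_profile_integrand a).intervalIntegrable _ _) fun t ht => ?_
  refine sub_le_sub_left (Real.smoothTransition.monotone ?_) 1
  have := div_le_div_of_nonneg_right (mul_le_mul_of_nonneg_left ht.2 zero_le_two) ha.le
  linarith

theorem profile_pos {a u : ℝ} (ha : 0 < a) (hu : 0 < u) : 0 < profile a u := by
  have hm : Monotone (profile a) := monotone_of_deriv_nonneg
    (fun u => (hasDerivAt_profile a u).differentiableAt) (deriv_profile_nonneg a)
  have h1 : 0 < min u (a / 2) := lt_min hu (half_pos ha)
  have h2 := hm (min_le_left u (a / 2))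
  rw [profile_of_le ha (min_le_right _ _)] at h2
  linarith

end RadialProfile

section OddKernel

/-- A skew form on a space of odd dimension is degenerate. -/
theorem exists_ne_zero_of_skew {V : Type*} [AddCommGroup V] [Module ℝ V] [FiniteDimensional ℝ V]
    {k : ℕ} (hV : Module.finrank ℝ V = 2 * k + 1) {w : BilinForm ℝ V}
    (hw : ∀ u v, w u v = -w v u) : ∃ R ≠ 0, w R = 0 := by
  let b := Module.finBasisOfFinrankEq ℝ V hV
  let A : Matrix (Fin (2 * k + 1)) (Fin (2 * k + 1)) ℝ := Matrix.of fun i j => w (b i) (b j)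
  have hA : A.transpose = -A := by
    ext i j
    exact hw _ _
  have hdet : A.det = 0 := by
    have h := A.det_transpose
    rw [hA, Matrix.det_neg, Fintype.card_fin, pow_succ, pow_mul, neg_one_sq, one_pow, one_mul] at h
    linarith
  obtain ⟨c, hc, hAc⟩ := Matrix.exists_mulVec_eq_zero_iff.2 hdet
  refine ⟨∑ j, c j • b j, fun h => hc ?_, ?_⟩
  · funext j
    exact Fintype.linearIndependent_iff.1 b.linearIndependent c h j
  · refine b.ext fun i => ?_
    have h1 := congrFun hAc i
    simp only [Matrix.mulVec, dotProduct, Pi.zero_apply, A, Matrix.of_apply] at h1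
    rw [hw, map_sum]
    simp only [map_smul, smul_eq_mul, LinearMap.zero_apply, neg_eq_zero]
    rw [← h1]
    exact Finset.sum_congr rfl fun j _ => mul_comm _ _

end OddKernel

section Reeb

variable [FiniteDimensional ℝ E] [IsManifold I ∞ M]

theorem exists_isReebVector {k : ℕ} (hdim : Module.finrank ℝ E = 2 * k + 1) {α : OneForm I M}
    (hα : IsContactForm k α) (x : M) : ∃ R, IsReebVector α x R := by
  obtain ⟨R, hR, hw⟩ := exists_ne_zero_of_skew (V := TangentSpace I x)
    ((finrank_tangentSpace x).trans hdim) (α.dB_neg x)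
  have hd : ∀ v, α.d x R v = 0 := fun v => DFunLike.congr_fun hw v
  have ha : α x R ≠ 0 := by
    intro h
    obtain ⟨v, hv⟩ := exists_oddForm_ne_zero hdim hα x
    exact hR (eq_zero_of_oddForm_ne_zero ((finrank_tangentSpace x).trans hdim) (α.dB_neg x) hv h hw)
  refine ⟨(α x R)⁻¹ • R, fun v => ?_, ?_⟩
  · have h1 : α.dB x ((α x R)⁻¹ • R) v = (α x R)⁻¹ * α.d x R v := by
      rw [map_smul]; rfl
    rw [← OneForm.dB_apply, h1, hd, mul_zero]
  · rw [map_smul, smul_eq_mul, inv_mul_cancel₀ ha]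

theorem contactVolume_mul_pos {k : ℕ} (hdim : Module.finrank ℝ E = 2 * k + 1)
    {α α' : OneForm I M} {x : M} {v v' : Fin (2 * k + 1) → TangentSpace I x}
    (hv : LinearIndependent ℝ v) (hv' : LinearIndependent ℝ v')
    (h : 0 < contactVolume k α x v * contactVolume k α' x v) :
    0 < contactVolume k α x v' * contactVolume k α' x v' := by
  simp only [contactVolume_eq_oddForm] at h ⊢
  exact topForm_mul_pos ((finrank_tangentSpace x).trans hdim) hv hv' h

theorem volumeChange_mul_contactVolume_pos {k : ℕ} (hdim : Module.finrank ℝ E = 2 * k + 1)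
    {γ η α : OneForm I M} {x : M} {v v' : Fin (2 * k + 1) → TangentSpace I x}
    (hv : LinearIndependent ℝ v) (hv' : LinearIndependent ℝ v')
    (h : 0 < volumeChange k γ η x v * contactVolume k α x v) :
    0 < volumeChange k γ η x v' * contactVolume k α x v' := by
  have hB : ∀ u, volumeChange k γ η x u = (oddForm k ((γ + η) x).toLinearMap ((γ + η).dB x) -
      oddForm k (γ x).toLinearMap (γ.dB x)) u := by
    intro u
    rw [volumeChange, contactVolume_eq_oddForm, contactVolume_eq_oddForm]
    rfl
  rw [hB, contactVolume_eq_oddForm] at h ⊢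
  exact topForm_mul_pos ((finrank_tangentSpace x).trans hdim) hv hv' h

theorem oddForm_mul_contactVolume_pos {k : ℕ} (hdim : Module.finrank ℝ E = 2 * k + 1)
    {α : OneForm I M} {x : M} (hα : ∀ v, LinearIndependent ℝ v → contactVolume k α x v ≠ 0)
    {R : TangentSpace I x} (hR : IsReebVector α x R) {q : Module.Dual ℝ (TangentSpace I x)}
    (hq : 0 < q R) {v : Fin (2 * k + 1) → TangentSpace I x} (hv : LinearIndependent ℝ v) :
    0 < oddForm k q (α.dB x) v * contactVolume k α x v := by
  rw [oddForm_eq_mul ((finrank_tangentSpace x).trans hdim) (a := (α x).toLinearMap) q (α.dB_neg x)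
    hR.2 (LinearMap.ext hR.1), ← contactVolume_eq_oddForm, mul_assoc]
  exact mul_pos hq (mul_self_pos.2 (hα v hv))

theorem IsContactForm.pullback {k : ℕ} {α : OneForm I M} (hα : IsContactForm k α)
    (F : M ≃ₘ⟮I, I⟯ M) : IsContactForm k (OneForm.pullback (I' := I) F α) := by
  refine ⟨hα.smooth.pullback F.contMDiff, fun x v hv => ?_⟩
  rw [contactVolume_pullback k (isSmooth_iff.1 hα.smooth _) (F.contMDiff x)]
  exact hα.volume_ne_zero _ _ (linearIndependent_mfderiv (F.isLocalDiffeomorph x) hv)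

end Reeb

section FamilyContinuity

open Set

variable [IsManifold I ∞ M] [I.Boundaryless]

theorem IsSmoothFamily.continuous_apply {A : ℝ → OneForm I M} (hA : IsSmoothFamily A) (x : M)
    (v : TangentSpace I x) : Continuous fun s => A s x v := by
  have h1 : Continuous fun s => (A s).inChart x (extChartAt I x x) v := by
    have h := (hA x).continuousOn
    have h2 : Continuous fun s : ℝ => (A s).inChart x (extChartAt I x x) :=
      h.comp_continuous (f := fun s : ℝ => ((s, extChartAt I x x) : ℝ × E))
        (by fun_prop) fun s => ⟨mem_univ _, mem_extChartAt_target x⟩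
    exact h2.clm_apply continuous_const
  refine h1.congr fun s => ?_
  have h3 : mfderivWithin 𝓘(ℝ, E) I (extChartAt I x).symm (range I) (extChartAt I x x) v = v := by
    have := mfderiv_extChartAt_comp_mfderivWithin_extChartAt_symm' (I := I)
      (mem_extChartAt_source (I := I) x)
    have h4 := DFunLike.congr_fun this v
    rw [mfderiv_extChartAt_self] at h4
    exact h4
  have key : ∀ p : M, p = x → ∀ w : E, w = v → (A s p) w = A s x v := by rintro p rfl w rfl; rfl
  exact key _ (extChartAt_to_inv x) _ h3

theorem IsSmoothFamily.continuous_d {A : ℝ → OneForm I M} (hA : IsSmoothFamily A) (x : M)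
    (u v : TangentSpace I x) : Continuous fun s => (A s).d x u v := by
  set y := extChartAt I x x with hy
  have hopen : IsOpen ((univ : Set ℝ) ×ˢ (extChartAt I x).target) :=
    isOpen_univ.prod (isOpen_extChartAt_target x)
  have hF := (hA x).fderiv_of_isOpen hopen (m := ∞) (by simp)
  have hmem : ∀ s : ℝ, (s, y) ∈ (univ : Set ℝ) ×ˢ (extChartAt I x).target := fun s =>
    ⟨mem_univ _, mem_extChartAt_target x⟩
  have hc : Continuous fun s : ℝ => fderiv ℝ (fun p : ℝ × E => (A p.1).inChart x p.2) (s, y) :=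
    hF.continuousOn.comp_continuous (by fun_prop) hmem
  have key : ∀ s (a b : E), fderivWithin ℝ ((A s).inChart x) (range I) y a b =
      fderiv ℝ (fun p : ℝ × E => (A p.1).inChart x p.2) (s, y) (0, a) b := by
    intro s a b
    have h1 : HasFDerivAt (fun p : ℝ × E => (A p.1).inChart x p.2)
        (fderiv ℝ (fun p : ℝ × E => (A p.1).inChart x p.2) (s, y)) (s, y) :=
      (((hA x).contDiffAt (hopen.mem_nhds (hmem s))).differentiableAt (by simp)).hasFDerivAt
    have h2 : HasFDerivAt (fun z : E => ((s, z) : ℝ × E)) (ContinuousLinearMap.inr ℝ ℝ E) y :=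
      (hasFDerivAt_const _ _).prodMk (hasFDerivAt_id _)
    have h3 : HasFDerivAt ((A s).inChart x) _ y := h1.comp y h2
    rw [h3.hasFDerivWithinAt.fderivWithin (I.uniqueDiffOn _ (mem_range_self _))]
    rfl
  have h : ∀ s, (A s).d x u v =
      fderiv ℝ (fun p : ℝ × E => (A p.1).inChart x p.2) (s, y) (0, u) v -
      fderiv ℝ (fun p : ℝ × E => (A p.1).inChart x p.2) (s, y) (0, v) u := by
    intro s
    rw [OneForm.d_eq_flatD]
    exact congrArg₂ (· - ·) (key s u v) (key s v u)
  refine Continuous.congr ?_ fun s => (h s).symm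
  exact ((hc.clm_apply continuous_const).clm_apply continuous_const).sub
    ((hc.clm_apply continuous_const).clm_apply continuous_const)

theorem IsSmoothFamily.continuous_contactVolume {A : ℝ → OneForm I M} (hA : IsSmoothFamily A)
    (k : ℕ) (x : M) (v : Fin (2 * k + 1) → TangentSpace I x) :
    Continuous fun s => contactVolume k (A s) x v :=
  continuous_iff_continuousAt.2 fun _ => continuousAt_wedgeWedgePow k
    (fun i => (hA.continuous_apply x (v i)).continuousAt)
    fun i j => (hA.continuous_d x (v i) (v j)).continuousAt

/-- A continuous function on `ℝ` without zeros has constant sign. -/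
theorem mul_pos_of_continuous {f : ℝ → ℝ} (hf : Continuous f) (h : ∀ t, f t ≠ 0) (s t : ℝ) :
    0 < f s * f t := by
  by_contra hlt
  have h0 : (0 : ℝ) ∈ f '' univ := by
    have hc : IsPreconnected (f '' univ) := isPreconnected_univ.image f hf.continuousOn
    rcases mul_neg_iff.1 (lt_of_le_of_ne (not_lt.1 hlt) (mul_ne_zero (h s) (h t))) with h1 | h1
    · exact hc.ordConnected.out ⟨t, mem_univ _, rfl⟩ ⟨s, mem_univ _, rfl⟩ ⟨h1.2.le, h1.1.le⟩
    · exact hc.ordConnected.out ⟨s, mem_univ _, rfl⟩ ⟨t, mem_univ _, rfl⟩ ⟨h1.1.le, h1.2.le⟩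
  obtain ⟨t, -, ht⟩ := h0
  exact h t ht

end FamilyContinuity

section Families

open Set

theorem IsSmoothFamily.add {A A' : ℝ → OneForm I M} (hA : IsSmoothFamily A)
    (hA' : IsSmoothFamily A') : IsSmoothFamily fun s => A s + A' s := by
  intro x₀
  refine ((hA x₀).add (hA' x₀)).congr fun p _ => ?_
  rw [OneForm.inChart_add]
  rfl

theorem IsSmoothFamily.smul {A : ℝ → OneForm I M} (hA : IsSmoothFamily A) {c : ℝ → ℝ}
    (hc : ContDiff ℝ ∞ c) : IsSmoothFamily fun s => c s • A s := by
  intro x₀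
  have h : ContDiffOn ℝ ∞ (fun p : ℝ × E => c p.1) (univ ×ˢ (extChartAt I x₀).target) :=
    (hc.comp contDiff_fst).contDiffOn
  refine (h.smul (hA x₀)).congr fun p _ => ?_
  exact congrFun (OneForm.inChart_fsmul (fun _ => c p.1) (A p.1) x₀) p.2

theorem IsSmoothFamily.comp {A : ℝ → OneForm I M} (hA : IsSmoothFamily A) {c : ℝ → ℝ}
    (hc : ContDiff ℝ ∞ c) : IsSmoothFamily fun s => A (c s) := by
  intro x₀
  have h : ContDiff ℝ ∞ (fun p : ℝ × E => (c p.1, p.2)) := (hc.comp contDiff_fst).prodMk contDiff_snd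
  exact (hA x₀).comp h.contDiffOn fun p hp => ⟨mem_univ _, hp.2⟩

theorem OneForm.IsSmooth.isSmoothFamily_const {α : OneForm I M} (hα : α.IsSmooth) :
    IsSmoothFamily fun _ => α := fun x₀ =>
  (hα x₀).comp contDiff_snd.contDiffOn fun _ hp => hp.2

end Families

theorem pos_of_mul_pos_mul_pos {a b c : ℝ} (h1 : 0 < a * b) (h2 : 0 < b * c) : 0 < a * c := by
  have h3 : b ≠ 0 := fun h => by simp [h] at h1
  have h4 : 0 < b * b := mul_self_pos.2 h3
  have h5 := mul_pos h1 h2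
  have h6 : a * b * (b * c) = (a * c) * (b * b) := by ring
  rw [h6] at h5
  exact pos_of_mul_pos_left h5 h4.le

variable {n : ℕ}

local notation "JP" => 𝓡∂ (2 * n + 2)
local notation "JB" => 𝓡 (2 * n + 1)
local notation "JM" => 𝓡 (2 * n + 3)
local notation "JT" => ModelWithCorners.prod (𝓡 (2 * n + 1)) 𝓘(ℝ, ℂ)
local notation "JR" => ModelWithCorners.prod (𝓡∂ (2 * n + 2)) 𝓘(ℝ, ℝ)
local notation "JH" => ModelWithCorners.prod (𝓡 (2 * n + 1)) (𝓡∂ 1)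
local notation "EB" => EuclideanSpace ℝ (Fin (2 * n + 1))
local notation "EP" => EuclideanSpace ℝ (Fin (2 * n + 2))
local notation "EM" => EuclideanSpace ℝ (Fin (2 * n + 3))
local notation "E1" => EuclideanSpace ℝ (Fin 1)
local notation "H1" => EuclideanHalfSpace 1
local notation "HP" => EuclideanHalfSpace (2 * n + 2)

/-! ### The angular form of an open book -/

section OpenBooks

open Set

variable {B : Type*} [TopologicalSpace B] [ChartedSpace (EuclideanSpace ℝ (Fin (2 * n + 1))) B] [IsManifold (𝓡 (2 * n + 1)) ∞ B]
  {M : Type*} [TopologicalSpace M] [ChartedSpace (EuclideanSpace ℝ (Fin (2 * n + 3))) M] [IsManifold (𝓡 (2 * n + 3)) ∞ M]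
  (ob : OpenBook n B M)

/-- The form `x dy - y dx` on `B × ℂ`. -/
def planeFormProd : OneForm JT (B × ℂ) :=
  pullback (I' := JT) (Prod.snd : B × ℂ → ℂ) planeForm

theorem isSmooth_planeFormProd : (planeFormProd : OneForm JT (B × ℂ)).IsSmooth :=
  isSmooth_planeForm.pullback contMDiff_snd

theorem mfderiv_snd_prod (p : B × ℂ) (v : EB × ℂ) :
    (mfderiv JT 𝓘(ℝ, ℂ) (Prod.snd : B × ℂ → ℂ) p v : ℂ) = v.2 := by
  have h : mfderiv JT 𝓘(ℝ, ℂ) (Prod.snd : B × ℂ → ℂ) p = _ := mfderiv_snd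
  exact DFunLike.congr_fun h v

theorem planeFormProd_apply (p : B × ℂ) (v : EB × ℂ) :
    (planeFormProd : OneForm JT (B × ℂ)) p v = rot p.2 v.2 :=
  congrArg (rot p.2) (mfderiv_snd_prod p v)

theorem d_planeFormProd (p : B × ℂ) (u v : EB × ℂ) :
    (planeFormProd : OneForm JT (B × ℂ)).d p u v =
      2 * (u.2.re * v.2.im - u.2.im * v.2.re) := by
  have h := OneForm.d_pullback (I' := JT) (f := (Prod.snd : B × ℂ → ℂ)) (x := p)
    (isSmooth_iff.1 isSmooth_planeForm _) contMDiff_snd.contMDiffAt u v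
  refine h.trans ((congrArg₂ (planeForm.d p.2) (mfderiv_snd_prod p u)
    (mfderiv_snd_prod p v)).trans ?_)
  exact d_planeForm p.2 u.2 v.2

namespace OpenBook

/-- The angular form, as a differential form; it is meaningful off the binding. -/
def angleForm : OneForm JM M :=
  pullback (I' := JM) (fun y => (ob.proj y : ℂ)) planeForm

theorem isLocalDiffeomorphAt_tube (b : B) {z : ℂ} (hz : ‖z‖ < ob.δ) :
    IsLocalDiffeomorphAt JT JM ∞ ob.tube (b, z) :=
  ob.tube.isLocalDiffeomorphAt _ _ _ (by rw [ob.tube_source]; exact ⟨mem_univ _, by simpa using hz⟩)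

theorem mem_tube_source (b : B) {z : ℂ} (hz : ‖z‖ < ob.δ) : (b, z) ∈ ob.tube.source := by
  rw [ob.tube_source]; exact ⟨mem_univ _, by simpa using hz⟩

theorem exists_tube_eq {x : M} (hx : x ∈ ob.tube.target) :
    ∃ (b : B) (z : ℂ), ‖z‖ < ob.δ ∧ x = ob.tube (b, z) := by
  have h := ob.tube.map_target' hx
  rw [ob.tube_source] at h
  exact ⟨(ob.tube.invFun x).1, (ob.tube.invFun x).2, by simpa using h.2,
    (ob.tube.right_inv' hx).symm⟩

theorem tube_mem_core_iff (b : B) {z : ℂ} (hz : ‖z‖ < ob.δ) :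
    ob.tube (b, z) ∈ range ob.incl ↔ z = 0 := by
  constructor
  · rintro ⟨b', h⟩
    have h1 := ob.tube.left_inv' (ob.mem_tube_source b hz)
    have h2 := ob.tube.left_inv' (ob.mem_tube_source b' (z := 0) (by simpa using ob.δ_pos))
    have h3 : ob.tube.toFun (b', 0) = ob.tube.toFun (b, z) := h
    rw [h3, h1] at h2
    exact congrArg Prod.snd h2
  · rintro rfl
    exact ⟨b, rfl⟩

theorem contMDiff_incl : ContMDiff JB JM ∞ ob.incl := fun b =>
  ContMDiffAt.comp b ((ob.isLocalDiffeomorphAt_tube b (z := 0) (by simpa using ob.δ_pos)).contMDiffAt)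
    (contMDiffAt_id.prodMk contMDiffAt_const)

theorem core_subset_target : range ob.incl ⊆ ob.tube.target := by
  rintro _ ⟨b, rfl⟩
  exact ob.tube.map_source' (ob.mem_tube_source b (z := 0) (by simpa using ob.δ_pos))

theorem isClosed_core [CompactSpace B] [T2Space M] : IsClosed (range ob.incl) :=
  (isCompact_range ob.contMDiff_incl.continuous).isClosed

variable [CompactSpace B] [T2Space M]

theorem contMDiffAt_proj {x : M} (hx : x ∉ range ob.incl) :
    ContMDiffAt JM 𝓘(ℝ, ℂ) ∞ (fun y => (ob.proj y : ℂ)) x :=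
  ob.proj_smooth.contMDiffAt (ob.isClosed_core.isOpen_compl.mem_nhds hx)

theorem smoothAt_angleForm {x : M} (hx : x ∉ range ob.incl) : ob.angleForm.SmoothAt x :=
  (isSmooth_iff.1 isSmooth_planeForm _).pullback (ob.contMDiffAt_proj hx)

theorem d_angleForm {x : M} (hx : x ∉ range ob.incl) (u v : TangentSpace JM x) :
    ob.angleForm.d x u v = 0 := by
  have h := OneForm.d_pullback (I' := JM) (f := fun y => (ob.proj y : ℂ)) (x := x)
    (isSmooth_iff.1 isSmooth_planeForm _) (ob.contMDiffAt_proj hx) u v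
  refine h.trans ((d_planeForm _ _ _).trans ?_)
  have hN : ∀ w : TangentSpace JM x, ∀ D : ℂ, D = mfderiv JM 𝓘(ℝ, ℂ) (fun y => (ob.proj y : ℂ)) x w →
      (ob.proj x : ℂ).re * D.re + (ob.proj x : ℂ).im * D.im = 0 := by
    rintro w _ rfl
    have hd : HasFDerivAt (fun z : ℂ => z.re * z.re + z.im * z.im)
        (((ob.proj x : ℂ).re • Complex.reCLM + (ob.proj x : ℂ).re • Complex.reCLM) +
          ((ob.proj x : ℂ).im • Complex.imCLM + (ob.proj x : ℂ).im • Complex.imCLM))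
        (ob.proj x : ℂ) :=
      (Complex.reCLM.hasFDerivAt.mul Complex.reCLM.hasFDerivAt).add
        (Complex.imCLM.hasFDerivAt.mul Complex.imCLM.hasFDerivAt)
    have hc := HasMFDerivAt.comp x hd.hasMFDerivAt
      ((ob.contMDiffAt_proj hx).mdifferentiableAt (by simp)).hasMFDerivAt
    have hconst : ((fun z : ℂ => z.re * z.re + z.im * z.im) ∘ fun y => (ob.proj y : ℂ)) =
        fun _ => (1 : ℝ) := by
      funext y
      have := Circle.normSq_coe (ob.proj y)
      rwa [Complex.normSq_apply] at this
    rw [hconst] at hc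
    have h0 := DFunLike.congr_fun (hasMFDerivAt_unique hc (hasMFDerivAt_const _ _)) w
    have h1 : ∀ D : ℂ, ((((ob.proj x : ℂ).re • Complex.reCLM + (ob.proj x : ℂ).re • Complex.reCLM) +
          ((ob.proj x : ℂ).im • Complex.imCLM + (ob.proj x : ℂ).im • Complex.imCLM)) :
          ℂ →L[ℝ] ℝ) D = 0 → (ob.proj x : ℂ).re * D.re + (ob.proj x : ℂ).im * D.im = 0 := by
      intro D hD
      simp only [add_apply, smul_apply, Complex.reCLM_apply,
        Complex.imCLM_apply, smul_eq_mul] at hD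
      linarith
    exact h1 _ h0
  have h1 := hN u _ rfl
  have h2 := hN v _ rfl
  have h3 := Circle.normSq_coe (ob.proj x)
  rw [Complex.normSq_apply] at h3
  generalize (mfderiv JM 𝓘(ℝ, ℂ) (fun y => (ob.proj y : ℂ)) x u : ℂ) = U at h1 ⊢
  generalize (mfderiv JM 𝓘(ℝ, ℂ) (fun y => (ob.proj y : ℂ)) x v : ℂ) = W at h2 ⊢
  have key : ∀ a b c d e f : ℝ, a * a + b * b = 1 → a * c + b * d = 0 → a * e + b * f = 0 →
      2 * (c * f - d * e) = 0 := by
    intro a b c d e f h3 h1 h2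
    have e1 : a * (c * f - d * e) = 0 := by linear_combination f * h1 - d * h2
    have e2 : b * (c * f - d * e) = 0 := by linear_combination c * h2 - e * h1
    linear_combination 2 * a * e1 + 2 * b * e2 - 2 * (c * f - d * e) * h3
  exact key _ _ _ _ _ _ h3 h1 h2

theorem pullback_tube_angleForm (b : B) {z : ℂ} (hz0 : z ≠ 0) (hz : ‖z‖ < ob.δ) :
    pullback (I' := JT) ob.tube ob.angleForm (b, z) =
      (‖z‖ ^ 2)⁻¹ • (planeFormProd : OneForm JT (B × ℂ)) (b, z) := by
  have hx : ob.tube (b, z) ∉ range ob.incl := by rwa [ob.tube_mem_core_iff b hz]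
  have h1 := OneForm.pullback_comp (I'' := JT) planeForm (f := fun y => (ob.proj y : ℂ))
    (g := ob.tube) (x := ((b, z) : B × ℂ)) ((ob.contMDiffAt_proj hx).mdifferentiableAt (by simp))
    (IsLocalDiffeomorphAt.mdifferentiableAt' (ob.isLocalDiffeomorphAt_tube b hz))
  have h2 : ((fun y => (ob.proj y : ℂ)) ∘ ob.tube) =ᶠ[𝓝 ((b, z) : B × ℂ)]
      ((fun z : ℂ => ‖z‖⁻¹ • z) ∘ Prod.snd) := by
    have e1 : ∀ᶠ p in 𝓝 ((b, z) : B × ℂ), p.2 ≠ 0 :=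
      continuous_snd.continuousAt.eventually_ne hz0
    have e2 : ∀ᶠ p in 𝓝 ((b, z) : B × ℂ), ‖p.2‖ < ob.δ :=
      continuous_snd.norm.continuousAt.eventually (gt_mem_nhds hz)
    filter_upwards [e1, e2] with p hp1 hp2
    refine (ob.proj_tube p.1 p.2 hp1 hp2).trans ?_
    simp only [Function.comp_apply, Complex.real_smul]
    push_cast
    field_simp
  have hd : DifferentiableAt ℝ (fun z : ℂ => ‖z‖⁻¹ • z) z :=
    (((contDiffAt_norm ℝ hz0 (n := 1)).differentiableAt (by simp)).inv
      (norm_ne_zero_iff.2 hz0)).smul differentiableAt_id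
  have h3 := OneForm.pullback_comp (I'' := JT) planeForm (f := fun z : ℂ => ‖z‖⁻¹ • z)
    (g := (Prod.snd : B × ℂ → ℂ)) (x := ((b, z) : B × ℂ)) hd.mdifferentiableAt
    mdifferentiableAt_snd
  rw [OneForm.pullback_congr _ h2, h3] at h1
  refine h1.symm.trans ?_
  refine ContinuousLinearMap.ext fun v => ?_
  have h4 : ∀ w : ℂ, pullback (I' := 𝓘(ℝ, ℂ)) (fun z : ℂ => ‖z‖⁻¹ • z) planeForm z w =
      (‖z‖ ^ 2)⁻¹ * rot z w := fun w => by
    refine Eq.trans ?_ (rot_normalize hz0 w)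
    show rot _ (mfderiv 𝓘(ℝ, ℂ) 𝓘(ℝ, ℂ) (fun z : ℂ => ‖z‖⁻¹ • z) z w) = _
    rw [mfderiv_eq_fderiv]
    rfl
  exact h4 _

open Classical in
/-- The square of the distance to the binding in the tubular neighbourhood, and a constant outside
of it. -/
def rsq (x : M) : ℝ := if x ∈ ob.tube.target then ‖(ob.tube.invFun x).2‖ ^ 2 else ob.δ ^ 2

theorem rsq_tube (b : B) {z : ℂ} (hz : ‖z‖ < ob.δ) : ob.rsq (ob.tube (b, z)) = ‖z‖ ^ 2 := by
  have h1 := ob.tube.left_inv' (ob.mem_tube_source b hz)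
  rw [rsq, if_pos (ob.tube.map_source' (ob.mem_tube_source b hz))]
  exact congrArg (fun p : B × ℂ => ‖p.2‖ ^ 2) h1

theorem rsq_of_notMem {x : M} (hx : x ∉ ob.tube.target) : ob.rsq x = ob.δ ^ 2 := if_neg hx

theorem rsq_nonneg (x : M) : 0 ≤ ob.rsq x := by
  unfold rsq; split_ifs <;> positivity

theorem contMDiffAt_rsq {x : M} (hx : x ∈ ob.tube.target) :
    ContMDiffAt JM 𝓘(ℝ, ℝ) ∞ ob.rsq x := by
  have h1 : ContMDiffAt JM JT ∞ ob.tube.invFun x :=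
    ob.tube.contMDiffOn_invFun.contMDiffAt (ob.tube.open_target.mem_nhds hx)
  have h2 : ContMDiffAt JM 𝓘(ℝ, ℝ) ∞ (fun y => ‖(ob.tube.invFun y).2‖ ^ 2) x :=
    (contDiff_norm_sq ℝ).contMDiff.contMDiffAt.comp x (contMDiffAt_snd.comp x h1)
  refine h2.congr_of_eventuallyEq ?_
  filter_upwards [ob.tube.open_target.mem_nhds hx] with y hy using if_pos hy

theorem rsq_eq_zero_iff (x : M) : ob.rsq x = 0 ↔ x ∈ range ob.incl := by
  by_cases hx : x ∈ ob.tube.target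
  · obtain ⟨b, z, hz, rfl⟩ := ob.exists_tube_eq hx
    rw [ob.rsq_tube b hz, ob.tube_mem_core_iff b hz]
    simp
  · rw [ob.rsq_of_notMem hx]
    have := ob.δ_pos
    exact iff_of_false (by positivity) fun h => hx (ob.core_subset_target h)

theorem eventually_comp_rsq_eq {g : ℝ → ℝ} {r : ℝ} (hr : 0 < r) (hr' : r < ob.δ)
    (hc : ∀ u, r ^ 2 ≤ u → g u = g (ob.δ ^ 2)) {x : M} (hx : x ∉ ob.tube.target) :
    ∀ᶠ y in 𝓝 x, g (ob.rsq y) = g (ob.δ ^ 2) := by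
  have hK : IsCompact (ob.tube.toFun '' (univ ×ˢ Metric.closedBall 0 r)) := by
    refine (isCompact_univ.prod (isCompact_closedBall _ _)).image_of_continuousOn ?_
    refine ob.tube.contMDiffOn_toFun.continuousOn.mono ?_
    rintro ⟨b, z⟩ ⟨-, hz⟩
    exact ob.mem_tube_source b (lt_of_le_of_lt (by simpa using hz) hr')
  have hx' : x ∈ (ob.tube.toFun '' (univ ×ˢ Metric.closedBall 0 r))ᶜ := by
    rintro ⟨⟨b, z⟩, ⟨-, hz⟩, rfl⟩
    exact hx (ob.tube.map_source' (ob.mem_tube_source b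
      (lt_of_le_of_lt (by simpa using hz) hr')))
  filter_upwards [hK.isClosed.isOpen_compl.mem_nhds hx'] with y hy
  by_cases hyt : y ∈ ob.tube.target
  · obtain ⟨b, z, hz, rfl⟩ := ob.exists_tube_eq hyt
    rw [ob.rsq_tube b hz]
    refine hc _ (pow_le_pow_left₀ hr.le ?_ 2)
    by_contra hlt
    exact hy ⟨(b, z), ⟨mem_univ _, by simpa using (not_le.1 hlt).le⟩, rfl⟩
  · rw [ob.rsq_of_notMem hyt]

/-- A function of the distance to the binding that is constant near the boundary of the tubular
neighbourhood is smooth. -/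
theorem contMDiff_comp_rsq {g : ℝ → ℝ} (hg : ContDiff ℝ ∞ g) {r : ℝ} (hr : 0 < r) (hr' : r < ob.δ)
    (hc : ∀ u, r ^ 2 ≤ u → g u = g (ob.δ ^ 2)) :
    ContMDiff JM 𝓘(ℝ, ℝ) ∞ (fun x => g (ob.rsq x)) := by
  intro x
  by_cases hx : x ∈ ob.tube.target
  · exact hg.contMDiff.contMDiffAt.comp x (ob.contMDiffAt_rsq hx)
  exact (contMDiffAt_const (c := g (ob.δ ^ 2))).congr_of_eventuallyEq
    (ob.eventually_comp_rsq_eq hr hr' hc hx)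

/-- The form that corresponds to `x dy - y dx` in the tubular neighbourhood. -/
def coreForm : OneForm JM M := OneForm.fsmul ob.rsq ob.angleForm

theorem pullback_tube_coreForm (b : B) {z : ℂ} (hz : ‖z‖ < ob.δ) :
    pullback (I' := JT) ob.tube ob.coreForm (b, z) =
      (planeFormProd : OneForm JT (B × ℂ)) (b, z) := by
  have h1 : pullback (I' := JT) ob.tube ob.coreForm (b, z) =
      (‖z‖ ^ 2) • pullback (I' := JT) ob.tube ob.angleForm (b, z) := by
    rw [← ob.rsq_tube b hz]; rfl
  rw [h1]
  by_cases hz0 : z = 0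
  · subst hz0
    refine ContinuousLinearMap.ext fun v => ?_
    have h2 : (planeFormProd : OneForm JT (B × ℂ)) (b, 0) v = 0 := by
      refine (planeFormProd_apply _ v).trans ?_
      rw [rot_apply]; simp
    rw [h2]
    simp
  · rw [ob.pullback_tube_angleForm b hz0 hz, smul_smul, mul_inv_cancel₀, one_smul]
    have := norm_pos_iff.2 hz0
    positivity

theorem smoothAt_coreForm {x : M} (hx : x ∈ ob.tube.target) : ob.coreForm.SmoothAt x := by
  obtain ⟨b, z, hz, rfl⟩ := ob.exists_tube_eq hx
  refine OneForm.SmoothAt.of_pullback (ob.isLocalDiffeomorphAt_tube b hz) ?_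
  refine OneForm.SmoothAt.congr (isSmooth_iff.1 isSmooth_planeFormProd (b, z)) ?_
  have e2 : ∀ᶠ p in 𝓝 ((b, z) : B × ℂ), ‖p.2‖ < ob.δ :=
    continuous_snd.norm.continuousAt.eventually (gt_mem_nhds hz)
  filter_upwards [e2] with p hp using ob.pullback_tube_coreForm p.1 hp

end OpenBook

/-! ### The form that is added to make a family of forms contact -/

theorem mixedForm_smul {V : Type*} [AddCommGroup V] [Module ℝ V] [FiniteDimensional ℝ V] (k : ℕ)
    (a p q : Module.Dual ℝ V) (w : BilinForm ℝ V) (c : ℝ) (v : Fin (2 * k + 1) → V) :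
    mixedForm k a (c • p) q w v = c * mixedForm k a p q w v := by
  rw [mixedForm_eq, mixedForm_eq, LinearMap.map_smul, smul_mul_assoc, smul_mul_assoc, mul_smul_comm,
    LinearMap.map_smul, smul_eq_mul]
  ring

theorem volumeChange_congr {k : ℕ} {γ η η' : OneForm JM M} {x : M}
    (h : ∀ᶠ y in 𝓝 x, η y = η' y) (v) : volumeChange k γ η x v = volumeChange k γ η' x v := by
  have h1 : ∀ᶠ y in 𝓝 x, (γ + η) y = (γ + η') y := h.mono fun y hy => congrArg (γ y + ·) hy
  simp only [volumeChange, contactVolume, OneForm.d_congr h1, h1.self_of_nhds]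

theorem differential_comp {g : ℝ → ℝ} {u : M → ℝ} {x : M} (hg : DifferentiableAt ℝ g (u x))
    (hu : MDifferentiableAt JM 𝓘(ℝ, ℝ) u x) :
    differential (I := JM) (fun x => g (u x)) x = deriv g (u x) • differential (I := JM) u x := by
  have e2 := HasMFDerivAt.comp x hg.hasDerivAt.hasFDerivAt.hasMFDerivAt hu.hasMFDerivAt
  refine e2.mfderiv.trans (ContinuousLinearMap.ext fun w => ?_)
  have e3 : ∀ c d : ℝ, ContinuousLinearMap.toSpanSingleton ℝ d c = d * c := fun c d => by
    simp [mul_comm]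
  exact e3 _ _

/-- The sign of the volume change by `ρ dθ` where `ρ = g ∘ r²` is increasing and concave. -/
theorem profile_sign {g u g' T W : ℝ} (hg : 0 < g) (hg' : 0 ≤ g') (hgu : 0 ≤ g - u * g')
    (hT : T ≠ 0) (h : g' = 0 ∨ 0 < (u * T + W) * T) : 0 < (g * T + g' * W) * T := by
  have hTT : 0 < T * T := mul_self_pos.2 hT
  rcases hg'.eq_or_lt with h8 | h8
  · rw [← h8, zero_mul, add_zero, mul_assoc]
    exact mul_pos hg hTT
  · have h9 := mul_pos h8 (h.resolve_left h8.ne')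
    have h10 := mul_nonneg hgu hTT.le
    refine lt_of_lt_of_le h9 ?_
    rw [← sub_nonneg]
    refine le_of_le_of_eq h10 ?_
    ring

namespace OpenBook

theorem mfderiv_incl (b : B) (v : EB) :
    (mfderiv JB JM ob.incl b v : EM) = ob.dTube b (v, 0) := by
  have h := ob.isLocalDiffeomorphAt_tube b (z := 0) (by simpa using ob.δ_pos)
  have h1 : HasMFDerivAt JB JT (fun b : B => ((b, 0) : B × ℂ)) b
      (ContinuousLinearMap.prod (ContinuousLinearMap.id ℝ EB) 0) :=
    HasMFDerivAt.prodMk (hasMFDerivAt_id b) (hasMFDerivAt_const _ _)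
  have h2 := HasMFDerivAt.comp b (IsLocalDiffeomorphAt.mdifferentiableAt' h).hasMFDerivAt h1
  exact DFunLike.congr_fun h2.mfderiv v

theorem exists_dTube_eq (b : B) (w : TangentSpace JM (ob.incl b)) : ∃ v, ob.dTube b v = w :=
  exists_mfderiv_eq (ob.isLocalDiffeomorphAt_tube b (z := 0) (by simpa using ob.δ_pos)) w

theorem linearIndependent_dTube (b : B) {ι : Type*}
    {v : ι → EB × ℂ} (hv : LinearIndependent ℝ v) :
    LinearIndependent ℝ fun i => ob.dTube b (v i) :=
  linearIndependent_mfderiv (ob.isLocalDiffeomorphAt_tube b (z := 0) (by simpa using ob.δ_pos)) hv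

variable [CompactSpace B] [T2Space M]

theorem coreForm_incl (b : B) : ob.coreForm (ob.incl b) = 0 := by
  show ob.rsq (ob.incl b) • ob.angleForm (ob.incl b) = 0
  rw [(ob.rsq_eq_zero_iff _).2 (mem_range_self b), zero_smul]

theorem d_coreForm_incl (b : B) (u v : EB × ℂ) :
    ob.coreForm.d (ob.incl b) (ob.dTube b u) (ob.dTube b v) =
      2 * (u.2.re * v.2.im - u.2.im * v.2.re) := by
  have h0 : ‖(0 : ℂ)‖ < ob.δ := by simpa using ob.δ_pos
  have h := OneForm.d_pullback (I' := JT) (f := ob.tube) (x := ((b, 0) : B × ℂ))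
    (ob.smoothAt_coreForm (ob.core_subset_target (mem_range_self b)))
    (ob.isLocalDiffeomorphAt_tube b h0).contMDiffAt u v
  have e2 : ∀ᶠ p in 𝓝 ((b, 0) : B × ℂ), ‖p.2‖ < ob.δ :=
    continuous_snd.norm.continuousAt.eventually (gt_mem_nhds h0)
  have e3 : ∀ᶠ p in 𝓝 ((b, 0) : B × ℂ), pullback (I' := JT) ob.tube ob.coreForm p =
      (planeFormProd : OneForm JT (B × ℂ)) p := by
    filter_upwards [e2] with p hp using ob.pullback_tube_coreForm p.1 hp
  rw [OneForm.d_congr e3] at h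
  exact h.symm.trans (d_planeFormProd _ u v)

theorem exists_decomposition_coreForm (b : B) :
    ∃ p q : Module.Dual ℝ (TangentSpace JM (ob.incl b)),
      ob.coreForm.dB (ob.incl b) = wedgeTwo p q ∧
      ∀ v, p (ob.dTube b v) = 2 * v.2.re ∧ q (ob.dTube b v) = v.2.im := by
  have hl := ob.isLocalDiffeomorphAt_tube b (z := 0) (by simpa using ob.δ_pos)
  let D := hl.mfderivToContinuousLinearEquiv (by simp)
  have hD : ∀ v, D.symm (ob.dTube b v) = v := fun v => by
    have h := DFunLike.congr_fun (hl.mfderivToContinuousLinearEquiv_coe (by simp)) v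
    have h' : ob.dTube b v = D v := h.symm
    rw [h']
    exact D.symm_apply_apply v
  let s : TangentSpace JM (ob.incl b) →ₗ[ℝ] ℂ :=
    (LinearMap.snd ℝ EB ℂ).comp D.symm.toLinearEquiv.toLinearMap
  have hs : ∀ v, s (ob.dTube b v) = v.2 := fun v => congrArg Prod.snd (hD v)
  have hp : ∀ v, ((2 : ℝ) • Complex.reCLM.toLinearMap.comp s) (ob.dTube b v) = 2 * v.2.re := fun v =>
    congrArg (fun z : ℂ => 2 * z.re) (hs v)
  have hq : ∀ v, (Complex.imCLM.toLinearMap.comp s) (ob.dTube b v) = v.2.im := fun v =>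
    congrArg (fun z : ℂ => z.im) (hs v)
  refine ⟨_, _, ?_, fun v => ⟨hp v, hq v⟩⟩
  refine LinearMap.ext fun u => LinearMap.ext fun v => ?_
  obtain ⟨u, rfl⟩ := ob.exists_dTube_eq b u
  obtain ⟨v, rfl⟩ := ob.exists_dTube_eq b v
  rw [wedgeTwo_apply, hp, hp, hq, hq]
  refine (ob.d_coreForm_incl b u v).trans ?_
  ring

/-- The volume change by the core form at the binding is a multiple of the volume of the
restriction to the binding. -/
theorem volumeChange_coreForm_incl {γ : OneForm JM M} {b : B} (hγ : γ.SmoothAt (ob.incl b))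
    (v : Fin (2 * n + 1) → TangentSpace JB b) :
    volumeChange (n + 1) γ ob.coreForm (ob.incl b)
      (Fin.append (m := 2 * n + 1) (n := 2) (fun i => ob.dTube b (v i, 0))
        ![ob.dTube b (0, 1), ob.dTube b (0, Complex.I)]) =
      2 * (n + 1) * contactVolume n (pullback (I' := JB) ob.incl γ) b v := by
  obtain ⟨p, q, hd, hpq⟩ := ob.exists_decomposition_coreForm b
  have he : (ob.coreForm (ob.incl b)).toLinearMap = (0 : ℝ) • q := by
    rw [zero_smul, ob.coreForm_incl]; rfl
  rw [volumeChange_eq (n + 1) hγ (ob.smoothAt_coreForm (ob.core_subset_target (mem_range_self b)))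
    he hd, zero_mul, zero_add]
  have h := mixedForm_append (k := n) (γ (ob.incl b)).toLinearMap (γ.dB (ob.incl b))
    (fun i => ob.dTube b (v i, 0)) (p := p) (q := q) (fun i => by rw [(hpq _).1]; simp)
    (fun i => by rw [(hpq _).2]; simp) (ob.dTube b (0, 1)) (ob.dTube b (0, Complex.I))
  refine h.trans ?_
  rw [wedgeTwo_apply, (hpq _).1, (hpq _).1, (hpq _).2, (hpq _).2, contactVolume_pullback n hγ
    (ob.contMDiff_incl b)]
  have h2 : (fun i => mfderiv JB JM ob.incl b (v i)) = fun i => ob.dTube b (v i, 0) :=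
    funext fun i => ob.mfderiv_incl b (v i)
  rw [h2]
  simp only [Complex.one_re, Complex.I_im, Complex.I_re, Complex.one_im]
  have h3 : ∀ a c : ℝ, (a + 1) * ((2 * 1 * 1 - 0 * (2 * 0)) * c) = 2 * (a + 1) * c := by
    intros; ring
  exact h3 n _

/-- The form `profile a (r²) dθ`. -/
def bindingForm (a : ℝ) : OneForm JM M :=
  OneForm.fsmul (fun x => profile a (ob.rsq x)) ob.angleForm

variable {ob}

theorem profile_rsq_const {r : ℝ} (hr : 0 < r) (hr' : r < ob.δ) (u : ℝ) (hu : r ^ 2 ≤ u) :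
    profile (r ^ 2) u = profile (r ^ 2) (ob.δ ^ 2) :=
  profile_of_ge (by positivity) hu (pow_le_pow_left₀ hr.le hr'.le 2)

theorem bindingForm_eventuallyEq {a : ℝ} (ha : 0 < a) (b : B) :
    ∀ᶠ y in 𝓝 (ob.incl b), ob.bindingForm a y = ob.coreForm y := by
  have hc := (ob.contMDiffAt_rsq (ob.core_subset_target (mem_range_self b))).continuousAt
  have h0 : ob.rsq (ob.incl b) < a / 2 := by
    rw [(ob.rsq_eq_zero_iff _).2 (mem_range_self b)]; exact half_pos ha
  filter_upwards [hc.eventually (gt_mem_nhds h0)] with y hy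
  show profile a (ob.rsq y) • ob.angleForm y = ob.rsq y • ob.angleForm y
  rw [profile_of_le ha hy.le]

theorem isSmooth_bindingForm {r : ℝ} (hr : 0 < r) (hr' : r < ob.δ) :
    (ob.bindingForm (r ^ 2)).IsSmooth := by
  refine isSmooth_iff.2 fun x => ?_
  by_cases hx : x ∈ range ob.incl
  · obtain ⟨b, rfl⟩ := hx
    exact (ob.smoothAt_coreForm (ob.core_subset_target (mem_range_self b))).congr
      (bindingForm_eventuallyEq (by positivity) b)
  · exact OneForm.SmoothAt.fsmul (ob.contMDiff_comp_rsq (contDiff_profile _) hr hr'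
      (profile_rsq_const hr hr') x) (ob.smoothAt_angleForm hx)

theorem dB_fsmul_angleForm {ρ : M → ℝ} {x : M} (hρ : ContMDiffAt JM 𝓘(ℝ, ℝ) ∞ ρ x)
    (hx : x ∉ range ob.incl) : (OneForm.fsmul ρ ob.angleForm).dB x =
      wedgeTwo (differential ρ x).toLinearMap (ob.angleForm x).toLinearMap := by
  refine LinearMap.ext fun u => LinearMap.ext fun v => ?_
  refine (OneForm.d_fsmul hρ (ob.smoothAt_angleForm hx) u v).trans ?_
  rw [ob.d_angleForm hx, mul_zero, zero_add]
  exact (congrArg (differential (I := JM) ρ x u * ob.angleForm x v - ·) (mul_comm _ _)).trans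
    (wedgeTwo_apply _ _ u v).symm

theorem volumeChange_fsmul_angleForm (k : ℕ) {ρ : M → ℝ} {x : M}
    (hρ : ContMDiffAt JM 𝓘(ℝ, ℝ) ∞ ρ x) (hx : x ∉ range ob.incl) {γ : OneForm JM M}
    (hγ : γ.SmoothAt x) (v) :
    volumeChange k γ (OneForm.fsmul ρ ob.angleForm) x v =
      ρ x * oddForm k (ob.angleForm x).toLinearMap (γ.dB x) v +
        mixedForm k (γ x).toLinearMap (differential ρ x).toLinearMap
          (ob.angleForm x).toLinearMap (γ.dB x) v :=
  volumeChange_eq k hγ (OneForm.SmoothAt.fsmul hρ (ob.smoothAt_angleForm hx)) rfl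
    (dB_fsmul_angleForm hρ hx) v

theorem exists_decomposition_bindingForm {r : ℝ} (hr : 0 < r) (hr' : r < ob.δ) (x : M) :
    ∃ (p q : Module.Dual ℝ (TangentSpace JM x)) (e : ℝ),
      (ob.bindingForm (r ^ 2) x).toLinearMap = e • q ∧
        (ob.bindingForm (r ^ 2)).dB x = wedgeTwo p q := by
  by_cases hx : x ∈ range ob.incl
  · obtain ⟨b, rfl⟩ := hx
    obtain ⟨p, q, hd, -⟩ := ob.exists_decomposition_coreForm b
    have h := bindingForm_eventuallyEq (ob := ob) (a := r ^ 2) (by positivity) b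
    refine ⟨p, q, 0, ?_, ?_⟩
    · rw [h.self_of_nhds, ob.coreForm_incl, zero_smul]; rfl
    · rw [← hd]
      exact LinearMap.ext fun u => LinearMap.ext fun v =>
        congrFun (congrFun (OneForm.d_congr h) u) v
  · exact ⟨_, _, _, rfl, dB_fsmul_angleForm (ob.contMDiff_comp_rsq (contDiff_profile _) hr hr'
      (profile_rsq_const hr hr') x) hx⟩

theorem volumeChange_bindingForm_incl {k : ℕ} {a : ℝ} (ha : 0 < a) {γ : OneForm JM M} (b : B) (v) :
    volumeChange k γ (ob.bindingForm a) (ob.incl b) v =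
      volumeChange k γ ob.coreForm (ob.incl b) v :=
  volumeChange_congr (bindingForm_eventuallyEq ha b) v

theorem differential_comp_rsq_of_notMem {g : ℝ → ℝ} {r : ℝ} (hr : 0 < r) (hr' : r < ob.δ)
    (hc : ∀ u, r ^ 2 ≤ u → g u = g (ob.δ ^ 2)) {x : M} (hx : x ∉ ob.tube.target) :
    differential (I := JM) (fun x => g (ob.rsq x)) x = 0 :=
  (Filter.EventuallyEq.mfderiv_eq (f := fun _ => g (ob.δ ^ 2))
    ((ob.eventually_comp_rsq_eq hr hr' hc hx).mono fun _ => id)).trans mfderiv_const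

/-- Off the binding, the volume change by `g (r²) dθ` has the sign of the volume of the pages. -/
theorem volumeChange_comp_rsq_mul_pos {k : ℕ} {g : ℝ → ℝ} (hg : ContDiff ℝ ∞ g) {r : ℝ}
    (hr : 0 < r) (hr' : r < ob.δ) (hc : ∀ u, r ^ 2 ≤ u → g u = g (ob.δ ^ 2))
    (h0 : ∀ u > 0, 0 < g u) (h1 : ∀ u, 0 ≤ deriv g u) (h2 : ∀ u > 0, 0 ≤ g u - u * deriv g u)
    (h3 : ∀ u, r ^ 2 ≤ u → deriv g u = 0)
    {γ : OneForm JM M} {x : M} (hx : x ∉ range ob.incl) (hγ : γ.SmoothAt x)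
    {v : Fin (2 * k + 1) → TangentSpace JM x}
    (hT : oddForm k (ob.angleForm x).toLinearMap (γ.dB x) v ≠ 0)
    (hprod : x ∈ ob.tube.target → ob.rsq x < r ^ 2 → 0 < volumeChange k γ ob.coreForm x v *
      oddForm k (ob.angleForm x).toLinearMap (γ.dB x) v) :
    0 < volumeChange k γ (OneForm.fsmul (fun x => g (ob.rsq x)) ob.angleForm) x v *
      oddForm k (ob.angleForm x).toLinearMap (γ.dB x) v := by
  have hρ := ob.contMDiff_comp_rsq hg hr hr' hc x
  have hu : 0 < ob.rsq x := lt_of_le_of_ne (ob.rsq_nonneg x) fun h =>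
    hx ((ob.rsq_eq_zero_iff x).1 h.symm)
  rw [volumeChange_fsmul_angleForm k hρ hx hγ v]
  have key : ∀ c : ℝ, ∀ p : TangentSpace JM x →L[ℝ] ℝ,
      differential (I := JM) (fun x => g (ob.rsq x)) x = c • p →
      mixedForm k (γ x).toLinearMap
        (differential (I := JM) (fun x => g (ob.rsq x)) x).toLinearMap (ob.angleForm x).toLinearMap
        (γ.dB x) v = c * mixedForm k (γ x).toLinearMap p.toLinearMap (ob.angleForm x).toLinearMap
        (γ.dB x) v := fun c p h => by
    rw [h, ContinuousLinearMap.toLinearMap_smul, mixedForm_smul]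
  by_cases hxt : x ∈ ob.tube.target
  · have h5 := volumeChange_fsmul_angleForm k (ob.contMDiffAt_rsq hxt) hx hγ v
    rw [key _ _ (differential_comp (hg.differentiable (by simp) _)
        ((ob.contMDiffAt_rsq hxt).mdifferentiableAt (by simp)))]
    refine profile_sign (h0 _ hu) (h1 _) (h2 _ hu) hT ?_
    by_cases hlt : ob.rsq x < r ^ 2
    · have h7 := hprod hxt hlt
      rw [coreForm, h5] at h7
      exact Or.inr h7
    · exact Or.inl (h3 _ (not_lt.1 hlt))
  · rw [key 0 0 ((differential_comp_rsq_of_notMem hr hr' hc hxt).trans (zero_smul _ _).symm),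
      zero_mul, add_zero, mul_assoc]
    exact mul_pos (h0 _ hu) (mul_self_pos.2 hT)

theorem volumeChange_bindingForm_mul_pos {k : ℕ} {r : ℝ} (hr : 0 < r) (hr' : r < ob.δ)
    {γ : OneForm JM M} {x : M} (hx : x ∉ range ob.incl) (hγ : γ.SmoothAt x)
    {v : Fin (2 * k + 1) → TangentSpace JM x}
    (hT : oddForm k (ob.angleForm x).toLinearMap (γ.dB x) v ≠ 0)
    (hprod : x ∈ ob.tube.target → ob.rsq x < r ^ 2 → 0 < volumeChange k γ ob.coreForm x v *
      oddForm k (ob.angleForm x).toLinearMap (γ.dB x) v) :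
    0 < volumeChange k γ (ob.bindingForm (r ^ 2)) x v *
      oddForm k (ob.angleForm x).toLinearMap (γ.dB x) v :=
  volumeChange_comp_rsq_mul_pos (contDiff_profile _) hr hr' (profile_rsq_const hr hr')
    (fun _ h => profile_pos (by positivity) h) (deriv_profile_nonneg _)
    (fun _ h => profile_sub_nonneg (by positivity) h.le)
    (fun _ h => deriv_profile_of_le (by positivity) h) hx hγ hT hprod

end OpenBook

variable {ob} [CompactSpace B] [T2Space M]

theorem finrank_total (n : ℕ) :
    Module.finrank ℝ (EuclideanSpace ℝ (Fin (2 * n + 3))) = 2 * (n + 1) + 1 := by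
  rw [finrank_euclideanSpace_fin]; ring

theorem append_map {X Y : Type*} {N : ℕ} (f : X → Y) (a : Fin N → X) (x y : X) (i : Fin (N + 2)) :
    Fin.append (m := N) (n := 2) (fun i => f (a i)) ![f x, f y] i =
      f (Fin.append (m := N) (n := 2) a ![x, y] i) := by
  refine Fin.addCases (fun i => ?_) (fun i => ?_) i
  · simp only [Fin.append_left]
  · simp only [Fin.append_right]
    fin_cases i <;> rfl

namespace OpenBook

theorem Supports.pages {α : OneForm JM M} (hα : IsContactForm (n + 1) α) (hs : ob.Supports α)
    {x : M} (hx : x ∉ range ob.incl) {v : Fin (2 * (n + 1) + 1) → TangentSpace JM x}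
    (hv : LinearIndependent ℝ v) :
    0 < oddForm (n + 1) (ob.angleForm x).toLinearMap (α.dB x) v * contactVolume (n + 1) α x v := by
  obtain ⟨R, hR⟩ := exists_isReebVector (finrank_total n) hα x
  exact oddForm_mul_contactVolume_pos (finrank_total n) (hα.volume_ne_zero x) hR
    (hs.reeb_transverse x hx R hR) hv

/-- A frame of `B` followed by a frame of the normal directions. -/
def appendFrame (ob : OpenBook n B M) (b : B) (v : Fin (2 * n + 1) → EB) :
    Fin (2 * (n + 1) + 1) → TangentSpace JM (ob.incl b) :=
  Fin.append (m := 2 * n + 1) (n := 2) (fun i => ob.dTube b (v i, 0))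
        ![ob.dTube b (0, 1), ob.dTube b (0, Complex.I)]

theorem linearIndependent_appendFrame (b : B)
    {v : Fin (2 * n + 1) → EB} (hv : LinearIndependent ℝ v) :
    LinearIndependent ℝ (ob.appendFrame b v) := by
  have h1 : LinearIndependent ℝ (Fin.append (m := 2 * n + 1) (n := 2)
      (fun i => ((v i, 0) : EB × ℂ)) ![(0, 1), (0, Complex.I)]) := by
    rw [Fintype.linearIndependent_iff]
    intro g hg
    rw [Fin.sum_univ_add] at hg
    simp only [Fin.append_left, Fin.append_right, Fin.sum_univ_two, Matrix.cons_val_zero,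
      Matrix.cons_val_one] at hg
    have e1 := congrArg Prod.fst hg
    have e2 := congrArg Prod.snd hg
    simp only [Prod.fst_add, Prod.snd_add, Prod.fst_sum, Prod.snd_sum, Prod.smul_fst, Prod.smul_snd,
      smul_zero, add_zero, Finset.sum_const_zero, zero_add, Prod.fst_zero, Prod.snd_zero] at e1 e2
    have e3 := Fintype.linearIndependent_iff.1 hv _ e1
    have e4 := congrArg Complex.re e2
    have e5 := congrArg Complex.im e2
    simp at e4 e5
    refine Fin.addCases e3 fun i => ?_
    fin_cases i
    · exact e4
    · exact e5
  have h2 := ob.linearIndependent_dTube b h1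
  have h3 : ob.appendFrame b v = fun i => ob.dTube b (Fin.append (m := 2 * n + 1) (n := 2)
      (fun i => ((v i, 0) : EB × ℂ)) ![(0, 1), (0, Complex.I)] i) :=
    funext fun i => append_map (ob.dTube b) _ _ _ i
  rw [h3]
  exact h2

theorem Supports.binding {α : OneForm JM M} (hs : ob.Supports α) (b : B)
    {v : Fin (2 * n + 1) → EB} (hv : LinearIndependent ℝ v) :
    0 < contactVolume n (OneForm.pullback (I' := JB) ob.incl α) b v *
      contactVolume (n + 1) α (ob.incl b) (ob.appendFrame b v) :=
  hs.positive_binding b v hv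

/-- Complements of the binding accumulate at the binding. -/
theorem exists_tendsto_incl (ob : OpenBook n B M) (b : B) : ∃ c : ℝ → M,
    Filter.Tendsto c (𝓝[>] 0) (𝓝 (ob.incl b)) ∧ ∀ᶠ r in 𝓝[>] (0 : ℝ), c r ∉ range ob.incl := by
  refine ⟨fun r => ob.tube (b, (r : ℂ)), ?_, ?_⟩
  · have h0 : ContinuousAt ob.tube.toFun (b, ((0 : ℝ) : ℂ)) :=
      (ob.isLocalDiffeomorphAt_tube b (z := ((0 : ℝ) : ℂ))
        (by simpa using ob.δ_pos)).contMDiffAt.continuousAt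
    have h1 : ContinuousAt (fun r : ℝ => ob.tube.toFun (b, (r : ℂ))) 0 :=
      ContinuousAt.comp (f := fun r : ℝ => ((b, (r : ℂ)) : B × ℂ)) h0 (by fun_prop)
    have h2 := h1.tendsto
    simp only [Complex.ofReal_zero] at h2
    exact h2.mono_left nhdsWithin_le_nhds
  · have h1 : ∀ᶠ r : ℝ in 𝓝[>] 0, r < ob.δ :=
      mem_nhdsWithin_of_mem_nhds (Iio_mem_nhds ob.δ_pos)
    filter_upwards [h1, self_mem_nhdsWithin] with r hr hr0
    have hr0' : 0 < r := hr0
    rw [ob.tube_mem_core_iff b (by rw [Complex.norm_real, Real.norm_of_nonneg hr0'.le]; exact hr)]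
    exact_mod_cast hr0'.ne'

/-- If the volumes of two contact forms have the same sign off the binding, then everywhere. -/
theorem contactVolume_mul_pos_of_off {α α' : OneForm JM M} (hα : IsContactForm (n + 1) α)
    (hα' : IsContactForm (n + 1) α')
    (h : ∀ x ∉ range ob.incl, ∀ v, LinearIndependent ℝ v →
      0 < contactVolume (n + 1) α x v * contactVolume (n + 1) α' x v) (x : M)
    {v : Fin (2 * (n + 1) + 1) → TangentSpace JM x} (hv : LinearIndependent ℝ v) :
    0 < contactVolume (n + 1) α x v * contactVolume (n + 1) α' x v := by
  by_cases hx : x ∈ range ob.incl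
  swap
  · exact h x hx v hv
  obtain ⟨b, rfl⟩ := hx
  obtain ⟨c, hc, hc'⟩ := ob.exists_tendsto_incl b
  obtain ⟨e, he⟩ := exists_linearIndependent (finrank_total n)
  obtain ⟨f, hf, hcont⟩ := exists_frame (I := JM) (ob.incl b) he
  have hct : ∀ {α : OneForm JM M}, IsContactForm (n + 1) α →
      ContinuousAt (fun x => contactVolume (n + 1) α x (f x)) (ob.incl b) := fun hα => by
    have h := hcont _ (Filter.Eventually.of_forall (isSmooth_iff.1 hα.smooth))
    exact continuousAt_wedgeWedgePow (n + 1) h.1 h.2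
  have hlim := ((hct hα).mul (hct hα')).tendsto.comp hc
  have hnn := ge_of_tendsto hlim (b := 0) (by
    filter_upwards [hc', hc.eventually hf] with r h1 h2
    exact (h _ h1 _ h2).le)
  refine contactVolume_mul_pos (finrank_total n) hf.self_of_nhds hv ?_
  exact lt_of_le_of_ne hnn (mul_ne_zero (hα.volume_ne_zero _ _ hf.self_of_nhds)
    (hα'.volume_ne_zero _ _ hf.self_of_nhds)).symm

/-- Neighbourhoods of the binding contain uniform tubes. -/
theorem exists_tube_subset {U : Set M} (hU : U ∈ 𝓝ˢ (range ob.incl)) :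
    ∃ r, 0 < r ∧ r < ob.δ ∧ ∀ x ∈ ob.tube.target, ob.rsq x < r ^ 2 → x ∈ U := by
  obtain ⟨U', hU'o, hU', hsub⟩ := mem_nhdsSet_iff_exists.1 hU
  have hopen : IsOpen (ob.tube.source ∩ ob.tube.toFun ⁻¹' U') :=
    ob.tube.contMDiffOn_toFun.continuousOn.isOpen_inter_preimage ob.tube.open_source hU'o
  obtain ⟨V, W, -, hW, hV, hWs, hVW⟩ := generalized_tube_lemma (isCompact_univ (X := B))
    (isCompact_singleton (x := (0 : ℂ))) hopen (by
      rintro ⟨b, z⟩ ⟨-, hz⟩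
      obtain rfl : z = 0 := hz
      exact ⟨ob.mem_tube_source b (by simpa using ob.δ_pos), hU' (mem_range_self b)⟩)
  obtain ⟨ε, hε, hball⟩ := Metric.isOpen_iff.1 hW 0 (hWs rfl)
  have h1 : 0 < min ε ob.δ := lt_min hε ob.δ_pos
  refine ⟨min ε ob.δ / 2, by positivity, ?_, fun x hx hr => ?_⟩
  · have := min_le_right ε ob.δ
    linarith
  obtain ⟨b, z, hz, rfl⟩ := ob.exists_tube_eq hx
  rw [ob.rsq_tube b hz] at hr
  have hz' : ‖z‖ < ε := by
    have := lt_of_pow_lt_pow_left₀ 2 (by positivity) hr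
    have := min_le_left ε ob.δ
    linarith
  exact hsub (hVW (show ((b, z) : B × ℂ) ∈ V ×ˢ W from
    ⟨hV (mem_univ b), hball (by simpa using hz')⟩)).2

end OpenBook

namespace OpenBook

/-- A family of forms that is positive on the pages, and compatible with the binding, becomes
contact when a large multiple of the binding form is added. -/
theorem exists_contact_perturbation [CompactSpace M] {γ₀ γ₁ : OneForm JM M} (h₀ : γ₀.IsSmooth)
    (h₁ : γ₁.IsSmooth) {r : ℝ} (hr : 0 < r) (hr' : r < ob.δ)
    (hT : ∀ s ∈ Icc (0 : ℝ) 1, ∀ x ∉ range ob.incl, ∀ v, LinearIndependent ℝ v →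
      oddForm (n + 1) (ob.angleForm x).toLinearMap ((segmentForm γ₀ γ₁ s).dB x) v ≠ 0)
    (hcore : ∀ s ∈ Icc (0 : ℝ) 1, ∀ b v, LinearIndependent ℝ v →
      volumeChange (n + 1) (segmentForm γ₀ γ₁ s) ob.coreForm (ob.incl b) v ≠ 0)
    (hprod : ∀ s ∈ Icc (0 : ℝ) 1, ∀ x ∈ ob.tube.target, x ∉ range ob.incl → ob.rsq x < r ^ 2 →
      ∀ v, LinearIndependent ℝ v → 0 < volumeChange (n + 1) (segmentForm γ₀ γ₁ s) ob.coreForm x v *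
        oddForm (n + 1) (ob.angleForm x).toLinearMap ((segmentForm γ₀ γ₁ s).dB x) v) :
    ∃ K : ℝ, 0 ≤ K ∧ ∀ κ ≥ K, ∀ s ∈ Icc (0 : ℝ) 1, ∀ x v, LinearIndependent ℝ v →
      0 < contactVolume (n + 1) (segmentForm γ₀ γ₁ s + κ • ob.bindingForm (r ^ 2)) x v *
        volumeChange (n + 1) (segmentForm γ₀ γ₁ s) (ob.bindingForm (r ^ 2)) x v := by
  refine exists_forall_contactVolume_pos (finrank_total n) h₀ h₁ (isSmooth_bindingForm hr hr')
    (exists_decomposition_bindingForm hr hr') fun s hs x v hv => ?_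
  by_cases hx : x ∈ range ob.incl
  · obtain ⟨b, rfl⟩ := hx
    rw [volumeChange_bindingForm_incl (by positivity)]
    exact hcore s hs b v hv
  · intro h
    have h1 := volumeChange_bindingForm_mul_pos hr hr' hx
      ((isSmooth_iff.1 h₀ x).segmentForm (isSmooth_iff.1 h₁ x) s) (hT s hs x hx v hv)
      fun hxt hlt => hprod s hs x hxt hx hlt v hv
    rw [h, zero_mul] at h1
    exact lt_irrefl _ h1

/-- A smooth `1`-form whose derivative vanishes on the open pages has closed restriction to the
binding. -/
theorem d_pullback_incl_eq_zero {β : OneForm JM M} (hβ : β.IsSmooth)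
    (h : ∀ x ∉ range ob.incl, ∀ u v : TangentSpace JM x, ob.angleForm x u = 0 →
      ob.angleForm x v = 0 → β.d x u v = 0) (b : B) (u v : TangentSpace JB b) :
    (pullback (I' := JB) ob.incl β).d b u v = 0 := by
  let ψ : ℝ → ℝ := fun t => ob.δ * (t ^ 2 / (1 + t ^ 2))
  have hψ : ContDiff ℝ ∞ ψ := by
    refine contDiff_const.mul (ContDiff.div (by fun_prop) (by fun_prop) fun t => ?_)
    positivity
  have hδ := ob.δ_pos
  have hψ0 : ∀ t, 0 ≤ ψ t := fun t => by positivity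
  have hψ1 : ∀ t, ψ t < ob.δ := fun t => by
    have : t ^ 2 / (1 + t ^ 2) < 1 := by rw [div_lt_one (by positivity)]; linarith
    nlinarith
  have hψn : ∀ t, ‖((ψ t : ℝ) : ℂ)‖ < ob.δ := fun t => by
    rw [Complex.norm_real, Real.norm_of_nonneg (hψ0 t)]; exact hψ1 t
  have hψpos : ∀ t ≠ 0, 0 < ψ t := fun t ht => by positivity
  let G : ℝ × B → M := fun p => ob.tube (p.2, ((ψ p.1 : ℝ) : ℂ))
  have hG : ContMDiff (𝓘(ℝ, ℝ).prod JB) JM ∞ G := fun p => by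
    refine ContMDiffAt.comp p (ob.isLocalDiffeomorphAt_tube p.2 (hψn p.1)).contMDiffAt ?_
    exact contMDiffAt_snd.prodMk
      ((Complex.ofRealCLM.contDiff.comp hψ).contMDiff.contMDiffAt.comp p contMDiffAt_fst)
  let A : ℝ → OneForm JB B := fun t =>
    pullback (I' := JB) (fun x : B => ((t, x) : ℝ × B))
      (pullback (I' := 𝓘(ℝ, ℝ).prod JB) G β)
  have hA : IsSmoothFamily A := isSmoothFamily_slice (hβ.pullback hG)
  have hAt : ∀ t, A t = pullback (I' := JB) (fun x : B => G (t, x)) β := fun t =>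
    funext fun x => (OneForm.pullback_comp (I'' := JB) β (f := G)
      (g := fun x : B => ((t, x) : ℝ × B)) (x := x) (hG.mdifferentiableAt (by simp))
      ((contMDiff_mk_left t).mdifferentiableAt (by simp))).symm
  have hGt : ∀ t, ContMDiff JB JM ∞ (fun x : B => G (t, x)) := fun t => hG.comp (contMDiff_mk_left t)
  have hzero : ∀ t ≠ 0, (A t).d b u v = 0 := by
    intro t ht
    have hx : ∀ y, G (t, y) ∉ range ob.incl := fun y => by
      rw [ob.tube_mem_core_iff y (hψn t)]
      exact_mod_cast (hψpos t ht).ne'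
    have hker : ∀ w : TangentSpace JB b,
        ob.angleForm (G (t, b)) (mfderiv JB JM (fun x : B => G (t, x)) b w) = 0 := by
      intro w
      have h1 := OneForm.pullback_comp (I'' := JB) planeForm (f := fun y => (ob.proj y : ℂ))
        (g := fun x : B => G (t, x)) (x := b)
        ((ob.contMDiffAt_proj (hx b)).mdifferentiableAt (by simp))
        ((hGt t).mdifferentiableAt (by simp))
      have h2 : (fun y => (ob.proj y : ℂ)) ∘ (fun x : B => G (t, x)) =
          fun _ => (((ψ t : ℝ) : ℂ) / ‖((ψ t : ℝ) : ℂ)‖) := funext fun y =>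
        ob.proj_tube y _ (by exact_mod_cast (hψpos t ht).ne') (hψn t)
      rw [h2] at h1
      have h3 := DFunLike.congr_fun h1 w
      refine h3.symm.trans ?_
      have h4 : mfderiv JB 𝓘(ℝ, ℂ) (fun _ : B => (((ψ t : ℝ) : ℂ) / ‖((ψ t : ℝ) : ℂ)‖)) b = 0 :=
        mfderiv_const
      have h5 : mfderiv JB 𝓘(ℝ, ℂ) (fun _ : B => (((ψ t : ℝ) : ℂ) / ‖((ψ t : ℝ) : ℂ)‖)) b w = 0 :=
        DFunLike.congr_fun h4 w
      exact (congrArg (rot _) h5).trans (map_zero _)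
    rw [hAt]
    refine (OneForm.d_pullback (isSmooth_iff.1 hβ _) (hGt t b) u v).trans ?_
    exact h _ (hx b) _ _ (hker u) (hker v)
  have hlim : (A 0).d b u v = 0 := by
    have hc := (hA.continuous_d b u v).continuousAt (x := 0)
    have h1 : Filter.Tendsto (fun t => (A t).d b u v) (𝓝[≠] 0) (𝓝 ((A 0).d b u v)) :=
      hc.tendsto.mono_left nhdsWithin_le_nhds
    have h2 : Filter.Tendsto (fun t => (A t).d b u v) (𝓝[≠] 0) (𝓝 0) := by
      refine tendsto_const_nhds.congr' ?_
      filter_upwards [self_mem_nhdsWithin] with t ht using (hzero t ht).symm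
    exact tendsto_nhds_unique h1 h2
  have h0 : (fun x : B => G (0, x)) = ob.incl := funext fun x => by simp [G, ψ, incl]
  rw [hAt, h0] at hlim
  exact hlim

end OpenBook

theorem isSmoothFamily_pullback_isotopy {α : OneForm JM M} (hα : α.IsSmooth)
    {F : ℝ → (M ≃ₘ⟮JM, JM⟯ M)} (hF : IsIsotopy F) :
    IsSmoothFamily fun t => pullback (I' := JM) (F t) α := by
  have h := isSmoothFamily_slice (hα.pullback (I' := 𝓘(ℝ, ℝ).prod JM) hF.1)
  have h2 : (fun t => pullback (I' := JM) (F t) α) = fun t =>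
      pullback (I' := JM) (fun x : M => ((t, x) : ℝ × M))
        (pullback (I' := 𝓘(ℝ, ℝ).prod JM) (fun p : ℝ × M => F p.1 p.2) α) :=
    funext fun t => funext fun x => OneForm.pullback_comp (I'' := JM) α
      (f := fun p : ℝ × M => F p.1 p.2) (g := fun x : M => ((t, x) : ℝ × M)) (x := x)
      (hF.1.mdifferentiableAt (by simp)) ((contMDiff_mk_left t).mdifferentiableAt (by simp))
  rw [h2]
  exact h

/-- An isotopy preserves the orientation. -/
theorem contactVolume_isotopy_pos {α : OneForm JM M} (hα : IsContactForm (n + 1) α)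
    {F : ℝ → (M ≃ₘ⟮JM, JM⟯ M)} (hF : IsIsotopy F) (t : ℝ) (x : M)
    {v : Fin (2 * (n + 1) + 1) → TangentSpace JM x} (hv : LinearIndependent ℝ v) :
    0 < contactVolume (n + 1) α x v *
      contactVolume (n + 1) (pullback (I' := JM) (F t) α) x v := by
  have h := mul_pos_of_continuous
    ((isSmoothFamily_pullback_isotopy hα.smooth hF).continuous_contactVolume (n + 1) x v)
    (fun t => (hα.pullback (F t)).volume_ne_zero x v hv) 0 t
  have h0 : (F 0 : M → M) = id := funext hF.2
  rw [h0, OneForm.pullback_id] at h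
  exact h

namespace OpenBook

/-- A contact form that is positive on the pages. -/
theorem mul_pos_pages_pullback {α : OneForm JM M} (hα : IsContactForm (n + 1) α)
    (hs : ob.Supports α) {F : M ≃ₘ⟮JM, JM⟯ M} (hF : ∀ b, F (ob.incl b) = ob.incl b)
    (hF' : ∀ x ∉ range ob.incl, ob.proj (F x) = ob.proj x) {x : M} (hx : x ∉ range ob.incl)
    {v : Fin (2 * (n + 1) + 1) → TangentSpace JM x} (hv : LinearIndependent ℝ v) :
    0 < oddForm (n + 1) (ob.angleForm x).toLinearMap
      ((pullback (I' := JM) F α).dB x) v *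
        contactVolume (n + 1) (pullback (I' := JM) F α) x v := by
  have hFx : F x ∉ range ob.incl := by
    rintro ⟨b, hb⟩
    exact hx ⟨b, F.injective ((hF b).trans hb)⟩
  have hang : ob.angleForm x = pullback (I' := JM) F ob.angleForm x := by
    have h1 := OneForm.pullback_comp (I'' := JM) planeForm (f := fun y => (ob.proj y : ℂ))
      (g := F) (x := x) ((ob.contMDiffAt_proj hFx).mdifferentiableAt (by simp))
      (F.contMDiff.mdifferentiableAt (by simp))
    have h2 : ((fun y => (ob.proj y : ℂ)) ∘ F) =ᶠ[𝓝 x] fun y => (ob.proj y : ℂ) := by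
      filter_upwards [ob.isClosed_core.isOpen_compl.mem_nhds hx] with y hy
      exact congrArg _ (hF' y hy)
    rw [OneForm.pullback_congr _ h2] at h1
    exact h1
  have h := hs.pages hα hFx (linearIndependent_mfderiv (F.isLocalDiffeomorph x) hv)
  rw [contactVolume_pullback _ (isSmooth_iff.1 hα.smooth _) (F.contMDiff x)]
  have hd : ∀ u w, (pullback (I' := JM) F α).dB x u w =
      α.dB (F x) (mfderiv JM JM F x u) (mfderiv JM JM F x w) := fun u w =>
    OneForm.d_pullback (isSmooth_iff.1 hα.smooth _) (F.contMDiff x) u w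
  rw [hang, oddForm_eq_wedgeWedgePow]
  simp only [hd]
  rw [oddForm_eq_wedgeWedgePow] at h
  exact h

end OpenBook

theorem segmentForm_zero (γ₀ γ₁ : OneForm JM M) : segmentForm γ₀ γ₁ 0 = γ₀ := by
  simp [segmentForm]

theorem segmentForm_one (γ₀ γ₁ : OneForm JM M) : segmentForm γ₀ γ₁ 1 = γ₁ := by
  simp [segmentForm]

/-- The hypotheses on two contact forms under which the segment between them can be made contact:
they agree on the pages, have the same sign, and are positive on pages and binding. -/
structure SamePages (ob : OpenBook n B M) (α₀ α₁ : OneForm JM M) : Prop where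
  contact₀ : IsContactForm (n + 1) α₀
  contact₁ : IsContactForm (n + 1) α₁
  pages : ∀ x ∉ range ob.incl, ∀ u v : TangentSpace JM x, ob.angleForm x u = 0 →
    ob.angleForm x v = 0 → α₁.d x u v = α₀.d x u v
  positive : ∀ x ∉ range ob.incl, ∀ v : Fin (2 * (n + 1) + 1) → TangentSpace JM x,
    LinearIndependent ℝ v →
    0 < oddForm (n + 1) (ob.angleForm x).toLinearMap (α₀.dB x) v * contactVolume (n + 1) α₀ x v
  sign : ∀ (x : M) (v : Fin (2 * (n + 1) + 1) → TangentSpace JM x), LinearIndependent ℝ v →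
    0 < contactVolume (n + 1) α₀ x v * contactVolume (n + 1) α₁ x v
  binding₀ : ∀ (b : B) (v : Fin (2 * n + 1) → EB),
    LinearIndependent ℝ v → 0 < contactVolume n (pullback (I := JM) (I' := JB) ob.incl α₀) b v *
      contactVolume (n + 1) α₀ (ob.incl b) (ob.appendFrame b v)
  binding₁ : ∀ (b : B) (v : Fin (2 * n + 1) → EB),
    LinearIndependent ℝ v → 0 < contactVolume n (pullback (I := JM) (I' := JB) ob.incl α₁) b v *
      contactVolume (n + 1) α₀ (ob.incl b) (ob.appendFrame b v)

namespace SamePages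

theorem smoothAt₀ {α₀ α₁ : OneForm JM M} (h : SamePages ob α₀ α₁) (x : M) : α₀.SmoothAt x := isSmooth_iff.1 h.contact₀.smooth x

theorem smoothAt₁ {α₀ α₁ : OneForm JM M} (h : SamePages ob α₀ α₁) (x : M) : α₁.SmoothAt x := isSmooth_iff.1 h.contact₁.smooth x

theorem oddForm_segment {α₀ α₁ : OneForm JM M} (h : SamePages ob α₀ α₁) (s : ℝ) {x : M} (hx : x ∉ range ob.incl)
    (v : Fin (2 * (n + 1) + 1) → TangentSpace JM x) :
    oddForm (n + 1) (ob.angleForm x).toLinearMap ((segmentForm α₀ α₁ s).dB x) v =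
      oddForm (n + 1) (ob.angleForm x).toLinearMap (α₀.dB x) v := by
  refine oddForm_congr_ker (OneForm.dB_neg _ x) (α₀.dB_neg x) (fun u w hu hw => ?_) v
  refine (OneForm.d_segmentForm (h.smoothAt₀ x) (h.smoothAt₁ x) s u w).trans ?_
  rw [h.pages x hx u w hu hw, OneForm.dB_apply]
  ring

theorem d_pullback_incl {α₀ α₁ : OneForm JM M} (h : SamePages ob α₀ α₁) (b : B) (u v : TangentSpace JB b) :
    (pullback (I := JM) (I' := JB) ob.incl α₁).d b u v =
      (pullback (I := JM) (I' := JB) ob.incl α₀).d b u v := by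
  have h1 := OpenBook.d_pullback_incl_eq_zero (ob := ob) (β := α₁ + (-1 : ℝ) • α₀)
    (isSmooth_iff.2 fun x => (h.smoothAt₁ x).add ((h.smoothAt₀ x).smul (-1)))
    (fun x hx u v hu hv => by
      rw [OneForm.d_add (h.smoothAt₁ x) ((h.smoothAt₀ x).smul _), OneForm.d_smul (h.smoothAt₀ x),
        h.pages x hx u v hu hv]
      ring) b u v
  rw [OneForm.pullback_add, OneForm.pullback_smul, OneForm.d_add
    ((h.smoothAt₁ _).pullback (ob.contMDiff_incl b))
    (((h.smoothAt₀ _).pullback (ob.contMDiff_incl b)).smul _),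
    OneForm.d_smul ((h.smoothAt₀ _).pullback (ob.contMDiff_incl b))] at h1
  linarith

theorem contactVolume_incl_segment {α₀ α₁ : OneForm JM M} (h : SamePages ob α₀ α₁) (s : ℝ) (b : B)
    (v : Fin (2 * n + 1) → EB) :
    contactVolume n (pullback (I := JM) (I' := JB) ob.incl (segmentForm α₀ α₁ s)) b v =
      (1 - s) * contactVolume n (pullback (I := JM) (I' := JB) ob.incl α₀) b v +
        s * contactVolume n (pullback (I := JM) (I' := JB) ob.incl α₁) b v := by
  have e0 := (h.smoothAt₀ _).pullback (ob.contMDiff_incl b)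
  have e1 := (h.smoothAt₁ _).pullback (ob.contMDiff_incl b)
  have hd1 : (pullback (I := JM) (I' := JB) ob.incl α₁).dB b =
      (pullback (I := JM) (I' := JB) ob.incl α₀).dB b :=
    LinearMap.ext fun u => LinearMap.ext fun v => h.d_pullback_incl b u v
  have hd : (pullback (I := JM) (I' := JB) ob.incl (segmentForm α₀ α₁ s)).dB b =
      (pullback (I := JM) (I' := JB) ob.incl α₀).dB b := by
    refine LinearMap.ext fun u => LinearMap.ext fun v => ?_
    refine (OneForm.d_segmentForm e0 e1 s u v).trans ?_
    rw [h.d_pullback_incl b u v, OneForm.dB_apply]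
    ring
  generalize hs' : pullback (I := JM) (I' := JB) ob.incl (segmentForm α₀ α₁ s) = γ at hd ⊢
  have hγ : γ b = (1 - s) • pullback (I := JM) (I' := JB) ob.incl α₀ b +
      s • pullback (I := JM) (I' := JB) ob.incl α₁ b := by rw [← hs']; rfl
  generalize pullback (I := JM) (I' := JB) ob.incl α₀ = γ₀ at *
  generalize pullback (I := JM) (I' := JB) ob.incl α₁ = γ₁ at *
  have e2 := contactVolume_eq_oddForm n γ b v
  have e3 := contactVolume_eq_oddForm n γ₀ b v
  have e4 := contactVolume_eq_oddForm n γ₁ b v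
  rw [hd, hγ] at e2
  rw [hd1] at e4
  refine e2.trans ?_
  rw [ContinuousLinearMap.toLinearMap_add, ContinuousLinearMap.toLinearMap_smul,
    ContinuousLinearMap.toLinearMap_smul]
  refine (oddForm_add_left _ _ _ _ _).trans ?_
  exact congrArg₂ (· + ·) ((oddForm_smul_left _ _ _ _ _).trans (congrArg _ e3.symm))
    ((oddForm_smul_left _ _ _ _ _).trans (congrArg _ e4.symm))

theorem core_segment {α₀ α₁ : OneForm JM M} (h : SamePages ob α₀ α₁) {s : ℝ} (hs : s ∈ Icc (0 : ℝ) 1) (b : B)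
    {v : Fin (2 * (n + 1) + 1) → TangentSpace JM (ob.incl b)} (hv : LinearIndependent ℝ v) :
    0 < volumeChange (n + 1) (segmentForm α₀ α₁ s) ob.coreForm (ob.incl b) v *
      contactVolume (n + 1) α₀ (ob.incl b) v := by
  obtain ⟨e, he⟩ := exists_linearIndependent
    (finrank_euclideanSpace_fin (𝕜 := ℝ) (n := 2 * n + 1))
  refine volumeChange_mul_contactVolume_pos (finrank_total n)
    (OpenBook.linearIndependent_appendFrame b he) hv ?_
  have h1 := ob.volumeChange_coreForm_incl
    ((h.smoothAt₀ (ob.incl b)).segmentForm (h.smoothAt₁ (ob.incl b)) s) e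
  have h2 : volumeChange (n + 1) (segmentForm α₀ α₁ s) ob.coreForm (ob.incl b)
      (ob.appendFrame b e) = _ := h1
  rw [h2, h.contactVolume_incl_segment]
  have h3 := h.binding₀ b e he
  have h4 := h.binding₁ b e he
  generalize contactVolume (n + 1) α₀ (ob.incl b) (ob.appendFrame b e) = X at h3 h4 ⊢
  generalize contactVolume n (pullback (I := JM) (I' := JB) ob.incl α₀) b e = Y at h3 ⊢
  generalize contactVolume n (pullback (I := JM) (I' := JB) ob.incl α₁) b e = Z at h4 ⊢
  have h5 : 2 * ((n : ℝ) + 1) * ((1 - s) * Y + s * Z) * X =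
      2 * ((n : ℝ) + 1) * ((1 - s) * (Y * X) + s * (Z * X)) := by ring
  rw [h5]
  have h6 : 0 ≤ 1 - s := sub_nonneg.2 hs.2
  have h7 : 0 < (1 - s) * (Y * X) + s * (Z * X) := by
    rcases hs.1.eq_or_lt with h8 | h8
    · rw [← h8]; linarith
    · have := mul_pos h8 h4
      have := mul_nonneg h6 h3.le
      linarith
  positivity

/-- Near the binding the volume change by the core form has a constant sign. -/
theorem exists_radius {α₀ α₁ : OneForm JM M} (h : SamePages ob α₀ α₁) : ∃ r, 0 < r ∧ r < ob.δ ∧ ∀ s ∈ Icc (0 : ℝ) 1, ∀ x ∈ ob.tube.target,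
    ob.rsq x < r ^ 2 → ∀ v, LinearIndependent ℝ v →
      0 < volumeChange (n + 1) (segmentForm α₀ α₁ s) ob.coreForm x v *
        contactVolume (n + 1) α₀ x v := by
  have hU : {x : M | ∀ s ∈ Icc (0 : ℝ) 1, ∀ v, LinearIndependent ℝ v →
      0 < volumeChange (n + 1) (segmentForm α₀ α₁ s) ob.coreForm x v *
        contactVolume (n + 1) α₀ x v} ∈ 𝓝ˢ (range ob.incl) := by
    rw [mem_nhdsSet_iff_forall]
    rintro _ ⟨b, rfl⟩
    refine isCompact_Icc.eventually_forall_of_forall_eventually (X := M) (Y := ℝ)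
      (P := fun x s => ∀ v, LinearIndependent ℝ v →
      0 < volumeChange (n + 1) (segmentForm α₀ α₁ s) ob.coreForm x v *
        contactVolume (n + 1) α₀ x v) fun s₀ hs₀ => ?_
    obtain ⟨e, he⟩ := exists_linearIndependent (finrank_total n)
    obtain ⟨f, hf, hcont⟩ := exists_frame (I := JM) (ob.incl b) he
    have ev₀ : ∀ᶠ x in 𝓝 (ob.incl b), α₀.SmoothAt x := Filter.Eventually.of_forall h.smoothAt₀
    have ev₁ : ∀ᶠ x in 𝓝 (ob.incl b), α₁.SmoothAt x := Filter.Eventually.of_forall h.smoothAt₁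
    have evc : ∀ᶠ x in 𝓝 (ob.incl b), ob.coreForm.SmoothAt x := by
      filter_upwards [ob.tube.open_target.mem_nhds (ob.core_subset_target (mem_range_self b))]
        with x hx using ob.smoothAt_coreForm hx
    have ev₀' : ∀ᶠ x in 𝓝 (ob.incl b), (α₀ + ob.coreForm).SmoothAt x := by
      filter_upwards [ev₀, evc] with x h1 h2 using h1.add h2
    have ev₁' : ∀ᶠ x in 𝓝 (ob.incl b), (α₁ + ob.coreForm).SmoothAt x := by
      filter_upwards [ev₁, evc] with x h1 h2 using h1.add h2
    have hca := continuousAt_contactVolume (n + 1) hcont ev₀ ev₁ s₀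
    have hcb : ContinuousAt (fun q : ℝ × M => volumeChange (n + 1) (segmentForm α₀ α₁ q.1)
        ob.coreForm q.2 (f q.2)) (s₀, ob.incl b) := by
      have := (continuousAt_contactVolume (n + 1) hcont ev₀' ev₁' s₀).sub hca
      refine this.congr (Filter.Eventually.of_forall fun q => ?_)
      simp only [volumeChange, segmentForm_add, Pi.sub_apply]
    have hc0 : ContinuousAt (fun x => contactVolume (n + 1) α₀ x (f x)) (ob.incl b) :=
      continuousAt_wedgeWedgePow (n + 1) (hcont _ ev₀).1 (hcont _ ev₀).2
    have hc1 := hcb.mul (hc0.comp (f := Prod.snd) (x := ((s₀, ob.incl b) : ℝ × M)) continuousAt_snd)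
    have hpos := hc1.eventually (lt_mem_nhds (h.core_segment hs₀ b hf.self_of_nhds))
    have hf' : ∀ᶠ q in 𝓝 ((s₀, ob.incl b) : ℝ × M), LinearIndependent ℝ (f q.2) := by
      rw [nhds_prod_eq]; exact hf.prod_inr _
    have h9 : ∀ᶠ q in 𝓝 ((s₀, ob.incl b) : ℝ × M), ∀ v, LinearIndependent ℝ v →
      0 < volumeChange (n + 1) (segmentForm α₀ α₁ q.1) ob.coreForm q.2 v *
        contactVolume (n + 1) α₀ q.2 v := by
      filter_upwards [hpos, hf'] with q h1 h2 v hv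
      exact volumeChange_mul_contactVolume_pos (finrank_total n) h2 hv h1
    exact (continuous_swap.tendsto ((ob.incl b, s₀) : M × ℝ)).eventually h9
  obtain ⟨r, hr, hr', hsub⟩ := OpenBook.exists_tube_subset hU
  exact ⟨r, hr, hr', fun s hs x hx hlt v hv => hsub x hx hlt s hs v hv⟩

theorem volumeChange_bindingForm_pos {α₀ α₁ : OneForm JM M} (h : SamePages ob α₀ α₁) {r : ℝ} (hr : 0 < r) (hr' : r < ob.δ)
    (hrad : ∀ s ∈ Icc (0 : ℝ) 1, ∀ x ∈ ob.tube.target, ob.rsq x < r ^ 2 → ∀ v,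
      LinearIndependent ℝ v → 0 < volumeChange (n + 1) (segmentForm α₀ α₁ s) ob.coreForm x v *
        contactVolume (n + 1) α₀ x v) {s : ℝ} (hs : s ∈ Icc (0 : ℝ) 1) (x : M)
    {v : Fin (2 * (n + 1) + 1) → TangentSpace JM x} (hv : LinearIndependent ℝ v) :
    0 < volumeChange (n + 1) (segmentForm α₀ α₁ s) (ob.bindingForm (r ^ 2)) x v *
      contactVolume (n + 1) α₀ x v := by
  by_cases hx : x ∈ range ob.incl
  · obtain ⟨b, rfl⟩ := hx
    rw [OpenBook.volumeChange_bindingForm_incl (by positivity)]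
    exact h.core_segment hs b hv
  · have h1 := h.positive x hx v hv
    have h2 := OpenBook.volumeChange_bindingForm_mul_pos hr hr' hx
      ((h.smoothAt₀ x).segmentForm (h.smoothAt₁ x) s) (v := v)
      (by
        rw [h.oddForm_segment s hx]
        exact left_ne_zero_of_mul h1.ne')
      (fun hxt hlt => by
        rw [h.oddForm_segment s hx]
        exact pos_of_mul_pos_mul_pos (hrad s hs x hxt hlt v hv) (by rwa [mul_comm] at h1))
    rw [h.oddForm_segment s hx] at h2
    exact pos_of_mul_pos_mul_pos h2 h1

/-- The segment between the two forms becomes contact after adding a suitable form `η`, which may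
be added to both ends without losing the contact property. -/
theorem exists_path {α₀ α₁ : OneForm JM M} (h : SamePages ob α₀ α₁) [CompactSpace M] : ∃ η : OneForm JM M, η.IsSmooth ∧
    (∀ c : ℝ, 0 ≤ c → IsContactForm (n + 1) (α₀ + c • η)) ∧
    (∀ c : ℝ, 0 ≤ c → IsContactForm (n + 1) (α₁ + c • η)) ∧
    ∀ s ∈ Icc (0 : ℝ) 1, IsContactForm (n + 1) (segmentForm α₀ α₁ s + η) := by
  obtain ⟨r, hr, hr', hrad⟩ := h.exists_radius
  obtain ⟨K, hK0, hK⟩ := OpenBook.exists_contact_perturbation (ob := ob) h.contact₀.smooth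
    h.contact₁.smooth hr hr'
    (fun s hs x hx v hv => by
      rw [h.oddForm_segment s hx]
      exact left_ne_zero_of_mul (h.positive x hx v hv).ne')
    (fun s hs b v hv => left_ne_zero_of_mul (h.core_segment hs b hv).ne')
    (fun s hs x hxt hx hlt v hv => by
      rw [h.oddForm_segment s hx]
      have h1 := h.positive x hx v hv
      rw [mul_comm] at h1
      exact pos_of_mul_pos_mul_pos (hrad s hs x hxt hlt v hv) h1)
  have hsm := OpenBook.isSmooth_bindingForm hr hr' (ob := ob)
  have hη := isSmooth_iff.1 hsm
  have hend : ∀ s ∈ Icc (0 : ℝ) 1, (∀ x v, LinearIndependent ℝ v →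
      0 < contactVolume (n + 1) (segmentForm α₀ α₁ s) x v * contactVolume (n + 1) α₀ x v) →
      ∀ c : ℝ, 0 ≤ c → IsContactForm (n + 1) (segmentForm α₀ α₁ s + c • (K • ob.bindingForm (r ^ 2))) := by
    intro s hs hvol c hc
    refine ⟨isSmooth_iff.2 fun x => ((h.smoothAt₀ x).segmentForm (h.smoothAt₁ x) s).add
      (((hη x).smul _).smul _), fun x v hv => ?_⟩
    obtain ⟨p, q, e, he, hd⟩ := OpenBook.exists_decomposition_bindingForm (ob := ob) hr hr' x
    have hγ := (h.smoothAt₀ x).segmentForm (h.smoothAt₁ x) s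
    rw [smul_smul, contactVolume_add_smul (n + 1) hγ (hη x) he hd,
      ← volumeChange_eq (n + 1) hγ (hη x) he hd]
    have h1 := hvol x v hv
    have h2 := h.volumeChange_bindingForm_pos hr hr' hrad hs x hv
    intro h3
    have h4 : 0 ≤ c * K * (volumeChange (n + 1) (segmentForm α₀ α₁ s) (ob.bindingForm (r ^ 2)) x v *
        contactVolume (n + 1) α₀ x v) := mul_nonneg (mul_nonneg hc hK0) h2.le
    have h5 := congrArg (· * contactVolume (n + 1) α₀ x v) h3
    simp only [zero_mul, add_mul] at h5
    linarith
  refine ⟨K • ob.bindingForm (r ^ 2), isSmooth_iff.2 fun x => (hη x).smul _, ?_, ?_, ?_⟩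
  · have h1 := hend 0 ⟨le_rfl, zero_le_one⟩
    rw [segmentForm_zero] at h1
    exact h1 fun x v hv => mul_self_pos.2 (h.contact₀.volume_ne_zero x v hv)
  · have h1 := hend 1 ⟨zero_le_one, le_rfl⟩
    rw [segmentForm_one] at h1
    exact h1 fun x v hv => by rw [mul_comm]; exact h.sign x v hv
  · exact fun s hs => ⟨isSmooth_iff.2 fun x =>
      ((h.smoothAt₀ x).segmentForm (h.smoothAt₁ x) s).add ((hη x).smul _),
      fun x v hv => left_ne_zero_of_mul (hK K le_rfl s hs x v hv).ne'⟩

end SamePages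

theorem samePages_pullback {α₀ α₁ : OneForm JM M} (h₀ : IsContactForm (n + 1) α₀)
    (hs₀ : ob.Supports α₀) (h₁ : IsContactForm (n + 1) α₁) (hs₁ : ob.Supports α₁)
    {F : ℝ → (M ≃ₘ⟮JM, JM⟯ M)} (hF : IsIsotopy F) (hFi : ∀ b, F 1 (ob.incl b) = ob.incl b)
    (hFp : ∀ x ∉ range ob.incl, ob.proj (F 1 x) = ob.proj x)
    (hFd : ∀ x ∉ range ob.incl, ∀ u v : TangentSpace JM x, ob.angleForm x u = 0 →
      ob.angleForm x v = 0 → α₁.d (F 1 x) (mfderiv JM JM (F 1) x u) (mfderiv JM JM (F 1) x v) =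
        α₀.d x u v) :
    SamePages ob α₀ (pullback (I' := JM) (F 1) α₁) := by
  have hc := h₁.pullback (F 1)
  have hpages : ∀ x ∉ range ob.incl, ∀ u v : TangentSpace JM x, ob.angleForm x u = 0 →
      ob.angleForm x v = 0 → (pullback (I' := JM) (F 1) α₁).d x u v = α₀.d x u v :=
    fun x hx u v hu hv => (OneForm.d_pullback (isSmooth_iff.1 h₁.smooth _)
      ((F 1).contMDiff x) u v).trans (hFd x hx u v hu hv)
  have hsign : ∀ (x : M) (v : Fin (2 * (n + 1) + 1) → TangentSpace JM x), LinearIndependent ℝ v →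
      0 < contactVolume (n + 1) α₀ x v *
        contactVolume (n + 1) (pullback (I' := JM) (F 1) α₁) x v := by
    refine fun x v hv => OpenBook.contactVolume_mul_pos_of_off (ob := ob) h₀ hc
      (fun x hx v hv => ?_) x hv
    have e1 := hs₀.pages h₀ hx hv
    have e2 := OpenBook.mul_pos_pages_pullback h₁ hs₁ hFi hFp hx hv
    have e3 : oddForm (n + 1) (ob.angleForm x).toLinearMap
        ((pullback (I' := JM) (F 1) α₁).dB x) v =
        oddForm (n + 1) (ob.angleForm x).toLinearMap (α₀.dB x) v :=
      oddForm_congr_ker (OneForm.dB_neg _ x) (α₀.dB_neg x)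
        (fun u w hu hw => hpages x hx u w hu hw) v
    rw [e3] at e2
    rw [mul_comm] at e1
    exact pos_of_mul_pos_mul_pos e1 e2
  refine ⟨h₀, hc, hpages, fun x hx v hv => hs₀.pages h₀ hx hv, hsign,
    fun b v hv => hs₀.binding b hv, fun b v hv => ?_⟩
  have e1 : pullback (I := JM) (I' := JB) ob.incl (pullback (I' := JM) (F 1) α₁) =
      pullback (I := JM) (I' := JB) ob.incl α₁ := by
    have e2 : (F 1 ∘ ob.incl) = ob.incl := funext hFi
    funext b
    have e3 := OneForm.pullback_comp (I'' := JB) α₁ (f := F 1) (g := ob.incl) (x := b)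
      ((F 1).contMDiff.mdifferentiableAt (by simp))
      ((ob.contMDiff_incl b).mdifferentiableAt (by simp))
    rw [e2] at e3
    exact e3.symm
  rw [e1]
  have hv' := OpenBook.linearIndependent_appendFrame (ob := ob) b hv
  have e4 := hs₁.binding b hv
  have e5 := contactVolume_isotopy_pos h₁ hF 1 (ob.incl b) hv'
  have e6 := hsign (ob.incl b) _ hv'
  rw [mul_comm] at e6
  exact pos_of_mul_pos_mul_pos (pos_of_mul_pos_mul_pos e4 e5) e6

/-- Contact forms that support the same open book and induce symplectomorphic pages define isotopic
contact structures. -/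
theorem OpenBook.isotopicThroughContact [CompactSpace M] {α₀ α₁ : OneForm JM M}
    (h₀ : IsContactForm (n + 1) α₀)
    (hs₀ : ob.Supports α₀) (h₁ : IsContactForm (n + 1) α₁) (hs₁ : ob.Supports α₁)
    (h : ob.SymplectomorphicPages α₀ α₁) : IsotopicThroughContact (n + 1) α₀ α₁ := by
  obtain ⟨F, hF, hFi, hF'⟩ := h
  have hS := samePages_pullback h₀ hs₀ h₁ hs₁ hF hFi (fun x hx => (hF' x hx).1)
    (fun x hx => (hF' x hx).2)
  obtain ⟨η, hη, c₀, c₁, cs⟩ := hS.exists_path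
  let st : ℝ → ℝ := Real.smoothTransition
  have hst : ContDiff ℝ ∞ st := Real.smoothTransition.contDiff
  have st0 : ∀ {s : ℝ}, s ≤ 0 → st s = 0 := fun h => Real.smoothTransition.zero_of_nonpos h
  have st1 : ∀ {s : ℝ}, 1 ≤ s → st s = 1 := fun h => Real.smoothTransition.one_of_one_le h
  have stI : ∀ s : ℝ, st s ∈ Icc (0 : ℝ) 1 := fun s =>
    ⟨Real.smoothTransition.nonneg s, Real.smoothTransition.le_one s⟩
  let A : ℝ → OneForm JM M := fun s => segmentForm α₀
    (pullback (I' := JM) (F (st (4 - 4 * s))) α₁) (st (4 * s - 1)) +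
      (st (4 * s) * st (3 - 4 * s)) • η
  have hA : IsSmoothFamily A := by
    refine IsSmoothFamily.add (IsSmoothFamily.add ?_ ?_) ?_
    · exact (h₀.smooth.isSmoothFamily_const).smul (c := fun s => 1 - st (4 * s - 1))
        (contDiff_const.sub (hst.comp (by fun_prop)))
    · exact ((isSmoothFamily_pullback_isotopy h₁.smooth hF).comp (c := fun s => st (4 - 4 * s))
        (hst.comp (by fun_prop))).smul (c := fun s => st (4 * s - 1)) (hst.comp (by fun_prop))
    · exact hη.isSmoothFamily_const.smul (c := fun s => st (4 * s) * st (3 - 4 * s))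
        ((hst.comp (by fun_prop)).mul (hst.comp (by fun_prop)))
  have A1 : ∀ s ≤ 1 / 4, A s = α₀ + (st (4 * s) * st (3 - 4 * s)) • η := fun s hs => by
    show segmentForm _ _ _ + _ = _
    rw [st0 (s := 4 * s - 1) (by linarith), segmentForm_zero]
  have A2 : ∀ s, 1 / 2 ≤ s → A s = pullback (I' := JM) (F (st (4 - 4 * s))) α₁ +
      (st (4 * s) * st (3 - 4 * s)) • η := fun s hs => by
    show segmentForm _ _ _ + _ = _
    rw [st1 (s := 4 * s - 1) (by linarith), segmentForm_one]
  have A3 : ∀ s, 3 / 4 ≤ s → A s = pullback (I' := JM) (F (st (4 - 4 * s))) α₁ :=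
    fun s hs => by
      rw [A2 s (by linarith), st0 (s := 3 - 4 * s) (by linarith), mul_zero, zero_smul, add_zero]
  have hc : ∀ s, IsContactForm (n + 1) (A s) := by
    intro s
    have hχ : 0 ≤ st (4 * s) * st (3 - 4 * s) := mul_nonneg (stI _).1 (stI _).1
    rcases le_total s (1 / 4) with hs | hs
    · rw [A1 s hs]; exact c₀ _ hχ
    rcases le_total s (1 / 2) with hs' | hs'
    · have e : A s = segmentForm α₀ (pullback (I' := JM) (F 1) α₁) (st (4 * s - 1)) + η := by
        show segmentForm _ _ _ + _ = _
        rw [st1 (s := 4 - 4 * s) (by linarith), st1 (s := 4 * s) (by linarith),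
          st1 (s := 3 - 4 * s) (by linarith), mul_one, one_smul]
      rw [e]
      exact cs _ (stI _)
    rcases le_total s (3 / 4) with hs'' | hs''
    · rw [A2 s hs', st1 (s := 4 - 4 * s) (by linarith)]
      exact c₁ _ hχ
    · rw [A3 s hs'']
      exact h₁.pullback _
  have Aneg : ∀ s ≤ 0, A s = α₀ := fun s hs => by
    rw [A1 s (by linarith), st0 (s := 4 * s) (by linarith), zero_mul, zero_smul, add_zero]
  have Aone : ∀ s, 1 ≤ s → A s = α₁ := fun s hs => by
    have e : (F 0 : M → M) = id := funext hF.2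
    rw [A3 s (by linarith), st0 (s := 4 - 4 * s) (by linarith), e, OneForm.pullback_id]
  obtain ⟨Φ, hΦ, hΦ'⟩ := gray (finrank_total n) hA hc
    (fun s hs => (Aneg s hs).trans (Aneg 0 le_rfl).symm)
    (fun s hs => (Aone s hs).trans (Aone 1 le_rfl).symm)
  refine ⟨A, Φ, hA, Aneg 0 le_rfl, Aone 1 le_rfl, hΦ, fun s _ => ⟨hc s, ?_⟩⟩
  rw [← Aneg 0 le_rfl]
  exact hΦ' s

end OpenBooks

/-! ### The topology of the closed manifold -/

section TotalSpace

open Set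

variable {P : Type*} [TopologicalSpace P]
  [ChartedSpace (EuclideanHalfSpace (2 * n + 2)) P]
  {Ψ : P ≃ₘ⟮𝓡∂ (2 * n + 2), 𝓡∂ (2 * n + 2)⟯ P}

open Classical in
/-- The representative with time in `[0, 1)` of an interior point of the closed manifold. -/
def normalForm : Total Ψ → Option (P × ℝ) :=
  Quot.lift (fun p => if p.1 ∈ (JP).interior P then
    some (if (p.2 : ℝ) < 1 then (p.1, (p.2 : ℝ)) else (Ψ p.1, 0)) else none) (by
    rintro _ _ (⟨p, hp, t, s⟩ | ⟨q⟩)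
    · rw [← (JP).compl_interior] at hp
      simp only [if_neg hp]
    · simp [interior_iff])

theorem normalForm_susp {x : P} (hx : x ∈ (JP).interior P) (t : ℝ) :
    normalForm (susp Ψ (x, t)) = some (((Ψ.toEquiv : Equiv.Perm P) ^ ⌊t⌋) x, Int.fract t) := by
  simp only [normalForm, susp]
  rw [if_pos ((zpow_interior_iff _ _).2 hx), if_pos (Int.fract_lt_one t)]

theorem normalForm_susp_boundary {x : P} (hx : x ∉ (JP).interior P) (t : ℝ) :
    normalForm (susp Ψ (x, t)) = none := by
  simp only [normalForm, susp]
  rw [if_neg fun h => hx ((zpow_interior_iff _ _).1 h)]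

theorem mk_eq_susp (p : P) (t : unitInterval) : Quot.mk (Glue Ψ) (p, t) = susp Ψ (p, (t : ℝ)) := by
  by_cases ht : (t : ℝ) < 1
  · have h1 : ⌊(t : ℝ)⌋ = 0 := Int.floor_eq_zero_iff.2 ⟨t.2.1, ht⟩
    have h2 : Int.fract (t : ℝ) = t := Int.fract_eq_self.2 ⟨t.2.1, ht⟩
    simp [susp, h1, h2]
  · have h1 : t = 1 := le_antisymm t.2.2 (not_lt.1 ht)
    rw [h1, ← Quot.sound (Glue.monodromy p)]
    simp [susp]

theorem susp_add_int (x : P) (t : ℝ) (k : ℤ) :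
    susp Ψ (x, t + k) = susp Ψ (((Ψ.toEquiv : Equiv.Perm P) ^ k) x, t) := by
  simp only [susp, Int.floor_add_intCast, Int.fract_add_intCast]
  rw [zpow_add]
  rfl

/-- The half line `[0, ∞)`. -/
def halfLine (r : ℝ) : H1 := ⟨!₂[max r 0], by simp⟩

theorem halfLine_val {r : ℝ} (hr : 0 ≤ r) : (halfLine r).val 0 = r := by simp [halfLine, hr]

theorem eq_halfLine (r : H1) : r = halfLine (r.val 0) := by
  apply Subtype.ext
  ext i
  fin_cases i
  exact (halfLine_val r.2).symm

variable {B : Type*} [TopologicalSpace B] [ChartedSpace (EuclideanSpace ℝ (Fin (2 * n + 1))) B]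
  [ChartedSpace (EuclideanSpace ℝ (Fin (2 * n + 3))) (Total Ψ)]

namespace SmoothGluing

variable (S : SmoothGluing Ψ B)

theorem tube_polar (b : B) {r : ℝ} (hr : 0 ≤ r) (hr' : r < S.δ) (t : ℝ) :
    S.tube (b, (r : ℂ) * Complex.exp (2 * Real.pi * t * Complex.I)) =
      susp Ψ (S.collar (b, halfLine r), t) := by
  have h := S.tube_eq b (halfLine r) t (by rwa [halfLine_val hr])
  rwa [halfLine_val hr] at h

theorem exists_polar (z : ℂ) : ∃ t : ℝ,
    z = (‖z‖ : ℂ) * Complex.exp (2 * Real.pi * t * Complex.I) := by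
  refine ⟨Complex.arg z / (2 * Real.pi), ?_⟩
  have h : (2 * Real.pi * ((Complex.arg z / (2 * Real.pi) : ℝ) : ℂ)) = Complex.arg z := by
    push_cast
    field_simp
  rw [h, Complex.norm_mul_exp_arg_mul_I]

theorem exists_tube_eq_susp (b : B) {z : ℂ} (hz : ‖z‖ < S.δ) :
    ∃ t : ℝ, S.tube (b, z) = susp Ψ (S.collar (b, halfLine ‖z‖), t) := by
  obtain ⟨t, ht⟩ := exists_polar z
  refine ⟨t, ?_⟩
  rw [← S.tube_polar b (norm_nonneg z) hz t, ← ht]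

theorem collar_halfLine_interior_iff (b : B) {r : ℝ} (hr : 0 ≤ r) (hr' : r < S.δ) :
    S.collar (b, halfLine r) ∈ (JP).interior P ↔ 0 < r := by
  have h := S.collar_interior_iff b (halfLine r) (by rwa [halfLine_val hr])
  rwa [halfLine_val hr] at h

theorem monodromy_collar (b : B) {r : ℝ} (hr : 0 < r) (hr' : r < S.δ) :
    Ψ (S.collar (b, halfLine r)) = S.collar (b, halfLine r) := by
  have hi := (S.collar_halfLine_interior_iff b hr.le hr').2 hr
  have h0 := S.tube_polar b hr.le hr' 0
  have h1 := S.tube_polar b hr.le hr' 1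
  have e : (r : ℂ) * Complex.exp (2 * Real.pi * (1 : ℝ) * Complex.I) =
      (r : ℂ) * Complex.exp (2 * Real.pi * (0 : ℝ) * Complex.I) := by
    simp
  rw [e, h0] at h1
  have h2 := congrArg normalForm h1
  rw [normalForm_susp hi, normalForm_susp hi] at h2
  simp only [Option.some.injEq, Prod.mk.injEq, Int.floor_zero, Int.floor_one, zpow_zero,
    zpow_one] at h2
  exact h2.1.symm

theorem exists_collar_eq {p : P} (hp : p ∈ (JP).boundary P) :
    ∃ b, p = S.collar (b, halfLine 0) := by
  have hpt := S.collar_target hp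
  have hs := S.collar.map_target' hpt
  have hr := S.collar.right_inv' hpt
  generalize S.collar.invFun p = c at hs hr
  obtain ⟨b, r⟩ := c
  rw [S.collar_source] at hs
  refine ⟨b, ?_⟩
  have hr' : S.collar (b, r) = p := hr
  have h0 : ¬ 0 < r.val 0 := fun h => by
    rw [← (JP).compl_interior] at hp
    exact hp (hr' ▸ (S.collar_interior_iff b r hs).2 h)
  rw [← hr', eq_halfLine r, le_antisymm (not_lt.1 h0) r.2]

theorem collar_mem_source (b : B) {r : ℝ} (hr : r < S.δ) : (b, halfLine r) ∈ S.collar.source := by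
  rw [S.collar_source]
  show max r 0 < S.δ
  exact max_lt hr S.δ_pos

theorem continuous_collar_zero : Continuous fun b => S.collar (b, halfLine 0) :=
  continuous_iff_continuousAt.2 fun b => ContinuousAt.comp (f := fun b : B => (b, halfLine 0))
    (S.collar.toOpenPartialHomeomorph.continuousAt (S.collar_mem_source b S.δ_pos)) (by fun_prop)

theorem injective_collar_zero : Function.Injective fun b => S.collar (b, halfLine 0) :=
  fun b b' h => congrArg Prod.fst (S.collar.injOn (S.collar_mem_source b S.δ_pos)
    (S.collar_mem_source b' S.δ_pos) h)

theorem t2Space_binding (S : SmoothGluing Ψ B) [T2Space P] : T2Space B :=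
  T2Space.of_injective_continuous S.injective_collar_zero S.continuous_collar_zero

theorem compactSpace_binding (S : SmoothGluing Ψ B) [CompactSpace P] [IsManifold JP ∞ P] :
    CompactSpace B := by
  have hc : IsCompact ((JP).boundary P) :=
    ((JP).isClosed_boundary (n := ∞) (by simp)).isCompact
  have h := hc.image_of_continuousOn (f := fun p => (S.collar.symm p).1)
    (continuous_fst.comp_continuousOn
      (S.collar.toOpenPartialHomeomorph.symm.continuousOn.mono S.collar_target))
  refine ⟨?_⟩
  convert h
  symm
  refine eq_univ_of_forall fun b => ⟨S.collar (b, halfLine 0), ?_, ?_⟩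
  · rw [← (JP).compl_interior]
    exact fun h => lt_irrefl _ ((S.collar_halfLine_interior_iff b le_rfl S.δ_pos).1 h)
  · exact congrArg Prod.fst (S.collar.left_inv' (S.collar_mem_source b S.δ_pos))

theorem isClosed_tube_image [T2Space P] [CompactSpace P] [IsManifold JP ∞ P] {ρ : ℝ}
    (hρ' : ρ < S.δ) : IsClosed (S.tube '' (univ ×ˢ Metric.closedBall 0 ρ)) := by
  have := S.compactSpace_binding
  rcases lt_or_ge ρ 0 with hneg | hρ
  · simp [Metric.closedBall_eq_empty.2 hneg]
  have hK : IsCompact ((fun q : B × ℝ => S.collar (q.1, halfLine q.2)) '' (univ ×ˢ Icc 0 ρ)) := by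
    refine (isCompact_univ.prod isCompact_Icc).image_of_continuousOn fun q hq => ?_
    refine ContinuousAt.continuousWithinAt (ContinuousAt.comp
      (f := fun q : B × ℝ => (q.1, halfLine q.2)) (S.collar.toOpenPartialHomeomorph.continuousAt
        (S.collar_mem_source q.1 (hq.2.2.trans_lt hρ'))) ?_)
    refine continuousAt_fst.prodMk (Continuous.continuousAt ?_)
    refine Continuous.subtype_mk ?_ _
    fun_prop
  refine (isQuotientMap_quot_mk (r := Glue Ψ)).isClosed_preimage.1 ?_
  have e : Quot.mk (Glue Ψ) ⁻¹' (S.tube '' (univ ×ˢ Metric.closedBall 0 ρ)) =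
      ((fun q : B × ℝ => S.collar (q.1, halfLine q.2)) '' (univ ×ˢ Icc 0 ρ)) ×ˢ univ := by
    ext ⟨p, t⟩
    constructor
    · rintro ⟨⟨b, z⟩, ⟨-, hz⟩, h⟩
      rw [mem_closedBall_zero_iff] at hz
      refine ⟨?_, mem_univ _⟩
      have hz' := hz.trans_lt hρ'
      obtain ⟨s, hs⟩ := S.exists_tube_eq_susp b hz'
      rw [mk_eq_susp] at h
      have h1 : susp Ψ (S.collar (b, halfLine ‖z‖), s) = susp Ψ (p, (t : ℝ)) := hs.symm.trans h
      by_cases hp : p ∈ (JP).interior P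
      · have h2 := congrArg normalForm h1
        rw [normalForm_susp hp] at h2
        have hi : S.collar (b, halfLine ‖z‖) ∈ (JP).interior P := by
          by_contra hn
          rw [normalForm_susp_boundary hn] at h2
          simp at h2
        rw [normalForm_susp hi] at h2
        have hpos := (S.collar_halfLine_interior_iff b (norm_nonneg z) hz').1 hi
        have hfix : (Ψ.toEquiv : Equiv.Perm P) (S.collar (b, halfLine ‖z‖)) =
          S.collar (b, halfLine ‖z‖) := S.monodromy_collar b hpos hz'
        simp only [Option.some.injEq, Prod.mk.injEq] at h2
        have h3 := h2.1
        rw [Equiv.Perm.zpow_apply_eq_self_of_apply_eq_self hfix] at h3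
        refine ⟨(b, ‖z‖), ⟨mem_univ _, norm_nonneg z, hz⟩, ?_⟩
        apply ((Ψ.toEquiv : Equiv.Perm P) ^ ⌊(t : ℝ)⌋).injective
        rw [← h3, Equiv.Perm.zpow_apply_eq_self_of_apply_eq_self hfix]
      · rw [← mem_compl_iff, (JP).compl_interior] at hp
        obtain ⟨b', hb'⟩ := S.exists_collar_eq hp
        exact ⟨(b', 0), ⟨mem_univ _, le_rfl, hρ⟩, hb'.symm⟩
    · rintro ⟨⟨⟨b, r⟩, ⟨-, hr⟩, hp⟩, -⟩
      have hp' : S.collar (b, halfLine r) = p := hp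
      refine ⟨(b, (r : ℂ) * Complex.exp (2 * Real.pi * (t : ℝ) * Complex.I)), ⟨mem_univ _, ?_⟩, ?_⟩
      · rw [mem_closedBall_zero_iff, norm_mul,
          show (2 * Real.pi * (t : ℝ) * Complex.I : ℂ) = ((2 * Real.pi * (t : ℝ) : ℝ) : ℂ) * Complex.I by
            push_cast; rfl, Complex.norm_exp_ofReal_mul_I, mul_one, Complex.norm_real,
          Real.norm_of_nonneg hr.1]
        exact hr.2
      · show S.tube _ = Quot.mk _ _
        rw [S.tube_polar b hr.1 (hr.2.trans_lt hρ'), hp', mk_eq_susp]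
  rw [e]
  exact hK.isClosed.prod isClosed_univ

theorem mem_tube_source (b : B) {z : ℂ} (hz : ‖z‖ < S.δ) : (b, z) ∈ S.tube.source := by
  rw [S.tube_source]; exact ⟨mem_univ _, by simpa using hz⟩

theorem susp_notMem_core {x : P} (hx : x ∈ (JP).interior P) (t : ℝ) :
    susp Ψ (x, t) ∉ range fun b => S.tube (b, 0) := by
  rintro ⟨b, hb⟩
  have hb' : S.tube (b, 0) = susp Ψ (x, t) := hb
  obtain ⟨s, hs⟩ := S.exists_tube_eq_susp b (z := 0) (by simpa using S.δ_pos)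
  rw [hs] at hb'
  have h := congrArg normalForm hb'
  rw [normalForm_susp hx, normalForm_susp_boundary] at h
  · simp at h
  · rw [norm_zero]
    exact fun h => lt_irrefl _ ((S.collar_halfLine_interior_iff b le_rfl S.δ_pos).1 h)

theorem disjoint_nhds_core [T2Space P] [CompactSpace P] [IsManifold JP ∞ P] (b : B)
    {y : Total Ψ} (hy : y ≠ S.tube (b, 0)) : Disjoint (𝓝 y) (𝓝 (S.tube (b, 0))) := by
  have := S.t2Space_binding
  have h0 := S.mem_tube_source b (z := 0) (by simpa using S.δ_pos)
  by_cases hyt : y ∈ S.tube.target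
  · have c1 := S.tube.toOpenPartialHomeomorph.symm.continuousAt hyt
    have c2 := S.tube.toOpenPartialHomeomorph.symm.continuousAt (S.tube.map_source' h0)
    refine Filter.Tendsto.disjoint c1 (disjoint_nhds_nhds.2 fun h => hy ?_) c2
    exact S.tube.symm.injOn hyt (S.tube.map_source' h0) h
  · have hδ := S.δ_pos
    have hc := S.isClosed_tube_image (ρ := S.δ / 2) (by linarith)
    have ho := S.tube.toOpenPartialHomeomorph.image_mem_nhds h0
      (prod_mem_nhds (Filter.univ_mem (f := 𝓝 b)) (Metric.closedBall_mem_nhds (0 : ℂ) (half_pos hδ)))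
    refine Filter.disjoint_iff.2 ⟨_, hc.isOpen_compl.mem_nhds ?_, _, ho, disjoint_compl_left⟩
    rintro ⟨⟨b', z⟩, ⟨-, hz⟩, rfl⟩
    rw [mem_closedBall_zero_iff] at hz
    exact hyt (S.tube.map_source' (S.mem_tube_source b' (by linarith)))

theorem disjoint_nhds_susp (S : SmoothGluing Ψ B) [T2Space P] [IsManifold JP ∞ P] {x x' : P}
    (hx : x ∈ (JP).interior P) (hx' : x' ∈ (JP).interior P) (t t' : ℝ)
    (h : susp Ψ (x, t) ≠ susp Ψ (x', t')) :
    Disjoint (𝓝 (susp Ψ (x, t))) (𝓝 (susp Ψ (x', t'))) := by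
  by_cases ha : (angle Ψ (susp Ψ (x, t)) : ℂ) = angle Ψ (susp Ψ (x', t'))
  swap
  · exact Filter.Tendsto.disjoint (S.angle_contMDiffAt hx t).continuousAt (disjoint_nhds_nhds.2 ha)
      (S.angle_contMDiffAt hx' t').continuousAt
  rw [angle_susp hx, angle_susp hx', Circle.coe_inj] at ha
  obtain ⟨k, hk⟩ : ∃ k : ℤ, t = t' + k := by
    obtain ⟨k, hk⟩ := Circle.exp_eq_exp.1 ha
    refine ⟨k, ?_⟩
    have hp : (2 * Real.pi) ≠ 0 := by positivity
    have h2 : 2 * Real.pi * t = 2 * Real.pi * (t' + k) := by rw [hk]; ring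
    exact mul_left_cancel₀ hp h2
  rw [hk, susp_add_int] at h ⊢
  have hx₁ := (zpow_interior_iff (Ψ := Ψ) k x).2 hx
  generalize ((Ψ.toEquiv : Equiv.Perm P) ^ k) x = x₁ at h hx₁ ⊢
  have hne : x₁ ≠ x' := fun e => h (by rw [e])
  obtain ⟨U, U', hU, hU', hxU, hxU', hd⟩ := t2_separation hne
  have hopen : ∀ {p : P}, p ∈ (JP).interior P → ∀ V : Set P, IsOpen V → p ∈ V →
      susp Ψ '' ((V ∩ (JP).interior P) ×ˢ Metric.ball t' (1 / 2)) ∈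
        𝓝 (susp Ψ (p, t')) := by
    intro p hp V hV hpV
    have hl := (S.susp_localDiffeo.isLocalHomeomorphOn).map_nhds_eq
      (⟨hp, mem_univ _⟩ : ((p, t') : P × ℝ) ∈ (JP).interior P ×ˢ univ)
    rw [← hl]
    exact Filter.image_mem_map (prod_mem_nhds ((hV.inter
      ((JP).isOpen_interior (n := ∞) (by simp))).mem_nhds ⟨hpV, hp⟩)
      (Metric.ball_mem_nhds _ (by norm_num)))
  refine Filter.disjoint_iff.2 ⟨_, hopen hx₁ U hU hxU, _, hopen hx' U' hU' hxU', ?_⟩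
  rw [Set.disjoint_left]
  rintro _ ⟨⟨p, s⟩, ⟨⟨hp, hpi⟩, hs⟩, rfl⟩ ⟨⟨p', s'⟩, ⟨⟨hp', hpi'⟩, hs'⟩, he⟩
  have h1 := congrArg normalForm he
  rw [normalForm_susp hpi, normalForm_susp hpi', Option.some.injEq, Prod.mk.injEq] at h1
  have hs1 : |s - t'| < 1 / 2 := hs
  have hs2 : |s' - t'| < 1 / 2 := hs'
  have hse : s' = s := by
    obtain ⟨m, hm⟩ := Int.fract_eq_fract.1 h1.2
    have h5 : |(m : ℝ)| < 1 := by
      rw [← hm]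
      rw [abs_lt] at hs1 hs2 ⊢
      constructor <;> linarith
    have h6 : m = 0 := by
      have : |m| < 1 := by exact_mod_cast h5
      exact Int.abs_lt_one_iff.1 this
    rw [h6] at hm
    simpa [sub_eq_zero] using hm
  rw [hse] at h1
  have h7 := ((Ψ.toEquiv : Equiv.Perm P) ^ ⌊s⌋).injective h1.1
  exact Set.disjoint_left.1 hd hp (h7 ▸ hp')

theorem t2Space_total (S : SmoothGluing Ψ B) [T2Space P] [CompactSpace P] [IsManifold JP ∞ P] :
    T2Space (Total Ψ) := by
  refine t2Space_iff_disjoint_nhds.2 fun y y' h => ?_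
  by_cases hy : y ∈ range fun b => S.tube (b, 0)
  · obtain ⟨b, rfl⟩ := hy
    exact (S.disjoint_nhds_core b h.symm).symm
  by_cases hy' : y' ∈ range fun b => S.tube (b, 0)
  · obtain ⟨b, rfl⟩ := hy'
    exact S.disjoint_nhds_core b h
  obtain ⟨x, hx, t, rfl⟩ := S.exists_susp hy
  obtain ⟨x', hx', t', rfl⟩ := S.exists_susp hy'
  exact S.disjoint_nhds_susp hx hx' t t' h

end SmoothGluing

end TotalSpace

/-! ### Forms on a collar -/

section Algebra

variable {V : Type*} [AddCommGroup V] [Module ℝ V] [FiniteDimensional ℝ V]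

open ExteriorAlgebra

theorem mixedForm_cons_cons {p q : Module.Dual ℝ V} {k : ℕ} (a : Module.Dual ℝ V)
    (w : BilinForm ℝ V) (v : Fin (2 * k + 1) → V) (hp : ∀ i, p (v i) = 0)
    (hq : ∀ i, q (v i) = 0) {X : V} (hX : q X = 0) (Y : V) :
    mixedForm (k + 1) a p q w (Fin.cons Y (Fin.cons X v : Fin (2 * k + 1 + 1) → V)) =
      -((k + 1) * (q Y * (p X * wedgeWedgePow k a (fun x y => w x y) v))) := by
  have h : ι ℝ a * (ι ℝ p * ι ℝ q * twoForm w ^ (k + 1 - 1)) =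
      -(ι ℝ q * (ι ℝ p * (ι ℝ a * twoForm w ^ k))) := by
    rw [Nat.add_sub_cancel, ← mul_assoc, (commute_ι_mul_ι a p q).eq, ι_mul_ι_swap p q, neg_mul,
      neg_mul, mul_assoc, mul_assoc]
  rw [mixedForm_eq, h, map_neg]
  have h1 := evalForm_cons_ι_mul (q := q) (Fin.cons X v : Fin (2 * k + 1 + 1) → V)
    (fun i => by
      refine Fin.cases ?_ (fun j => ?_) i
      · exact hX
      · exact hq j) Y (ι ℝ p * (ι ℝ a * twoForm w ^ k))
  have h2 := evalForm_cons_ι_mul (q := p) v hp X (ι ℝ a * twoForm w ^ k)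
  rw [← wedgeWedgePow_eq] at h2
  rw [h2] at h1
  push_cast
  rw [mul_neg]
  exact congrArg (fun c => -(((k : ℝ) + 1) * c)) h1

theorem continuousAt_wedgePow {X : Type*} [TopologicalSpace X] {p₀ : X} (k : ℕ)
    {V : X → Type*} {w : ∀ p, V p → V p → ℝ} {v : ∀ p, Fin (2 * k) → V p}
    (hw : ∀ i j, ContinuousAt (fun p => w p (v p i) (v p j)) p₀) :
    ContinuousAt (fun p => wedgePow k (w p) (v p)) p₀ := by
  unfold wedgePow
  exact continuousAt_const.mul (tendsto_finsetSum _ fun σ _ => continuousAt_const.mul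
    (tendsto_finsetProd _ fun i _ => hw _ _))

theorem mul_pos_of_continuousOn {X : Type*} [TopologicalSpace X] {s : Set X}
    (hs : IsPreconnected s) {f : X → ℝ} (hf : ContinuousOn f s) (h0 : ∀ x ∈ s, f x ≠ 0) {a b : X}
    (ha : a ∈ s) (hb : b ∈ s) : 0 < f a * f b := by
  rcases lt_or_gt_of_ne (h0 a ha) with h1 | h1 <;> rcases lt_or_gt_of_ne (h0 b hb) with h2 | h2
  · exact mul_pos_of_neg_of_neg h1 h2
  · obtain ⟨c, hc, hc'⟩ := hs.intermediate_value ha hb hf ⟨h1.le, h2.le⟩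
    exact absurd hc' (h0 c hc)
  · obtain ⟨c, hc, hc'⟩ := hs.intermediate_value hb ha hf ⟨h2.le, h1.le⟩
    exact absurd hc' (h0 c hc)
  · exact mul_pos h1 h2

end Algebra

section HalfSpace

open Set

theorem contMDiff_halfSpace_val : ContMDiff (𝓡∂ 1) 𝓘(ℝ, ℝ) ∞ fun r : H1 =>
    r.val 0 :=
  (EuclideanSpace.proj (𝕜 := ℝ) (0 : Fin 1)).contMDiff.comp
    (𝓡∂ 1).contMDiff

theorem continuous_halfLine : Continuous halfLine := by
  refine Continuous.subtype_mk ?_ _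
  fun_prop

theorem contMDiffAt_halfLine {f : M → ℝ} {x : M} (hf : ContMDiffAt I 𝓘(ℝ, ℝ) ∞ f x)
    (h0 : ∀ᶠ y in 𝓝 x, 0 ≤ f y) : ContMDiffAt I (𝓡∂ 1) ∞ (fun y => halfLine (f y)) x := by
  rw [contMDiffAt_iff_target]
  refine ⟨continuous_halfLine.continuousAt.comp hf.continuousAt, ?_⟩
  have h : ContDiff ℝ ∞ fun t : ℝ => (!₂[t] : E1) := by
    rw [contDiff_euclidean]
    intro i
    fin_cases i
    exact contDiff_id
  refine (h.contMDiff.contMDiffAt.comp x hf).congr_of_eventuallyEq ?_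
  filter_upwards [h0] with y hy
  show (halfLine (f y)).val = !₂[f y]
  simp [halfLine, hy]

theorem mfderiv_halfSpace_val (r : H1) (ξ : E1) :
    (mfderiv (𝓡∂ 1) 𝓘(ℝ, ℝ) (fun r : H1 => r.val 0) r ξ : ℝ) = ξ 0 := by
  have h1 : HasMFDerivAt (𝓡∂ 1) 𝓘(ℝ, E1) (extChartAt (𝓡∂ 1) r) r
      (mfderiv (𝓡∂ 1) 𝓘(ℝ, E1) (extChartAt (𝓡∂ 1) r) r) :=
    (mdifferentiableAt_extChartAt (mem_chart_source _ _)).hasMFDerivAt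
  rw [mfderiv_extChartAt_self] at h1
  have h2 := HasMFDerivAt.comp r
    (EuclideanSpace.proj (𝕜 := ℝ) (0 : Fin 1)).hasFDerivAt.hasMFDerivAt h1
  exact DFunLike.congr_fun h2.mfderiv ξ

end HalfSpace

section Radius

/-- A smooth monotone function of the radius that is `r² / a` near `0` and `r` from `a` on. -/
def radiusProfile (a r : ℝ) : ℝ :=
  r ^ 2 / a + Real.smoothTransition (2 * r / a - 1) * (r - r ^ 2 / a)

theorem contDiff_transition (a : ℝ) :
    ContDiff ℝ ∞ fun r : ℝ => Real.smoothTransition (2 * r / a - 1) :=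
  Real.smoothTransition.contDiff.comp (by fun_prop)

theorem contDiff_radiusProfile (a : ℝ) : ContDiff ℝ ∞ (radiusProfile a) :=
  ContDiff.add (by fun_prop) ((contDiff_transition a).mul (by fun_prop))

theorem radiusProfile_of_le {a r : ℝ} (ha : 0 < a) (hr : r ≤ a / 2) :
    radiusProfile a r = r ^ 2 / a := by
  rw [radiusProfile, Real.smoothTransition.zero_of_nonpos, zero_mul, add_zero]
  rw [sub_nonpos, div_le_one ha]
  linarith

theorem transition_of_ge {a r : ℝ} (ha : 0 < a) (hr : a ≤ r) :
    Real.smoothTransition (2 * r / a - 1) = 1 := by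
  apply Real.smoothTransition.one_of_one_le
  rw [le_sub_iff_add_le, le_div_iff₀ ha]
  linarith

theorem radiusProfile_of_ge {a r : ℝ} (ha : 0 < a) (hr : a ≤ r) : radiusProfile a r = r := by
  rw [radiusProfile, transition_of_ge ha hr]
  ring

theorem radiusProfile_nonneg {a r : ℝ} (ha : 0 < a) (hr : 0 ≤ r) : 0 ≤ radiusProfile a r := by
  have h0 := Real.smoothTransition.nonneg (2 * r / a - 1)
  have h1 := Real.smoothTransition.le_one (2 * r / a - 1)
  have h2 : 0 ≤ r ^ 2 / a := by positivity
  unfold radiusProfile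
  nlinarith

theorem sub_sq_div_nonneg {a r : ℝ} (ha : 0 < a) (hr : 0 ≤ r) (hr' : r ≤ a) :
    0 ≤ r - r ^ 2 / a := by
  rw [sub_nonneg, div_le_iff₀ ha]
  nlinarith

theorem radiusProfile_le {a r : ℝ} (ha : 0 < a) (hr : 0 ≤ r) : radiusProfile a r ≤ r := by
  rcases le_total a r with h | h
  · exact (radiusProfile_of_ge ha h).le
  · have h1 := Real.smoothTransition.le_one (2 * r / a - 1)
    have h2 := sub_sq_div_nonneg ha hr h
    unfold radiusProfile
    nlinarith

theorem deriv_radiusProfile_pos {a r : ℝ} (ha : 0 < a) (hr : 0 < r) :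
    0 < deriv (radiusProfile a) r := by
  rcases lt_or_ge a r with h | h
  · have h1 : radiusProfile a =ᶠ[𝓝 r] id := by
      filter_upwards [lt_mem_nhds h] with t ht
      exact radiusProfile_of_ge ha ht.le
    rw [h1.deriv_eq, deriv_id]
    exact one_pos
  · have hT : HasDerivAt (fun r : ℝ => Real.smoothTransition (2 * r / a - 1))
        (deriv (fun r : ℝ => Real.smoothTransition (2 * r / a - 1)) r) r :=
      ((contDiff_transition a).differentiable (by simp) r).hasDerivAt
    have hm : Monotone fun r : ℝ => Real.smoothTransition (2 * r / a - 1) := fun s t hst =>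
      Real.smoothTransition.monotone (by gcongr)
    have hnn := hm.deriv_nonneg (x := r)
    have hq : HasDerivAt (fun r : ℝ => r ^ 2 / a) (2 * r / a) r := by
      simpa using (hasDerivAt_pow 2 r).div_const a
    have h1 := hq.add (hT.mul ((hasDerivAt_id r).sub hq))
    have h2 := h1.deriv
    rw [show deriv (radiusProfile a) r = _ from h2]
    have h3 := sub_sq_div_nonneg ha hr.le h
    have h4 : 0 < 2 * r / a := by positivity
    have h5 := Real.smoothTransition.nonneg (2 * r / a - 1)
    have h6 := Real.smoothTransition.le_one (2 * r / a - 1)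
    simp only [id, Pi.sub_apply]
    have h7 := mul_nonneg hnn h3
    rcases eq_or_lt_of_le h6 with h8 | h8
    · rw [h8]; linarith
    · nlinarith [mul_pos h4 (sub_pos.2 h8)]

end Radius

section HalfLineMaps

variable {E : Type*} [NormedAddCommGroup E] [NormedSpace ℝ E]
  {H : Type*} [TopologicalSpace H] {I : ModelWithCorners ℝ E H}
  {M : Type*} [TopologicalSpace M] [ChartedSpace H M]
  {E' : Type*} [NormedAddCommGroup E'] [NormedSpace ℝ E']
  {H' : Type*} [TopologicalSpace H'] {I' : ModelWithCorners ℝ E' H'}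
  {B : Type*} [TopologicalSpace B] [ChartedSpace H' B]

theorem mfderiv_halfLine {f : M → ℝ} {x : M} (hf : ContMDiffAt I 𝓘(ℝ, ℝ) ∞ f x)
    (h0 : ∀ᶠ y in 𝓝 x, 0 ≤ f y) (w : TangentSpace I x) :
    (show E1 from mfderiv I (𝓡∂ 1) (fun y => halfLine (f y)) x w) 0 =
      mfderiv I 𝓘(ℝ, ℝ) f x w := by
  have h1 := HasMFDerivAt.comp x ((contMDiff_halfSpace_val.mdifferentiableAt
    (x := halfLine (f x)) (by simp)).hasMFDerivAt)
    ((contMDiffAt_halfLine hf h0).mdifferentiableAt (by simp)).hasMFDerivAt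
  have h2 : (fun r : H1 => r.val 0) ∘ (fun y => halfLine (f y)) =ᶠ[𝓝 x] f := by
    filter_upwards [h0] with y hy
    exact halfLine_val hy
  have h3 := h1.congr_of_eventuallyEq h2.symm
  refine ((DFunLike.congr_fun h3.mfderiv w).trans ?_).symm
  exact mfderiv_halfSpace_val _ _

/-- The map `(b, x) ↦ (b, f x)` to the collar. -/
def toCollar (B : Type*) (f : M → ℝ) (q : B × M) : B × H1 :=
  (q.1, halfLine (f q.2))

theorem contMDiffAt_toCollar {f : M → ℝ} {q : B × M} (hf : ContMDiffAt I 𝓘(ℝ, ℝ) ∞ f q.2)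
    (h0 : ∀ᶠ y in 𝓝 q.2, 0 ≤ f y) :
    ContMDiffAt (I'.prod I) (I'.prod (𝓡∂ 1)) ∞ (toCollar B f) q :=
  contMDiffAt_fst.prodMk
    (ContMDiffAt.comp q (g := fun y => halfLine (f y)) (contMDiffAt_halfLine hf h0) contMDiffAt_snd)

theorem mfderiv_toCollar {f : M → ℝ} {q : B × M} (hf : ContMDiffAt I 𝓘(ℝ, ℝ) ∞ f q.2)
    (h0 : ∀ᶠ y in 𝓝 q.2, 0 ≤ f y) (v : E' × E) :
    (mfderiv (I'.prod I) (I'.prod (𝓡∂ 1)) (toCollar B f) q v : E' × E1) =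
      (v.1, mfderiv I (𝓡∂ 1) (fun y => halfLine (f y)) q.2 v.2) := by
  have h2 := HasMFDerivAt.comp q
    ((contMDiffAt_halfLine hf h0).mdifferentiableAt (by simp)).hasMFDerivAt
    (hasMFDerivAt_snd (I := I') (I' := I) q)
  have h1 := (hasMFDerivAt_fst (I := I') (I' := I) q).prodMk h2
  exact DFunLike.congr_fun h1.mfderiv v

end HalfLineMaps

theorem wedgePow_congr {V V' : Type*} {k : ℕ} {w : V → V → ℝ} {w' : V' → V' → ℝ}
    {v : Fin (2 * k) → V} {v' : Fin (2 * k) → V'} (h : ∀ i j, w (v i) (v j) = w' (v' i) (v' j)) :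
    wedgePow k w v = wedgePow k w' v' := by
  simp only [wedgePow, h]

theorem wedgeWedgePow_congr {V V' : Type*} {k : ℕ} {a : V → ℝ} {a' : V' → ℝ} {w : V → V → ℝ}
    {w' : V' → V' → ℝ} {v : Fin (2 * k + 1) → V} {v' : Fin (2 * k + 1) → V'}
    (ha : ∀ i, a (v i) = a' (v' i)) (h : ∀ i j, w (v i) (v j) = w' (v' i) (v' j)) :
    wedgeWedgePow k a w v = wedgeWedgePow k a' w' v' := by
  simp only [wedgeWedgePow, ha, h]

section Suspension

open Set

variable {P : Type*} [TopologicalSpace P]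
  [ChartedSpace (EuclideanHalfSpace (2 * n + 2)) P] [IsManifold (𝓡∂ (2 * n + 2)) ∞ P]

variable (Ψ : P ≃ₘ⟮𝓡∂ (2 * n + 2), 𝓡∂ (2 * n + 2)⟯ P)

/-- The `k`-th iterate of the monodromy. -/
def iter (k : ℤ) (x : P) : P := ((Ψ.toEquiv : Equiv.Perm P) ^ k) x

theorem iter_zero : iter Ψ 0 = id := by
  funext x
  simp [iter]

theorem iter_add (j k : ℤ) : iter Ψ (j + k) = iter Ψ j ∘ iter Ψ k := by
  funext x
  simp [iter, zpow_add]

theorem iter_add_one (k : ℤ) : iter Ψ (k + 1) = iter Ψ k ∘ Ψ := by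
  funext x
  simp only [iter, zpow_add_one]
  rfl

theorem contMDiff_iter (k : ℤ) : ContMDiff JP JP ∞ (iter Ψ k) := by
  induction k with
  | zero => rw [iter_zero]; exact contMDiff_id
  | succ k ih => rw [iter_add_one]; exact ih.comp Ψ.contMDiff
  | pred k ih =>
    have h : iter Ψ (-(k : ℤ) - 1) = iter Ψ (-(k : ℤ)) ∘ Ψ.symm := by
      funext x
      simp only [iter, zpow_sub_one]
      rfl
    rw [h]
    exact ih.comp Ψ.symm.contMDiff

theorem iter_eq_self {x : P} (hx : Ψ x = x) (k : ℤ) : iter Ψ k x = x := by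
  have h : (Ψ.toEquiv : Equiv.Perm P) x = x := hx
  exact Equiv.Perm.zpow_apply_eq_self_of_apply_eq_self h k

/-- The pull-back of a form under an iterate of the monodromy. -/
def iterForm (γ : OneForm JP P) (k : ℤ) : OneForm JP P := pullback (I' := JP) (iter Ψ k) γ

theorem isSmooth_iterForm {γ : OneForm JP P} (hγ : γ.IsSmooth) (k : ℤ) :
    (iterForm Ψ γ k).IsSmooth := hγ.pullback (contMDiff_iter Ψ k)

theorem pullback_iterForm (γ : OneForm JP P) (j k : ℤ) :
    pullback (I' := JP) (iter Ψ j) (iterForm Ψ γ k) = iterForm Ψ γ (k + j) := by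
  funext x
  have h := OneForm.pullback_comp (I'' := JP) γ (f := iter Ψ k) (g := iter Ψ j) (x := x)
    ((contMDiff_iter Ψ k).mdifferentiableAt (by simp))
    ((contMDiff_iter Ψ j).mdifferentiableAt (by simp))
  rw [← iter_add] at h
  exact h.symm

theorem iterForm_zero (γ : OneForm JP P) : iterForm Ψ γ 0 = γ := by
  rw [iterForm, iter_zero, OneForm.pullback_id]

theorem iterForm_add_one (γ : OneForm JP P) (k : ℤ) :
    iterForm Ψ γ (k + 1) = pullback (I' := JP) Ψ (iterForm Ψ γ k) := by
  rw [← pullback_iterForm Ψ γ 1 k]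
  congr 1

theorem iterForm_eq_self (γ : OneForm JP P) {x : P} (hx : ∀ᶠ y in 𝓝 x, Ψ y = y) (k : ℤ) :
    iterForm Ψ γ k x = γ x := by
  have h : iter Ψ k =ᶠ[𝓝 x] id := by
    filter_upwards [hx] with y hy
    exact iter_eq_self Ψ hy k
  exact (OneForm.pullback_congr γ h).trans (congrFun (OneForm.pullback_id γ) x)

variable {Ψ}

theorem d_iterForm {γ : OneForm JP P} (hγ : γ.IsSmooth)
    (h : ∀ (x : P) (u v : TangentSpace JP x),
      γ.d (Ψ x) (mfderiv JP JP Ψ x u) (mfderiv JP JP Ψ x v) = γ.d x u v) (k : ℤ) :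
    ∀ (x : P) (u v : TangentSpace JP x), (iterForm Ψ γ k).d x u v = γ.d x u v := by
  have hd : ∀ k (x : P) (u v : TangentSpace JP x), (iterForm Ψ γ (k + 1)).d x u v =
      (iterForm Ψ γ k).d (Ψ x) (mfderiv JP JP Ψ x u) (mfderiv JP JP Ψ x v) := fun k x u v => by
    rw [iterForm_add_one]
    exact OneForm.d_pullback (isSmooth_iff.1 (isSmooth_iterForm Ψ hγ k) _)
      (Ψ.contMDiff x) u v
  induction k with
  | zero => intro x u v; rw [iterForm_zero]
  | succ k ih => intro x u v; exact (hd k x u v).trans ((ih _ _ _).trans (h x u v))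
  | pred k ih =>
    intro x u v
    obtain ⟨x, rfl⟩ := Ψ.surjective x
    have hl : IsLocalDiffeomorphAt JP JP ∞ Ψ x := Ψ.isLocalDiffeomorph x
    obtain ⟨u, rfl⟩ := exists_mfderiv_eq hl u
    obtain ⟨v, rfl⟩ := exists_mfderiv_eq hl v
    have h1 := hd (-(k : ℤ) - 1) x u v
    rw [sub_add_cancel] at h1
    exact h1.symm.trans ((ih x u v).trans (h x u v).symm)

/-- A smooth monotone function that is `0` until `1 / 4` and `1` from `3 / 4` on. -/
def cut (t : ℝ) : ℝ := Real.smoothTransition (2 * t - 1 / 2)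

theorem contDiff_cut : ContDiff ℝ ∞ cut := Real.smoothTransition.contDiff.comp (by fun_prop)

theorem cut_of_le {t : ℝ} (ht : t ≤ 1 / 4) : cut t = 0 :=
  Real.smoothTransition.zero_of_nonpos (by linarith)

theorem cut_of_ge {t : ℝ} (ht : 3 / 4 ≤ t) : cut t = 1 :=
  Real.smoothTransition.one_of_one_le (by linarith)

variable (Ψ) in
/-- The transition from the `k`-th to the `(k + 1)`-st iterate of a form, at time `t`. -/
def stepForm (γ : OneForm JP P) (k : ℤ) (t : ℝ) : OneForm JP P :=
  (1 - cut (t - k)) • iterForm Ψ γ k + cut (t - k) • iterForm Ψ γ (k + 1)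

variable (Ψ) in
/-- A path of forms which is compatible with the monodromy. -/
def suspForm (γ : OneForm JP P) (t : ℝ) : OneForm JP P := stepForm Ψ γ ⌊t⌋ t

theorem stepForm_of_le (γ : OneForm JP P) {k : ℤ} {t : ℝ} (ht : t ≤ k + 1 / 4) :
    stepForm Ψ γ k t = iterForm Ψ γ k := by
  rw [stepForm, cut_of_le (by linarith), sub_zero, one_smul, zero_smul, add_zero]

theorem stepForm_of_ge (γ : OneForm JP P) {k : ℤ} {t : ℝ} (ht : k + 3 / 4 ≤ t) :
    stepForm Ψ γ k t = iterForm Ψ γ (k + 1) := by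
  rw [stepForm, cut_of_ge (by linarith), sub_self, one_smul, zero_smul, zero_add]

theorem suspForm_eq_stepForm (γ : OneForm JP P) {k : ℤ} {t : ℝ} (ht : k - 1 / 4 ≤ t)
    (ht' : t ≤ k + 5 / 4) : suspForm Ψ γ t = stepForm Ψ γ k t := by
  have h1 := Int.floor_le t
  have h2 := Int.lt_floor_add_one t
  rcases lt_trichotomy ⌊t⌋ k with h | h | h
  · have h3 : ((⌊t⌋ + 1 : ℤ) : ℝ) ≤ k := by exact_mod_cast h
    push_cast at h3
    have h4 : ⌊t⌋ = k - 1 := by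
      have : (k : ℝ) < ((⌊t⌋ + 2 : ℤ) : ℝ) := by push_cast; linarith
      have : k < ⌊t⌋ + 2 := by exact_mod_cast this
      omega
    have h5 : ((⌊t⌋ : ℤ) : ℝ) = k - 1 := by rw [h4]; push_cast; ring
    rw [suspForm, stepForm_of_ge γ (by linarith), stepForm_of_le γ (by linarith), h4, sub_add_cancel]
  · rw [suspForm, h]
  · have h3 : ((k + 1 : ℤ) : ℝ) ≤ ⌊t⌋ := by exact_mod_cast h
    push_cast at h3
    have h4 : ⌊t⌋ = k + 1 := by
      have : ((⌊t⌋ : ℤ) : ℝ) < ((k + 2 : ℤ) : ℝ) := by push_cast; linarith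
      have : ⌊t⌋ < k + 2 := by exact_mod_cast this
      omega
    have h5 : ((⌊t⌋ : ℤ) : ℝ) = k + 1 := by rw [h4]; push_cast; ring
    rw [suspForm, stepForm_of_le γ (by linarith), stepForm_of_ge γ (by linarith), h4]

theorem isSmoothFamily_suspForm {γ : OneForm JP P} (hγ : γ.IsSmooth) :
    IsSmoothFamily (suspForm Ψ γ) := by
  have hstep : ∀ k, IsSmoothFamily (stepForm Ψ γ k) := fun k => by
    have hc : ContDiff ℝ ∞ fun t : ℝ => cut (t - k) :=
      contDiff_cut.comp (contDiff_id.sub contDiff_const)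
    exact ((isSmooth_iterForm Ψ hγ k).isSmoothFamily_const.smul (contDiff_const.sub hc)).add
      ((isSmooth_iterForm Ψ hγ (k + 1)).isSmoothFamily_const.smul hc)
  intro x₀ p hp
  refine (hstep ⌊p.1⌋ x₀ p hp).congr_of_eventuallyEq ?_ ?_
  · have h1 : ∀ᶠ q : ℝ × EP in 𝓝 p, (⌊p.1⌋ : ℝ) - 1 / 4 < q.1 := by
      refine continuous_fst.continuousAt.eventually (lt_mem_nhds ?_)
      linarith [Int.floor_le p.1]
    have h2 : ∀ᶠ q : ℝ × EP in 𝓝 p, q.1 < ⌊p.1⌋ + 5 / 4 := by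
      refine continuous_fst.continuousAt.eventually (gt_mem_nhds ?_)
      linarith [Int.lt_floor_add_one p.1]
    filter_upwards [nhdsWithin_le_nhds h1, nhdsWithin_le_nhds h2] with q h1 h2
    rw [suspForm_eq_stepForm γ h1.le h2.le]
  · rfl

theorem d_suspForm {γ : OneForm JP P} (hγ : γ.IsSmooth)
    (h : ∀ (x : P) (u v : TangentSpace JP x),
      γ.d (Ψ x) (mfderiv JP JP Ψ x u) (mfderiv JP JP Ψ x v) = γ.d x u v) (t : ℝ) (x : P)
    (u v : TangentSpace JP x) : (suspForm Ψ γ t).d x u v = γ.d x u v := by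
  have h1 := isSmooth_iff.1 (isSmooth_iterForm Ψ hγ ⌊t⌋) x
  have h2 := isSmooth_iff.1 (isSmooth_iterForm Ψ hγ (⌊t⌋ + 1)) x
  rw [suspForm, stepForm, OneForm.d_add (h1.smul _) (h2.smul _), OneForm.d_smul h1,
    OneForm.d_smul h2, d_iterForm hγ h, d_iterForm hγ h]
  ring

theorem suspForm_add_int (γ : OneForm JP P) (t : ℝ) (k : ℤ) :
    suspForm Ψ γ (t + k) = pullback (I' := JP) (iter Ψ k) (suspForm Ψ γ t) := by
  simp only [suspForm, stepForm, Int.floor_add_intCast, OneForm.pullback_add, OneForm.pullback_smul,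
    pullback_iterForm]
  have h1 : t + k - ((⌊t⌋ + k : ℤ) : ℝ) = t - ⌊t⌋ := by push_cast; ring
  rw [h1, add_right_comm]

theorem suspForm_eq_self (γ : OneForm JP P) {x : P} (hx : ∀ᶠ y in 𝓝 x, Ψ y = y) (t : ℝ) :
    suspForm Ψ γ t x = γ x := by
  show (1 - cut (t - ⌊t⌋)) • iterForm Ψ γ ⌊t⌋ x + cut (t - ⌊t⌋) • iterForm Ψ γ (⌊t⌋ + 1) x = γ x
  rw [iterForm_eq_self Ψ γ hx, iterForm_eq_self Ψ γ hx, ← add_smul, sub_add_cancel, one_smul]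

/-- A path of forms on `P`, as a form on `P × ℝ`. -/
def pathForm (A : ℝ → OneForm JP P) : OneForm JR (P × ℝ) :=
  pullback (I' := JR) Prod.swap (totalForm A)

theorem mfderiv_swap_apply (p : P × ℝ) (v : EP × ℝ) :
    (mfderiv JR (𝓘(ℝ, ℝ).prod JP) (Prod.swap : P × ℝ → ℝ × P) p v : ℝ × EP) = v.swap := by
  have h := (hasMFDerivAt_snd (I := JP) (I' := 𝓘(ℝ, ℝ)) p).prodMk (hasMFDerivAt_fst p)
  exact DFunLike.congr_fun h.mfderiv v

theorem contMDiff_swap_line : ContMDiff JR (𝓘(ℝ, ℝ).prod JP) ∞ (Prod.swap : P × ℝ → ℝ × P) :=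
  contMDiff_snd.prodMk contMDiff_fst

theorem pathForm_apply (A : ℝ → OneForm JP P) (p : P × ℝ) (v : EP × ℝ) :
    pathForm A p v = A p.2 p.1 v.1 :=
  congrArg (totalForm A p.swap) (mfderiv_swap_apply p v)

theorem isSmooth_pathForm {A : ℝ → OneForm JP P} (hA : IsSmoothFamily A) :
    (pathForm A).IsSmooth := (isSmooth_totalForm hA).pullback contMDiff_swap_line

theorem d_pathForm {A : ℝ → OneForm JP P} (hA : IsSmoothFamily A) (p : P × ℝ) (u v : EP) :
    (pathForm A).d p ((u, 0) : EP × ℝ) ((v, 0) : EP × ℝ) = (A p.2).d p.1 u v := by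
  have h := OneForm.d_pullback (I' := JR) (f := (Prod.swap : P × ℝ → ℝ × P)) (x := p)
    (isSmooth_iff.1 (isSmooth_totalForm hA) p.swap) (contMDiff_swap_line p)
    ((u, 0) : EP × ℝ) ((v, 0) : EP × ℝ)
  refine h.trans ?_
  refine (congrArg₂ ((totalForm A).d p.swap) (mfderiv_swap_apply p (u, 0))
    (mfderiv_swap_apply p (v, 0))).trans ?_
  exact d_totalForm hA p.2 p.1 u v

/-- The deck transformations of `P × ℝ` over the mapping torus. -/
def deck (Ψ : P ≃ₘ⟮JP, JP⟯ P) (k : ℤ) (p : P × ℝ) : P × ℝ :=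
  (iter Ψ k p.1, p.2 - k)

theorem contMDiff_deck (k : ℤ) : ContMDiff JR JR ∞ (deck Ψ k) :=
  ((contMDiff_iter Ψ k).comp contMDiff_fst).prodMk
    ((contDiff_id.sub contDiff_const).contMDiff.comp contMDiff_snd)

theorem susp_deck (k : ℤ) (p : P × ℝ) : susp Ψ (deck Ψ k p) = susp Ψ p := by
  have h := susp_add_int (Ψ := Ψ) p.1 (p.2 - k) k
  rw [sub_add_cancel] at h
  exact h.symm

theorem exists_deck {p p' : P × ℝ} (hp : p.1 ∈ (JP).interior P) (hp' : p'.1 ∈ (JP).interior P)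
    (h : susp Ψ p = susp Ψ p') : ∃ k, p' = deck Ψ k p := by
  have h1 := (normalForm_susp hp p.2).symm.trans
    ((congrArg normalForm h).trans (normalForm_susp hp' p'.2))
  simp only [Option.some.injEq, Prod.mk.injEq] at h1
  refine ⟨⌊p.2⌋ - ⌊p'.2⌋, Prod.ext ?_ ?_⟩
  · show p'.1 = ((Ψ.toEquiv : Equiv.Perm P) ^ (⌊p.2⌋ - ⌊p'.2⌋)) p.1
    rw [sub_eq_neg_add, zpow_add, Equiv.Perm.mul_apply, h1.1, zpow_neg]
    exact (Equiv.symm_apply_apply _ _).symm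
  · have h2 := Int.floor_add_fract p.2
    have h3 := Int.floor_add_fract p'.2
    show p'.2 = p.2 - ((⌊p.2⌋ - ⌊p'.2⌋ : ℤ) : ℝ)
    push_cast
    linarith [h1.2]

theorem mfderiv_deck (k : ℤ) (p : P × ℝ) (v : EP × ℝ) :
    (mfderiv JR JR (deck Ψ k) p v : EP × ℝ) = (mfderiv JP JP (iter Ψ k) p.1 v.1, v.2) := by
  have h1 := HasMFDerivAt.comp p ((contMDiff_iter Ψ k).mdifferentiableAt (x := p.1)
    (by simp)).hasMFDerivAt (hasMFDerivAt_fst (I := JP) (I' := 𝓘(ℝ, ℝ)) p)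
  have h2 := HasMFDerivAt.comp p ((hasDerivAt_id p.2).sub_const (k : ℝ)).hasFDerivAt.hasMFDerivAt
    (hasMFDerivAt_snd (I := JP) (I' := 𝓘(ℝ, ℝ)) p)
  refine (DFunLike.congr_fun (h1.prodMk h2).mfderiv v).trans (Prod.ext rfl ?_)
  show (ContinuousLinearMap.toSpanSingleton ℝ (1 : ℝ)) v.2 = v.2
  simp

theorem pullback_deck_pathForm (γ : OneForm JP P) (k : ℤ) :
    pullback (I' := JR) (deck Ψ k) (pathForm (suspForm Ψ γ)) = pathForm (suspForm Ψ γ) := by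
  funext p
  refine ContinuousLinearMap.ext fun v => ?_
  have h1 := suspForm_add_int (Ψ := Ψ) γ (p.2 - k) k
  rw [sub_add_cancel] at h1
  refine Eq.trans ?_ ((pathForm_apply _ p v).trans (DFunLike.congr_fun (congrFun h1 p.1) v.1)).symm
  refine (congrArg (pathForm (suspForm Ψ γ) (deck Ψ k p)) (mfderiv_deck k p v)).trans ?_
  exact pathForm_apply _ (deck Ψ k p) _

end Suspension

section Pages

open Set

variable {P : Type*} [TopologicalSpace P] [ChartedSpace (EuclideanHalfSpace (2 * n + 2)) P] [IsManifold (𝓡∂ (2 * n + 2)) ∞ P]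
  {Ψ : P ≃ₘ⟮𝓡∂ (2 * n + 2), 𝓡∂ (2 * n + 2)⟯ P}
  {B : Type*} [TopologicalSpace B] [ChartedSpace (EuclideanSpace ℝ (Fin (2 * n + 1))) B] [IsManifold (𝓡 (2 * n + 1)) ∞ B]
  [ChartedSpace (EuclideanSpace ℝ (Fin (2 * n + 3))) (Total Ψ)]
  {β : OneForm (𝓡∂ (2 * n + 2)) P}

theorem finrank_prod_line : Module.finrank ℝ (EB × E1) = 2 * (n + 1) := by
  rw [Module.finrank_prod, finrank_euclideanSpace_fin, finrank_euclideanSpace_fin]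
  ring

/-- The coordinate of the half line, as a linear form. -/
def radialForm (n : ℕ) : Module.Dual ℝ ((EuclideanSpace ℝ (Fin (2 * n + 1))) × (EuclideanSpace ℝ (Fin 1))) :=
  (EuclideanSpace.proj (𝕜 := ℝ) (0 : Fin 1)).toLinearMap.comp (LinearMap.snd ℝ _ _)

/-- A frame of the half line followed by a frame of `B`. -/
def collarFrame (v : Fin (2 * n + 1) → EB) : Fin (2 * (n + 1)) → EB × E1 :=
  (Fin.cons ((0 : EB), EuclideanSpace.single (0 : Fin 1) (1 : ℝ)) fun i => (v i, 0) :
    Fin (2 * n + 1 + 1) → EB × E1)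

theorem linearIndependent_inl {v : Fin (2 * n + 1) → EB} (hv : LinearIndependent ℝ v) :
    LinearIndependent ℝ fun i => ((v i, 0) : EB × E1) :=
  hv.map' (LinearMap.inl ℝ EB E1) (LinearMap.ker_eq_bot.2 LinearMap.inl_injective)

theorem linearIndependent_collarFrame {v : Fin (2 * n + 1) → EB} (hv : LinearIndependent ℝ v) :
    LinearIndependent ℝ (collarFrame v) := by
  refine (linearIndependent_finCons (n := 2 * n + 1)).2 ⟨linearIndependent_inl hv, fun h => ?_⟩
  have h1 : Submodule.span ℝ (range fun i => ((v i, 0) : EB × E1)) ≤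
      LinearMap.ker (LinearMap.snd ℝ EB E1) := by
    rw [Submodule.span_le]
    rintro _ ⟨i, rfl⟩
    rfl
  have h2 : EuclideanSpace.single (0 : Fin 1) (1 : ℝ) = (0 : E1) := h1 h
  have h3 := congrArg (fun x : E1 => x 0) h2
  simp at h3

theorem continuousAt_d_slice {α : OneForm JH (B × H1)} {b : B} {ρ₀ : H1}
    (hα : α.SmoothAt (b, ρ₀)) (u v : EB × E1) :
    ContinuousAt (fun ρ : H1 => α.d (b, ρ) u v) ρ₀ := by
  have ht : Filter.Tendsto (fun ρ : H1 => extChartAt JH ((b, ρ) : B × H1) (b, ρ)) (𝓝 ρ₀)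
      (𝓝[range JH] (extChartAt JH ((b, ρ₀) : B × H1) (b, ρ₀))) := by
    refine tendsto_nhdsWithin_of_tendsto_nhds_of_eventually_within _ ?_
      (Filter.Eventually.of_forall fun _ => mem_range_self _)
    have h := (continuousAt_extChartAt (I := JH) ((b, ρ₀) : B × H1)).comp
      (f := fun ρ : H1 => ((b, ρ) : B × H1)) (x := ρ₀) (by fun_prop)
    exact h
  have hd : ContinuousWithinAt (fderivWithin ℝ (α.inChart (b, ρ₀)) (range JH)) (range JH)
      (extChartAt JH ((b, ρ₀) : B × H1) (b, ρ₀)) :=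
    (ContDiffWithinAt.fderivWithin_right (m := 0) hα (JH).uniqueDiffOn (by simp)
      (mem_range_self _)).continuousWithinAt
  have h1 : ∀ u v : EB × E1, ContinuousAt (fun ρ : H1 => fderivWithin ℝ (α.inChart (b, ρ₀))
      (range JH) (extChartAt JH ((b, ρ) : B × H1) (b, ρ)) u v) ρ₀ := fun u v =>
    ContinuousAt.clm_apply (ContinuousAt.clm_apply (hd.tendsto.comp ht) continuousAt_const)
      continuousAt_const
  refine ((h1 u v).sub (h1 v u)).congr (Filter.Eventually.of_forall fun ρ => ?_)
  exact (OneForm.d_eq_flatD α (b, ρ) u v).symm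

/-- Contraction of a volume form with a vector field is the contraction with its radial part. -/
theorem evenForm_cons_radial (w : (EB × E1) →ₗ[ℝ] (EB × E1) →ₗ[ℝ] ℝ) (y : EB × E1)
    (v : Fin (2 * n + 1) → EB) :
    evenForm (n + 1) w (Fin.cons y (fun i => (v i, 0)) : Fin (2 * n + 1 + 1) → EB × E1) =
      y.2 0 * evenForm (n + 1) w (collarFrame v) := by
  have hy : y = LinearMap.inl ℝ EB E1 y.1 + y.2 0 •
      ((0 : EB), EuclideanSpace.single (0 : Fin 1) (1 : ℝ)) := by
    refine Prod.ext ?_ ?_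
    · simp
    · ext i
      fin_cases i
      simp
  have h0 : evenForm (n + 1) w (Fin.cons (LinearMap.inl ℝ EB E1 y.1) (fun i => (v i, 0)) :
      Fin (2 * n + 1 + 1) → EB × E1) = 0 := by
    have h1 := ((evenForm (n + 1) w).compLinearMap (LinearMap.inl ℝ EB E1)).map_linearDependent
      (Fin.cons y.1 v : Fin (2 * n + 1 + 1) → EB) (fun h => by
        have := h.fintype_card_le_finrank
        rw [finrank_euclideanSpace_fin, Fintype.card_fin] at this
        omega)
    rw [AlternatingMap.compLinearMap_apply] at h1
    convert! h1 using 2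
    funext i
    refine Fin.cases ?_ (fun j => ?_) i <;> rfl
  have hup : ∀ z : EB × E1, (Fin.cons z (fun i => (v i, 0)) : Fin (2 * n + 1 + 1) → EB × E1) =
      Function.update (collarFrame v) (0 : Fin (2 * n + 1 + 1)) z := fun z =>
    (Fin.update_cons_zero _ _ _).symm
  conv_lhs => rw [hy, hup, AlternatingMap.map_update_add, AlternatingMap.map_update_smul, ← hup,
    ← hup, h0, zero_add]
  rfl

namespace SmoothGluing

variable (S : SmoothGluing Ψ B)

theorem isLocalDiffeomorphAt_collar (b : B) {ρ : H1} (hρ : ρ.val 0 < S.δ) :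
    IsLocalDiffeomorphAt JH JP ∞ S.collar (b, ρ) :=
  S.collar.isLocalDiffeomorphAt _ _ _ (by rw [S.collar_source]; exact hρ)

/-- The expression of a form on `P` in the collar. -/
def collarForm (β : OneForm JP P) : OneForm JH (B × H1) := pullback (I' := JH) S.collar β

theorem smoothAt_collarForm (hβ : β.IsSmooth) (b : B) {ρ : H1} (hρ : ρ.val 0 < S.δ) :
    (S.collarForm β).SmoothAt (b, ρ) :=
  (isSmooth_iff.1 hβ _).pullback (S.isLocalDiffeomorphAt_collar b hρ).contMDiffAt

theorem d_collarForm (hβ : β.IsSmooth) (b : B) {ρ : H1} (hρ : ρ.val 0 < S.δ) (u v : EB × E1) :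
    (S.collarForm β).d (b, ρ) u v =
      β.d (S.collar (b, ρ)) (mfderiv JH JP S.collar (b, ρ) u) (mfderiv JH JP S.collar (b, ρ) v) :=
  OneForm.d_pullback (isSmooth_iff.1 hβ _)
    (S.isLocalDiffeomorphAt_collar b hρ).contMDiffAt u v

theorem evenForm_collarForm_ne_zero (hβ : β.IsSmooth)
    (hn : ∀ (x : P) (u : TangentSpace JP x), (∀ v, β.d x u v = 0) → u = 0) (b : B) {ρ : H1}
    (hρ : ρ.val 0 < S.δ) {v : Fin (2 * (n + 1)) → EB × E1} (hv : LinearIndependent ℝ v) :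
    evenForm (n + 1) ((S.collarForm β).dB (b, ρ)) v ≠ 0 := by
  refine evenForm_ne_zero (V := EB × E1) finrank_prod_line ((S.collarForm β).dB_neg (b, ρ))
    (fun u hu => ?_) hv
  have hl := S.isLocalDiffeomorphAt_collar b hρ
  have h1 : mfderiv JH JP S.collar (b, ρ) u = 0 := hn _ _ fun w => by
    obtain ⟨w, rfl⟩ := exists_mfderiv_eq hl w
    rw [← S.d_collarForm hβ b hρ u w]
    exact DFunLike.congr_fun hu w
  have h2 := DFunLike.congr_fun (hl.mfderivToContinuousLinearEquiv_coe (by simp)) u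
  exact (hl.mfderivToContinuousLinearEquiv (by simp)).map_eq_zero_iff.1 (h2.trans h1)

/-- The volume form of the collar has constant sign on a frame that does not depend on the radius. -/
theorem collarFrame_mul_pos (hβ : β.IsSmooth)
    (hn : ∀ (x : P) (u : TangentSpace JP x), (∀ v, β.d x u v = 0) → u = 0) (b : B)
    {v : Fin (2 * n + 1) → EB} (hv : LinearIndependent ℝ v) {r r' : ℝ} (hr : 0 ≤ r) (hr' : r < S.δ)
    (hs : 0 ≤ r') (hs' : r' < S.δ) :
    0 < evenForm (n + 1) ((S.collarForm β).dB (b, halfLine r)) (collarFrame v) *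
      evenForm (n + 1) ((S.collarForm β).dB (b, halfLine r')) (collarFrame v) := by
  refine mul_pos_of_continuousOn (s := Ico 0 S.δ)
    (f := fun r => evenForm (n + 1) ((S.collarForm β).dB (b, halfLine r)) (collarFrame v))
    isPreconnected_Ico (fun r hr => ContinuousAt.continuousWithinAt ?_) (fun r hr => ?_)
    ⟨hr, hr'⟩ ⟨hs, hs'⟩
  · have h1 : ContinuousAt (fun ρ : H1 => evenForm (n + 1) ((S.collarForm β).dB (b, ρ))
        (collarFrame v)) (halfLine r) := by
      refine ContinuousAt.congr ?_ (Filter.Eventually.of_forall fun ρ =>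
        (evenForm_eq_wedgePow (V := TangentSpace JH (b, ρ)) (n + 1) ((S.collarForm β).dB (b, ρ))
          (collarFrame v)).symm)
      exact continuousAt_wedgePow (V := fun _ => EB × E1) (n + 1) fun i j => continuousAt_d_slice
        (S.smoothAt_collarForm hβ b (by rw [halfLine_val hr.1]; exact hr.2)) _ _
    exact h1.comp continuous_halfLine.continuousAt
  · exact S.evenForm_collarForm_ne_zero hβ hn b (by rw [halfLine_val hr.1]; exact hr.2)
      (linearIndependent_collarFrame hv)

theorem radial_neg_of_pointsOutward (b : B) (y : EB × E1)
    (h : PointsOutward (S.collar (b, halfLine 0)) (mfderiv JH JP S.collar (b, halfLine 0) y)) :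
    y.2 0 < 0 := by
  by_contra! hy
  have hδ : (halfLine 0).val 0 < S.δ := by rw [halfLine_val le_rfl]; exact S.δ_pos
  have hl := S.isLocalDiffeomorphAt_collar b hδ
  generalize hp : S.collar (b, halfLine 0) = p at h
  have hc0 : MDifferentiableAt JP 𝓘(ℝ, EP) (extChartAt JP p) (S.collar (b, halfLine 0)) :=
    mdifferentiableAt_extChartAt (by rw [hp]; exact mem_chart_source _ _)
  have hcomp := HasMFDerivAt.comp (b, halfLine 0)
    (EuclideanSpace.proj (𝕜 := ℝ) (0 : Fin (2 * n + 2))).hasFDerivAt.hasMFDerivAt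
    (HasMFDerivAt.comp (b, halfLine 0) hc0.hasMFDerivAt
      (IsLocalDiffeomorphAt.mdifferentiableAt' hl).hasMFDerivAt)
  have hd := hcomp.2
  subst hp
  have hbd : S.collar (b, halfLine 0) ∉ (JP).interior P := fun h' =>
    lt_irrefl _ ((S.collar_halfLine_interior_iff b le_rfl S.δ_pos).1 h')
  have hnn : ∀ q : P, 0 ≤ (extChartAt JP (S.collar (b, halfLine 0)) q) 0 := fun q =>
    (range_modelWithCornersEuclideanHalfSpace (2 * n + 2)).le (mem_range_self _)
  have hz : (extChartAt JP (S.collar (b, halfLine 0)) (S.collar (b, halfLine 0))) 0 = 0 := by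
    refine le_antisymm (not_lt.1 fun h' => hbd ?_) (hnn _)
    show _ ∈ interior (range JP)
    rw [interior_range_modelWithCornersEuclideanHalfSpace]
    exact h'
  have hmin : IsLocalMinOn (writtenInExtChartAt JH 𝓘(ℝ, ℝ) (b, halfLine 0)
      ((EuclideanSpace.proj (𝕜 := ℝ) (0 : Fin (2 * n + 2))) ∘
        (extChartAt JP (S.collar (b, halfLine 0))) ∘ S.collar)) (range JH)
      (extChartAt JH (b, halfLine 0) (b, halfLine 0)) := by
    refine Filter.Eventually.of_forall fun q => ?_
    have h1 : writtenInExtChartAt JH 𝓘(ℝ, ℝ) (b, halfLine 0)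
      ((EuclideanSpace.proj (𝕜 := ℝ) (0 : Fin (2 * n + 2))) ∘
        (extChartAt JP (S.collar (b, halfLine 0))) ∘ S.collar)
        (extChartAt JH (b, halfLine 0) (b, halfLine 0)) = 0 := by
      have h2 := extChartAt_to_inv (I := JH) (b, halfLine 0)
      show (extChartAt JP (S.collar (b, halfLine 0)) (S.collar ((extChartAt JH (b, halfLine 0)).symm
        (extChartAt JH (b, halfLine 0) (b, halfLine 0))))) 0 = 0
      rw [h2, hz]
    show _ ≤ _
    rw [h1]
    exact hnn _
  have hcone : y ∈ posTangentConeAt (range JH) (extChartAt JH (b, halfLine 0) (b, halfLine 0)) := by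
    refine mem_posTangentConeAt_of_segment_subset
      ((JH).convex_range.segment_subset (mem_range_self _) ?_)
    rw [modelWithCorners_prod_coe, range_prodMap]
    refine ⟨by simp, ?_⟩
    rw [range_modelWithCornersEuclideanHalfSpace]
    show 0 ≤ (halfLine 0).val 0 + y.2 0
    rw [halfLine_val le_rfl, zero_add]
    exact hy
  have h3 := hmin.hasFDerivWithinAt_nonneg hd hcone
  exact absurd h (not_lt.2 h3)

end SmoothGluing

variable (n B) in
/-- The differential of the radius of the collar. -/
def radialOneForm : OneForm JH (B × H1) :=
  pullback (I := 𝓘(ℝ, ℝ)) (I' := JH) (fun q : B × H1 => q.2.val 0)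
    (fun _ => ContinuousLinearMap.id ℝ ℝ)

theorem contMDiff_radius : ContMDiff JH 𝓘(ℝ, ℝ) ∞ fun q : B × H1 => q.2.val 0 :=
  contMDiff_halfSpace_val.comp contMDiff_snd

variable (n B) in
theorem smoothAt_radialOneForm (q : B × H1) : (radialOneForm n B).SmoothAt q :=
  isSmooth_iff.1
    (OneForm.IsSmooth.pullback (isSmooth_vecForm contDiff_const) contMDiff_radius) q

theorem radialOneForm_apply (q : B × H1) (v : EB × E1) : radialOneForm n B q v = v.2 0 := by
  have h1 := HasMFDerivAt.comp q ((contMDiff_halfSpace_val.mdifferentiableAt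
    (x := q.2) (by simp)).hasMFDerivAt) (hasMFDerivAt_snd (I := JB) (I' := 𝓡∂ 1) q)
  exact (DFunLike.congr_fun h1.mfderiv v).trans (mfderiv_halfSpace_val q.2 v.2)

theorem evenForm_add_radial (w : (EB × E1) →ₗ[ℝ] (EB × E1) →ₗ[ℝ] ℝ) (a : Module.Dual ℝ (EB × E1))
    (v : Fin (2 * n + 1) → EB) :
    evenForm (n + 1) (w + wedgeTwo (radialForm n) a) (collarFrame v) -
      evenForm (n + 1) w (collarFrame v) =
      (n + 1) * wedgeWedgePow n a (fun u u' => w u u') fun i => ((v i, 0) : EB × E1) := by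
  have h := evenForm_add_smul (n + 1) (radialForm n) a w 1 (collarFrame v)
  rw [one_smul] at h
  have h2 := evalForm_cons_mixed (p := radialForm n) (q := a) w
    ((0 : EB), EuclideanSpace.single (0 : Fin 1) (1 : ℝ)) (fun i => ((v i, 0) : EB × E1))
    (fun i => rfl)
  have h3 : radialForm n ((0 : EB), EuclideanSpace.single (0 : Fin 1) (1 : ℝ)) = 1 := by
    simp [radialForm]
  rw [h3, one_mul] at h2
  refine (sub_eq_of_eq_add' h).trans ?_
  rw [one_mul]
  push_cast
  exact congrArg (fun c => ((n : ℝ) + 1) * c) h2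

namespace SmoothGluing

variable (S : SmoothGluing Ψ B)

/-- The exterior derivative of the form on the collar, with plain types. -/
def collarTwo (β : OneForm JP P) (q : B × H1) : (EB × E1) →ₗ[ℝ] (EB × E1) →ₗ[ℝ] ℝ :=
  (S.collarForm β).dB q

/-- The form on the collar, with plain types. -/
def collarOne (β : OneForm JP P) (q : B × H1) : Module.Dual ℝ (EB × E1) :=
  (S.collarForm β q).toLinearMap

/-- The volume `λ ∧ (dλ)ⁿ` on a copy of `B` in the collar, where `λ` is the restriction of `β`. -/
def collarVolume (β : OneForm JP P) (b : B) (ρ : H1) (v : Fin (2 * n + 1) → EB) : ℝ :=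
  wedgeWedgePow n (S.collarOne β (b, ρ)) (fun u u' => S.collarTwo β (b, ρ) u u') fun i => (v i, 0)

/-- Convexity of the boundary: its volume form and that of `P` have opposite signs on frames that
start with an inward vector. -/
theorem collarVolume_mul_neg (hβ : β.IsSmooth)
    (hn : ∀ (x : P) (u : TangentSpace JP x), (∀ v, β.d x u v = 0) → u = 0)
    (hc : ∀ x ∈ (JP).boundary P, ∀ X : TangentSpace JP x, (∀ v, β.d x X v = β x v) →
      PointsOutward x X) (b : B) {v : Fin (2 * n + 1) → EB} (hv : LinearIndependent ℝ v) :
    S.collarVolume β b (halfLine 0) v *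
      evenForm (n + 1) (S.collarTwo β (b, halfLine 0)) (collarFrame v) < 0 := by
  have hδ : (halfLine 0).val 0 < S.δ := by rw [halfLine_val le_rfl]; exact S.δ_pos
  have hl := S.isLocalDiffeomorphAt_collar b hδ
  have hE : evenForm (n + 1) (S.collarTwo β (b, halfLine 0)) (collarFrame v) ≠ 0 :=
    S.evenForm_collarForm_ne_zero hβ hn b hδ (linearIndependent_collarFrame hv)
  have hskew : ∀ u u', S.collarTwo β (b, halfLine 0) u u' = -S.collarTwo β (b, halfLine 0) u' u :=
    (S.collarForm β).dB_neg (b, halfLine 0)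
  have hvol : S.collarVolume β b (halfLine 0) v = wedgeWedgePow n (S.collarOne β (b, halfLine 0))
    (fun u u' => S.collarTwo β (b, halfLine 0) u u') fun i => (v i, 0) := rfl
  have hinj : Function.Injective (S.collarTwo β (b, halfLine 0)) := by
    refine (injective_iff_map_eq_zero _).2 fun u hu => ?_
    have h1 : mfderiv JH JP S.collar (b, halfLine 0) u = 0 := hn _ _ fun w' => by
      obtain ⟨w', rfl⟩ := exists_mfderiv_eq hl w'
      rw [← S.d_collarForm hβ b hδ u w']
      exact DFunLike.congr_fun hu w'
    have h2 := DFunLike.congr_fun (hl.mfderivToContinuousLinearEquiv_coe (by simp)) u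
    exact (hl.mfderivToContinuousLinearEquiv (by simp)).map_eq_zero_iff.1 (h2.trans h1)
  have hsurj : Function.Surjective (S.collarTwo β (b, halfLine 0)) :=
    (LinearMap.injective_iff_surjective_of_finrank_eq_finrank
      (Subspace.dual_finrank_eq (K := ℝ) (V := EB × E1)).symm).1 hinj
  obtain ⟨y, hy⟩ := hsurj (S.collarOne β (b, halfLine 0))
  have hout : y.2 0 < 0 := by
    refine S.radial_neg_of_pointsOutward b y (hc _ ?_ _ fun u => ?_)
    · rw [← (JP).compl_interior]
      exact fun h' => lt_irrefl _ ((S.collar_halfLine_interior_iff b le_rfl S.δ_pos).1 h')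
    · obtain ⟨u, rfl⟩ := exists_mfderiv_eq hl u
      rw [← S.d_collarForm hβ b hδ y u]
      exact DFunLike.congr_fun hy u
  generalize S.collarTwo β (b, halfLine 0) = w at hskew hE hvol hy ⊢
  generalize S.collarOne β (b, halfLine 0) = a at hvol hy
  have h1 := evenForm_cons hskew y (fun i => ((v i, 0) : EB × E1))
  rw [hy, ← hvol] at h1
  have h3 := (evenForm_cons_radial w y v).symm.trans h1
  generalize evenForm (n + 1) w (collarFrame v) = A at h3 hE ⊢
  generalize S.collarVolume β b (halfLine 0) v = C at h3 ⊢
  have hA : 0 < A * A := mul_self_pos.2 hE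
  have h4 : (n + 1 : ℝ) * (C * A) = y.2 0 * (A * A) := by rw [← mul_assoc, ← h3]; ring
  have h5 : (n + 1 : ℝ) * (C * A) < 0 := h4 ▸ mul_neg_of_neg_of_pos hout hA
  by_contra! h6
  have : (0 : ℝ) ≤ (n + 1) * (C * A) := by positivity
  linarith

/-- Copies of the boundary close to the boundary are convex, too. -/
theorem exists_radius [CompactSpace B] (hβ : β.IsSmooth)
    (hn : ∀ (x : P) (u : TangentSpace JP x), (∀ v, β.d x u v = 0) → u = 0)
    (hc : ∀ x ∈ (JP).boundary P, ∀ X : TangentSpace JP x, (∀ v, β.d x X v = β x v) →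
      PointsOutward x X) : ∃ s, 0 < s ∧ s < S.δ ∧ ∀ b r, 0 ≤ r → r < s →
      ∀ v : Fin (2 * n + 1) → EB, LinearIndependent ℝ v → S.collarVolume β b (halfLine r) v *
        evenForm (n + 1) (S.collarTwo β (b, halfLine r)) (collarFrame v) < 0 := by
  have hδ : (halfLine 0).val 0 < S.δ := by rw [halfLine_val le_rfl]; exact S.δ_pos
  let A : ∀ q : B × H1, (EB × E1) [⋀^Fin (2 * (n + 1))]→ₗ[ℝ] ℝ := fun q =>
    evenForm (n + 1) (S.collarTwo β q)
  let C : ∀ q : B × H1, (EB × E1) [⋀^Fin (2 * (n + 1))]→ₗ[ℝ] ℝ := fun q =>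
    evenForm (n + 1) (S.collarTwo β q) -
      evenForm (n + 1) (S.collarTwo β q + wedgeTwo (radialForm n) (S.collarOne β q))
  have hCA : ∀ b ρ v, C (b, ρ) (collarFrame v) = -((n + 1) * S.collarVolume β b ρ v) :=
    fun b ρ v => (neg_sub _ _).symm.trans
      (congrArg Neg.neg (evenForm_add_radial (S.collarTwo β (b, ρ)) (S.collarOne β (b, ρ)) v))
  obtain ⟨e, he⟩ := exists_linearIndependent
    (finrank_euclideanSpace_fin (𝕜 := ℝ) (n := 2 * n + 1))
  have h1 : ∀ᶠ ρ in 𝓝 (halfLine 0), ∀ b ∈ (univ : Set B), ∀ f : Fin (2 * (n + 1)) → EB × E1,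
      LinearIndependent ℝ f → 0 < C (b, ρ) f * A (b, ρ) f := by
    refine isCompact_univ.eventually_forall_of_forall_eventually (X := H1) (Y := B)
      (P := fun ρ b => ∀ f : Fin (2 * (n + 1)) → EB × E1,
      LinearIndependent ℝ f → 0 < C (b, ρ) f * A (b, ρ) f) fun b _ => ?_
    obtain ⟨f, hf, hcont⟩ := exists_frame (I := JH) ((b, halfLine 0) : B × H1)
      (linearIndependent_collarFrame he)
    have hev : ∀ᶠ q in 𝓝 ((b, halfLine 0) : B × H1), (S.collarForm β).SmoothAt q := by
      have : Continuous fun q : B × H1 => q.2.val 0 := (contMDiff_radius (n := n)).continuous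
      filter_upwards [this.continuousAt.eventually (gt_mem_nhds hδ)] with q hq
      exact S.smoothAt_collarForm hβ q.1 hq
    obtain ⟨c1, c2⟩ := hcont _ hev
    obtain ⟨c3, -⟩ := hcont (radialOneForm n B) (Filter.Eventually.of_forall (smoothAt_radialOneForm n B))
    have c3' : ∀ i, ContinuousAt (fun q => radialForm n (f q i)) (b, halfLine 0) := fun i =>
      (c3 i).congr (Filter.Eventually.of_forall fun q => radialOneForm_apply q (f q i))
    have hA : ContinuousAt (fun q => A q (f q)) (b, halfLine 0) := by
      refine ContinuousAt.congr ?_ (Filter.Eventually.of_forall fun q =>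
        (evenForm_eq_wedgePow (n + 1) (S.collarTwo β q) (f q)).symm)
      exact continuousAt_wedgePow (V := fun _ => EB × E1) (n + 1) fun i j => c2 i j
    have hC : ContinuousAt (fun q => C q (f q)) (b, halfLine 0) := by
      refine ContinuousAt.sub hA ?_
      refine ContinuousAt.congr ?_ (Filter.Eventually.of_forall fun q =>
        (evenForm_eq_wedgePow (n + 1) (S.collarTwo β q + wedgeTwo (radialForm n) (S.collarOne β q))
          (f q)).symm)
      refine continuousAt_wedgePow (V := fun _ => EB × E1) (n + 1) fun i j => ?_
      exact (c2 i j).add (((c3' i).mul (c1 j)).sub ((c1 i).mul (c3' j)))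
    have hpos : 0 < C (b, halfLine 0) (f (b, halfLine 0)) * A (b, halfLine 0) (f (b, halfLine 0)) := by
      refine topForm_mul_pos (V := EB × E1) finrank_prod_line (linearIndependent_collarFrame he)
        hf.self_of_nhds ?_
      rw [hCA]
      have h2 := S.collarVolume_mul_neg hβ hn hc b he
      have h3 : 0 < -(((n : ℝ) + 1) * (S.collarVolume β b (halfLine 0) e *
          evenForm (n + 1) (S.collarTwo β (b, halfLine 0)) (collarFrame e))) :=
        neg_pos.2 (mul_neg_of_pos_of_neg (by positivity) h2)
      refine lt_of_lt_of_eq h3 ?_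
      show _ = -(((n : ℝ) + 1) * S.collarVolume β b (halfLine 0) e) *
        evenForm (n + 1) (S.collarTwo β (b, halfLine 0)) (collarFrame e)
      ring
    have h4 : ∀ᶠ q in 𝓝 ((b, halfLine 0) : B × H1), ∀ f : Fin (2 * (n + 1)) → EB × E1,
        LinearIndependent ℝ f → 0 < C q f * A q f := by
      filter_upwards [(hC.mul hA).eventually (lt_mem_nhds hpos), hf] with q h5 h6 f' hf'
      exact topForm_mul_pos (V := EB × E1) finrank_prod_line h6 hf' h5
    exact (continuous_swap.tendsto ((halfLine 0, b) : H1 × B)).eventually h4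
  have h2 := (continuous_halfLine.tendsto 0).eventually h1
  obtain ⟨s, hs, hs'⟩ := Metric.eventually_nhds_iff.1 h2
  have hδ' := S.δ_pos
  refine ⟨min s (S.δ / 2), lt_min hs (by linarith), (min_le_right _ _).trans_lt (by linarith),
    fun b r hr hr' v hv => ?_⟩
  have h3 := hs' (y := r) (by
    rw [Real.dist_eq, sub_zero, abs_of_nonneg hr]
    exact hr'.trans_le (min_le_left _ _)) b (mem_univ b) _ (linearIndependent_collarFrame hv)
  rw [hCA] at h3
  by_contra! h4
  have h5 : 0 ≤ ((n : ℝ) + 1) * (S.collarVolume β b (halfLine r) v *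
      evenForm (n + 1) (S.collarTwo β (b, halfLine r)) (collarFrame v)) := by positivity
  have h6 : 0 < -(((n : ℝ) + 1) * S.collarVolume β b (halfLine r) v) *
      evenForm (n + 1) (S.collarTwo β (b, halfLine r)) (collarFrame v) := h3
  linarith [h5, h6, neg_mul (((n : ℝ) + 1) * S.collarVolume β b (halfLine r) v)
    (evenForm (n + 1) (S.collarTwo β (b, halfLine r)) (collarFrame v)),
    mul_assoc ((n : ℝ) + 1) (S.collarVolume β b (halfLine r) v)
    (evenForm (n + 1) (S.collarTwo β (b, halfLine r)) (collarFrame v))]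

end SmoothGluing

variable (B) in
/-- The map `(b, r) ↦ (b, g r)` of the collar, where `g` is the profile of the radius. -/
def stretchCollar (a : ℝ) : B × H1 → B × H1 := toCollar B fun ρ : H1 => radiusProfile a (ρ.val 0)

theorem contMDiff_radiusProfile (a : ℝ) :
    ContMDiff (𝓡∂ 1) 𝓘(ℝ, ℝ) ∞ fun ρ : H1 => radiusProfile a (ρ.val 0) :=
  (contDiff_radiusProfile a).contMDiff.comp contMDiff_halfSpace_val

theorem contMDiff_stretchCollar {a : ℝ} (ha : 0 < a) : ContMDiff JH JH ∞ (stretchCollar B a) :=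
  fun _ => contMDiffAt_toCollar (contMDiff_radiusProfile a _)
    (Filter.Eventually.of_forall fun ρ => radiusProfile_nonneg ha ρ.2)

theorem mfderiv_stretchCollar {a : ℝ} (ha : 0 < a) (q : B × H1) (v : EB × E1) :
    ∃ ξ : E1, (mfderiv JH JH (stretchCollar B a) q v : EB × E1) = (v.1, ξ) ∧
      ξ 0 = deriv (radiusProfile a) (q.2.val 0) * v.2 0 := by
  have h0 : ∀ᶠ ρ in 𝓝 q.2, 0 ≤ radiusProfile a (ρ.val 0) :=
    Filter.Eventually.of_forall fun ρ => radiusProfile_nonneg ha ρ.2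
  refine ⟨_, mfderiv_toCollar (contMDiff_radiusProfile a q.2) h0 v, ?_⟩
  refine (mfderiv_halfLine (contMDiff_radiusProfile a q.2) h0 v.2).trans ?_
  have h1 := HasMFDerivAt.comp q.2
    ((contDiff_radiusProfile a).differentiable (by simp) (q.2.val 0)).hasDerivAt.hasFDerivAt.hasMFDerivAt
    (contMDiff_halfSpace_val.mdifferentiableAt (x := q.2) (by simp)).hasMFDerivAt
  refine (DFunLike.congr_fun h1.mfderiv v.2).trans ?_
  refine (congrArg (fun c : ℝ => (ContinuousLinearMap.toSpanSingleton ℝ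
    (deriv (radiusProfile a) (q.2.val 0))) c) (mfderiv_halfSpace_val q.2 v.2)).trans ?_
  simp [mul_comm]

namespace SmoothGluing

variable (S : SmoothGluing Ψ B)

open Classical in
/-- The map of `P` which in the collar only changes the radius, by the profile. -/
def stretch (a : ℝ) (p : P) : P :=
  if p ∈ S.collar.target then S.collar (stretchCollar B a (S.collar.symm p)) else p

theorem exists_of_mem_target {p : P} (hp : p ∈ S.collar.target) :
    ∃ b r, 0 ≤ r ∧ r < S.δ ∧ p = S.collar (b, halfLine r) := by
  have hs := S.collar.map_target' hp
  have hr := S.collar.right_inv' hp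
  rw [S.collar_source] at hs
  refine ⟨(S.collar.invFun p).1, (S.collar.invFun p).2.val 0, (S.collar.invFun p).2.2, hs, ?_⟩
  rw [← eq_halfLine]
  exact hr.symm

theorem collar_mem_target (b : B) {r : ℝ} (hr : r < S.δ) :
    S.collar (b, halfLine r) ∈ S.collar.target :=
  S.collar.map_source' (S.collar_mem_source b hr)

theorem stretch_comp_collar {a : ℝ} {q : B × H1} (hq : q.2.val 0 < S.δ) :
    S.stretch a (S.collar q) = S.collar (stretchCollar B a q) := by
  have hq' : q ∈ S.collar.source := by rw [S.collar_source]; exact hq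
  rw [stretch, if_pos (S.collar.map_source' hq')]
  exact congrArg (fun p => S.collar (stretchCollar B a p)) (S.collar.left_inv' hq')

theorem stretch_collar (b : B) {a r : ℝ} (hr : 0 ≤ r) (hr' : r < S.δ) :
    S.stretch a (S.collar (b, halfLine r)) = S.collar (b, halfLine (radiusProfile a r)) := by
  rw [S.stretch_comp_collar (by rw [halfLine_val hr]; exact hr')]
  rw [stretchCollar, toCollar, halfLine_val hr]

theorem stretch_of_notMem {a : ℝ} {p : P} (hp : p ∉ S.collar.target) : S.stretch a p = p :=
  if_neg hp

theorem stretch_mem_target {a : ℝ} (ha : 0 < a) {p : P} (hp : p ∈ S.collar.target) :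
    S.stretch a p ∈ S.collar.target := by
  obtain ⟨b, r, hr, hr', rfl⟩ := S.exists_of_mem_target hp
  rw [S.stretch_collar b hr hr']
  exact S.collar_mem_target b ((radiusProfile_le ha hr).trans_lt hr')

theorem eventually_stretch_eq [T2Space P] [CompactSpace P] {a : ℝ} (ha : 0 < a) (ha' : a < S.δ)
    {p : P} (hp : p ∉ S.collar.target) : ∀ᶠ p' in 𝓝 p, S.stretch a p' = p' := by
  have := S.compactSpace_binding
  let K : Set P := S.collar '' (univ ×ˢ (halfLine '' Icc 0 a))
  have hK : IsCompact K := by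
    refine (isCompact_univ.prod (isCompact_Icc.image continuous_halfLine)).image_of_continuousOn ?_
    refine S.collar.contMDiffOn_toFun.continuousOn.mono ?_
    rintro ⟨b, _⟩ ⟨-, r, hr, rfl⟩
    exact S.collar_mem_source b (hr.2.trans_lt ha')
  have hpK : p ∉ K := by
    rintro ⟨⟨b, _⟩, ⟨-, r, hr, rfl⟩, rfl⟩
    exact hp (S.collar_mem_target b (hr.2.trans_lt ha'))
  filter_upwards [hK.isClosed.isOpen_compl.mem_nhds hpK] with p' hp'
  by_cases h : p' ∈ S.collar.target
  · obtain ⟨b, r, hr, hr', rfl⟩ := S.exists_of_mem_target h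
    rw [S.stretch_collar b hr hr', radiusProfile_of_ge ha]
    by_contra! h2
    exact hp' ⟨(b, halfLine r), ⟨mem_univ _, r, ⟨hr, h2.le⟩, rfl⟩, rfl⟩
  · exact S.stretch_of_notMem h

theorem contMDiff_stretch [T2Space P] [CompactSpace P] {a : ℝ} (ha : 0 < a) (ha' : a < S.δ) :
    ContMDiff JP JP ∞ (S.stretch a) := by
  intro p
  by_cases hp : p ∈ S.collar.target
  · have h1 : ContMDiffAt JP JH ∞ S.collar.symm p :=
      S.collar.contMDiffOn_invFun.contMDiffAt (S.collar.open_target.mem_nhds hp)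
    have h2 : ContMDiffAt JP JH ∞ (fun p => stretchCollar B a (S.collar.symm p)) p :=
      ContMDiffAt.comp p (contMDiff_stretchCollar ha _) h1
    have h3 : stretchCollar B a (S.collar.symm p) ∈ S.collar.source := by
      obtain ⟨b, r, hr, hr', rfl⟩ := S.exists_of_mem_target hp
      have h4 : S.collar.symm (S.collar (b, halfLine r)) = (b, halfLine r) :=
        S.collar.left_inv' (S.collar_mem_source b hr')
      rw [h4, stretchCollar, toCollar]
      refine S.collar_mem_source b ?_
      rw [halfLine_val hr]
      exact (radiusProfile_le ha hr).trans_lt hr'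
    have h5 : ContMDiffAt JH JP ∞ S.collar (stretchCollar B a (S.collar.symm p)) :=
      S.collar.contMDiffOn_toFun.contMDiffAt (S.collar.open_source.mem_nhds h3)
    refine (ContMDiffAt.comp p h5 h2).congr_of_eventuallyEq ?_
    filter_upwards [S.collar.open_target.mem_nhds hp] with p' hp'
    exact if_pos hp'
  · refine contMDiffAt_id.congr_of_eventuallyEq ?_
    filter_upwards [S.eventually_stretch_eq ha ha' hp] with p' hp'
    exact hp'

theorem monodromy_of_mem_target (hΨ : ∀ x ∈ (JP).boundary P, Ψ x = x) {p : P}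
    (hp : p ∈ S.collar.target) : Ψ p = p := by
  obtain ⟨b, r, hr, hr', rfl⟩ := S.exists_of_mem_target hp
  rcases hr.eq_or_lt with rfl | hr
  · refine hΨ _ ?_
    rw [← (JP).compl_interior]
    exact fun h' => lt_irrefl _ ((S.collar_halfLine_interior_iff b le_rfl S.δ_pos).1 h')
  · exact S.monodromy_collar b hr hr'

theorem stretch_monodromy (hΨ : ∀ x ∈ (JP).boundary P, Ψ x = x) {a : ℝ} (ha : 0 < a) (p : P) :
    S.stretch a (Ψ p) = Ψ (S.stretch a p) := by
  by_cases hp : p ∈ S.collar.target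
  · rw [S.monodromy_of_mem_target hΨ hp, S.monodromy_of_mem_target hΨ (S.stretch_mem_target ha hp)]
  · have h2 : Ψ p ∉ S.collar.target := fun h => by
      have h3 : Ψ p = p := Ψ.injective (S.monodromy_of_mem_target hΨ h)
      rw [h3] at h
      exact hp h
    rw [S.stretch_of_notMem hp, S.stretch_of_notMem h2]

/-- The form on `P` whose expression in the collar depends on the square of the radius. -/
def stretchForm (a : ℝ) (β : OneForm JP P) : OneForm JP P :=
  pullback (I' := JP) (S.stretch a) β

theorem isSmooth_stretchForm [T2Space P] [CompactSpace P] (hβ : β.IsSmooth)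
    {a : ℝ} (ha : 0 < a) (ha' : a < S.δ) : (S.stretchForm a β).IsSmooth :=
  hβ.pullback (S.contMDiff_stretch ha ha')

theorem pullback_stretchForm [T2Space P] [CompactSpace P] 
    (hΨ : ∀ x ∈ (JP).boundary P, Ψ x = x) {a : ℝ} (ha : 0 < a) (ha' : a < S.δ) :
    pullback (I' := JP) Ψ (S.stretchForm a β) =
      S.stretchForm a (pullback (I' := JP) Ψ β) := by
  funext x
  have hs := S.contMDiff_stretch ha ha'
  have h1 := OneForm.pullback_comp (I'' := JP) β (f := S.stretch a) (g := Ψ) (x := x)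
    (hs.mdifferentiableAt (by simp)) (Ψ.contMDiff.mdifferentiableAt (by simp))
  have h2 := OneForm.pullback_comp (I'' := JP) β (f := Ψ) (g := S.stretch a) (x := x)
    (Ψ.contMDiff.mdifferentiableAt (by simp)) (hs.mdifferentiableAt (by simp))
  have h3 : S.stretch a ∘ Ψ = Ψ ∘ S.stretch a := funext (S.stretch_monodromy hΨ ha)
  rw [h3] at h1
  exact h1.symm.trans h2

theorem d_pullback_stretchForm [T2Space P] [CompactSpace P] 
    (h : IsSymplecticOpenBook β Ψ) {a : ℝ} (ha : 0 < a) (ha' : a < S.δ) (x : P)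
    (u v : TangentSpace JP x) : (S.stretchForm a β).d (Ψ x) (mfderiv JP JP Ψ x u)
      (mfderiv JP JP Ψ x v) = (S.stretchForm a β).d x u v := by
  have hs := S.contMDiff_stretch ha ha'
  have hΨ : ∀ x ∈ (JP).boundary P, Ψ x = x := fun x hx =>
    h.id_near_boundary.self_of_nhdsSet x hx
  have h1 := OneForm.d_pullback (isSmooth_iff.1 (S.isSmooth_stretchForm h.smooth ha ha') _)
    (Ψ.contMDiff x) u v
  rw [← h1, S.pullback_stretchForm hΨ ha ha']
  have h2 := OneForm.d_pullback (isSmooth_iff.1 (h.smooth.pullback Ψ.contMDiff) _)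
    (hs x) u v
  refine h2.trans ?_
  have h3 := OneForm.d_pullback (isSmooth_iff.1 h.smooth _)
    (hs x) u v
  refine Eq.trans ?_ h3.symm
  refine (OneForm.d_pullback (isSmooth_iff.1 h.smooth _) (Ψ.contMDiff _) _ _).trans ?_
  exact h.symplecto _ _ _

theorem collarForm_stretchForm [T2Space P] [CompactSpace P] {a : ℝ} (ha : 0 < a)
    (ha' : a < S.δ) (b : B) {ρ : H1} (hρ : ρ.val 0 < S.δ) :
    S.collarForm (S.stretchForm a β) (b, ρ) =
      pullback (I' := JH) (stretchCollar B a) (S.collarForm β) (b, ρ) := by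
  have hs := S.contMDiff_stretch ha ha'
  have hρ' : (stretchCollar B a (b, ρ)).2.val 0 < S.δ := by
    show (halfLine (radiusProfile a (ρ.val 0))).val 0 < S.δ
    rw [halfLine_val (radiusProfile_nonneg ha ρ.2)]
    exact (radiusProfile_le ha ρ.2).trans_lt hρ
  have h1 := OneForm.pullback_comp (I'' := JH) β (f := S.stretch a) (g := S.collar) (x := (b, ρ))
    (hs.mdifferentiableAt (by simp))
    (IsLocalDiffeomorphAt.mdifferentiableAt' (S.isLocalDiffeomorphAt_collar b hρ))
  have h2 := OneForm.pullback_comp (I'' := JH) β (f := S.collar) (g := stretchCollar B a)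
    (x := (b, ρ))
    (IsLocalDiffeomorphAt.mdifferentiableAt' (S.isLocalDiffeomorphAt_collar _ hρ'))
    ((contMDiff_stretchCollar ha).mdifferentiableAt (by simp))
  have h3 : S.stretch a ∘ S.collar =ᶠ[𝓝 ((b, ρ) : B × H1)] S.collar ∘ stretchCollar B a := by
    have hc : Continuous fun q : B × H1 => q.2.val 0 := (contMDiff_radius (n := n)).continuous
    filter_upwards [hc.continuousAt.eventually (gt_mem_nhds hρ)] with q hq
    exact S.stretch_comp_collar hq
  rw [OneForm.pullback_congr _ h3] at h1
  exact h1.symm.trans h2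

theorem d_collarForm_stretchForm [T2Space P] [CompactSpace P] 
    (hβ : β.IsSmooth) {a : ℝ} (ha : 0 < a) (ha' : a < S.δ) (b : B) {ρ : H1} (hρ : ρ.val 0 < S.δ)
    (u u' : EB × E1) : S.collarTwo (S.stretchForm a β) (b, ρ) u u' =
      S.collarTwo β (stretchCollar B a (b, ρ)) (mfderiv JH JH (stretchCollar B a) (b, ρ) u)
        (mfderiv JH JH (stretchCollar B a) (b, ρ) u') := by
  have hρ' : (stretchCollar B a (b, ρ)).2.val 0 < S.δ := by
    show (halfLine (radiusProfile a (ρ.val 0))).val 0 < S.δ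
    rw [halfLine_val (radiusProfile_nonneg ha ρ.2)]
    exact (radiusProfile_le ha ρ.2).trans_lt hρ
  have hc : Continuous fun q : B × H1 => q.2.val 0 := (contMDiff_radius (n := n)).continuous
  have h1 : (S.collarForm (S.stretchForm a β)).d (b, ρ) =
      (pullback (I' := JH) (stretchCollar B a) (S.collarForm β)).d (b, ρ) := by
    refine OneForm.d_congr ?_
    filter_upwards [hc.continuousAt.eventually (gt_mem_nhds hρ)] with q hq
    exact S.collarForm_stretchForm ha ha' q.1 hq
  have hsm : (S.collarForm β).SmoothAt (stretchCollar B a (b, ρ)) :=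
    S.smoothAt_collarForm hβ (stretchCollar B a (b, ρ)).1 hρ'
  have h2 := OneForm.d_pullback (I' := JH) (f := stretchCollar B a) (x := (b, ρ)) hsm
    (contMDiff_stretchCollar ha _) u u'
  exact (congrFun (congrFun h1 u) u').trans h2

theorem evenForm_collarTwo_stretchForm [T2Space P] [CompactSpace P] 
    (hβ : β.IsSmooth) {a : ℝ} (ha : 0 < a) (ha' : a < S.δ) (b : B) {ρ : H1} (hρ : ρ.val 0 < S.δ)
    (v : Fin (2 * n + 1) → EB) :
    evenForm (n + 1) (S.collarTwo (S.stretchForm a β) (b, ρ)) (collarFrame v) =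
      deriv (radiusProfile a) (ρ.val 0) *
        evenForm (n + 1) (S.collarTwo β (stretchCollar B a (b, ρ))) (collarFrame v) := by
  choose ξ hξ hξ' using mfderiv_stretchCollar (n := n) ha ((b, ρ) : B × H1)
  have hc : Continuous fun q : B × H1 => q.2.val 0 := (contMDiff_radius (n := n)).continuous
  have hd : ∀ u u' : EB × E1, S.collarTwo (S.stretchForm a β) (b, ρ) u u' =
      S.collarTwo β (stretchCollar B a (b, ρ)) (u.1, ξ u) (u'.1, ξ u') := fun u u' =>
    (S.d_collarForm_stretchForm hβ ha ha' b hρ u u').trans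
      (congrArg₂ (fun u u' => S.collarTwo β (stretchCollar B a (b, ρ)) u u') (hξ u) (hξ u'))
  have hcons := evenForm_cons_radial (S.collarTwo β (stretchCollar B a (b, ρ)))
    ((0 : EB), ξ ((0 : EB), EuclideanSpace.single (0 : Fin 1) (1 : ℝ))) v
  have h1 : ξ ((0 : EB), EuclideanSpace.single (0 : Fin 1) (1 : ℝ)) 0 =
      deriv (radiusProfile a) (ρ.val 0) := (hξ' _).trans (by simp)
  simp only [h1] at hcons
  refine Eq.trans ?_ hcons
  refine (evenForm_eq_wedgePow (n + 1) _ _).trans (Eq.trans ?_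
    (evenForm_eq_wedgePow (n + 1) _ _).symm)
  have hfr : ∀ i, (Fin.cons ((0 : EB), ξ ((0 : EB), EuclideanSpace.single (0 : Fin 1) (1 : ℝ)))
      (fun i => ((v i, 0) : EB × E1)) : Fin (2 * n + 1 + 1) → EB × E1) i =
      ((collarFrame v i).1, ξ (collarFrame v i)) := by
    intro i
    refine Fin.cases rfl (fun i => ?_) i
    have h2 : ξ ((v i, 0) : EB × E1) = 0 := by
      ext j
      have h3 := hξ' (v i, 0)
      fin_cases j
      exact h3.trans (by simp)
    exact congrArg (Prod.mk (v i)) h2.symm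
  refine wedgePow_congr fun i j => (hd _ _).trans ?_
  exact congrArg₂ (fun u u' => S.collarTwo β (stretchCollar B a (b, ρ)) u u')
    (hfr i).symm (hfr j).symm

/-- The pages keep their orientation. -/
theorem evenForm_stretchForm_mul_pos [T2Space P] [CompactSpace P] 
    (hβ : β.IsSmooth)
    (hn : ∀ (x : P) (u : TangentSpace JP x), (∀ v, β.d x u v = 0) → u = 0) {a : ℝ} (ha : 0 < a)
    (ha' : a < S.δ) {x : P} (hx : x ∈ (JP).interior P)
    {w : Fin (2 * (n + 1)) → TangentSpace JP x} (hw : LinearIndependent ℝ w) :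
    0 < evenForm (n + 1) ((S.stretchForm a β).dB x) w * evenForm (n + 1) (β.dB x) w := by
  have hdim : Module.finrank ℝ (TangentSpace JP x) = 2 * (n + 1) :=
    finrank_euclideanSpace_fin (𝕜 := ℝ) (n := 2 * n + 2)
  by_cases hxt : x ∈ S.collar.target
  · obtain ⟨b, r, hr, hr', rfl⟩ := S.exists_of_mem_target hxt
    have hr0 := (S.collar_halfLine_interior_iff b hr hr').1 hx
    have hrδ : (halfLine r).val 0 < S.δ := by rw [halfLine_val hr]; exact hr'
    obtain ⟨e, he⟩ := exists_linearIndependent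
      (finrank_euclideanSpace_fin (𝕜 := ℝ) (n := 2 * n + 1))
    have hl := S.isLocalDiffeomorphAt_collar b hrδ
    have hli := linearIndependent_mfderiv hl (linearIndependent_collarFrame he)
    refine topForm_mul_pos hdim hli hw ?_
    have key : ∀ γ : OneForm JP P, γ.IsSmooth → evenForm (n + 1)
        (γ.dB (S.collar (b, halfLine r)))
        (fun i => mfderiv JH JP S.collar (b, halfLine r) (collarFrame e i)) =
        evenForm (n + 1) (S.collarTwo γ (b, halfLine r)) (collarFrame e) := by
      intro γ hγ
      refine (evenForm_eq_wedgePow (n + 1) _ _).trans (Eq.trans ?_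
        (evenForm_eq_wedgePow (n + 1) _ _).symm)
      exact wedgePow_congr fun i j => (S.d_collarForm hγ b hrδ _ _).symm
    rw [key _ (S.isSmooth_stretchForm hβ ha ha'), key _ hβ,
      S.evenForm_collarTwo_stretchForm hβ ha ha' b hrδ, halfLine_val hr, mul_assoc]
    refine mul_pos (deriv_radiusProfile_pos ha hr0) ?_
    have h1 := S.collarFrame_mul_pos hβ hn b he (radiusProfile_nonneg ha hr)
      ((radiusProfile_le ha hr).trans_lt hr') hr hr'
    have h2 : stretchCollar B a (b, halfLine r) = (b, halfLine (radiusProfile a r)) := by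
      rw [stretchCollar, toCollar, halfLine_val hr]
    rw [h2]
    exact h1
  · have h1 : (S.stretchForm a β).dB x = β.dB x := by
      have h2 : (S.stretchForm a β).d x = β.d x := by
        refine OneForm.d_congr ?_
        have h3 : ∀ᶠ y in 𝓝 x, ∀ᶠ y' in 𝓝 y, S.stretch a y' = id y' :=
          eventually_eventually_nhds.2 (S.eventually_stretch_eq ha ha' hxt)
        filter_upwards [h3] with y hy
        exact (OneForm.pullback_congr β hy).trans (congrFun (OneForm.pullback_id β) y)
      exact LinearMap.ext₂ fun u v => congrFun (congrFun h2 u) v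
    rw [h1]
    refine mul_self_pos.2 ?_
    exact evenForm_ne_zero hdim (β.dB_neg x) (fun u hu => hn x u (DFunLike.congr_fun hu)) hw

end SmoothGluing

variable [IsManifold (𝓡 (2 * n + 3)) ∞ (Total Ψ)]

theorem contDiffAt_arg_div {z : ℂ} (hz : z ≠ 0) :
    ContDiffAt ℝ ∞ (fun w : ℂ => Complex.arg (w / z)) z := by
  have h1 : ContDiffAt ℝ ∞ Complex.log (z / z) :=
    (Complex.contDiffAt_log (by rw [div_self hz]; exact Complex.one_mem_slitPlane)).restrict_scalars ℝ
  have h2 : ContDiffAt ℝ ∞ (fun w : ℂ => w / z) z := contDiffAt_id.div_const z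
  exact (Complex.imCLM.contDiff.contDiffAt.comp z
    (ContDiffAt.comp (f := fun w : ℂ => w / z) z h1 h2)).congr_of_eventuallyEq
    (Filter.Eventually.of_forall fun w => (Complex.log_im (w / z)).symm)

theorem eq_polar {z w : ℂ} (hz : z ≠ 0) {t : ℝ}
    (ht : z = (‖z‖ : ℂ) * Complex.exp (2 * Real.pi * t * Complex.I)) :
    w = (‖w‖ : ℂ) * Complex.exp (2 * Real.pi * ((t + Complex.arg (w / z) / (2 * Real.pi) : ℝ) : ℂ) *
      Complex.I) := by
  have h1 := Complex.norm_mul_exp_arg_mul_I (w / z)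
  have h2 : Complex.exp (2 * Real.pi * ((t + Complex.arg (w / z) / (2 * Real.pi) : ℝ) : ℂ) *
      Complex.I) = Complex.exp (2 * Real.pi * t * Complex.I) *
        Complex.exp (Complex.arg (w / z) * Complex.I) := by
    rw [← Complex.exp_add]
    congr 1
    have : (Real.pi : ℂ) ≠ 0 := by exact_mod_cast Real.pi_ne_zero
    push_cast
    field_simp
  have hz' : (‖z‖ : ℂ) ≠ 0 := by exact_mod_cast norm_ne_zero_iff.2 hz
  rw [norm_div] at h1
  push_cast at h1
  rw [h2]
  generalize Complex.exp (Complex.arg (w / z) * Complex.I) = f at h1 ⊢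
  generalize Complex.exp (2 * Real.pi * t * Complex.I) = e at ht ⊢
  generalize (‖z‖ : ℂ) = c at ht hz' h1
  generalize (‖w‖ : ℂ) = d at h1 ⊢
  subst ht
  have he : e ≠ 0 := right_ne_zero_of_mul hz
  field_simp at h1
  rw [← h1]
  ring

namespace SmoothGluing

variable (S : SmoothGluing Ψ B)

theorem isLocalDiffeomorphAt_susp (S : SmoothGluing Ψ B) {p : P × ℝ} (hp : p.1 ∈ (JP).interior P) :
    IsLocalDiffeomorphAt JR JM ∞ (susp Ψ) p :=
  S.susp_localDiffeo ⟨p, hp, mem_univ _⟩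

/-- The form on the tubular neighbourhood of the binding, in terms of the square of the radius. -/
def tubeForm (a : ℝ) (β : OneForm JP P) : OneForm JT (B × ℂ) :=
  pullback (I' := JT) (toCollar B fun z : ℂ => ‖z‖ ^ 2 / a) (S.collarForm β)

theorem contMDiff_normSq_div (a : ℝ) : ContMDiff 𝓘(ℝ, ℂ) 𝓘(ℝ, ℝ) ∞ fun z : ℂ => ‖z‖ ^ 2 / a :=
  (show ContDiff ℝ ∞ fun z : ℂ => ‖z‖ ^ 2 / a from (contDiff_norm_sq ℝ).div_const a).contMDiff

theorem contMDiff_toCollar_normSq {a : ℝ} (ha : 0 < a) :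
    ContMDiff JT JH ∞ (toCollar B fun z : ℂ => ‖z‖ ^ 2 / a) := fun _ =>
  contMDiffAt_toCollar (contMDiff_normSq_div a _) (Filter.Eventually.of_forall fun z => by positivity)

theorem smoothAt_tubeForm (hβ : β.IsSmooth) {a : ℝ} (ha : 0 < a) (b : B) {z : ℂ}
    (hz : ‖z‖ ^ 2 / a < S.δ) : (S.tubeForm a β).SmoothAt (b, z) := by
  have h : (S.collarForm β).SmoothAt (toCollar B (fun z : ℂ => ‖z‖ ^ 2 / a) (b, z)) :=
    S.smoothAt_collarForm hβ b (by rw [halfLine_val (by positivity)]; exact hz)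
  exact h.pullback (contMDiff_toCollar_normSq ha _)

theorem exists_gluedForm
    (a : ℝ) (β : OneForm JP P) (y : Total Ψ) : ∃ L : TangentSpace JM y →L[ℝ] ℝ,
      (∀ p : P × ℝ, p.1 ∈ (JP).interior P → susp Ψ p = y → ∀ v : EP × ℝ,
        L (show EM from mfderiv JR JM (susp Ψ) p v) =
          pathForm (suspForm Ψ (S.stretchForm a β)) p v) ∧
      ∀ b, S.tube (b, 0) = y → ∀ v : EB × ℂ,
        L (show EM from mfderiv JT JM S.tube (b, 0) v) = S.tubeForm a β (b, 0) v := by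
  by_cases hy : y ∈ range fun b => S.tube (b, 0)
  · obtain ⟨b, rfl⟩ := hy
    have hl := S.openBook.isLocalDiffeomorphAt_tube b (z := 0) (by simpa using S.openBook.δ_pos)
    let e := hl.mfderivToContinuousLinearEquiv (by simp)
    have he : ∀ v : EB × ℂ, e.symm (mfderiv JT JM S.tube (b, 0) v) = v := fun v => by
      have h := DFunLike.congr_fun (hl.mfderivToContinuousLinearEquiv_coe (by simp)) v
      exact (congrArg e.symm h).symm.trans (e.symm_apply_apply v)
    refine ⟨(S.tubeForm a β (b, 0)).comp e.symm.toContinuousLinearMap, fun p hp h => ?_,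
      fun b' hb v => ?_⟩
    · exact absurd ⟨b, h.symm⟩ (S.susp_notMem_core hp p.2)
    · have h1 := S.tube.injOn (S.mem_tube_source b' (z := 0) (by simpa using S.δ_pos))
        (S.mem_tube_source b (z := 0) (by simpa using S.δ_pos)) hb
      obtain rfl : b' = b := congrArg Prod.fst h1
      exact congrArg (S.tubeForm a β (b', 0)) (he v)
  · obtain ⟨x, hx, t, rfl⟩ := S.exists_susp hy
    have hl := S.isLocalDiffeomorphAt_susp (p := (x, t)) hx
    let e := hl.mfderivToContinuousLinearEquiv (by simp)
    have he : ∀ v : EP × ℝ, e.symm (mfderiv JR JM (susp Ψ) (x, t) v) = v := fun v => by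
      have h := DFunLike.congr_fun (hl.mfderivToContinuousLinearEquiv_coe (by simp)) v
      exact (congrArg e.symm h).symm.trans (e.symm_apply_apply v)
    refine ⟨(pathForm (suspForm Ψ (S.stretchForm a β)) (x, t)).comp e.symm.toContinuousLinearMap,
      fun p hp h v => ?_, fun b hb => absurd ⟨b, hb⟩ hy⟩
    obtain ⟨k, hk⟩ := exists_deck (p := p) (p' := (x, t)) hp hx h
    have h1 := HasMFDerivAt.comp p (IsLocalDiffeomorphAt.mdifferentiableAt'
      (S.isLocalDiffeomorphAt_susp (p := deck Ψ k p) (by rw [← hk]; exact hx))).hasMFDerivAt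
      ((contMDiff_deck k).mdifferentiableAt (by simp)).hasMFDerivAt
    have h2 : susp Ψ ∘ deck Ψ k = susp Ψ := funext (susp_deck k)
    rw [h2] at h1
    have h3 : ∀ u : EP × ℝ, (mfderiv JR JM (susp Ψ) (deck Ψ k p) u : EM) =
        mfderiv JR JM (susp Ψ) (x, t) u := by rw [← hk]; exact fun _ => rfl
    have h4 : (mfderiv JR JM (susp Ψ) p v : EM) =
        mfderiv JR JM (susp Ψ) (x, t) (mfderiv JR JR (deck Ψ k) p v : EP × ℝ) :=
      (DFunLike.congr_fun h1.mfderiv v).trans (h3 _)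
    have h5 := DFunLike.congr_fun (congrFun (pullback_deck_pathForm (Ψ := Ψ) (S.stretchForm a β) k) p) v
    refine Eq.trans ?_ h5
    refine (congrArg (fun u : EM => pathForm (suspForm Ψ (S.stretchForm a β)) (x, t) (e.symm u))
      h4).trans ?_
    refine (congrArg (pathForm (suspForm Ψ (S.stretchForm a β)) (x, t)) (he _)).trans ?_
    exact congrArg (fun q => pathForm (suspForm Ψ (S.stretchForm a β)) q
      (mfderiv JR JR (deck Ψ k) p v : EP × ℝ)) hk

/-- A form on the total space that restricts to the pages as primitive of a symplectic form. -/
def gluedForm (a : ℝ) (β : OneForm JP P) : OneForm JM (Total Ψ) := fun y =>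
  (S.exists_gluedForm a β y).choose

theorem pullback_susp_gluedForm (a : ℝ) (β : OneForm JP P) {p : P × ℝ}
    (hp : p.1 ∈ (JP).interior P) :
    pullback (I' := JR) (susp Ψ) (S.gluedForm a β) p =
      pathForm (suspForm Ψ (S.stretchForm a β)) p :=
  ContinuousLinearMap.ext fun v =>
    (S.exists_gluedForm a β (susp Ψ p)).choose_spec.1 p hp rfl v

theorem pullback_tube_zero_gluedForm (a : ℝ) (β : OneForm JP P) (b : B) :
    pullback (I' := JT) S.tube (S.gluedForm a β) (b, 0) = S.tubeForm a β (b, 0) :=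
  ContinuousLinearMap.ext fun v =>
    (S.exists_gluedForm a β (S.tube (b, 0))).choose_spec.2 b rfl v

/-- The radius and the angle, as a map from the tubular neighbourhood to `P × ℝ`. -/
def polar (z₀ : ℂ) (t₀ : ℝ) (q : B × ℂ) : P × ℝ :=
  (S.collar (toCollar B (fun z : ℂ => ‖z‖) q), t₀ + Complex.arg (q.2 / z₀) / (2 * Real.pi))

theorem isLocalDiffeomorphAt_tube (b : B) {z : ℂ} (hz : ‖z‖ < S.δ) :
    IsLocalDiffeomorphAt JT JM ∞ S.tube (b, z) :=
  S.openBook.isLocalDiffeomorphAt_tube b hz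

theorem contMDiffAt_toCollar_norm (b : B) {z : ℂ} (hz : z ≠ 0) :
    ContMDiffAt JT JH ∞ (toCollar B fun z : ℂ => ‖z‖) (b, z) :=
  contMDiffAt_toCollar (q := (b, z)) (contDiffAt_norm ℝ hz).contMDiffAt
    (Filter.Eventually.of_forall fun z => norm_nonneg z)

theorem contMDiffAt_collar_norm (b : B) {z : ℂ} (hz : z ≠ 0) (hzδ : ‖z‖ < S.δ) :
    ContMDiffAt JT JP ∞ (S.collar ∘ toCollar B fun z : ℂ => ‖z‖) (b, z) :=
  ContMDiffAt.comp (b, z) (S.isLocalDiffeomorphAt_collar b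
    (by rw [halfLine_val (norm_nonneg z)]; exact hzδ)).contMDiffAt (contMDiffAt_toCollar_norm b hz)

theorem contMDiffAt_polar (b : B) {z : ℂ} (hz : z ≠ 0) (hzδ : ‖z‖ < S.δ) (t₀ : ℝ) :
    ContMDiffAt JT JR ∞ (S.polar z t₀) (b, z) := by
  have h1 : ContDiffAt ℝ ∞ (fun w : ℂ => t₀ + Complex.arg (w / z) / (2 * Real.pi)) z :=
    contDiffAt_const.add ((contDiffAt_arg_div hz).div_const _)
  exact (S.contMDiffAt_collar_norm b hz hzδ).prodMk
    (ContMDiffAt.comp (b, z) (g := fun w : ℂ => t₀ + Complex.arg (w / z) / (2 * Real.pi))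
      h1.contMDiffAt contMDiffAt_snd)

theorem susp_polar {z₀ : ℂ} (hz₀ : z₀ ≠ 0) {t₀ : ℝ}
    (ht : z₀ = (‖z₀‖ : ℂ) * Complex.exp (2 * Real.pi * t₀ * Complex.I)) (b : B) {z : ℂ}
    (hz : ‖z‖ < S.δ) : susp Ψ (S.polar z₀ t₀ (b, z)) = S.tube (b, z) := by
  have h := S.tube_polar b (norm_nonneg z) hz (t₀ + Complex.arg (z / z₀) / (2 * Real.pi))
  rw [← eq_polar hz₀ ht] at h
  exact h.symm

theorem eventually_monodromy_eq (hΨ : ∀ x ∈ (JP).boundary P, Ψ x = x) {p : P}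
    (hp : p ∈ S.collar.target) : ∀ᶠ p' in 𝓝 p, Ψ p' = p' := by
  filter_upwards [S.collar.open_target.mem_nhds hp] with p' hp'
  exact S.monodromy_of_mem_target hΨ hp'

theorem pullback_tube_gluedForm [T2Space P] [CompactSpace P]
    (hΨ : ∀ x ∈ (JP).boundary P, Ψ x = x) {a : ℝ} (ha : 0 < a) (ha' : a < S.δ)
    (b : B) {z : ℂ} (hz : ‖z‖ < a / 2) :
    pullback (I' := JT) S.tube (S.gluedForm a β) (b, z) = S.tubeForm a β (b, z) := by
  by_cases hz0 : z = 0
  · rw [hz0]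
    exact S.pullback_tube_zero_gluedForm a β b
  have hzδ : ‖z‖ < S.δ := by linarith
  obtain ⟨t₀, ht₀⟩ := exists_polar z
  have hint : (S.polar z t₀ (b, z)).1 ∈ (JP).interior P :=
    (S.collar_halfLine_interior_iff b (norm_nonneg z) hzδ).2 (norm_pos_iff.2 hz0)
  have hnear : ∀ c, ‖z‖ < c → ∀ᶠ q in 𝓝 ((b, z) : B × ℂ), ‖q.2‖ < c := fun c hc =>
    (continuous_snd.norm.continuousAt (x := ((b, z) : B × ℂ))).eventually (gt_mem_nhds hc)
  -- in polar coordinates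
  have h1 : S.tube =ᶠ[𝓝 ((b, z) : B × ℂ)] susp Ψ ∘ S.polar z t₀ := by
    filter_upwards [hnear _ hzδ] with q hq
    exact (S.susp_polar hz0 ht₀ q.1 hq).symm
  have h2 := OneForm.pullback_comp (I'' := JT) (S.gluedForm a β) (f := susp Ψ)
    (g := S.polar z t₀) (x := (b, z))
    (IsLocalDiffeomorphAt.mdifferentiableAt' (S.isLocalDiffeomorphAt_susp hint))
    ((S.contMDiffAt_polar b hz0 hzδ t₀).mdifferentiableAt (by simp))
  have h3 : ∀ v, pullback (I' := JT) (S.polar z t₀)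
      (pullback (I' := JR) (susp Ψ) (S.gluedForm a β)) (b, z) v =
      pullback (I' := JT) (S.collar ∘ toCollar B fun z : ℂ => ‖z‖) (S.stretchForm a β)
        (b, z) v := by
    intro v
    refine (DFunLike.congr_fun (S.pullback_susp_gluedForm a β hint) _).trans ?_
    refine (pathForm_apply _ _ _).trans ?_
    refine (DFunLike.congr_fun (suspForm_eq_self (Ψ := Ψ) (S.stretchForm a β)
      (S.eventually_monodromy_eq hΨ (S.collar_mem_target b hzδ)) _) _).trans ?_
    refine congrArg (S.stretchForm a β (S.collar (b, halfLine ‖z‖))) ?_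
    have h4 := HasMFDerivAt.comp ((b, z) : B × ℂ) (hasMFDerivAt_fst (I := JP) (I' := 𝓘(ℝ, ℝ))
      (S.polar z t₀ (b, z)))
      ((S.contMDiffAt_polar b hz0 hzδ t₀).mdifferentiableAt (by simp)).hasMFDerivAt
    exact (DFunLike.congr_fun h4.mfderiv v).symm
  -- the radius
  have h5 := OneForm.pullback_comp (I'' := JT) (S.stretchForm a β) (f := S.collar)
    (g := toCollar B fun z : ℂ => ‖z‖) (x := (b, z))
    (IsLocalDiffeomorphAt.mdifferentiableAt' (S.isLocalDiffeomorphAt_collar b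
      (by rw [halfLine_val (norm_nonneg z)]; exact hzδ)))
    ((contMDiffAt_toCollar_norm b hz0).mdifferentiableAt (by simp))
  have h6 : ∀ v, pullback (I' := JT) (toCollar B fun z : ℂ => ‖z‖)
      (pullback (I' := JH) S.collar (S.stretchForm a β)) (b, z) v =
      pullback (I' := JT) (toCollar B fun z : ℂ => ‖z‖)
        (pullback (I' := JH) (stretchCollar B a) (S.collarForm β)) (b, z) v := fun v =>
    DFunLike.congr_fun (S.collarForm_stretchForm ha ha' b
      (by rw [halfLine_val (norm_nonneg z)]; exact hzδ)) _
  have h7 := OneForm.pullback_comp (I'' := JT) (S.collarForm β) (f := stretchCollar B a)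
    (g := toCollar B fun z : ℂ => ‖z‖) (x := (b, z))
    ((contMDiff_stretchCollar ha).mdifferentiableAt (by simp))
    ((contMDiffAt_toCollar_norm b hz0).mdifferentiableAt (by simp))
  have h8 : (toCollar B fun z : ℂ => ‖z‖ ^ 2 / a) =ᶠ[𝓝 ((b, z) : B × ℂ)]
      stretchCollar B a ∘ toCollar B fun z : ℂ => ‖z‖ := by
    filter_upwards [hnear _ hz] with q hq
    simp only [Function.comp, stretchCollar, toCollar, halfLine_val (norm_nonneg q.2)]
    rw [radiusProfile_of_le ha hq.le]
  refine (OneForm.pullback_congr _ h1).trans (h2.trans ?_)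
  refine Eq.trans ?_ (OneForm.pullback_congr _ h8).symm
  exact ContinuousLinearMap.ext fun v => (h3 v).trans ((DFunLike.congr_fun h5 v).trans
    ((h6 v).trans (DFunLike.congr_fun h7 v).symm))

theorem sq_div_lt {a : ℝ} (ha : 0 < a) {r : ℝ} (hr : 0 ≤ r) (hr' : r < a / 2) :
    r ^ 2 / a < a / 2 := by
  rw [div_lt_iff₀ ha]
  nlinarith

theorem isSmooth_gluedForm [T2Space P] [CompactSpace P]
    (hΨ : ∀ x ∈ (JP).boundary P, Ψ x = x) {a : ℝ} (ha : 0 < a) (ha' : a < S.δ)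
    (hβ : β.IsSmooth) : (S.gluedForm a β).IsSmooth := by
  refine isSmooth_iff.2 fun y => ?_
  by_cases hy : y ∈ range fun b => S.tube (b, 0)
  · obtain ⟨b, rfl⟩ := hy
    refine OneForm.SmoothAt.of_pullback (S.isLocalDiffeomorphAt_tube b (by simpa using S.δ_pos)) ?_
    refine (S.smoothAt_tubeForm hβ ha b (z := 0) (by simpa using S.δ_pos)).congr ?_
    have h1 : ∀ᶠ q in 𝓝 ((b, 0) : B × ℂ), ‖q.2‖ < a / 2 :=
      (continuous_snd.norm.continuousAt (x := ((b, 0) : B × ℂ))).eventually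
        (gt_mem_nhds (by simpa using ha))
    filter_upwards [h1] with q hq
    exact S.pullback_tube_gluedForm hΨ ha ha' q.1 hq
  · obtain ⟨x, hx, t, rfl⟩ := S.exists_susp hy
    refine OneForm.SmoothAt.of_pullback (S.isLocalDiffeomorphAt_susp (p := (x, t)) hx) ?_
    have h1 := isSmooth_pathForm (isSmoothFamily_suspForm (Ψ := Ψ)
      (S.isSmooth_stretchForm hβ ha ha'))
    refine (isSmooth_iff.1 h1 (x, t)).congr ?_
    have h2 : ∀ᶠ p : P × ℝ in 𝓝 (x, t), p.1 ∈ (JP).interior P :=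
      continuous_fst.continuousAt.eventually
        (((JP).isOpen_interior (n := ∞) (by simp)).mem_nhds hx)
    filter_upwards [h2] with p hp
    exact S.pullback_susp_gluedForm a β hp

end SmoothGluing

theorem IsSymplecticOpenBook.monodromy_boundary (h : IsSymplecticOpenBook β Ψ) :
    ∀ x ∈ (JP).boundary P, Ψ x = x := fun x hx => h.id_near_boundary.self_of_nhdsSet x hx

theorem rot_circle (z : ℂ) (hz : ‖z‖ = 1) (c : ℝ) :
    rot z (c • (z * (2 * Real.pi * Complex.I))) = 2 * Real.pi * c := by
  have h : z.re * z.re + z.im * z.im = 1 := by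
    rw [← Complex.normSq_apply, Complex.normSq_eq_norm_sq, hz, one_pow]
  rw [rot_apply]
  simp only [Complex.smul_re, Complex.smul_im, Complex.mul_re, Complex.mul_im, Complex.I_re,
    Complex.I_im, Complex.ofReal_re, Complex.ofReal_im, Complex.re_ofNat, Complex.im_ofNat,
    smul_eq_mul]
  linear_combination 2 * Real.pi * c * h

theorem pullback_circle (t c : ℝ) : pullback (I := 𝓘(ℝ, ℂ)) (I' := 𝓘(ℝ, ℝ))
    (fun s : ℝ => Complex.exp (2 * Real.pi * s * Complex.I)) planeForm t c = 2 * Real.pi * c := by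
  have h1 : HasDerivAt (fun s : ℝ => Complex.exp (2 * Real.pi * s * Complex.I))
      (Complex.exp (2 * Real.pi * t * Complex.I) * (2 * Real.pi * Complex.I)) t := by
    have : HasDerivAt (fun s : ℝ => (2 * Real.pi * (s : ℂ) * Complex.I))
        (2 * Real.pi * Complex.I) t := by
      simpa using ((Complex.ofRealCLM.hasDerivAt (x := t)).const_mul (2 * Real.pi : ℂ)).mul_const
        Complex.I
    exact this.cexp
  refine (congrArg (rot (Complex.exp (2 * Real.pi * t * Complex.I)))
    (DFunLike.congr_fun h1.hasFDerivAt.hasMFDerivAt.mfderiv c)).trans ?_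
  refine rot_circle _ ?_ c
  have h2 := Complex.norm_exp_ofReal_mul_I (2 * Real.pi * t)
  push_cast at h2
  exact h2

namespace SmoothGluing

variable (S : SmoothGluing Ψ B)

theorem angleForm_susp {p : P × ℝ} (hp : p.1 ∈ (JP).interior P) (v : EP × ℝ) :
    S.openBook.angleForm (susp Ψ p) (mfderiv JR JM (susp Ψ) p v) = 2 * Real.pi * v.2 := by
  have h1 := OneForm.pullback_comp (I'' := JR) planeForm (f := fun y => (angle Ψ y : ℂ))
    (g := susp Ψ) (x := p) ((S.angle_contMDiffAt hp p.2).mdifferentiableAt (by simp))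
    (IsLocalDiffeomorphAt.mdifferentiableAt' (S.isLocalDiffeomorphAt_susp hp))
  have h2 : (fun y => (angle Ψ y : ℂ)) ∘ susp Ψ =ᶠ[𝓝 p]
      (fun s : ℝ => Complex.exp (2 * Real.pi * s * Complex.I)) ∘ Prod.snd := by
    have h3 : ∀ᶠ q : P × ℝ in 𝓝 p, q.1 ∈ (JP).interior P :=
      continuous_fst.continuousAt.eventually
        (((JP).isOpen_interior (n := ∞) (by simp)).mem_nhds hp)
    filter_upwards [h3] with q hq
    show (angle Ψ (susp Ψ (q.1, q.2)) : ℂ) = _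
    rw [angle_susp hq, Circle.coe_exp]
    push_cast
    rfl
  have h4 : ContDiff ℝ ∞ fun s : ℝ => Complex.exp (2 * Real.pi * (s : ℂ) * Complex.I) :=
    ((contDiff_const.mul Complex.ofRealCLM.contDiff).mul contDiff_const).cexp
  have h5 := OneForm.pullback_comp (I'' := JR) planeForm
    (f := fun s : ℝ => Complex.exp (2 * Real.pi * s * Complex.I)) (g := (Prod.snd : P × ℝ → ℝ))
    (x := p) (h4.contMDiff.mdifferentiableAt (by simp)) mdifferentiableAt_snd
  rw [OneForm.pullback_congr _ h2] at h1
  refine (DFunLike.congr_fun (h1.symm.trans h5) v).trans ?_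
  refine Eq.trans ?_ (pullback_circle p.2 v.2)
  refine congrArg (pullback (I := 𝓘(ℝ, ℂ)) (I' := 𝓘(ℝ, ℝ))
    (fun s : ℝ => Complex.exp (2 * Real.pi * s * Complex.I)) planeForm p.2) ?_
  exact DFunLike.congr_fun (hasMFDerivAt_snd (I := JP) (I' := 𝓘(ℝ, ℝ)) p).mfderiv v

variable [T2Space P] [CompactSpace P]

theorem d_gluedForm_susp 
    (h : IsSymplecticOpenBook β Ψ) {a : ℝ} (ha : 0 < a) (ha' : a < S.δ) {p : P × ℝ}
    (hp : p.1 ∈ (JP).interior P) (u v : EP) :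
    (S.gluedForm a β).d (susp Ψ p) (mfderiv JR JM (susp Ψ) p ((u, 0) : EP × ℝ))
      (mfderiv JR JM (susp Ψ) p ((v, 0) : EP × ℝ)) = (S.stretchForm a β).d p.1 u v := by
  have hs := S.isSmooth_stretchForm h.smooth ha ha'
  have h1 := OneForm.d_pullback (I' := JR) (f := susp Ψ) (x := p) (isSmooth_iff.1
    (S.isSmooth_gluedForm h.monodromy_boundary ha ha' h.smooth) (susp Ψ p))
    (S.isLocalDiffeomorphAt_susp hp).contMDiffAt ((u, 0) : EP × ℝ) ((v, 0) : EP × ℝ)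
  refine h1.symm.trans ?_
  have h2 : (pullback (I' := JR) (susp Ψ) (S.gluedForm a β)).d p =
      (pathForm (suspForm Ψ (S.stretchForm a β))).d p := by
    refine OneForm.d_congr ?_
    have h3 : ∀ᶠ q : P × ℝ in 𝓝 p, q.1 ∈ (JP).interior P :=
      continuous_fst.continuousAt.eventually
        (((JP).isOpen_interior (n := ∞) (by simp)).mem_nhds hp)
    filter_upwards [h3] with q hq
    exact S.pullback_susp_gluedForm a β hq
  rw [h2, d_pathForm (isSmoothFamily_suspForm hs)]
  exact d_suspForm hs (S.d_pullback_stretchForm h ha ha') p.2 p.1 u v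

/-- A frame of the total space made of the time direction and a frame of the page. -/
def suspFrame (Ψ : P ≃ₘ⟮JP, JP⟯ P)
    [ChartedSpace EM (Total Ψ)] (p : P × ℝ) (w : Fin (2 * (n + 1)) → EP) :
    Fin (2 * (n + 1) + 1) → TangentSpace JM (susp Ψ p) :=
  Fin.cons (mfderiv JR JM (susp Ψ) p ((0, 1) : EP × ℝ))
    fun i => mfderiv JR JM (susp Ψ) p ((w i, 0) : EP × ℝ)

theorem oddForm_suspFrame 
    (h : IsSymplecticOpenBook β Ψ) {a : ℝ} (ha : 0 < a) (ha' : a < S.δ) {p : P × ℝ}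
    (hp : p.1 ∈ (JP).interior P) (w : Fin (2 * (n + 1)) → EP) :
    oddForm (n + 1) (S.openBook.angleForm (susp Ψ p)).toLinearMap
      ((S.gluedForm a β).dB (susp Ψ p)) (suspFrame Ψ p w) =
      2 * Real.pi * wedgePow (n + 1) ((S.stretchForm a β).d p.1) w := by
  have h0 : ∀ i, (S.openBook.angleForm (susp Ψ p)).toLinearMap
      (mfderiv JR JM (susp Ψ) p ((w i, 0) : EP × ℝ)) = 0 := fun i =>
    (S.angleForm_susp hp (w i, 0)).trans (mul_zero _)
  refine (oddForm_cons _ _ h0 _).trans ?_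
  refine congrArg₂ (· * ·) ((S.angleForm_susp hp (0, 1)).trans (mul_one _)) ?_
  exact wedgePow_congr fun i j => S.d_gluedForm_susp h ha ha' hp (w i) (w j)

/-- The derivative of the form is positive on the pages. -/
theorem oddForm_suspFrame_pos 
    (h : IsSymplecticOpenBook β Ψ) {a : ℝ} (ha : 0 < a) (ha' : a < S.δ) {p : P × ℝ}
    (hp : p.1 ∈ (JP).interior P) {w : Fin (2 * (n + 1)) → EP}
    (hw : 0 < wedgePow (n + 1) (β.d p.1) w) :
    0 < oddForm (n + 1) (S.openBook.angleForm (susp Ψ p)).toLinearMap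
      ((S.gluedForm a β).dB (susp Ψ p)) (suspFrame Ψ p w) := by
  rw [S.oddForm_suspFrame h ha ha' hp]
  have h1 : 0 < evenForm (V := TangentSpace JP p.1) (n + 1) (β.dB p.1) w :=
    lt_of_lt_of_eq hw (evenForm_eq_wedgePow (V := TangentSpace JP p.1) (n + 1) (β.dB p.1) w).symm
  have h2 := S.evenForm_stretchForm_mul_pos h.smooth h.nondegenerate ha ha' hp
    (linearIndependent_of_topForm h1.ne')
  have h3 := pos_of_mul_pos_left h2 h1.le
  have h4 : 0 < wedgePow (n + 1) ((S.stretchForm a β).d p.1) w :=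
    lt_of_lt_of_eq h3 (evenForm_eq_wedgePow (V := TangentSpace JP p.1) (n + 1) _ w)
  have := Real.pi_pos
  positivity

theorem oddForm_gluedForm_ne_zero 
    (h : IsSymplecticOpenBook β Ψ) {a : ℝ} (ha : 0 < a) (ha' : a < S.δ) {y : Total Ψ}
    (hy : y ∉ range S.openBook.incl) {v : Fin (2 * (n + 1) + 1) → TangentSpace JM y}
    (hv : LinearIndependent ℝ v) : oddForm (n + 1) (S.openBook.angleForm y).toLinearMap
      ((S.gluedForm a β).dB y) v ≠ 0 := by
  obtain ⟨x, hx, t, rfl⟩ := S.exists_susp hy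
  have hdim : Module.finrank ℝ (TangentSpace JP x) = 2 * (n + 1) :=
    finrank_euclideanSpace_fin (𝕜 := ℝ) (n := 2 * n + 2)
  obtain ⟨w, hw⟩ := exists_linearIndependent hdim
  have h1 := S.evenForm_stretchForm_mul_pos h.smooth h.nondegenerate ha ha' hx hw
  have h2 : oddForm (n + 1) (S.openBook.angleForm (susp Ψ (x, t))).toLinearMap
      ((S.gluedForm a β).dB (susp Ψ (x, t))) (suspFrame Ψ (x, t) w) ≠ 0 := by
    refine fun h4 => ?_
    have h5 := (S.oddForm_suspFrame h ha ha' (p := (x, t)) hx w).symm.trans h4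
    refine left_ne_zero_of_mul h1.ne' ?_
    exact (evenForm_eq_wedgePow (V := TangentSpace JP x) (n + 1) _ w).trans
      ((mul_eq_zero.1 h5).resolve_left (by positivity))
  exact topForm_ne_zero (finrank_total n) (linearIndependent_of_topForm h2) hv h2

end SmoothGluing

namespace SmoothGluing

variable (S : SmoothGluing Ψ B)

theorem mfderiv_toCollar_normSq {a : ℝ} (ha : 0 < a) (q : B × ℂ) (v : EB × ℂ) :
    ∃ ξ : E1, (mfderiv JT JH (toCollar B fun z : ℂ => ‖z‖ ^ 2 / a) q v : EB × E1) = (v.1, ξ) ∧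
      ξ 0 = 2 / a * (q.2.re * v.2.re + q.2.im * v.2.im) := by
  have h0 : ∀ᶠ z : ℂ in 𝓝 q.2, 0 ≤ ‖z‖ ^ 2 / a :=
    Filter.Eventually.of_forall fun z => by positivity
  refine ⟨_, mfderiv_toCollar (contMDiff_normSq_div a q.2) h0 v, ?_⟩
  refine (mfderiv_halfLine (contMDiff_normSq_div a q.2) h0 v.2).trans ?_
  have h1 := ((((hasStrictFDerivAt_norm_sq (F := ℂ) q.2).hasFDerivAt.mul_const a⁻¹).congr_of_eventuallyEq
    (Filter.Eventually.of_forall fun z => div_eq_mul_inv (‖z‖ ^ 2) a)).hasMFDerivAt).mfderiv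
  refine (DFunLike.congr_fun h1 v.2).trans ?_
  show a⁻¹ * (2 • (inner ℝ q.2 v.2 : ℝ)) = _
  rw [Complex.inner]
  simp only [Complex.mul_re, Complex.conj_re, Complex.conj_im, nsmul_eq_mul]
  push_cast
  ring

variable [T2Space P] [CompactSpace P]

theorem gluedForm_tube 
    (h : IsSymplecticOpenBook β Ψ) {a : ℝ} (ha : 0 < a) (ha' : a < S.δ) (b : B) {z : ℂ}
    (hz : ‖z‖ < a / 2) (v : EB × ℂ) :
    S.gluedForm a β (S.tube (b, z)) (mfderiv JT JM S.tube (b, z) v) =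
      S.collarOne β (b, halfLine (‖z‖ ^ 2 / a))
        (mfderiv JT JH (toCollar B fun z : ℂ => ‖z‖ ^ 2 / a) (b, z) v) :=
  DFunLike.congr_fun (S.pullback_tube_gluedForm h.monodromy_boundary ha ha' b hz) v

theorem d_gluedForm_tube 
    (h : IsSymplecticOpenBook β Ψ) {a : ℝ} (ha : 0 < a) (ha' : a < S.δ) (b : B) {z : ℂ}
    (hz : ‖z‖ < a / 2) (u v : EB × ℂ) :
    (S.gluedForm a β).d (S.tube (b, z)) (mfderiv JT JM S.tube (b, z) u)
      (mfderiv JT JM S.tube (b, z) v) = S.collarTwo β (b, halfLine (‖z‖ ^ 2 / a))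
        (mfderiv JT JH (toCollar B fun z : ℂ => ‖z‖ ^ 2 / a) (b, z) u)
        (mfderiv JT JH (toCollar B fun z : ℂ => ‖z‖ ^ 2 / a) (b, z) v) := by
  have h1 := OneForm.d_pullback (I' := JT) (f := S.tube) (x := (b, z)) (isSmooth_iff.1
    (S.isSmooth_gluedForm h.monodromy_boundary ha ha' h.smooth) (S.tube (b, z)))
    (S.isLocalDiffeomorphAt_tube b (hz.trans (by linarith))).contMDiffAt u v
  refine h1.symm.trans ?_
  have h2 : (pullback (I' := JT) S.tube (S.gluedForm a β)).d (b, z) =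
      (S.tubeForm a β).d (b, z) := by
    refine OneForm.d_congr ?_
    have h3 : ∀ᶠ q in 𝓝 ((b, z) : B × ℂ), ‖q.2‖ < a / 2 :=
      (continuous_snd.norm.continuousAt (x := ((b, z) : B × ℂ))).eventually (gt_mem_nhds hz)
    filter_upwards [h3] with q hq
    exact S.pullback_tube_gluedForm h.monodromy_boundary ha ha' q.1 hq
  rw [h2]
  have h4 : ‖z‖ ^ 2 / a < S.δ := (sq_div_lt ha (norm_nonneg z) hz).trans (by linarith)
  have h5 : (S.collarForm β).SmoothAt (toCollar B (fun z : ℂ => ‖z‖ ^ 2 / a) (b, z)) :=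
    S.smoothAt_collarForm h.smooth b (by rw [halfLine_val (by positivity)]; exact h4)
  exact OneForm.d_pullback (I' := JT) (f := toCollar B fun z : ℂ => ‖z‖ ^ 2 / a) (x := (b, z)) h5
    (contMDiff_toCollar_normSq ha _) u v

theorem mfderiv_toCollar_normSq_horizontal {a : ℝ} (ha : 0 < a) (b : B) (z : ℂ) (v : EB) :
    (mfderiv JT JH (toCollar B fun z : ℂ => ‖z‖ ^ 2 / a) (b, z) ((v, 0) : EB × ℂ) : EB × E1) =
      (v, 0) := by
  obtain ⟨ξ, h1, h2⟩ := mfderiv_toCollar_normSq ha (b, z) ((v, 0) : EB × ℂ)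
  have h3 : ξ = 0 := by
    ext j
    fin_cases j
    exact h2.trans (by simp)
  rw [h1, h3]

/-- The restriction of the form to the binding. -/
theorem contactVolume_gluedForm_incl 
    (h : IsSymplecticOpenBook β Ψ) {a : ℝ} (ha : 0 < a) (ha' : a < S.δ) (b : B)
    (v : Fin (2 * n + 1) → EB) :
    contactVolume n (pullback (I' := JB) S.openBook.incl (S.gluedForm a β)) b v =
      S.collarVolume β b (halfLine 0) v := by
  have h0 : ‖(0 : ℂ)‖ < a / 2 := by simpa using ha
  have hr : halfLine (‖(0 : ℂ)‖ ^ 2 / a) = halfLine 0 := by simp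
  have h1 := contactVolume_pullback n (isSmooth_iff.1
    (S.isSmooth_gluedForm h.monodromy_boundary ha ha' h.smooth) _)
    (S.openBook.contMDiff_incl b) v
  have h2 : (fun i => mfderiv JB JM S.openBook.incl b (v i)) =
      fun i => (mfderiv JT JM S.tube (b, 0) ((v i, 0) : EB × ℂ) : EM) :=
    funext fun i => S.openBook.mfderiv_incl b (v i)
  have h3 : contactVolume n (S.gluedForm a β) (S.openBook.incl b)
      (fun i => (mfderiv JT JM S.tube (b, 0) ((v i, 0) : EB × ℂ) : EM)) =
      S.collarVolume β b (halfLine 0) v := by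
    refine wedgeWedgePow_congr (fun i => ?_) fun i j => ?_
    · refine (S.gluedForm_tube h ha ha' b h0 (v i, 0)).trans ?_
      rw [hr]
      exact congrArg (S.collarOne β (b, halfLine 0))
        (mfderiv_toCollar_normSq_horizontal ha b 0 (v i))
    · refine (S.d_gluedForm_tube h ha ha' b h0 (v i, 0) (v j, 0)).trans ?_
      rw [hr]
      exact congrArg₂ (fun u u' => S.collarTwo β (b, halfLine 0) u u')
        (mfderiv_toCollar_normSq_horizontal ha b 0 (v i))
        (mfderiv_toCollar_normSq_horizontal ha b 0 (v j))
  exact h1.trans ((congrArg (contactVolume n (S.gluedForm a β) (S.openBook.incl b)) h2).trans h3)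

end SmoothGluing

namespace SmoothGluing

variable (S : SmoothGluing Ψ B)

theorem angleForm_tube [CompactSpace B] [T2Space (Total Ψ)] (b : B) {z : ℂ} (hz0 : z ≠ 0)
    (hz : ‖z‖ < S.δ) (v : EB × ℂ) :
    S.openBook.angleForm (S.tube (b, z)) (mfderiv JT JM S.tube (b, z) v) =
      (‖z‖ ^ 2)⁻¹ * rot z v.2 :=
  (DFunLike.congr_fun (S.openBook.pullback_tube_angleForm b hz0 hz) v).trans
    (congrArg ((‖z‖ ^ 2)⁻¹ * ·) (planeFormProd_apply (b, z) v))

theorem differential_rsq_tube [CompactSpace B] [T2Space (Total Ψ)] (b : B) {z : ℂ} (hz : ‖z‖ < S.δ) (v : EB × ℂ) :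
    differential (I := JM) S.openBook.rsq (S.tube (b, z)) (mfderiv JT JM S.tube (b, z) v) =
      2 * (z.re * v.2.re + z.im * v.2.im) := by
  have hs : S.tube (b, z) ∈ S.openBook.tube.target :=
    S.tube.map_source' (S.mem_tube_source b hz)
  have h1 := HasMFDerivAt.comp ((b, z) : B × ℂ)
    ((S.openBook.contMDiffAt_rsq hs).mdifferentiableAt (by simp)).hasMFDerivAt
    (IsLocalDiffeomorphAt.mdifferentiableAt' (S.isLocalDiffeomorphAt_tube b hz)).hasMFDerivAt
  have h2 : S.openBook.rsq ∘ S.tube =ᶠ[𝓝 ((b, z) : B × ℂ)] (fun w : ℂ => ‖w‖ ^ 2) ∘ Prod.snd := by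
    have h3 : ∀ᶠ q in 𝓝 ((b, z) : B × ℂ), ‖q.2‖ < S.δ :=
      (continuous_snd.norm.continuousAt (x := ((b, z) : B × ℂ))).eventually (gt_mem_nhds hz)
    filter_upwards [h3] with q hq
    exact S.openBook.rsq_tube q.1 hq
  have h4 := HasMFDerivAt.comp ((b, z) : B × ℂ)
    (hasStrictFDerivAt_norm_sq (F := ℂ) z).hasFDerivAt.hasMFDerivAt
    (hasMFDerivAt_snd (I := JB) (I' := 𝓘(ℝ, ℂ)) (b, z))
  have h5 := h1.mfderiv.symm.trans ((Filter.EventuallyEq.mfderiv_eq h2).trans h4.mfderiv)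
  refine (DFunLike.congr_fun h5 v).trans ?_
  show (2 • (inner ℝ z v.2 : ℝ)) = _
  rw [Complex.inner]
  simp only [Complex.mul_re, Complex.conj_re, Complex.conj_im, nsmul_eq_mul]
  push_cast
  ring

/-- A frame near the binding: the angular direction, the radial direction, and a frame of `B`. -/
def tubeFrame (b : B) (z : ℂ) (v : Fin (2 * n + 1) → EB) :
    Fin (2 * (n + 1) + 1) → TangentSpace JM (S.tube (b, z)) :=
  Fin.cons (mfderiv JT JM S.tube (b, z) ((0, z * Complex.I) : EB × ℂ))
    (Fin.cons (mfderiv JT JM S.tube (b, z) ((0, z) : EB × ℂ))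
      (fun i => mfderiv JT JM S.tube (b, z) ((v i, 0) : EB × ℂ)) :
        Fin (2 * n + 1 + 1) → TangentSpace JM (S.tube (b, z)))

theorem normSq_eq (z : ℂ) : z.re * z.re + z.im * z.im = ‖z‖ ^ 2 := by
  rw [← Complex.normSq_apply, Complex.normSq_eq_norm_sq]

theorem angleForm_tube_angular [CompactSpace B] [T2Space (Total Ψ)] (b : B) {z : ℂ} (hz0 : z ≠ 0)
    (hz : ‖z‖ < S.δ) : S.openBook.angleForm (S.tube (b, z))
      (mfderiv JT JM S.tube (b, z) ((0, z * Complex.I) : EB × ℂ)) = 1 := by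
  refine (S.angleForm_tube b hz0 hz _).trans ?_
  rw [rot_apply]
  simp only [Complex.mul_im, Complex.mul_re, Complex.I_im, Complex.I_re]
  rw [show z.re * (z.re * 1 + z.im * 0) - z.im * (z.re * 0 - z.im * 1) =
    z.re * z.re + z.im * z.im by ring, normSq_eq]
  have hzn : ‖z‖ ≠ 0 := norm_ne_zero_iff.2 hz0
  field_simp

variable [T2Space P] [CompactSpace P]

theorem oddForm_tubeFrame [CompactSpace B] [T2Space (Total Ψ)] 
    (h : IsSymplecticOpenBook β Ψ) {a : ℝ} (ha : 0 < a) (ha' : a < S.δ) (b : B) {z : ℂ}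
    (hz0 : z ≠ 0) (hz : ‖z‖ < a / 2) (v : Fin (2 * n + 1) → EB) :
    oddForm (n + 1) (S.openBook.angleForm (S.tube (b, z))).toLinearMap
      ((S.gluedForm a β).dB (S.tube (b, z))) (S.tubeFrame b z v) =
      2 / a * ‖z‖ ^ 2 * evenForm (n + 1) (S.collarTwo β (b, halfLine (‖z‖ ^ 2 / a)))
        (collarFrame v) := by
  have hzδ : ‖z‖ < S.δ := hz.trans (by linarith)
  have hA := S.angleForm_tube b hz0 hzδ
  have h1 := S.angleForm_tube_angular b hz0 hzδ
  have h2 : ∀ i, (S.openBook.angleForm (S.tube (b, z))).toLinearMap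
      ((Fin.cons (mfderiv JT JM S.tube (b, z) ((0, z) : EB × ℂ))
      (fun i => mfderiv JT JM S.tube (b, z) ((v i, 0) : EB × ℂ)) :
        Fin (2 * n + 1 + 1) → TangentSpace JM (S.tube (b, z))) i) = 0 := by
    intro i
    refine Fin.cases ?_ (fun i => ?_) i
    · refine (hA ((0, z) : EB × ℂ)).trans ?_
      rw [rot_apply]
      ring
    · refine (hA ((v i, 0) : EB × ℂ)).trans ?_
      rw [map_zero, mul_zero]
  refine (oddForm_cons _ _ h2 _).trans ?_
  refine (congrArg (· * _) h1).trans ((one_mul _).trans ?_)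
  obtain ⟨ξ, hξ, hξ0⟩ := mfderiv_toCollar_normSq ha (b, z) ((0, z) : EB × ℂ)
  have h3 := evenForm_cons_radial (S.collarTwo β (b, halfLine (‖z‖ ^ 2 / a))) ((0, ξ) : EB × E1) v
  have h4 : ((0, ξ) : EB × E1).2 0 = 2 / a * ‖z‖ ^ 2 := by
    rw [← normSq_eq z]
    exact hξ0
  rw [h4] at h3
  refine Eq.trans ?_ h3
  refine Eq.trans ?_ (evenForm_eq_wedgePow (n + 1) _ _).symm
  let f : Fin (2 * n + 1 + 1) → EB × ℂ := Fin.cons (0, z) fun i => (v i, 0)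
  have h5 : ∀ i : Fin (2 * n + 1 + 1),
      (Fin.cons (mfderiv JT JM S.tube (b, z) ((0, z) : EB × ℂ))
      (fun i => mfderiv JT JM S.tube (b, z) ((v i, 0) : EB × ℂ)) :
        Fin (2 * n + 1 + 1) → TangentSpace JM (S.tube (b, z))) i =
        mfderiv JT JM S.tube (b, z) (f i) := fun i =>
    Fin.cases rfl (fun i => rfl) i
  have h6 : ∀ i : Fin (2 * n + 1 + 1), (mfderiv JT JH (toCollar B fun z : ℂ => ‖z‖ ^ 2 / a) (b, z)
      (f i) : EB × E1) = (Fin.cons ((0, ξ) : EB × E1) (fun i => ((v i, 0) : EB × E1)) :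
        Fin (2 * n + 1 + 1) → EB × E1) i := fun i =>
    Fin.cases hξ (fun i => mfderiv_toCollar_normSq_horizontal ha b z (v i)) i
  refine wedgePow_congr fun i j => ?_
  refine (congrArg₂ (fun u u' => (S.gluedForm a β).d (S.tube (b, z)) u u') (h5 i) (h5 j)).trans ?_
  refine (S.d_gluedForm_tube h ha ha' b hz (f i) (f j)).trans ?_
  exact congrArg₂ (fun u u' => S.collarTwo β (b, halfLine (‖z‖ ^ 2 / a)) u u') (h6 i) (h6 j)

theorem mixedForm_tubeFrame [CompactSpace B] [T2Space (Total Ψ)] 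
    (h : IsSymplecticOpenBook β Ψ) {a : ℝ} (ha : 0 < a) (ha' : a < S.δ) (b : B) {z : ℂ}
    (hz0 : z ≠ 0) (hz : ‖z‖ < a / 2) (v : Fin (2 * n + 1) → EB) :
    mixedForm (n + 1) (S.gluedForm a β (S.tube (b, z))).toLinearMap
      (differential (I := JM) S.openBook.rsq (S.tube (b, z))).toLinearMap
      (S.openBook.angleForm (S.tube (b, z))).toLinearMap
      ((S.gluedForm a β).dB (S.tube (b, z))) (S.tubeFrame b z v) =
      -((n + 1) * (2 * ‖z‖ ^ 2 * S.collarVolume β b (halfLine (‖z‖ ^ 2 / a)) v)) := by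
  have hzδ : ‖z‖ < S.δ := hz.trans (by linarith)
  have hA := S.angleForm_tube b hz0 hzδ
  have hD := S.differential_rsq_tube b hzδ
  have h1 := S.angleForm_tube_angular b hz0 hzδ
  have h2 : S.openBook.angleForm (S.tube (b, z))
      (mfderiv JT JM S.tube (b, z) ((0, z) : EB × ℂ)) = 0 := by
    refine (hA _).trans ?_
    rw [rot_apply]
    ring
  have h3 : differential (I := JM) S.openBook.rsq (S.tube (b, z))
      (mfderiv JT JM S.tube (b, z) ((0, z) : EB × ℂ)) = 2 * ‖z‖ ^ 2 := by
    rw [← normSq_eq z]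
    exact hD _
  have h4 : ∀ i, (S.openBook.angleForm (S.tube (b, z))).toLinearMap
      (mfderiv JT JM S.tube (b, z) ((v i, 0) : EB × ℂ)) = 0 := fun i => by
    refine (hA ((v i, 0) : EB × ℂ)).trans ?_
    rw [map_zero, mul_zero]
  have h5 : ∀ i, (differential (I := JM) S.openBook.rsq (S.tube (b, z))).toLinearMap
      (mfderiv JT JM S.tube (b, z) ((v i, 0) : EB × ℂ)) = 0 := fun i => by
    refine (hD ((v i, 0) : EB × ℂ)).trans ?_
    simp
  have h6 := mixedForm_cons_cons (k := n) (S.gluedForm a β (S.tube (b, z))).toLinearMap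
    ((S.gluedForm a β).dB (S.tube (b, z))) _ h5 h4 h2
    (mfderiv JT JM S.tube (b, z) ((0, z * Complex.I) : EB × ℂ))
  refine h6.trans ?_
  have h7 : wedgeWedgePow n (S.gluedForm a β (S.tube (b, z))).toLinearMap
      (fun x y => (S.gluedForm a β).dB (S.tube (b, z)) x y)
      (fun i => mfderiv JT JM S.tube (b, z) ((v i, 0) : EB × ℂ)) =
      S.collarVolume β b (halfLine (‖z‖ ^ 2 / a)) v := by
    refine wedgeWedgePow_congr (fun i => ?_) fun i j => ?_
    · refine (S.gluedForm_tube h ha ha' b hz (v i, 0)).trans ?_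
      exact congrArg (S.collarOne β (b, halfLine (‖z‖ ^ 2 / a)))
        (mfderiv_toCollar_normSq_horizontal ha b z (v i))
    · refine (S.d_gluedForm_tube h ha ha' b hz (v i, 0) (v j, 0)).trans ?_
      exact congrArg₂ (fun u u' => S.collarTwo β (b, halfLine (‖z‖ ^ 2 / a)) u u')
        (mfderiv_toCollar_normSq_horizontal ha b z (v i))
        (mfderiv_toCollar_normSq_horizontal ha b z (v j))
  have key : ∀ q p c c' m : ℝ, q = 1 → p = 2 * ‖z‖ ^ 2 → c = c' →
      -((m + 1) * (q * (p * c))) = -((m + 1) * (2 * ‖z‖ ^ 2 * c')) := by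
    rintro q p c c' m rfl rfl rfl
    ring
  exact key _ _ _ _ _ h1 h3 h7

end SmoothGluing

theorem exists_mixedForm_eq {V : Type*} [AddCommGroup V] [Module ℝ V] [FiniteDimensional ℝ V] (k : ℕ)
    (a p q : Module.Dual ℝ V) (w : BilinForm ℝ V) :
    ∃ W : V [⋀^Fin (2 * k + 1)]→ₗ[ℝ] ℝ, ∀ v, mixedForm k a p q w v = W v :=
  ⟨oddForm k a (w + wedgeTwo p q) - oddForm k a w, fun _ => rfl⟩

theorem segmentForm_self {E : Type*} [NormedAddCommGroup E] [NormedSpace ℝ E]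
    {H : Type*} [TopologicalSpace H] {I : ModelWithCorners ℝ E H}
    {M : Type*} [TopologicalSpace M] [ChartedSpace H M] (γ : OneForm I M) (s : ℝ) :
    segmentForm γ γ s = γ := by
  rw [segmentForm, ← add_smul, sub_add_cancel, one_smul]

namespace SmoothGluing

variable (S : SmoothGluing Ψ B) [T2Space P] [CompactSpace P] [CompactSpace B] [T2Space (Total Ψ)]

theorem volumeChange_gluedForm_mul_pos 
    (h : IsSymplecticOpenBook β Ψ) {a s : ℝ} (ha : 0 < a) (ha' : a < S.δ)
    (hs : ∀ b r, 0 ≤ r → r < s → ∀ v : Fin (2 * n + 1) → EB, LinearIndependent ℝ v →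
      S.collarVolume β b (halfLine r) v *
        evenForm (n + 1) (S.collarTwo β (b, halfLine r)) (collarFrame v) < 0)
    (b : B) {z : ℂ} (hz0 : z ≠ 0) (hz : ‖z‖ < a / 2) (hzs : ‖z‖ ^ 2 / a < s)
    {v : Fin (2 * (n + 1) + 1) → TangentSpace JM (S.tube (b, z))} (hv : LinearIndependent ℝ v) :
    0 < volumeChange (n + 1) (S.gluedForm a β) S.openBook.coreForm (S.tube (b, z)) v *
      oddForm (n + 1) (S.openBook.angleForm (S.tube (b, z))).toLinearMap
        ((S.gluedForm a β).dB (S.tube (b, z))) v := by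
  have hzδ : ‖z‖ < S.δ := hz.trans (by linarith)
  have hmem : S.tube (b, z) ∈ S.openBook.tube.target :=
    S.tube.map_source' (S.mem_tube_source b hzδ)
  have hcore : S.tube (b, z) ∉ range S.openBook.incl := fun h' =>
    hz0 ((S.openBook.tube_mem_core_iff b hzδ).1 h')
  have hvc := S.openBook.volumeChange_fsmul_angleForm (n + 1) (S.openBook.contMDiffAt_rsq hmem) hcore
    (isSmooth_iff.1 (S.isSmooth_gluedForm h.monodromy_boundary ha ha' h.smooth)
      (S.tube (b, z)))
  obtain ⟨e, he⟩ := exists_linearIndependent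
    (finrank_euclideanSpace_fin (𝕜 := ℝ) (n := 2 * n + 1))
  have hneg := hs b (‖z‖ ^ 2 / a) (by positivity) hzs e he
  have hT := S.oddForm_tubeFrame h ha ha' b hz0 hz e
  have hW := S.mixedForm_tubeFrame h ha ha' b hz0 hz e
  refine lt_of_lt_of_eq ?_ (congrArg (· * _) (hvc v).symm)
  generalize hA : oddForm (n + 1) (S.openBook.angleForm (S.tube (b, z))).toLinearMap
    ((S.gluedForm a β).dB (S.tube (b, z))) = A at hT ⊢
  obtain ⟨W, hWm⟩ := exists_mixedForm_eq (n + 1) (S.gluedForm a β (S.tube (b, z))).toLinearMap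
      (differential (I := JM) S.openBook.rsq (S.tube (b, z))).toLinearMap
      (S.openBook.angleForm (S.tube (b, z))).toLinearMap
      ((S.gluedForm a β).dB (S.tube (b, z)))
  rw [hWm] at hW
  rw [hWm]
  have hpos : 0 < (S.openBook.rsq (S.tube (b, z)) • A + W) (S.tubeFrame b z e) *
      A (S.tubeFrame b z e) := by
    have hrsq : S.openBook.rsq (S.tube (b, z)) = ‖z‖ ^ 2 := S.openBook.rsq_tube b hzδ
    show 0 < (S.openBook.rsq (S.tube (b, z)) * A (S.tubeFrame b z e) + W (S.tubeFrame b z e)) *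
      A (S.tubeFrame b z e)
    rw [hrsq, hT, hW]
    have hzn : 0 < ‖z‖ := norm_pos_iff.2 hz0
    generalize evenForm (n + 1) (S.collarTwo β (b, halfLine (‖z‖ ^ 2 / a))) (collarFrame e) = x at hneg ⊢
    generalize S.collarVolume β b (halfLine (‖z‖ ^ 2 / a)) e = y at hneg ⊢
    have h1 : (‖z‖ ^ 2 * (2 / a * ‖z‖ ^ 2 * x) + -((n + 1) * (2 * ‖z‖ ^ 2 * y))) *
        (2 / a * ‖z‖ ^ 2 * x) = ‖z‖ ^ 2 * (2 / a * ‖z‖ ^ 2 * x) ^ 2 +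
          (n + 1) * (4 / a * (‖z‖ ^ 2) ^ 2) * -(y * x) := by ring
    rw [h1]
    have h2 : 0 < ((n : ℝ) + 1) * (4 / a * (‖z‖ ^ 2) ^ 2) * -(y * x) :=
      mul_pos (by positivity) (by linarith)
    positivity
  exact topForm_mul_pos (A := S.openBook.rsq (S.tube (b, z)) • A + W) (B := A) (finrank_total n)
    (linearIndependent_of_topForm (right_ne_zero_of_mul hpos.ne')) hv hpos

theorem collarVolume_ne_zero (h : IsSymplecticOpenBook β Ψ)
    (b : B) {v : Fin (2 * n + 1) → EB} (hv : LinearIndependent ℝ v) :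
    S.collarVolume β b (halfLine 0) v ≠ 0 :=
  left_ne_zero_of_mul (S.collarVolume_mul_neg h.smooth h.nondegenerate h.convex_boundary b hv).ne

theorem volumeChange_gluedForm_incl 
    (h : IsSymplecticOpenBook β Ψ) {a : ℝ} (ha : 0 < a) (ha' : a < S.δ) (b : B)
    (v : Fin (2 * n + 1) → EB) :
    volumeChange (n + 1) (S.gluedForm a β) S.openBook.coreForm (S.openBook.incl b)
      (S.openBook.appendFrame b v) =
      2 * (n + 1) * contactVolume n (pullback (I' := JB) S.openBook.incl
        (S.gluedForm a β)) b v :=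
  S.openBook.volumeChange_coreForm_incl (isSmooth_iff.1
    (S.isSmooth_gluedForm h.monodromy_boundary ha ha' h.smooth) _) v

theorem volumeChange_gluedForm_core_ne_zero 
    (h : IsSymplecticOpenBook β Ψ) {a : ℝ} (ha : 0 < a) (ha' : a < S.δ) (b : B)
    {v : Fin (2 * (n + 1) + 1) → TangentSpace JM (S.openBook.incl b)}
    (hv : LinearIndependent ℝ v) :
    volumeChange (n + 1) (S.gluedForm a β) S.openBook.coreForm (S.openBook.incl b) v ≠ 0 := by
  obtain ⟨e, he⟩ := exists_linearIndependent
    (finrank_euclideanSpace_fin (𝕜 := ℝ) (n := 2 * n + 1))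
  have h1 := S.volumeChange_gluedForm_incl h ha ha' b e
  have h2 := S.contactVolume_gluedForm_incl h ha ha' b e
  have h3 : volumeChange (n + 1) (S.gluedForm a β) S.openBook.coreForm (S.openBook.incl b)
      (S.openBook.appendFrame b e) ≠ 0 := by
    rw [h1, h2]
    exact mul_ne_zero (by positivity) (S.collarVolume_ne_zero h b he)
  have h4 : ∀ f, volumeChange (n + 1) (S.gluedForm a β) S.openBook.coreForm (S.openBook.incl b) f =
      (oddForm (n + 1) ((S.gluedForm a β + S.openBook.coreForm) (S.openBook.incl b)).toLinearMap
        ((S.gluedForm a β + S.openBook.coreForm).dB (S.openBook.incl b)) -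
      oddForm (n + 1) (S.gluedForm a β (S.openBook.incl b)).toLinearMap
        ((S.gluedForm a β).dB (S.openBook.incl b))) f := fun f => by
    rw [volumeChange, contactVolume_eq_oddForm, contactVolume_eq_oddForm]
    rfl
  rw [h4] at h3 ⊢
  exact topForm_ne_zero (finrank_total n)
    (S.openBook.linearIndependent_appendFrame b he) hv h3

/-- The form on the total space, corrected by a large multiple of the angular form, is contact. -/
theorem exists_contact_correction 
    (h : IsSymplecticOpenBook β Ψ) : ∃ a r κ : ℝ, 0 < a ∧ a < S.δ ∧ 0 < r ∧ r < S.δ ∧ 0 < κ ∧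
      (∀ x v, LinearIndependent ℝ v → 0 <
        contactVolume (n + 1) (S.gluedForm a β + κ • S.openBook.bindingForm (r ^ 2)) x v *
          volumeChange (n + 1) (S.gluedForm a β) (S.openBook.bindingForm (r ^ 2)) x v) ∧
      ∀ x ∉ range S.openBook.incl, ∀ v, LinearIndependent ℝ v → 0 <
        volumeChange (n + 1) (S.gluedForm a β) (S.openBook.bindingForm (r ^ 2)) x v *
          oddForm (n + 1) (S.openBook.angleForm x).toLinearMap ((S.gluedForm a β).dB x) v := by
  obtain ⟨s, hs, -, hs'⟩ := S.exists_radius h.smooth h.nondegenerate h.convex_boundary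
  have hδ := S.δ_pos
  obtain ⟨a, rfl⟩ : ∃ a, a = S.δ / 2 := ⟨_, rfl⟩
  have ha : 0 < S.δ / 2 := by linarith
  have ha' : S.δ / 2 < S.δ := by linarith
  generalize S.δ / 2 = a at ha ha'
  have hr : 0 < min (a / 2) s := lt_min (by linarith) hs
  have hr1 := min_le_left (a / 2) s
  have hr2 := min_le_right (a / 2) s
  generalize min (a / 2) s = r at hr hr1 hr2
  have hr' : r < S.δ := by linarith
  have hsm := S.isSmooth_gluedForm h.monodromy_boundary ha ha' h.smooth
  have hprod : ∀ x ∈ S.openBook.tube.target, x ∉ range S.openBook.incl → S.openBook.rsq x < r ^ 2 →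
      ∀ v, LinearIndependent ℝ v → 0 <
        volumeChange (n + 1) (S.gluedForm a β) S.openBook.coreForm x v *
          oddForm (n + 1) (S.openBook.angleForm x).toLinearMap ((S.gluedForm a β).dB x) v := by
    intro x hx hxc hxr v hv
    obtain ⟨b, z, hz, rfl⟩ := S.openBook.exists_tube_eq hx
    have hz0 : z ≠ 0 := fun h' => hxc ((S.openBook.tube_mem_core_iff b hz).2 h')
    rw [S.openBook.rsq_tube b hz] at hxr
    have hzr : ‖z‖ < r := lt_of_pow_lt_pow_left₀ 2 hr.le hxr
    have hza : ‖z‖ < a / 2 := hzr.trans_le hr1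
    refine S.volumeChange_gluedForm_mul_pos h ha ha' hs' b hz0 hza ?_ hv
    rw [div_lt_iff₀ ha]
    nlinarith [norm_nonneg z]
  have hT : ∀ x ∉ range S.openBook.incl, ∀ v, LinearIndependent ℝ v →
      oddForm (n + 1) (S.openBook.angleForm x).toLinearMap ((S.gluedForm a β).dB x) v ≠ 0 :=
    fun x hx v hv => S.oddForm_gluedForm_ne_zero h ha ha' hx hv
  obtain ⟨K, hK, hK'⟩ := S.openBook.exists_contact_perturbation hsm hsm hr hr'
    (fun s _ => by rw [segmentForm_self]; exact hT)
    (fun s _ => by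
      rw [segmentForm_self]
      exact fun b v hv => S.volumeChange_gluedForm_core_ne_zero h ha ha' b hv)
    (fun s _ => by rw [segmentForm_self]; exact hprod)
  refine ⟨a, r, K + 1, ha, ha', hr, hr', by linarith, fun x v hv => ?_, fun x hx v hv => ?_⟩
  · have h1 := hK' (K + 1) (by linarith) 0 ⟨le_rfl, zero_le_one⟩ x v hv
    rwa [segmentForm_self] at h1
  · exact OpenBook.volumeChange_bindingForm_mul_pos hr hr' hx (isSmooth_iff.1 hsm x)
      (hT x hx v hv) fun hxt hlt => hprod x hxt hx hlt v hv

variable {a r κ : ℝ}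

theorem dB_contact_correction 
    (h : IsSymplecticOpenBook β Ψ) (ha : 0 < a) (ha' : a < S.δ) (hr : 0 < r) (hr' : r < S.δ)
    (κ : ℝ) (x : Total Ψ) :
    (S.gluedForm a β + κ • S.openBook.bindingForm (r ^ 2)).dB x =
      (S.gluedForm a β).dB x + κ • (S.openBook.bindingForm (r ^ 2)).dB x := by
  have h1 := isSmooth_iff.1
    (S.isSmooth_gluedForm h.monodromy_boundary ha ha' h.smooth) x
  have h2 := isSmooth_iff.1 (S.openBook.isSmooth_bindingForm hr hr') x
  rw [OneForm.dB_add h1 (h2.smul κ), OneForm.dB_smul h2]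

theorem oddForm_contact_correction 
    (h : IsSymplecticOpenBook β Ψ) (ha : 0 < a) (ha' : a < S.δ) (hr : 0 < r) (hr' : r < S.δ)
    (κ : ℝ) {x : Total Ψ} (hx : x ∉ range S.openBook.incl)
    (v : Fin (2 * (n + 1) + 1) → TangentSpace JM x) :
    oddForm (n + 1) (S.openBook.angleForm x).toLinearMap
      ((S.gluedForm a β + κ • S.openBook.bindingForm (r ^ 2)).dB x) v =
      oddForm (n + 1) (S.openBook.angleForm x).toLinearMap ((S.gluedForm a β).dB x) v := by
  refine oddForm_congr_ker (OneForm.dB_neg _ x) (OneForm.dB_neg _ x) (fun u w hu hw => ?_) v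
  rw [S.dB_contact_correction h ha ha' hr hr']
  have h1 : (S.openBook.bindingForm (r ^ 2)).dB x u w = 0 := by
    have h2 := S.openBook.dB_fsmul_angleForm
      (S.openBook.contMDiff_comp_rsq (contDiff_profile (r ^ 2)) hr hr'
        (OpenBook.profile_rsq_const (ob := S.openBook) hr hr') x) hx
    refine (congrArg (fun f => f u w) h2).trans ?_
    refine (wedgeTwo_apply _ _ u w).trans ?_
    rw [hu, hw, mul_zero, zero_mul, sub_zero]
  show (S.gluedForm a β).dB x u w + κ * (S.openBook.bindingForm (r ^ 2)).dB x u w = _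
  rw [h1, mul_zero, add_zero]

theorem pullback_incl_contact_correction (β : OneForm JP P) (a κ : ℝ)
    (hr : 0 < r) : pullback (I' := JB) S.openBook.incl
      (S.gluedForm a β + κ • S.openBook.bindingForm (r ^ 2)) =
      pullback (I' := JB) S.openBook.incl (S.gluedForm a β) := by
  funext b
  have h1 : S.openBook.bindingForm (r ^ 2) (S.openBook.incl b) = 0 :=
    (OpenBook.bindingForm_eventuallyEq (ob := S.openBook) (a := r ^ 2) (by positivity)
      b).self_of_nhds.trans (S.openBook.coreForm_incl b)
  refine ContinuousLinearMap.ext fun v => ?_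
  show S.gluedForm a β (S.openBook.incl b) _ + κ * S.openBook.bindingForm (r ^ 2) (S.openBook.incl b) _ = _
  rw [h1]
  exact (congrArg (_ + ·) (mul_zero κ)).trans (add_zero _)

theorem reeb_tangent_contact_correction 
    (h : IsSymplecticOpenBook β Ψ) (ha : 0 < a) (ha' : a < S.δ) (hr : 0 < r) (hr' : r < S.δ)
    (hκ : 0 < κ) (b : B) {R : TangentSpace JM (S.openBook.incl b)}
    (hR : ∀ v, (S.gluedForm a β + κ • S.openBook.bindingForm (r ^ 2)).d (S.openBook.incl b) R v = 0) :
    ∃ w : TangentSpace JB b, mfderiv JB JM S.openBook.incl b w = R := by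
  obtain ⟨u, rfl⟩ := S.openBook.exists_dTube_eq b R
  have h0 : ‖(0 : ℂ)‖ < a / 2 := by simpa using ha
  have key : ∀ ζ : ℂ, u.2.re * ζ.im - u.2.im * ζ.re = 0 := by
    intro ζ
    have h1 : (S.gluedForm a β).d (S.openBook.incl b) (S.openBook.dTube b u)
        (S.openBook.dTube b (0, ζ)) = 0 := by
      refine (S.d_gluedForm_tube h ha ha' b h0 u (0, ζ)).trans ?_
      obtain ⟨ξ, hξ, hξ0⟩ := mfderiv_toCollar_normSq ha (b, 0) ((0, ζ) : EB × ℂ)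
      have hξ' : ξ = 0 := by
        ext j
        fin_cases j
        exact hξ0.trans (by simp)
      rw [hξ'] at hξ
      refine (congrArg (S.collarTwo β (b, halfLine (‖(0 : ℂ)‖ ^ 2 / a)) _) hξ).trans ?_
      exact map_zero _
    have h2 : (S.openBook.bindingForm (r ^ 2)).d (S.openBook.incl b) (S.openBook.dTube b u)
        (S.openBook.dTube b (0, ζ)) = 2 * (u.2.re * ζ.im - u.2.im * ζ.re) := by
      rw [OneForm.d_congr (OpenBook.bindingForm_eventuallyEq (ob := S.openBook) (a := r ^ 2)
        (by positivity) b)]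
      exact S.openBook.d_coreForm_incl b u (0, ζ)
    have h3 := congrArg (fun f => f (S.openBook.dTube b u) (S.openBook.dTube b (0, ζ)))
      (S.dB_contact_correction h ha ha' hr hr' κ (S.openBook.incl b))
    have h4 : (0 : ℝ) = 0 + κ * (2 * (u.2.re * ζ.im - u.2.im * ζ.re)) := by
      refine (hR (S.openBook.dTube b (0, ζ))).symm.trans (h3.trans ?_)
      exact congrArg₂ (fun c d => c + κ * d) h1 h2
    have h5 : κ * (2 * (u.2.re * ζ.im - u.2.im * ζ.re)) = 0 := by linarith
    rcases mul_eq_zero.1 h5 with h6 | h6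
    · exact absurd h6 hκ.ne'
    · linarith
  have hu : u.2 = 0 := by
    have h1 := key 1
    have h2 := key Complex.I
    simp only [Complex.one_im, Complex.one_re, Complex.I_im, Complex.I_re] at h1 h2
    exact Complex.ext (by simpa using h2) (by simpa using h1)
  refine ⟨u.1, (S.openBook.mfderiv_incl b u.1).trans ?_⟩
  exact congrArg (S.openBook.dTube b) (Prod.ext rfl hu.symm)

/-- Existence of a positive supported contact form. -/
theorem exists_supported_contactForm 
    (h : IsSymplecticOpenBook β Ψ) : ∃ α : OneForm JM (Total Ψ), IsContactForm (n + 1) α ∧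
      S.openBook.Supports α ∧ IsPositive β α := by
  obtain ⟨a, r, κ, ha, ha', hr, hr', hκ, hvol, hT⟩ := S.exists_contact_correction h
  have hsm := S.isSmooth_gluedForm h.monodromy_boundary ha ha' h.smooth
  have hsα : (S.gluedForm a β + κ • S.openBook.bindingForm (r ^ 2)).IsSmooth :=
    isSmooth_iff.2 fun x => (isSmooth_iff.1 hsm x).add
      ((isSmooth_iff.1 (S.openBook.isSmooth_bindingForm hr hr') x).smul κ)
  have hpull := S.pullback_incl_contact_correction β a κ hr
  have hpos : ∀ x ∉ range S.openBook.incl, ∀ v, LinearIndependent ℝ v → 0 <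
      contactVolume (n + 1) (S.gluedForm a β + κ • S.openBook.bindingForm (r ^ 2)) x v *
        oddForm (n + 1) (S.openBook.angleForm x).toLinearMap ((S.gluedForm a β).dB x) v :=
    fun x hx v hv => pos_of_mul_pos_mul_pos (hvol x v hv) (hT x hx v hv)
  refine ⟨S.gluedForm a β + κ • S.openBook.bindingForm (r ^ 2), ⟨hsα, fun x v hv =>
    left_ne_zero_of_mul (hvol x v hv).ne'⟩, ⟨?_, fun b v hv => ?_, fun x hx R hR => ?_,
    fun b R hR => ?_⟩, fun x hx t w hw => ?_⟩
  · rw [hpull]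
    refine ⟨hsm.pullback S.openBook.contMDiff_incl, fun b v hv => ?_⟩
    intro h1
    exact S.collarVolume_ne_zero h b hv ((S.contactVolume_gluedForm_incl h ha ha' b v).symm.trans h1)
  · rw [hpull]
    have h1 := hvol (S.openBook.incl b) (S.openBook.appendFrame b v)
      (S.openBook.linearIndependent_appendFrame b hv)
    have h2 := (OpenBook.volumeChange_bindingForm_incl (ob := S.openBook) (k := n + 1)
      (a := r ^ 2) (γ := S.gluedForm a β) (by positivity) b
      (S.openBook.appendFrame b v)).trans (S.volumeChange_gluedForm_incl h ha ha' b v)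
    have key : ∀ c d e m : ℝ, 0 ≤ m → 0 < c * d → d = 2 * (m + 1) * e → 0 < e * c := by
      rintro c d e m hm h3 rfl
      by_contra! h4
      nlinarith [mul_nonneg (by linarith : (0 : ℝ) ≤ 2 * (m + 1)) (neg_nonneg.2 h4)]
    exact key _ _ _ n (Nat.cast_nonneg n) h1 h2
  · obtain ⟨v, hv⟩ : ∃ v : Fin (2 * (n + 1) + 1) → TangentSpace JM x, LinearIndependent ℝ v :=
      exists_linearIndependent (V := EM) (finrank_total n)
    have h1 := hpos x hx v hv
    rw [← S.oddForm_contact_correction h ha ha' hr hr' κ hx] at h1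
    have h2 := oddForm_eq_mul (finrank_total n)
      (a := ((S.gluedForm a β + κ • S.openBook.bindingForm (r ^ 2)) x).toLinearMap)
      (S.openBook.angleForm x).toLinearMap
      (OneForm.dB_neg (S.gluedForm a β + κ • S.openBook.bindingForm (r ^ 2)) x) hR.2
      (LinearMap.ext hR.1) v
    have key : ∀ c d e f : ℝ, 0 < c * e → e = d * f → c = f → 0 < d := by
      rintro c d _ _ h3 rfl rfl
      by_contra! h4
      nlinarith [mul_nonneg (neg_nonneg.2 h4) (mul_self_nonneg c)]
    exact key _ _ _ _ h1 h2 (contactVolume_eq_oddForm _ _ _ _)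
  · exact S.reeb_tangent_contact_correction h ha ha' hr hr' hκ b hR.1
  · have h1 := S.oddForm_suspFrame_pos h ha ha' (p := (x, t)) hx hw
    have h2 := hpos (susp Ψ (x, t)) (S.susp_notMem_core hx t) (suspFrame Ψ (x, t) w)
      (linearIndependent_of_topForm h1.ne')
    exact pos_of_mul_pos_left h2 h1.le

end SmoothGluing

end Pages

end SymplecticOpenBook

end

theorem mainTheorem6 (n : ℕ)
    -- a compact manifold `P` of dimension `2n + 2` with boundary, and its boundary `B`
    (P : Type*) [TopologicalSpace P] [T2Space P] [CompactSpace P]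
    [ChartedSpace (EuclideanHalfSpace (2 * n + 2)) P] [IsManifold (𝓡∂ (2 * n + 2)) ∞ P]
    (B : Type*) [TopologicalSpace B]
    [ChartedSpace (EuclideanSpace ℝ (Fin (2 * n + 1))) B] [IsManifold (𝓡 (2 * n + 1)) ∞ B]
    -- a symplectic open book `(P, Ψ)`
    (β : SymplecticOpenBook.OneForm (𝓡∂ (2 * n + 2)) P)
    (Ψ : P ≃ₘ⟮𝓡∂ (2 * n + 2), 𝓡∂ (2 * n + 2)⟯ P)
    (hsymp : SymplecticOpenBook.IsSymplecticOpenBook β Ψ)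
    -- the smooth structure of the closed manifold `M = (P × [0, 1]) / ∼`
    [ChartedSpace (EuclideanSpace ℝ (Fin (2 * n + 3))) (SymplecticOpenBook.Total Ψ)]
    [IsManifold (𝓡 (2 * n + 3)) ∞ (SymplecticOpenBook.Total Ψ)]
    (S : SymplecticOpenBook.SmoothGluing Ψ B) :
    (∃ α : SymplecticOpenBook.OneForm (𝓡 (2 * n + 3)) (SymplecticOpenBook.Total Ψ),
      SymplecticOpenBook.IsContactForm (n + 1) α ∧ S.openBook.Supports α ∧
        SymplecticOpenBook.IsPositive β α) ∧
    ∀ α₀ α₁ : SymplecticOpenBook.OneForm (𝓡 (2 * n + 3)) (SymplecticOpenBook.Total Ψ),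
      SymplecticOpenBook.IsContactForm (n + 1) α₀ → S.openBook.Supports α₀ →
      SymplecticOpenBook.IsContactForm (n + 1) α₁ → S.openBook.Supports α₁ →
      S.openBook.SymplectomorphicPages α₀ α₁ →
      SymplecticOpenBook.IsotopicThroughContact (n + 1) α₀ α₁ := by
  have := S.compactSpace_binding
  have := S.t2Space_total
  exact ⟨S.exists_supported_contactForm hsymp, fun α₀ α₁ h₀ hs₀ h₁ hs₁ h =>
    SymplecticOpenBook.OpenBook.isotopicThroughContact h₀ hs₀ h₁ hs₁ h⟩
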